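/- Let $\omega$ be the matrix multiplication exponent, i.e. the infimum of all real $\tau$ such that the tensor $\langle n,n,n\rangle$ of $n\times n$ matrix multiplication (over $\mathbb{Q}$) has rank $O(n^{\tau})$; as usual for an infimum, a time bound $O(k^{\omega-1}n)$ means a bound $O(k^{\omega-1+\varepsilon}n)$ for every fixed $\varepsilon>0$. A $k$-separator of a finite simple undirected graph $G$ is a set $S$ of at most $k$ vertices such that every connected component of $G-S$ has at most $k-|S|$ vertices. For every fixed integer $\ell\ge 0$ and every fixed $\varepsilon>0$ there is a word RAM program with word size $O(\log n)$ which, given a graph $G$ on $n\ge 1$ vertices (by adjacency lists) and a vertex set $S$, finds a (not necessarily induced) cycle of length $\ell$ in $G$ if one exists, and reports that there is none otherwise. For every $k$ such that $S$ is a $k$-separator of $G$, it takes $O(k^{\omega-1+\varepsilon}\,n)$ time, where the constant depends only on $\ell$ and $\varepsilon$. (In detail: there are a program and a constant $C$, depending only on $\ell$ and $\varepsilon$, such that for all $n\ge1$, all such $G$, $k$ and $k$-separators $S$, and every word size $w\ge C(\lfloor\log_2 n\rfloor+1)$, the program halts with a correct answer after at most $C k^{\omega-1+\varepsilon}n$ steps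 and never computes a number that does not fit into a word of $w$ bits. Operations on words, comparisons and indirectly addressed memory accesses take one step each.) -/

import Mathlib

/-! ### The exponent of matrix multiplication -/

/-- `n × n` matrices over `ℚ` can be multiplied by a bilinear algorithm with `r` essential
multiplications, i.e. the tensor `⟨n, n, n⟩` of matrix multiplication has rank at most `r`. -/
def MatMulRankLE (n r : ℕ) : Prop :=
  ∃ α β γ : Fin r → Matrix (Fin n) (Fin n) ℚ, ∀ A B : Matrix (Fin n) (Fin n) ℚ,
    A * B = ∑ q, ((∑ i, ∑ j, α q i j * A i j) * (∑ i, ∑ j, β q i j * B i j)) • γ q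

/-- The matrix multiplication exponent `ω`: the infimum of all `τ` such that the rank of
`⟨n, n, n⟩` is `O(n ^ τ)`. -/
noncomputable def matMulExponent : ℝ :=
  sInf {τ : ℝ | ∃ C : ℝ, ∀ n : ℕ, 1 ≤ n → ∃ r : ℕ, MatMulRankLE n r ∧ (r : ℝ) ≤ C * (n : ℝ) ^ τ}

/-! ### Separators -/

/-- `S` is a `k`-separator of `G`: it has at most `k` vertices, and every connected component of
`G - S` has at most `k - |S|` vertices. -/
def IsSeparator {V : Type*} [Finite V] (G : SimpleGraph V) (k : ℕ) (S : Finset V) : Prop :=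
  S.card ≤ k ∧
    ∀ K : (G.induce ((S : Set V)ᶜ)).ConnectedComponent, K.supp.ncard ≤ k - S.card

/-! ### A word RAM with step count

The machine has registers and a random access memory, which is divided into arrays; a program
mentions finitely many registers and arrays. All of them hold words of `w` bits, i.e. natural
numbers below `2 ^ w`. An operation whose result does not fit into a word makes the machine fail
(it then has no execution), so nothing is gained from long words. -/

namespace WordRAM

/-- The contents of the registers, and of the cells of the arrays: `mem a i` is cell `i` of
array `a`. -/
structure State where
  reg : ℕ → ℕ
  mem : ℕ → ℕ → ℕ

/-- The operations on words. -/
inductive Op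
  | add | sub | mul | div | mod | band | bor | bxor | shl | shr | lt | eq

/-- The result of an operation; subtraction is truncated, comparisons return `0` or `1`. -/
def Op.apply : Op → ℕ → ℕ → ℕ
  | .add, x, y => x + y
  | .sub, x, y => x - y
  | .mul, x, y => x * y
  | .div, x, y => x / y
  | .mod, x, y => x % y
  | .band, x, y => x &&& y
  | .bor, x, y => x ||| y
  | .bxor, x, y => x ^^^ y
  | .shl, x, y => x <<< y
  | .shr, x, y => x >>> y
  | .lt, x, y => if x < y then 1 else 0
  | .eq, x, y => if x = y then 1 else 0

/-- Expressions: constants, registers, indirectly addressed memory cells, and operations. -/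
inductive Expr
  | const (c : ℕ)
  | reg (r : ℕ)
  | load (a : ℕ) (i : Expr)
  | op (o : Op) (e f : Expr)

/-- The value `x` if it fits into a word of `w` bits. -/
def fit (w x : ℕ) : Option ℕ := if x < 2 ^ w then some x else none

/-- The value of an expression on a machine with words of `w` bits, if there is no overflow. -/
def Expr.eval (w : ℕ) (s : State) : Expr → Option ℕ
  | .const c => fit w c
  | .reg r => some (s.reg r)
  | .load a i => (i.eval w s).map (s.mem a)
  | .op o e f => (e.eval w s).bind fun x => (f.eval w s).bind fun y => fit w (o.apply x y)

/-- The number of steps for evaluating an expression: one for every constant, register access,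
memory access and operation in it. -/
def Expr.cost : Expr → ℕ
  | .const _ => 1
  | .reg _ => 1
  | .load _ i => i.cost + 1
  | .op _ e f => e.cost + f.cost + 1

/-- Programs. A condition holds if its value is not `0`. -/
inductive Prog
  | skip
  | assign (r : ℕ) (e : Expr)
  | store (a : ℕ) (i e : Expr)
  | seq (p q : Prog)
  | ite (e : Expr) (p q : Prog)
  | loop (e : Expr) (p : Prog)

/-- `Exec w p s s' t`: on a machine with words of `w` bits, the program `p`, started in state `s`,
halts in state `s'` after exactly `t` steps, without overflow. -/
inductive Exec (w : ℕ) : Prog → State → State → ℕ → Prop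
  | skip (s : State) : Exec w .skip s s 1
  | assign (r : ℕ) (e : Expr) (s : State) (x : ℕ) (hx : e.eval w s = some x) :
      Exec w (.assign r e) s { s with reg := Function.update s.reg r x } (e.cost + 1)
  | store (a : ℕ) (i e : Expr) (s : State) (j x : ℕ)
      (hj : i.eval w s = some j) (hx : e.eval w s = some x) :
      Exec w (.store a i e) s
        { s with mem := Function.update s.mem a (Function.update (s.mem a) j x) }
        (i.cost + e.cost + 1)
  | seq (p q : Prog) (s s' s'' : State) (t t' : ℕ)
      (hp : Exec w p s s' t) (hq : Exec w q s' s'' t') : Exec w (.seq p q) s s'' (t + t')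
  | ite_true (e : Expr) (p q : Prog) (s s' : State) (x t : ℕ)
      (hx : e.eval w s = some x) (hx0 : x ≠ 0) (hp : Exec w p s s' t) :
      Exec w (.ite e p q) s s' (e.cost + 1 + t)
  | ite_false (e : Expr) (p q : Prog) (s s' : State) (t : ℕ)
      (hx : e.eval w s = some 0) (hq : Exec w q s s' t) :
      Exec w (.ite e p q) s s' (e.cost + 1 + t)
  | loop_true (e : Expr) (p : Prog) (s s' s'' : State) (x t t' : ℕ)
      (hx : e.eval w s = some x) (hx0 : x ≠ 0) (hp : Exec w p s s' t)
      (hl : Exec w (.loop e p) s' s'' t') :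
      Exec w (.loop e p) s s'' (e.cost + 1 + t + t')
  | loop_false (e : Expr) (p : Prog) (s : State) (hx : e.eval w s = some 0) :
      Exec w (.loop e p) s s (e.cost + 1)

/-- The state `s` of a machine with words of `w` bits holds the input `(G, S)`. The graph is given
by adjacency lists (in any order): array `1` holds them one after the other, and array `0` holds
the positions where they start and end. Array `2` lists `S` (in any order), and registers `0` and
`1` hold the number of vertices and the size of `S`. All other cells and registers may hold
arbitrary words. -/
structure IsInput (w : ℕ) {n : ℕ} (G : SimpleGraph (Fin n)) (S : Finset (Fin n))
    (s : State) : Prop where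
  reg_lt : ∀ r, s.reg r < 2 ^ w
  mem_lt : ∀ a i, s.mem a i < 2 ^ w
  order : s.reg 0 = n
  card : s.reg 1 = S.card
  start : s.mem 0 0 = 0
  mono : ∀ v : Fin n, s.mem 0 v ≤ s.mem 0 (v + 1)
  adj : ∀ v : Fin n, Set.BijOn (s.mem 1) (Set.Ico (s.mem 0 v) (s.mem 0 (v + 1)))
    ((fun u : Fin n => (u : ℕ)) '' G.neighborSet v)
  sep : Set.BijOn (s.mem 2) (Set.Iio S.card) ((fun u : Fin n => (u : ℕ)) '' (S : Set (Fin n)))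

/-- The final state `s` answers the search for a (not necessarily induced) cycle of length `ℓ`
in `G` correctly: register `0` holds `1` and array `0` starts with the vertices of such a cycle in
cyclic order, or register `0` holds `0` and there is no such cycle. -/
def IsCycleAnswer (ℓ : ℕ) {n : ℕ} (G : SimpleGraph (Fin n)) (s : State) : Prop :=
  (s.reg 0 = 1 ∧ ∃ (u : Fin n) (p : G.Walk u u), p.IsCycle ∧ p.length = ℓ ∧
      ∀ i < ℓ, s.mem 0 i = (p.getVert i : ℕ)) ∨
  (s.reg 0 = 0 ∧ ¬ ∃ (u : Fin n) (p : G.Walk u u), p.IsCycle ∧ p.length = ℓ)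

end WordRAM

/-! The algorithm cuts the graph into blocks, finds coloured walks inside each block by fast Boolean
matrix multiplication, and joins them at the separator. The difficulty is to keep the number of
colourings independent of `n`.

Blocks. A graph search orders the vertices so that the separator comes first and the components of
the rest are intervals. With `M` the largest component size and `kk = |S| + M ≤ k`, consecutive
components are merged greedily into `O(n / kk)` blocks of `O(kk)` vertices each. No edge joins two
blocks outside of the separator. A matrix product per block costs `kk ^ (ω + o(1))`, hence `kk ^ (ω
- 1 + o(1)) * n` in total; reading the adjacency lists costs `O(kk * n)`, which is no more because
`2 ≤ ω` (`two_le_matMulExponent`).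

Matrix products. A bilinear algorithm for one fixed small order, with rational coefficients, is
iterated as a Kronecker power (`kron_mul`). Division by the common denominator `D` is replaced by
arithmetic modulo `D * N + 1`, where `-N` is the inverse of `D`. An entry of the product of two 0/1
matrices of order `N` is at most `N`, so its residue determines it (`boolMul_runs`).

Colours. Fix a colouring and look for closed walks whose vertex number `i` has colour `i` modulo
`l`; such a walk is automatically a cycle. It either stays in one block and avoids the separator, or
splits at the separator into segments that each lie in one block (`Layout.ext_segment`). The program
records, for all pairs of positions `i < j` and all separator vertices `x`, `y`, how many blocks
contain a segment from `x` to `y` with the colours from `i` to `j`, and then composes segments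
(`Layout.sW_iff`).

Two passes. A family of colourings that treats all `n` vertices separately would have to grow with
`n`. In the first pass a vertex is therefore coloured by its local number in its block, which is
`O(kk)`. This suffices for cycles that avoid the separator, and for every single segment. For each
colouring and each kind of segment the first `l` blocks that contain it are kept; their number is
polynomial in `kk` (`Layout.card_kept_le`). If a cycle uses a segment in a block that is not kept,
some kept block contains a segment of the same kind and meets no other vertex of the cycle, so the
segment can be exchanged (`Layout.Cyc.exists_good_of_sep`). Hence a cycle through the separator can
be moved into the kept blocks. Their vertices get distinct numbers, polynomial in `kk`, and the
second pass colours by these numbers.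

The family of colourings. Numbers are hashed by evaluating the polynomial of their base-`b` digits
at one of constantly many points; the colouring then lists which hash value gets which colour
(`rich_colour`). With constantly many digits and `b` about `kk ^ (1 / q)`, the universe can be
polynomial in `kk` while there are only `O(kk ^ (l / q))` colourings, a factor absorbed by `ε`.

All of this is proved for the concrete machine with a small program logic: `Runs` for total
correctness with time bounds, and `Same` for frames. -/

namespace WordRAM

/-! ### Syntax for programs -/

instance : Add Expr := ⟨.op .add⟩
instance : Sub Expr := ⟨.op .sub⟩
instance : Mul Expr := ⟨.op .mul⟩
instance : Div Expr := ⟨.op .div⟩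
instance : Mod Expr := ⟨.op .mod⟩

/-- The expression that compares two words by `<`. -/
def Expr.less (e f : Expr) : Expr := .op .lt e f

/-- The expression that tests two words for equality. -/
def Expr.same (e f : Expr) : Expr := .op .eq e f

/-- Counting loop: register `r` runs through the numbers below the value of `e`. -/
def forTo (r : ℕ) (e : Expr) (p : Prog) : Prog :=
  .seq (.assign r (.const 0)) (.loop (.op .lt (.reg r) e) (.seq p (.assign r (.reg r + .const 1))))

infixr:60 " ;; " => Prog.seq

/-! ### States -/

def State.setReg (s : State) (r x : ℕ) : State := { s with reg := Function.update s.reg r x }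

def State.setMem (s : State) (a j x : ℕ) : State :=
  { s with mem := Function.update s.mem a (Function.update (s.mem a) j x) }

@[simp] theorem setReg_mem (s : State) (r x : ℕ) : (s.setReg r x).mem = s.mem := rfl

@[simp] theorem setReg_reg (s : State) (r x q : ℕ) :
    (s.setReg r x).reg q = if q = r then x else s.reg q := by
  simp [State.setReg, Function.update_apply]

@[simp] theorem setMem_reg (s : State) (a j x : ℕ) : (s.setMem a j x).reg = s.reg := rfl

@[simp] theorem setMem_mem (s : State) (a j x b i : ℕ) :
    (s.setMem a j x).mem b i = if b = a ∧ i = j then x else s.mem b i := by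
  by_cases h : b = a
  · subst h; simp [State.setMem, Function.update_apply]
  · simp [State.setMem, h]

/-- All registers and cells of a state hold words. -/
structure State.Ok (w : ℕ) (s : State) : Prop where
  pos : 0 < w
  reg : ∀ r, s.reg r < 2 ^ w
  mem : ∀ a i, s.mem a i < 2 ^ w

theorem State.Ok.setReg {w : ℕ} {s : State} (h : s.Ok w) {r x : ℕ} (hx : x < 2 ^ w) :
    (s.setReg r x).Ok w :=
  ⟨h.pos, fun q => by rw [setReg_reg]; split_ifs <;> simp [hx, h.reg], h.mem⟩

theorem State.Ok.setMem {w : ℕ} {s : State} (h : s.Ok w) {a j x : ℕ} (hx : x < 2 ^ w) :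
    (s.setMem a j x).Ok w :=
  ⟨h.pos, h.reg, fun b i => by rw [setMem_mem]; split_ifs <;> simp [hx, h.mem]⟩

/-! ### Values of expressions -/

/-- The value of an expression on a machine with unbounded words. -/
def Expr.val (s : State) : Expr → ℕ
  | .const c => c
  | .reg r => s.reg r
  | .load a i => s.mem a (i.val s)
  | .op o e f => o.apply (e.val s) (f.val s)

/-- An operation that may leave the words applied to two words does not. -/
def Op.fits (w : ℕ) : Op → ℕ → ℕ → Prop
  | .add, x, y => x + y < 2 ^ w
  | .mul, x, y => x * y < 2 ^ w
  | .shl, x, y => x <<< y < 2 ^ w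
  | .bor, x, y => x ||| y < 2 ^ w
  | .bxor, x, y => x ^^^ y < 2 ^ w
  | _, _, _ => True

/-- The evaluation of an expression does not overflow. -/
def Expr.safe (w : ℕ) (s : State) : Expr → Prop
  | .const c => c < 2 ^ w
  | .reg _ => True
  | .load _ i => i.safe w s
  | .op o e f => e.safe w s ∧ f.safe w s ∧ o.fits w (e.val s) (f.val s)

/-- The operations without a condition in `fits` never exceed their first argument, or are
comparisons, whose value `1` is a word because `w` is positive. -/
theorem Op.apply_lt {w x y : ℕ} (hw : 0 < w) (o : Op) (hx : x < 2 ^ w)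
    (h : o.fits w x y) : o.apply x y < 2 ^ w := by
  have h1 : 1 < 2 ^ w := Nat.one_lt_two_pow hw.ne'
  cases o <;> simp only [Op.fits, Op.apply] at *
  · exact h
  · omega
  · exact h
  · exact (Nat.div_le_self _ _).trans_lt hx
  · exact (Nat.mod_le _ _).trans_lt hx
  · exact Nat.and_le_left.trans_lt hx
  · exact h
  · exact h
  · exact h
  · exact (Nat.shiftRight_le _ _).trans_lt hx
  · split_ifs <;> omega
  · split_ifs <;> omega

/-- This separates overflow from values: once `safe` is checked, everything else is reasoning about
`val` over the natural numbers. -/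
theorem Expr.eval_eq {w : ℕ} {s : State} (hs : s.Ok w) (e : Expr) (h : e.safe w s) :
    e.eval w s = some (e.val s) ∧ e.val s < 2 ^ w := by
  induction e with
  | const c => exact ⟨by simp [Expr.eval, fit, Expr.val]; exact h, h⟩
  | reg r => exact ⟨rfl, hs.reg r⟩
  | load a i ih => exact ⟨by simp [Expr.eval, (ih h).1, Expr.val], hs.mem _ _⟩
  | op o e f ihe ihf =>
    obtain ⟨h1, h2, h3⟩ := h
    have h4 := o.apply_lt hs.pos (ihe h1).2 h3
    exact ⟨by simp [Expr.eval, (ihe h1).1, (ihf h2).1, Expr.val, fit, h4], h4⟩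

section simp_lemmas
variable (s : State) (w : ℕ) (e f : Expr)
@[simp] theorem val_const (c : ℕ) : (Expr.const c).val s = c := rfl
@[simp] theorem val_reg (r : ℕ) : (Expr.reg r).val s = s.reg r := rfl
@[simp] theorem val_load (a : ℕ) : (Expr.load a e).val s = s.mem a (e.val s) := rfl
@[simp] theorem val_add : (e + f).val s = e.val s + f.val s := rfl
@[simp] theorem val_sub : (e - f).val s = e.val s - f.val s := rfl
@[simp] theorem val_mul : (e * f).val s = e.val s * f.val s := rfl
@[simp] theorem val_div : (e / f).val s = e.val s / f.val s := rfl
@[simp] theorem val_mod : (e % f).val s = e.val s % f.val s := rfl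
@[simp] theorem val_less : (e.less f).val s = if e.val s < f.val s then 1 else 0 := rfl
@[simp] theorem val_same : (e.same f).val s = if e.val s = f.val s then 1 else 0 := rfl
@[simp] theorem safe_const (c : ℕ) : (Expr.const c).safe w s ↔ c < 2 ^ w := Iff.rfl
@[simp] theorem safe_reg (r : ℕ) : (Expr.reg r).safe w s ↔ True := Iff.rfl
@[simp] theorem safe_load (a : ℕ) : (Expr.load a e).safe w s ↔ e.safe w s := Iff.rfl
@[simp] theorem safe_add :
    (e + f).safe w s ↔ e.safe w s ∧ f.safe w s ∧ e.val s + f.val s < 2 ^ w := Iff.rfl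
@[simp] theorem safe_mul :
    (e * f).safe w s ↔ e.safe w s ∧ f.safe w s ∧ e.val s * f.val s < 2 ^ w := Iff.rfl
@[simp] theorem safe_sub : (e - f).safe w s ↔ e.safe w s ∧ f.safe w s :=
  and_congr Iff.rfl (by simp [Op.fits])
@[simp] theorem safe_div : (e / f).safe w s ↔ e.safe w s ∧ f.safe w s :=
  and_congr Iff.rfl (by simp [Op.fits])
@[simp] theorem safe_mod : (e % f).safe w s ↔ e.safe w s ∧ f.safe w s :=
  and_congr Iff.rfl (by simp [Op.fits])
@[simp] theorem safe_less : (e.less f).safe w s ↔ e.safe w s ∧ f.safe w s :=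
  and_congr Iff.rfl (by simp [Op.fits])
@[simp] theorem safe_same : (e.same f).safe w s ↔ e.safe w s ∧ f.safe w s :=
  and_congr Iff.rfl (by simp [Op.fits])
@[simp] theorem cost_const (c : ℕ) : (Expr.const c).cost = 1 := rfl
@[simp] theorem cost_reg (r : ℕ) : (Expr.reg r).cost = 1 := rfl
@[simp] theorem cost_load (a : ℕ) : (Expr.load a e).cost = e.cost + 1 := rfl
@[simp] theorem cost_add : (e + f).cost = e.cost + f.cost + 1 := rfl
@[simp] theorem cost_sub : (e - f).cost = e.cost + f.cost + 1 := rfl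
@[simp] theorem cost_mul : (e * f).cost = e.cost + f.cost + 1 := rfl
@[simp] theorem cost_div : (e / f).cost = e.cost + f.cost + 1 := rfl
@[simp] theorem cost_mod : (e % f).cost = e.cost + f.cost + 1 := rfl
@[simp] theorem cost_less : (e.less f).cost = e.cost + f.cost + 1 := rfl
@[simp] theorem cost_same : (e.same f).cost = e.cost + f.cost + 1 := rfl
end simp_lemmas

/-! ### Frames -/

/-- The registers that a program writes. -/
def Prog.wr : Prog → List ℕ
  | .skip => []
  | .assign r _ => [r]
  | .store _ _ _ => []
  | .seq p q => p.wr ++ q.wr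
  | .ite _ p q => p.wr ++ q.wr
  | .loop _ p => p.wr

/-- The arrays that a program writes. -/
def Prog.wm : Prog → List ℕ
  | .skip => []
  | .assign _ _ => []
  | .store a _ _ => [a]
  | .seq p q => p.wm ++ q.wm
  | .ite _ p q => p.wm ++ q.wm
  | .loop _ p => p.wm

/-- Two states agree outside of the registers in `R` and the arrays in `A`. -/
def Same (R A : List ℕ) (s s' : State) : Prop :=
  (∀ r, R.elem r = false → s'.reg r = s.reg r) ∧ ∀ a, A.elem a = false → s'.mem a = s.mem a

theorem Same.refl (R A : List ℕ) (s : State) : Same R A s s := ⟨fun _ _ => rfl, fun _ _ => rfl⟩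

theorem Same.trans {R A : List ℕ} {s s' s'' : State} (h : Same R A s s') (h' : Same R A s' s'') :
    Same R A s s'' :=
  ⟨fun r hr => (h'.1 r hr).trans (h.1 r hr), fun a ha => (h'.2 a ha).trans (h.2 a ha)⟩

theorem Same.mono {R A R' A' : List ℕ} {s s' : State} (h : Same R A s s') (hR : R ⊆ R')
    (hA : A ⊆ A') : Same R' A' s s' := by
  refine ⟨fun r hr => h.1 r ?_, fun a ha => h.2 a ?_⟩
  · by_contra h'; simp at h' hr; exact hr (hR h')
  · by_contra h'; simp at h' ha; exact ha (hA h')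

/-- The frame is read off the syntax. `Same` is phrased with the Boolean `List.elem`, so that for
concrete programs each unchanged register or array is justified by `rfl`. -/
theorem Exec.same {w : ℕ} {p : Prog} {s s' : State} {t : ℕ} (h : Exec w p s s' t) :
    Same p.wr p.wm s s' := by
  induction h with
  | skip => exact Same.refl _ _ _
  | assign r e s x hx =>
    refine ⟨fun q hq => ?_, fun _ _ => rfl⟩
    have : q ≠ r := by rintro rfl; simp [Prog.wr] at hq
    simp [Function.update_of_ne this]
  | store a i e s j x hj hx =>
    refine ⟨fun _ _ => rfl, fun q hq => ?_⟩
    have : q ≠ a := by rintro rfl; simp [Prog.wm] at hq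
    simp [Function.update_of_ne this]
  | seq p q s s' s'' t t' hp hq h1 h2 =>
    exact (h1.mono (by simp [Prog.wr]) (by simp [Prog.wm])).trans
      (h2.mono (by simp [Prog.wr]) (by simp [Prog.wm]))
  | ite_true e p q s s' x t hx hx0 hp h1 => exact h1.mono (by simp [Prog.wr]) (by simp [Prog.wm])
  | ite_false e p q s s' t hx hp h1 => exact h1.mono (by simp [Prog.wr]) (by simp [Prog.wm])
  | loop_true e p s s' s'' x t t' hx hx0 hp hl h1 h2 => exact h1.trans h2
  | loop_false => exact Same.refl _ _ _

/-! ### Total correctness -/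

/-- Started in state `s`, the program `p` halts without overflow after at most `T` steps in a state
that satisfies `Q`, provided that all words of `s` have `w` bits. -/
def Runs (w : ℕ) (p : Prog) (s : State) (T : ℕ) (Q : State → Prop) : Prop :=
  s.Ok w → ∃ s' t, Exec w p s s' t ∧ t ≤ T ∧ s'.Ok w ∧ Q s'

theorem Runs.intro_ok {w : ℕ} {p : Prog} {s : State} {T : ℕ} {Q : State → Prop}
    (h : s.Ok w → Runs w p s T Q) : Runs w p s T Q := fun hs => h hs hs

theorem Runs.mono {w : ℕ} {p : Prog} {s : State} {T T' : ℕ} {Q Q' : State → Prop}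
    (h : Runs w p s T Q) (hT : T ≤ T') (hQ : ∀ s', Same p.wr p.wm s s' → Q s' → Q' s') :
    Runs w p s T' Q' := fun hs =>
  let ⟨s', t, h1, h2, h3, h4⟩ := h hs
  ⟨s', t, h1, h2.trans hT, h3, hQ s' h1.same h4⟩

theorem Runs.time_le {w : ℕ} {p : Prog} {s : State} {T T' : ℕ} {Q : State → Prop}
    (h : Runs w p s T Q) (hT : T ≤ T') : Runs w p s T' Q := h.mono hT fun _ _ h => h

/-- The continuation receives the frame of the first program besides its postcondition, so
postconditions need to mention only what changes. -/
theorem Runs.seq {w : ℕ} {p q : Prog} {s : State} {T T' : ℕ} {Q Q' : State → Prop}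
    (h : Runs w p s T Q) (h' : ∀ s', Same p.wr p.wm s s' → Q s' → Runs w q s' T' Q') :
    Runs w (p ;; q) s (T + T') Q' := fun hs =>
  let ⟨s', _, h1, h2, h3, h4⟩ := h hs
  let ⟨s'', _, h1', h2', h3', h4'⟩ := h' s' h1.same h4 h3
  ⟨s'', _, .seq _ _ _ _ _ _ _ h1 h1', Nat.add_le_add h2 h2', h3', h4'⟩

theorem Runs.ite {w : ℕ} {e : Expr} {p q : Prog} {s : State} {T : ℕ} {Q : State → Prop}
    (he : e.safe w s) (h : e.val s ≠ 0 → Runs w p s T Q) (h' : e.val s = 0 → Runs w q s T Q) :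
    Runs w (.ite e p q) s (e.cost + 1 + T) Q := fun hs => by
  have hv := (e.eval_eq hs he).1
  by_cases h0 : e.val s = 0
  · obtain ⟨s', t, h1, h2, h3, h4⟩ := h' h0 hs
    exact ⟨s', _, .ite_false _ _ _ _ _ _ (h0 ▸ hv) h1, by omega, h3, h4⟩
  · obtain ⟨s', t, h1, h2, h3, h4⟩ := h h0 hs
    exact ⟨s', _, .ite_true _ _ _ _ _ _ _ hv h0 h1, by omega, h3, h4⟩

/-- The weakest precondition of a program without loops. -/
def Prog.wp (w : ℕ) : Prog → State → (State → Prop) → Prop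
  | .skip, s, Q => Q s
  | .assign r e, s, Q => e.safe w s ∧ Q (s.setReg r (e.val s))
  | .store a i e, s, Q => i.safe w s ∧ e.safe w s ∧ Q (s.setMem a (i.val s) (e.val s))
  | .seq p q, s, Q => p.wp w s fun s' => q.wp w s' Q
  | .ite e p q, s, Q => e.safe w s ∧ (e.val s ≠ 0 → p.wp w s Q) ∧ (e.val s = 0 → q.wp w s Q)
  | .loop _ _, _, _ => False

/-- A bound for the number of steps of a program without loops. -/
def Prog.time : Prog → ℕ
  | .skip => 1
  | .assign _ e => e.cost + 1
  | .store _ i e => i.cost + e.cost + 1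
  | .seq p q => p.time + q.time
  | .ite e p q => e.cost + 1 + (p.time + q.time)
  | .loop _ _ => 0

/-- Both branches of a conditional are charged in `time`, which makes the bound independent of the
state. The value of `time` on loops is irrelevant, since `wp` is false there. -/
theorem Runs.straight {w : ℕ} {p : Prog} {s : State} {Q : State → Prop} (h : p.wp w s Q) :
    Runs w p s p.time Q := by
  induction p generalizing s Q with
  | skip => exact fun hs => ⟨s, 1, .skip s, le_rfl, hs, h⟩
  | assign r e =>
    intro hs
    obtain ⟨h1, h2⟩ := e.eval_eq hs h.1
    exact ⟨_, _, .assign _ _ _ _ h1, le_rfl, hs.setReg h2, h.2⟩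
  | store a i e =>
    intro hs
    obtain ⟨h1, h2⟩ := e.eval_eq hs h.2.1
    exact ⟨_, _, .store _ _ _ _ _ _ (i.eval_eq hs h.1).1 h1, le_rfl, hs.setMem h2, h.2.2⟩
  | seq p q ihp ihq => exact (ihp h).seq fun s' _ h => ihq h
  | ite e p q ihp ihq =>
    exact Runs.ite h.1 (fun h0 => (ihp (h.2.1 h0)).time_le (by omega))
      (fun h0 => (ihq (h.2.2 h0)).time_le (by omega))
  | loop => exact h.elim

theorem Runs.wp_seq {w : ℕ} {p q : Prog} {s : State} {T : ℕ} {Q : State → Prop}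
    (h : p.wp w s fun s' => Runs w q s' T Q) : Runs w (p ;; q) s (p.time + T) Q :=
  (Runs.straight h).seq fun _ _ h => h

/-- Each round pays `e.cost + 3` for the test and `4` for the increment; the extra round covers the
initialization and the last test. The invariant must be insensitive to the counter, since the
increment happens after the body. -/
theorem Runs.for_loop {w r m : ℕ} {e : Expr} {p : Prog} {s : State} {Q : State → Prop} (T : ℕ → ℕ)
    (I : ℕ → State → Prop) (hr : p.wr.elem r = false)
    (he : ∀ s', Same (r :: p.wr) p.wm s s' → e.safe w s' ∧ e.val s' = m)
    (hI : ∀ i s x, I i s → I i (s.setReg r x)) (h0 : I 0 s)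
    (hs : ∀ i s', i < m → s'.reg r = i → Same (r :: p.wr) p.wm s s' → I i s' →
      Runs w p s' (T i) (I (i + 1)))
    (hQ : ∀ s', Same (r :: p.wr) p.wm s s' → s'.reg r = m → I m s' → Q s') :
    Runs w (forTo r e p) s (∑ i ∈ Finset.range m, T i + (m + 1) * (e.cost + 7)) Q := by
  have hset : ∀ s' x, Same (r :: p.wr) p.wm s s' → Same (r :: p.wr) p.wm s (s'.setReg r x) := by
    refine fun s' x h => ⟨fun q hq => ?_, h.2⟩
    have : q ≠ r := by rintro rfl; simp at hq
    simp [this, h.1 q hq]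
  have key : ∀ d i s', i + d = m → s'.reg r = i → Same (r :: p.wr) p.wm s s' → I i s' →
      Runs w (.loop (.op .lt (.reg r) e) (.seq p (.assign r (.reg r + .const 1)))) s'
        (∑ j ∈ Finset.Ico i m, (T j + (e.cost + 7)) + (e.cost + 3)) Q := by
    intro d
    induction d with
    | zero =>
      intro i s' hi hri hS hIi hok
      obtain ⟨h1, h2⟩ := he s' hS
      obtain rfl : i = m := by omega
      refine ⟨s', _, .loop_false _ _ _ ?_, ?_, hok, hQ s' hS hri hIi⟩
      · rw [(Expr.eval_eq hok _ (show (Expr.op .lt (.reg r) e).safe w s' from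
          ⟨trivial, h1, trivial⟩)).1]
        simp [Expr.val, Op.apply, h2, hri]
      · simp [Expr.cost]; omega
    | succ d ih =>
      intro i s' hi hri hS hIi hok
      obtain ⟨h1, h2⟩ := he s' hS
      obtain ⟨s1, t1, hx1, ht1, hok1, hI1⟩ := hs i s' (by omega) hri hS hIi hok
      have hS1 : Same (r :: p.wr) p.wm s s1 :=
        hS.trans (hx1.same.mono (by simp) (by simp))
      have hr1 : s1.reg r = i := by rw [hx1.same.1 r hr, hri]
      -- The counter never exceeds `m`, which is a word as the value of `e`, so the increment cannot
      -- overflow.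
      have hm : m < 2 ^ w := by
        have := (Expr.eval_eq hok _ h1).2
        omega
      have hsafe : (Expr.reg r + .const 1).safe w s1 := by
        have := Nat.one_lt_two_pow hok.pos.ne'
        simp only [safe_add, safe_reg, safe_const, val_reg, val_const, hr1, true_and]
        omega
      obtain ⟨hv, hlt⟩ := Expr.eval_eq hok1 _ hsafe
      obtain ⟨s2, t2, hx2, ht2, hok2, hq2⟩ := ih (i + 1) (s1.setReg r (i + 1)) (by omega)
        (by simp) (hset _ _ hS1) (hI _ _ _ hI1)
        (hok1.setReg (by simpa [hr1] using hlt))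
      have hx2' := hx2
      rw [← show (Expr.reg r + .const 1).val s1 = i + 1 by simp [hr1]] at hx2'
      refine ⟨s2, _, .loop_true (x := 1) (hx := ?_) (hx0 := one_ne_zero) (hp :=
         (.seq _ _ _ _ _ _ _ hx1 (.assign _ _ _ _ hv))) (hl := hx2'), ?_, hok2, hq2⟩
      · rw [(Expr.eval_eq hok _ (show (Expr.op .lt (.reg r) e).safe w s' from
          ⟨trivial, h1, trivial⟩)).1]
        simp [Expr.val, Op.apply, h2, hri]; omega
      · rw [Finset.sum_eq_sum_Ico_succ_bot (by omega)]
        simp only [Expr.cost]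
        omega
  intro hok
  obtain ⟨s2, t2, hx2, ht2, hok2, hq2⟩ := key m 0 (s.setReg r 0) (by omega) (by simp)
    (hset _ _ (Same.refl _ _ _)) (hI _ _ _ h0) (hok.setReg (by positivity))
  refine ⟨s2, _, .seq _ _ _ _ _ _ _ (.assign _ _ _ 0 ?_) hx2, ?_, hok2, hq2⟩
  · simp [Expr.eval, fit]
  · rw [Finset.sum_add_distrib] at ht2
    simp only [Finset.sum_const, Finset.card_range, smul_eq_mul, Nat.Ico_zero_eq_range] at ht2
    simp only [Expr.cost]
    have : (m + 1) * (e.cost + 7) = m * (e.cost + 7) + (e.cost + 7) := by ring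
    omega

/-- Counting loop whose body takes at most `T` steps every time. -/
theorem Runs.for_const {w r m T : ℕ} {e : Expr} {p : Prog} {s : State} {Q : State → Prop}
    (I : ℕ → State → Prop) (hr : p.wr.elem r = false)
    (he : ∀ s', Same (r :: p.wr) p.wm s s' → e.safe w s' ∧ e.val s' = m)
    (hI : ∀ i s x, I i s → I i (s.setReg r x)) (h0 : I 0 s)
    (hs : ∀ i s', i < m → s'.reg r = i → Same (r :: p.wr) p.wm s s' → I i s' →
      Runs w p s' T (I (i + 1)))
    (hQ : ∀ s', Same (r :: p.wr) p.wm s s' → s'.reg r = m → I m s' → Q s') :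
    Runs w (forTo r e p) s ((m + 1) * (T + (e.cost + 7))) Q := by
  refine (Runs.for_loop (fun _ => T) I hr he hI h0 hs hQ).time_le ?_
  simp only [Finset.sum_const, Finset.card_range, smul_eq_mul]
  nlinarith

/-- A loop whose number of iterations is bounded by a potential. -/
theorem Runs.while {w : ℕ} {e : Expr} {p : Prog} {s : State} {Q : State → Prop} (T : ℕ)
    (I : State → Prop) (Φ : State → ℕ) (h0 : I s)
    (he : ∀ s', Same p.wr p.wm s s' → I s' → e.safe w s')
    (hs : ∀ s', Same p.wr p.wm s s' → I s' → e.val s' ≠ 0 →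
      Runs w p s' T fun s'' => I s'' ∧ Φ s'' < Φ s')
    (hQ : ∀ s', Same p.wr p.wm s s' → I s' → e.val s' = 0 → Q s') :
    Runs w (.loop e p) s ((Φ s + 1) * (T + (e.cost + 1))) Q := by
  have key : ∀ d s', Φ s' ≤ d → Same p.wr p.wm s s' → I s' →
      Runs w (.loop e p) s' (d * (T + (e.cost + 1)) + (e.cost + 1)) Q := by
    intro d
    induction d with
    | zero =>
      intro s' hd hS hIs hok
      have hv := (Expr.eval_eq hok _ (he s' hS hIs)).1
      by_cases h : e.val s' = 0
      · exact ⟨s', _, .loop_false _ _ _ (h ▸ hv), by omega, hok, hQ s' hS hIs h⟩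
      · obtain ⟨s1, t1, _, _, _, _, h6⟩ := hs s' hS hIs h hok
        omega
    | succ d ih =>
      intro s' hd hS hIs hok
      have hv := (Expr.eval_eq hok _ (he s' hS hIs)).1
      by_cases h : e.val s' = 0
      · exact ⟨s', _, .loop_false _ _ _ (h ▸ hv), by omega, hok, hQ s' hS hIs h⟩
      · obtain ⟨s1, t1, hx1, ht1, hok1, hI1, hlt⟩ := hs s' hS hIs h hok
        obtain ⟨s2, t2, hx2, ht2, hok2, hq2⟩ := ih s1 (by omega) (hS.trans hx1.same) hI1 hok1
        exact ⟨s2, _, .loop_true _ _ _ _ _ _ _ _ hv h hx1 hx2, by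
          rw [add_mul]; omega, hok2, hq2⟩
  refine (key _ s le_rfl (Same.refl _ _ _) h0).time_le ?_
  nlinarith

end WordRAM

/-! ### Exponent -/

/-- The exponents in the definition of `matMulExponent`. -/
def matMulExponents : Set ℝ :=
  {τ : ℝ | ∃ C : ℝ, ∀ n : ℕ, 1 ≤ n → ∃ r : ℕ, MatMulRankLE n r ∧ (r : ℝ) ≤ C * (n : ℝ) ^ τ}

/-- Multiplying by the identity writes every matrix as a combination of the `γ q`, so these span a
space of dimension `n ^ 2`. -/
theorem MatMulRankLE.sq_le {n r : ℕ} (h : MatMulRankLE n r) : n ^ 2 ≤ r := by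
  obtain ⟨α, β, γ, h⟩ := h
  have hs : Submodule.span ℚ (Set.range γ) = ⊤ := by
    rw [eq_top_iff]
    intro A _
    rw [← mul_one A, h A 1]
    exact Submodule.sum_mem _ fun q _ => Submodule.smul_mem _ _ (Submodule.subset_span ⟨q, rfl⟩)
  have h1 := finrank_range_le_card (R := ℚ) γ
  rw [Set.finrank, hs, finrank_top, Module.finrank_matrix] at h1
  simpa [pow_two] using h1

/-- The school method. It only serves to show that the infimum is over a nonempty set. -/
theorem matMulRankLE_cube (n : ℕ) : MatMulRankLE n (n ^ 3) := by
  have e : Fin (n ^ 3) ≃ Fin n × Fin n × Fin n :=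
    Fintype.equivOfCardEq (by simp; ring)
  refine ⟨fun q => Matrix.single (e q).1 (e q).2.1 1, fun q => Matrix.single (e q).2.1 (e q).2.2 1,
    fun q => Matrix.single (e q).1 (e q).2.2 1, fun A B => ?_⟩
  rw [e.sum_comp (fun q : Fin n × Fin n × Fin n =>
    ((∑ i, ∑ j, Matrix.single q.1 q.2.1 (1 : ℚ) i j * A i j) *
      (∑ i, ∑ j, Matrix.single q.2.1 q.2.2 (1 : ℚ) i j * B i j)) •
        Matrix.single q.1 q.2.2 (1 : ℚ))]
  ext i k
  simp only [Fintype.sum_prod_type, Matrix.single_apply, Matrix.mul_apply, Matrix.sum_apply,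
    Matrix.smul_apply, ite_and, ite_mul, one_mul, zero_mul, Finset.sum_ite_eq,
    Finset.mem_univ, if_true, smul_eq_mul, mul_ite, mul_one, mul_zero]
  simp [Finset.sum_ite_eq, Finset.sum_ite_eq', Finset.sum_ite_irrel]

theorem three_mem_matMulExponents : (3 : ℝ) ∈ matMulExponents :=
  ⟨1, fun n _ => ⟨n ^ 3, matMulRankLE_cube n, by norm_cast; simp⟩⟩

theorem two_le_of_mem_matMulExponents {τ : ℝ} (h : τ ∈ matMulExponents) : 2 ≤ τ := by
  by_contra! hτ
  obtain ⟨C, h⟩ := h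
  have h1 := (tendsto_rpow_atTop (show 0 < 2 - τ by linarith)).comp
    (tendsto_natCast_atTop_atTop (R := ℝ))
  obtain ⟨n, hn1, hn⟩ := ((h1.eventually_gt_atTop C).and (Filter.eventually_ge_atTop 1)).exists
  obtain ⟨r, hr, hle⟩ := h n hn
  have hn0 : (0 : ℝ) < n := by exact_mod_cast hn
  have h2 : ((n ^ 2 : ℕ) : ℝ) ≤ r := by exact_mod_cast hr.sq_le
  have h3 : (n : ℝ) ^ (2 - τ) * (n : ℝ) ^ τ = ((n ^ 2 : ℕ) : ℝ) := by
    rw [← Real.rpow_add hn0]; norm_num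
  have h4 : 0 < (n : ℝ) ^ τ := by positivity
  simp only [Function.comp] at hn1
  nlinarith

theorem two_le_matMulExponent : 2 ≤ matMulExponent :=
  le_csInf ⟨3, three_mem_matMulExponents⟩ fun _ => two_le_of_mem_matMulExponents

/-- Some admissible exponent `τ` is below `ω + δ`, and for large `n` the power `n ^ (ω + δ - τ)`
swallows its constant. The order `n` is also chosen with `2 ≤ n ^ δ`: this later absorbs the factor
`L + 1` of the Kronecker power. -/
theorem exists_matMulRankLE {δ : ℝ} (hδ : 0 < δ) :
    ∃ n r : ℕ, 2 ≤ n ∧ MatMulRankLE n r ∧ (r : ℝ) ≤ (n : ℝ) ^ (matMulExponent + δ) ∧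
      2 ≤ (n : ℝ) ^ δ := by
  obtain ⟨τ, hτ, hlt⟩ := exists_lt_of_csInf_lt (s := matMulExponents)
    ⟨3, three_mem_matMulExponents⟩ (show matMulExponent < matMulExponent + δ by linarith)
  obtain ⟨C, h⟩ := hτ
  have h1 := (tendsto_rpow_atTop (show 0 < matMulExponent + δ - τ by linarith)).comp
    (tendsto_natCast_atTop_atTop (R := ℝ))
  have h2 := (tendsto_rpow_atTop hδ).comp (tendsto_natCast_atTop_atTop (R := ℝ))
  obtain ⟨n, hn1, hn2, hn⟩ := ((h1.eventually_ge_atTop C).and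
    ((h2.eventually_ge_atTop 2).and (Filter.eventually_ge_atTop 2))).exists
  obtain ⟨r, hr, hle⟩ := h n (by omega)
  refine ⟨n, r, hn, hr, hle.trans ?_, hn2⟩
  have hn0 : (0 : ℝ) < n := by exact_mod_cast (by omega : 0 < n)
  have h3 : (n : ℝ) ^ (matMulExponent + δ) =
      (n : ℝ) ^ (matMulExponent + δ - τ) * (n : ℝ) ^ τ := by
    rw [← Real.rpow_add hn0]; ring_nf
  rw [h3]
  exact mul_le_mul_of_nonneg_right hn1 (by positivity)

/-! ### Bilinear algorithms with integral coefficients -/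

/-- The integers `α`, `β`, `γ` are the numerators of the coefficients, over the denominator `D`, of
a bilinear algorithm with `r` multiplications for matrices of order `n`. -/
def IsBilinearAlgorithm (n r D : ℕ) (α β γ : ℕ → ℕ → ℤ) : Prop :=
  ∀ i < n, ∀ j < n, ∀ j' < n, ∀ k < n, ∀ i' < n, ∀ k' < n,
    ∑ q ∈ Finset.range r, α q (i * n + j) * β q (j' * n + k) * γ q (i' * n + k') =
      if i = i' ∧ j = j' ∧ k = k' then (D : ℤ) ^ 3 else 0

theorem exists_denominator {ι : Type*} (s : Finset ι) (f : ι → ℚ) :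
    ∃ D : ℕ, 0 < D ∧ ∀ i ∈ s, ∃ z : ℤ, (z : ℚ) = D * f i := by
  classical
  refine ⟨∏ i ∈ s, (f i).den, Finset.prod_pos fun i _ => (f i).den_pos, fun i hi => ?_⟩
  obtain ⟨c, hc⟩ := Finset.dvd_prod_of_mem (fun i => (f i).den) hi
  refine ⟨(f i).num * c, ?_⟩
  rw [hc]; push_cast
  have := Rat.num_div_den (f i)
  have h0 : ((f i).den : ℚ) ≠ 0 := by exact_mod_cast (f i).den_ne_zero
  field_simp at this
  rw [this]; ring

/-- Testing the algorithm on pairs of matrix units turns the identity of bilinear maps into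
equations for the coefficients. Each of the three factors is scaled by the same denominator, hence
`D ^ 3`. -/
theorem MatMulRankLE.exists_isBilinearAlgorithm {n r : ℕ} (hn : 0 < n) (h : MatMulRankLE n r) :
    ∃ (D : ℕ) (α β γ : ℕ → ℕ → ℤ), 0 < D ∧ IsBilinearAlgorithm n r D α β γ := by
  obtain ⟨α, β, γ, h⟩ := h
  obtain ⟨D, hD, hz⟩ := exists_denominator (Finset.univ : Finset (Fin 3 × Fin r × Fin n × Fin n))
    (fun x => ![α, β, γ] x.1 x.2.1 x.2.2.1 x.2.2.2)
  choose! z hz using hz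
  let Z : Fin 3 → ℕ → ℕ → ℤ := fun t q x => if hq : q < r ∧ x / n < n then
    z (t, ⟨q, hq.1⟩, ⟨x / n, hq.2⟩, ⟨x % n, Nat.mod_lt _ hn⟩) else 0
  have hZ : ∀ t (q : Fin r) (i j : Fin n),
      (Z t q (i * n + j) : ℚ) = D * ![α, β, γ] t q i j := by
    intro t q i j
    have h1 : ((i : ℕ) * n + j) / n = i := by
      rw [mul_comm, Nat.mul_add_div hn, Nat.div_eq_of_lt j.2, add_zero]
    have h2 : ((i : ℕ) * n + j) % n = j := by
      rw [mul_comm, Nat.mul_add_mod, Nat.mod_eq_of_lt j.2]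
    have := hz (t, q, i, j) (Finset.mem_univ _)
    simp only [Z, h1, h2, q.2, i.2, and_self, dite_true, Fin.eta]
    exact this
  refine ⟨D, Z 0, Z 1, Z 2, hD, fun i hi j hj j' hj' k hk i' hi' k' hk' => ?_⟩
  have key := congrFun (congrFun (h (Matrix.single ⟨i, hi⟩ ⟨j, hj⟩ 1)
    (Matrix.single ⟨j', hj'⟩ ⟨k, hk⟩ 1)) ⟨i', hi'⟩) ⟨k', hk'⟩
  simp only [Matrix.single_apply, Matrix.mul_apply, Matrix.sum_apply,
    Matrix.smul_apply, ite_and, smul_eq_mul, mul_ite, mul_one, mul_zero, ite_mul, zero_mul, one_mul,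
    Finset.sum_ite_irrel, Finset.sum_ite_eq, Finset.sum_ite_eq', Finset.mem_univ, if_true,
    Finset.sum_const_zero] at key
  have : ((∑ q ∈ Finset.range r, Z 0 q (i * n + j) * Z 1 q (j' * n + k) * Z 2 q (i' * n + k') : ℤ)
      : ℚ) = ((if i = i' ∧ j = j' ∧ k = k' then (D : ℤ) ^ 3 else 0 : ℤ) : ℚ) := by
    rw [Finset.sum_range]
    push_cast
    have h3 : ∀ q : Fin r, (Z 0 q (i * n + j) * Z 1 q (j' * n + k) * Z 2 q (i' * n + k') : ℚ) =
        (D : ℚ) ^ 3 * (α q ⟨i, hi⟩ ⟨j, hj⟩ * β q ⟨j', hj'⟩ ⟨k, hk⟩ * γ q ⟨i', hi'⟩ ⟨k', hk'⟩) := by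
      intro q
      have a1 := hZ 0 q ⟨i, hi⟩ ⟨j, hj⟩
      have a2 := hZ 1 q ⟨j', hj'⟩ ⟨k, hk⟩
      have a3 := hZ 2 q ⟨i', hi'⟩ ⟨k', hk'⟩
      simp only at a1 a2 a3
      rw [a1, a2, a3]
      simp only [Matrix.cons_val]
      ring
    rw [Finset.sum_congr rfl fun q _ => h3 q, ← Finset.mul_sum, ← key]
    simp only [Fin.mk.injEq]
    by_cases e1 : i = i' <;> by_cases e2 : j = j' <;> by_cases e3 : k = k' <;>
      simp [e1, e2, e3, eq_comm]
  exact_mod_cast this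

/-! ### Kronecker powers of linear maps -/

section Kron
variable {K : Type*} [CommRing K]

/-- The `L`-th Kronecker power of the `q × p` matrix `c`, applied to the vector `x`. -/
def kron (p q : ℕ) (c : ℕ → ℕ → K) : ℕ → (ℕ → K) → ℕ → K
  | 0, x, i => x i
  | L + 1, x, i =>
    kron p q c L (fun j => ∑ b ∈ Finset.range p, c (i / q ^ L) b * x (b * p ^ L + j)) (i % q ^ L)

theorem kron_congr {p q : ℕ} {c : ℕ → ℕ → K} {L : ℕ} {x y : ℕ → K} {i : ℕ} (hi : i < q ^ L)
    (h : ∀ j < p ^ L, x j = y j) : kron p q c L x i = kron p q c L y i := by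
  induction L generalizing x y i with
  | zero => simp at hi; subst hi; exact h 0 (by simp)
  | succ L ih =>
    have hq : 0 < q ^ L := Nat.pos_of_ne_zero fun h0 => by simp [pow_succ, h0] at hi
    refine ih (Nat.mod_lt _ hq) fun j hj => Finset.sum_congr rfl fun b hb => ?_
    rw [h]
    have := Finset.mem_range.1 hb
    calc b * p ^ L + j < (b + 1) * p ^ L := by rw [add_mul]; omega
      _ ≤ p ^ (L + 1) := by rw [pow_succ, mul_comm]; exact Nat.mul_le_mul_left _ this

theorem kron_sum {ι : Type*} (t : Finset ι) (g : ι → K) (z : ι → ℕ → K) (p q : ℕ)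
    (c : ℕ → ℕ → K) (L i : ℕ) :
    kron p q c L (fun j => ∑ a ∈ t, g a * z a j) i = ∑ a ∈ t, g a * kron p q c L (z a) i := by
  induction L generalizing z i with
  | zero => rfl
  | succ L ih =>
    simp only [kron]
    rw [← ih]
    congr 1
    funext j
    simp only [Finset.mul_sum]
    rw [Finset.sum_comm]
    exact Finset.sum_congr rfl fun a _ => Finset.sum_congr rfl fun b _ => by ring

/-- The digits of `i` in base `n`, read in base `n ^ 2`. -/
def spread (n : ℕ) : ℕ → ℕ → ℕ
  | 0, _ => 0
  | L + 1, i => i / n ^ L * (n * n) ^ L + spread n L (i % n ^ L)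

/-- The position of the entry `(i, j)` in the recursive layout of a matrix of order `n ^ L`. -/
def addr (n L i j : ℕ) : ℕ := n * spread n L i + spread n L j

theorem spread_succ {n L a i : ℕ} (hi : i < n ^ L) :
    spread n (L + 1) (a * n ^ L + i) = a * (n * n) ^ L + spread n L i := by
  have h0 : 0 < n ^ L := by omega
  rw [spread, mul_comm a, Nat.mul_add_div h0, Nat.div_eq_of_lt hi, Nat.mul_add_mod,
    Nat.mod_eq_of_lt hi, add_zero]

/-- In the recursive layout the `n * n` blocks of a matrix are contiguous segments, so that applying
the small algorithm to blocks means transforming the top digit of the address. -/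
theorem addr_succ {n L a b i j : ℕ} (hi : i < n ^ L) (hj : j < n ^ L) :
    addr n (L + 1) (a * n ^ L + i) (b * n ^ L + j) = (a * n + b) * (n * n) ^ L + addr n L i j := by
  rw [addr, addr, spread_succ hi, spread_succ hj]; ring

theorem mul_add_lt {a b c d : ℕ} (ha : a < c) (hb : b < d) : a * d + b < c * d := by
  calc a * d + b < (a + 1) * d := by rw [add_mul]; omega
    _ ≤ c * d := Nat.mul_le_mul_right _ ha

theorem exists_eq_mul_add {x c d : ℕ} (h : x < c * d) : ∃ a < c, ∃ b < d, x = a * d + b := by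
  have hd : 0 < d := Nat.pos_of_ne_zero fun h0 => by simp [h0] at h
  exact ⟨x / d, Nat.div_lt_of_lt_mul (by rwa [mul_comm]), x % d, Nat.mod_lt _ hd,
    (Nat.div_add_mod' x d).symm⟩

theorem exists_eq_top_digit {n L x : ℕ} (h : x < n ^ (L + 1)) :
    ∃ a < n, ∃ b < n ^ L, x = a * n ^ L + b :=
  exists_eq_mul_add (by rwa [pow_succ'] at h)

theorem mul_add_inj {a b a' b' d : ℕ} (hb : b < d) (hb' : b' < d) :
    a * d + b = a' * d + b' ↔ a = a' ∧ b = b' := by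
  refine ⟨fun h => ?_, fun h => by rw [h.1, h.2]⟩
  have hd : 0 < d := by omega
  have h1 := congrArg (· / d) h
  simp only [mul_comm _ d, Nat.mul_add_div hd, Nat.div_eq_of_lt hb, Nat.div_eq_of_lt hb',
    add_zero] at h1
  subst h1
  exact ⟨rfl, by omega⟩

theorem addr_lt {n L i j : ℕ} (hi : i < n ^ L) (hj : j < n ^ L) :
    addr n L i j < (n * n) ^ L := by
  induction L generalizing i j with
  | zero => simp [addr, spread]
  | succ L ih =>
    obtain ⟨a, ha, i, h0i, rfl⟩ := exists_eq_top_digit hi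
    obtain ⟨b, hb, j, h0j, rfl⟩ := exists_eq_top_digit hj
    rw [addr_succ h0i h0j, pow_succ']
    exact mul_add_lt (mul_add_lt ha hb) (ih h0i h0j)

theorem addr_inj {n L i j i' j' : ℕ} (hi : i < n ^ L) (hj : j < n ^ L) (hi' : i' < n ^ L)
    (hj' : j' < n ^ L) : addr n L i j = addr n L i' j' ↔ i = i' ∧ j = j' := by
  refine ⟨fun h => ?_, fun h => by rw [h.1, h.2]⟩
  induction L generalizing i j i' j' with
  | zero => simp at hi hj hi' hj'; simp [*]
  | succ L ih =>
    obtain ⟨a, ha, i, h0i, rfl⟩ := exists_eq_top_digit hi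
    obtain ⟨b, hb, j, h0j, rfl⟩ := exists_eq_top_digit hj
    obtain ⟨a', ha', i', h0i', rfl⟩ := exists_eq_top_digit hi'
    obtain ⟨b', hb', j', h0j', rfl⟩ := exists_eq_top_digit hj'
    rw [addr_succ h0i h0j, addr_succ h0i' h0j', mul_add_inj (addr_lt h0i h0j) (addr_lt h0i' h0j'),
      mul_add_inj hb hb'] at h
    obtain ⟨⟨rfl, rfl⟩, h⟩ := h
    obtain ⟨rfl, rfl⟩ := ih h0i h0j h0i' h0j' h
    exact ⟨rfl, rfl⟩

theorem exists_eq_addr {n L x : ℕ} (h : x < (n * n) ^ L) :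
    ∃ i < n ^ L, ∃ j < n ^ L, x = addr n L i j := by
  induction L generalizing x with
  | zero => simp at h; subst h; exact ⟨0, by simp, 0, by simp, rfl⟩
  | succ L ih =>
    obtain ⟨c, hc, y, hy, rfl⟩ := exists_eq_top_digit h
    obtain ⟨a, ha, b, hb, rfl⟩ := exists_eq_mul_add hc
    obtain ⟨i, hi, j, hj, rfl⟩ := ih hy
    refine ⟨a * n ^ L + i, ?_, b * n ^ L + j, ?_, (addr_succ hi hj).symm⟩ <;>
    · rw [pow_succ']; exact mul_add_lt ‹_› ‹_›

/-- The digits of a number, from the lowest one. -/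
theorem spread_eq {n L i : ℕ} (hn : 0 < n) (hi : i < n ^ L) :
    spread n L i = spread n L (i / n) * (n * n) + i % n := by
  have key : ∀ L i, i < n ^ (L + 1) →
      spread n (L + 1) i = spread n L (i / n) * (n * n) + i % n := by
    intro L
    induction L with
    | zero =>
      intro i hi
      simp at hi
      simp [spread, Nat.mod_eq_of_lt hi]
    | succ L ih =>
      intro i hi
      obtain ⟨a, ha, i, h0i, rfl⟩ := exists_eq_top_digit hi
      have h1 : i / n < n ^ L := Nat.div_lt_of_lt_mul (by rwa [pow_succ'] at h0i)
      have h2 : (a * n ^ (L + 1) + i) / n = a * n ^ L + i / n := by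
        rw [pow_succ, ← mul_assoc, mul_comm, Nat.mul_add_div hn]
      have h3 : (a * n ^ (L + 1) + i) % n = i % n := by
        rw [pow_succ, ← mul_assoc, mul_comm, Nat.mul_add_mod]
      rw [spread_succ h0i, ih i h0i, h2, h3, spread_succ h1]; ring
  cases L with
  | zero => simp at hi; subst hi; simp [spread]
  | succ L =>
    have h1 : i / n < n ^ L := Nat.div_lt_of_lt_mul (by rwa [pow_succ'] at hi)
    have h2 := spread_succ (a := 0) h1
    simp only [zero_mul, zero_add] at h2
    rw [key L i hi, h2]

theorem sum_range_mul' {M : Type*} [AddCommMonoid M] (c d : ℕ) (f : ℕ → M) :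
    ∑ x ∈ Finset.range (c * d), f x =
      ∑ a ∈ Finset.range c, ∑ b ∈ Finset.range d, f (a * d + b) := by
  induction c with
  | zero => simp
  | succ c ih => rw [add_mul, one_mul, Finset.sum_range_add, ih, Finset.sum_range_succ]

/-- A matrix of order `n ^ (L + 1)` is an `n × n` matrix of blocks. The small algorithm, applied to
blocks, needs `r` products of matrices of order `n ^ L`, which are correct by induction; linearity
(`kron_sum`) allows combining them before or after the lower levels. -/
theorem kron_mul {n r : ℕ} (hn : 0 < n) {α β γ : ℕ → ℕ → K}
    (h : ∀ i < n, ∀ j < n, ∀ j' < n, ∀ k < n, ∀ i' < n, ∀ k' < n,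
      ∑ q ∈ Finset.range r, α q (i * n + j) * β q (j' * n + k) * γ (i' * n + k') q =
        if i = i' ∧ j = j' ∧ k = k' then 1 else 0)
    {L i k : ℕ} (hi : i < n ^ L) (hk : k < n ^ L) (x y : ℕ → K) :
    kron r (n * n) γ L (fun q => kron (n * n) r α L x q * kron (n * n) r β L y q) (addr n L i k) =
      ∑ j ∈ Finset.range (n ^ L), x (addr n L i j) * y (addr n L j k) := by
  induction L generalizing x y i k with
  | zero => simp at hi hk; subst hi hk; simp [kron, addr, spread]
  | succ L ih =>
    obtain ⟨a, ha, i, h0i, rfl⟩ := exists_eq_top_digit hi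
    obtain ⟨c, hc, k, h0k, rfl⟩ := exists_eq_top_digit hk
    have hp := addr_lt h0i h0k
    have hp0 : 0 < (n * n) ^ L := by positivity
    rw [addr_succ h0i h0k, kron]
    have e1 : ((a * n + c) * (n * n) ^ L + addr n L i k) / (n * n) ^ L = a * n + c := by
      rw [mul_comm, Nat.mul_add_div hp0, Nat.div_eq_of_lt hp, add_zero]
    have e2 : ((a * n + c) * (n * n) ^ L + addr n L i k) % (n * n) ^ L = addr n L i k := by
      rw [mul_comm, Nat.mul_add_mod, Nat.mod_eq_of_lt hp]
    rw [e1, e2]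
    have e3 : ∀ q < r, ∀ j < r ^ L, (q * r ^ L + j) / r ^ L = q ∧ (q * r ^ L + j) % r ^ L = j := by
      intro q hq j hj
      have : 0 < r ^ L := by omega
      rw [mul_comm, Nat.mul_add_div this, Nat.div_eq_of_lt hj, Nat.mul_add_mod,
        Nat.mod_eq_of_lt hj]
      simp
    -- `X q` and `Y q` are the linear combinations of blocks that enter the product number `q`.
    let X : ℕ → ℕ → K := fun q j => ∑ b ∈ Finset.range (n * n), α q b * x (b * (n * n) ^ L + j)
    let Y : ℕ → ℕ → K := fun q j => ∑ b ∈ Finset.range (n * n), β q b * y (b * (n * n) ^ L + j)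
    have e4 : kron r (n * n) γ L (fun j => ∑ q ∈ Finset.range r, γ (a * n + c) q *
        (kron (n * n) r α (L + 1) x (q * r ^ L + j) * kron (n * n) r β (L + 1) y (q * r ^ L + j)))
        (addr n L i k) =
        kron r (n * n) γ L (fun j => ∑ q ∈ Finset.range r, γ (a * n + c) q *
          (kron (n * n) r α L (X q) j * kron (n * n) r β L (Y q) j)) (addr n L i k) := by
      refine kron_congr hp fun j hj => Finset.sum_congr rfl fun q hq => ?_
      obtain ⟨h1, h2⟩ := e3 q (Finset.mem_range.1 hq) j hj
      simp only [kron, h1, h2, X, Y]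
    rw [e4, kron_sum (Finset.range r) (fun q => γ (a * n + c) q)
      (fun q j => kron (n * n) r α L (X q) j * kron (n * n) r β L (Y q) j)]
    simp only [fun q => ih h0i h0k (X q) (Y q)]
    rw [pow_succ', sum_range_mul']
    have e5 : ∀ b < n, ∀ j < n ^ L,
        x (addr n (L + 1) (a * n ^ L + i) (b * n ^ L + j)) *
          y (addr n (L + 1) (b * n ^ L + j) (c * n ^ L + k)) =
        x ((a * n + b) * (n * n) ^ L + addr n L i j) *
          y ((b * n + c) * (n * n) ^ L + addr n L j k) := by
      intro b _ j hj
      rw [addr_succ h0i hj, addr_succ hj h0k]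
    rw [Finset.sum_congr rfl fun b hb => Finset.sum_congr rfl fun j hj =>
      e5 b (Finset.mem_range.1 hb) j (Finset.mem_range.1 hj), Finset.sum_comm]
    simp only [Finset.mul_sum]
    rw [Finset.sum_comm]
    refine Finset.sum_congr rfl fun j _ => ?_
    simp only [X, Y, sum_range_mul']
    generalize hX : (fun u v => x ((u * n + v) * (n * n) ^ L + addr n L i j)) = X'
    generalize hY : (fun u v => y ((u * n + v) * (n * n) ^ L + addr n L j k)) = Y'
    have hX' : ∀ u v, x ((u * n + v) * (n * n) ^ L + addr n L i j) = X' u v := fun u v => by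
      rw [← hX]
    have hY' : ∀ u v, y ((u * n + v) * (n * n) ^ L + addr n L j k) = Y' u v := fun u v => by
      rw [← hY]
    simp only [hX', hY']
    calc ∑ q ∈ Finset.range r, γ (a * n + c) q *
          ((∑ u ∈ Finset.range n, ∑ v ∈ Finset.range n, α q (u * n + v) * X' u v) *
            ∑ u ∈ Finset.range n, ∑ v ∈ Finset.range n, β q (u * n + v) * Y' u v)
        = ∑ q ∈ Finset.range r, ∑ u ∈ Finset.range n, ∑ v ∈ Finset.range n,
          ∑ u' ∈ Finset.range n, ∑ v' ∈ Finset.range n,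
            (α q (u * n + v) * β q (u' * n + v') * γ (a * n + c) q) * (X' u v * Y' u' v') := by
          refine Finset.sum_congr rfl fun q _ => ?_
          rw [Finset.sum_mul, Finset.mul_sum]
          refine Finset.sum_congr rfl fun u _ => ?_
          rw [Finset.sum_mul, Finset.mul_sum]
          refine Finset.sum_congr rfl fun v _ => ?_
          rw [Finset.mul_sum, Finset.mul_sum]
          refine Finset.sum_congr rfl fun u' _ => ?_
          rw [Finset.mul_sum, Finset.mul_sum]
          exact Finset.sum_congr rfl fun v' _ => by ring
      _ = ∑ u ∈ Finset.range n, ∑ v ∈ Finset.range n,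
          ∑ u' ∈ Finset.range n, ∑ v' ∈ Finset.range n,
            (if u = a ∧ v = u' ∧ v' = c then 1 else 0) * (X' u v * Y' u' v') := by
          rw [Finset.sum_comm]
          refine Finset.sum_congr rfl fun u hu => ?_
          rw [Finset.sum_comm]
          refine Finset.sum_congr rfl fun v hv => ?_
          rw [Finset.sum_comm]
          refine Finset.sum_congr rfl fun u' hu' => ?_
          rw [Finset.sum_comm]
          refine Finset.sum_congr rfl fun v' hv' => ?_
          rw [← Finset.sum_mul, h u (by simpa using hu) v (by simpa using hv) u'
            (by simpa using hu') v' (by simpa using hv') a ha c hc]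
      _ = ∑ b ∈ Finset.range n, X' a b * Y' b c := by
          simp only [ite_and, ite_mul, one_mul, zero_mul]
          rw [Finset.sum_eq_single a (fun u _ hu => by simp [hu]) (fun h => by simp [ha] at h)]
          refine Finset.sum_congr rfl fun v hv => ?_
          rw [Finset.sum_eq_single v (fun u _ hu => by simp [hu.symm]) (fun h => absurd hv h)]
          simp [hc]

end Kron

/-- The integer `x / D` modulo `D * N + 1`. -/
theorem IsBilinearAlgorithm.map_zmod {n r D N : ℕ} {α β γ : ℕ → ℕ → ℤ}
    (h : IsBilinearAlgorithm n r D α β γ) :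
    ∀ i < n, ∀ j < n, ∀ j' < n, ∀ k < n, ∀ i' < n, ∀ k' < n,
      ∑ q ∈ Finset.range r, (-(N : ZMod (D * N + 1)) * α q (i * n + j)) *
        (-(N : ZMod (D * N + 1)) * β q (j' * n + k)) *
        (-(N : ZMod (D * N + 1)) * γ q (i' * n + k')) =
        if i = i' ∧ j = j' ∧ k = k' then 1 else 0 := by
  intro i hi j hj j' hj' k hk i' hi' k' hk'
  -- So `-N` is an inverse of `D` in this ring and plays the part of `1 / D`; the modulus need not
  -- be prime.
  have h1 : (D : ZMod (D * N + 1)) * N = -1 := by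
    have := ZMod.natCast_self (D * N + 1)
    push_cast at this
    linear_combination this
  have h2 := congrArg (Int.cast : ℤ → ZMod (D * N + 1)) (h i hi j hj j' hj' k hk i' hi' k' hk')
  push_cast at h2
  calc _ = (-(N : ZMod (D * N + 1))) ^ 3 * ∑ q ∈ Finset.range r,
        ((α q (i * n + j) : ZMod (D * N + 1)) * β q (j' * n + k) * γ q (i' * n + k')) := by
        rw [Finset.mul_sum]
        exact Finset.sum_congr rfl fun q _ => by ring
    _ = _ := by
      rw [h2]
      split_ifs
      · linear_combination (-(D : ZMod (D * N + 1))^2 * N^2 + D * N - 1) * h1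
      · simp

namespace WordRAM
open Expr (reg load const)
open Prog (assign store skip)

/-! ### Fast matrix multiplication -/

/-- The value of one entry of a Kronecker step. -/
def xformEntry (arr carr p q : ℕ) : Prog :=
  assign 44 (const 0) ;;
  forTo 45 (const p)
    (assign 44 ((reg 44 + load carr (reg 43 / reg 40 % const q * const p + reg 45) *
      load arr ((reg 43 / reg 40 / const q * const p + reg 45) * reg 40 + reg 43 % reg 40)) %
        reg 8)) ;;
  store 27 (reg 43) (reg 44)

/-- One step of the application of a Kronecker power. -/
def xformStep (arr carr p q : ℕ) : Prog :=
  assign 40 (reg 40 / const p) ;;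
  assign 41 (reg 41 * const q) ;;
  forTo 43 (reg 41 * reg 40) (xformEntry arr carr p q) ;;
  forTo 43 (reg 41 * reg 40) (store arr (reg 43) (load 27 (reg 43)))

/-- Applies the Kronecker power of the `q × p` matrix in array `carr` to the vector in array `arr`,
whose length is in register `len`. -/
def xform (arr carr p q len : ℕ) : Prog :=
  assign 40 (reg len) ;;
  assign 41 (const 1) ;;
  forTo 42 (reg 5) (xformStep arr carr p q)

section
variable {w arr carr p q L Md B : ℕ} {c : ℕ → ℕ → ℕ} {s : State}

/-- The sum is reduced after every term, so no intermediate value exceeds `Md * Md + Md`, which `hw`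
keeps within a word. -/
theorem xformEntry_runs (h27 : arr ≠ 27) (hc27 : carr ≠ 27) (hMd : 0 < Md) (h8 : s.reg 8 = Md)
    (hw : Md * Md + Md < 2 ^ w) {v len idx : ℕ} (h43 : s.reg 43 = idx) (h40 : s.reg 40 = v)
    (hidx : idx / v % q < q) (hpq : q * p < 2 ^ w) (hp : p < 2 ^ w) (hq : q < 2 ^ w)
    (hlen : ∀ b < p, (idx / v / q * p + b) * v + idx % v < len) (hv : 0 < v) (hlw : len < 2 ^ w)
    (hcoef : ∀ a < q, ∀ b < p, s.mem carr (a * p + b) = c a b) (hcM : ∀ a < q, ∀ b < p, c a b < Md)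
    (hx : ∀ i < len, s.mem arr i < Md) :
    Runs w (xformEntry arr carr p q) s (p * 60 + 60) fun s' =>
      (∀ i, i ≠ idx → s'.mem 27 i = s.mem 27 i) ∧ s'.mem 27 idx < Md ∧
        (s'.mem 27 idx : ZMod Md) = ∑ b ∈ Finset.range p, (c (idx / v % q) b : ZMod Md) *
          s.mem arr ((idx / v / q * p + b) * v + idx % v) := by
  apply Runs.time_le
  · apply Runs.wp_seq
    apply And.intro (by simp)
    apply Runs.seq
    · apply Runs.for_const (m := p) (I := fun i s' => s'.reg 44 < Md ∧
        (s'.reg 44 : ZMod Md) = ∑ b ∈ Finset.range i, (c (idx / v % q) b : ZMod Md) *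
          s.mem arr ((idx / v / q * p + b) * v + idx % v))
      · rfl
      · exact fun s' _ => ⟨hp, rfl⟩
      · exact fun _ _ _ h => h
      · simp [hMd]
      intro i s' hi h45 hS ⟨hlt, hsum⟩
      have e43 : s'.reg 43 = idx := (hS.1 43 rfl).trans (by simpa using h43)
      have e40 : s'.reg 40 = v := (hS.1 40 rfl).trans (by simpa using h40)
      have e8 : s'.reg 8 = Md := (hS.1 8 rfl).trans (by simpa using h8)
      have ec := hS.2 carr rfl
      have ea := hS.2 arr rfl
      have hl := hlen i hi
      have h1 : idx / v % q * p + i < q * p := mul_add_lt hidx hi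
      have h2 : s.mem carr (idx / v % q * p + i) < Md := by
        rw [hcoef _ hidx _ hi]; exact hcM _ hidx _ hi
      have h3 := hx _ hl
      have h4 := Nat.mul_le_mul h2.le h3.le
      have h5 : idx / v / q * p + i ≤ (idx / v / q * p + i) * v := Nat.le_mul_of_pos_right _ hv
      refine Runs.straight ⟨?_, ?_, ?_⟩
      · simp only [setReg_mem] at ec ea
        simp only [safe_mod, safe_add, safe_mul, safe_load, safe_reg, safe_const, safe_div,
          val_add, val_mul, val_load, val_reg, val_const, val_div, val_mod, e43, e40, h45, ec, ea,
          true_and, and_true]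
        and_intros <;> omega
      · simp only [setReg_reg, if_true, val_mod, val_reg, e8]
        exact Nat.mod_lt _ hMd
      · simp only [setReg_mem] at ec ea
        simp only [setReg_reg, if_true, val_mod, val_reg, e8, ZMod.natCast_mod, val_add, val_mul,
          val_load, val_const, val_div, e43, e40, h45, ec, ea]
        rw [Finset.sum_range_succ, ← hsum, hcoef _ hidx _ hi]
        push_cast
        rfl
      · exact fun _ _ _ h => h
    · rintro s' hS ⟨h1, h2⟩
      refine Runs.straight ⟨trivial, trivial, ?_⟩
      have e43 : s'.reg 43 = idx := (hS.1 43 rfl).trans (by simpa using h43)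
      have e27 : s'.mem 27 = s.mem 27 := hS.2 27 rfl
      simp only [val_reg, e43, setMem_mem, true_and, if_true]
      exact ⟨fun i hi => by rw [if_neg hi, e27], h1, h2⟩
  · simp only [Prog.time, cost_add, cost_const, cost_reg, cost_load, cost_mod, cost_mul, cost_div]
    omega

/-- The array is read as a box of size `u × p × v` and the matrix acts on the middle coordinate.
Array `27` buffers the result because every old entry enters several new ones. -/
theorem xformStep_runs (h27 : arr ≠ 27) (hc27 : carr ≠ 27) (hca : carr ≠ arr) (hMd : 0 < Md)
    (h8 : s.reg 8 = Md) (hw : Md * Md + Md < 2 ^ w) {u v : ℕ} (h40 : s.reg 40 = v * p)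
    (h41 : s.reg 41 = u) (hpq : q * p < 2 ^ w) (hp : p < 2 ^ w) (hq : q < 2 ^ w) (hp0 : 0 < p)
    (hq0 : 0 < q) (hv : 0 < v) (hB : u * p * v ≤ B) (hB' : u * q * v ≤ B) (hBw : B < 2 ^ w)
    (hcoef : ∀ a < q, ∀ b < p, s.mem carr (a * p + b) = c a b) (hcM : ∀ a < q, ∀ b < p, c a b < Md)
    (hx : ∀ i < u * p * v, s.mem arr i < Md) :
    Runs w (xformStep arr carr p q) s ((B + 1) * (p * 60 + 100)) fun s' =>
      s'.reg 40 = v ∧ s'.reg 41 = u * q ∧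
      ∀ i < u * q * v, s'.mem arr i < Md ∧ (s'.mem arr i : ZMod Md) =
        ∑ b ∈ Finset.range p, (c (i / v % q) b : ZMod Md) *
          s.mem arr ((i / v / q * p + b) * v + i % v) := by
  have huq : u * q ≤ u * q * v := Nat.le_mul_of_pos_right _ hv
  have hvp : v * p / p = v := Nat.mul_div_cancel _ hp0
  apply Runs.time_le
  · apply Runs.wp_seq
    refine ⟨⟨trivial, hp, trivial⟩, ?_⟩
    apply Runs.wp_seq
    refine ⟨by simp [h41]; omega, ?_⟩
    apply Runs.seq
    · apply Runs.for_const (m := u * q * v) (I := fun i s' => ∀ j < i, s'.mem 27 j < Md ∧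
        (s'.mem 27 j : ZMod Md) = ∑ b ∈ Finset.range p, (c (j / v % q) b : ZMod Md) *
          s.mem arr ((j / v / q * p + b) * v + j % v))
      · rfl
      · intro s' hS
        have e40 := hS.1 40 rfl
        have e41 := hS.1 41 rfl
        simp [h41, h40, hvp] at e40 e41
        simp [e40, e41]; omega
      · exact fun _ _ _ h => h
      · simp
      · intro i s' hi h43 hS hI
        have e40 := hS.1 40 rfl
        simp [h40, hvp] at e40
        have e8 : s'.reg 8 = Md := (hS.1 8 rfl).trans (by simpa using h8)
        have ea : s'.mem arr = s.mem arr := hS.2 arr (by simp [Prog.wm, forTo, xformEntry, h27])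
        have ec : s'.mem carr = s.mem carr := hS.2 carr (by simp [Prog.wm, forTo, xformEntry, hc27])
        have hiv : i / v < u * q := Nat.div_lt_of_lt_mul (by rwa [mul_comm])
        have hiq : i / v / q < u := Nat.div_lt_of_lt_mul (by rwa [mul_comm])
        refine (xformEntry_runs (c := c) (len := u * p * v) h27 hc27 hMd e8 hw h43 e40
          (Nat.mod_lt _ hq0) hpq hp hq (fun b hb => mul_add_lt (mul_add_lt hiq hb) (Nat.mod_lt _ hv))
          hv (by omega) (by rwa [ec]) hcM (by rwa [ea])).mono le_rfl ?_
        rintro s'' - ⟨h1, h2, h3⟩ j hj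
        rcases Nat.lt_succ_iff_lt_or_eq.1 hj with hj | rfl
        · rw [h1 j (by omega)]; exact hI j hj
        · exact ⟨h2, by rw [h3, ea]⟩
      · exact fun s' _ _ h => h
    · intro s1 hS1 h1
      have e40 := hS1.1 40 rfl
      have e41 := hS1.1 41 rfl
      simp [h41, h40, hvp] at e40 e41
      apply Runs.for_const (m := u * q * v) (I := fun i s' => ∀ j < i, s'.mem arr j = s1.mem 27 j)
      · rfl
      · intro s' hS
        have e40' := hS.1 40 rfl
        have e41' := hS.1 41 rfl
        simp [e40', e41', e40, e41]; omega
      · exact fun _ _ _ h => h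
      · simp
      · intro i s' hi h43 hS hI
        have e27 : s'.mem 27 = s1.mem 27 := hS.2 27 (by simp [Prog.wm, h27.symm])
        refine Runs.straight ⟨trivial, trivial, ?_⟩
        intro j hj
        simp only [setMem_mem, val_reg, h43, val_load, e27, true_and]
        split_ifs with h
        · rw [h]
        · exact hI j (by omega)
      · intro s' hS _ hI
        refine ⟨(hS.1 40 rfl).trans e40, (hS.1 41 rfl).trans e41, fun i hi => ?_⟩
        rw [hI i hi]
        exact h1 i hi
  · simp only [Prog.time, cost_add, cost_const, cost_reg, cost_load, cost_mod, cost_mul, cost_div]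
    nlinarith

/-- After `t` rounds the `t` top digits are transformed: the array consists of `q ^ t` segments of
length `p ^ (L - t)`, and the invariant says that the remaining Kronecker power, applied to each
segment, gives the final values. `B` bounds the length at every stage. -/
theorem xform_runs {len : ℕ} (h27 : arr ≠ 27) (hc27 : carr ≠ 27) (hca : carr ≠ arr) (hMd : 0 < Md)
    (h8 : s.reg 8 = Md) (hw : Md * Md + Md < 2 ^ w) (h5 : s.reg 5 = L) (hlen : s.reg len = p ^ L)
    (hpq : q * p < 2 ^ w) (hp : p < 2 ^ w) (hq : q < 2 ^ w) (hp0 : 0 < p) (hq0 : 0 < q)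
    (hB : ∀ t ≤ L, q ^ t * p ^ (L - t) ≤ B) (hBw : B < 2 ^ w)
    (hcoef : ∀ a < q, ∀ b < p, s.mem carr (a * p + b) = c a b) (hcM : ∀ a < q, ∀ b < p, c a b < Md)
    (hx : ∀ i < p ^ L, s.mem arr i < Md) :
    Runs w (xform arr carr p q len) s ((L + 1) * (B + 1) * (p * 60 + 120)) fun s' =>
      ∀ i < q ^ L, s'.mem arr i < Md ∧ (s'.mem arr i : ZMod Md) =
        kron p q (fun a b => (c a b : ZMod Md)) L (fun j => s.mem arr j) i := by
  apply Runs.time_le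
  · apply Runs.wp_seq
    refine ⟨trivial, ?_⟩
    apply Runs.wp_seq
    refine ⟨by simp only [safe_const]; nlinarith, ?_⟩
    apply Runs.for_const (m := L) (T := (B + 1) * (p * 60 + 100)) (I := fun t s' =>
      s'.reg 40 = p ^ (L - t) ∧ s'.reg 41 = q ^ t ∧
      (∀ i < q ^ t * p ^ (L - t), s'.mem arr i < Md) ∧
      ∀ a < q ^ t, ∀ b < q ^ (L - t),
        kron p q (fun a b => (c a b : ZMod Md)) (L - t)
          (fun j => s'.mem arr (a * p ^ (L - t) + j)) b =
        kron p q (fun a b => (c a b : ZMod Md)) L (fun j => s.mem arr j) (a * q ^ (L - t) + b))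
    · rfl
    · intro s' hS
      have e5 := hS.1 5 rfl
      simp [h5] at e5
      simp [e5]
    · exact fun _ _ _ h => h
    · simp [hlen]
      exact hx
    · rintro t s' ht - hS ⟨h40, h41, hlt, hk⟩
      have e5 := hS.1 5 rfl
      have e8 := hS.1 8 rfl
      have ec := hS.2 carr (by simp [Prog.wm, forTo, xformEntry, xformStep, hc27, hca])
      simp [h8] at e8
      simp only [setReg_mem] at ec
      obtain ⟨d, hd⟩ : ∃ d, L - t = d + 1 := ⟨L - t - 1, by omega⟩
      have hd' : L - (t + 1) = d := by omega
      have hpd : 0 < p ^ d := by positivity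
      rw [hd] at h40 hlt hk
      rw [hd']
      refine (xformStep_runs (B := B) (c := c) h27 hc27 hca hMd e8 hw (u := q ^ t) (v := p ^ d)
        (by rw [h40, pow_succ]) h41 hpq hp hq hp0 hq0 hpd ?_ ?_ hBw (by rwa [ec]) hcM ?_).mono
        le_rfl ?_
      · have := hB t (by omega)
        rwa [hd, pow_succ', ← mul_assoc] at this
      · have := hB (t + 1) (by omega)
        rwa [hd', pow_succ] at this
      · rwa [pow_succ', ← mul_assoc] at hlt
      · rintro s'' - ⟨h1, h2, h3⟩
        refine ⟨h1, by rw [h2, pow_succ], fun i hi => (h3 i (by rwa [pow_succ] at hi)).1, ?_⟩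
        intro a' ha' b hb
        rw [pow_succ] at ha'
        obtain ⟨A, hA, a, ha, rfl⟩ := exists_eq_mul_add ha'
        have hqd : 0 < q ^ d := by positivity
        have hb1 : a * q ^ d + b < q ^ (d + 1) := by rw [pow_succ']; exact mul_add_lt ha hb
        have h4 := hk A hA (a * q ^ d + b) hb1
        rw [show A * q ^ (d + 1) + (a * q ^ d + b) = (A * q + a) * q ^ d + b by ring] at h4
        rw [← h4, kron]
        have e1 : (a * q ^ d + b) / q ^ d = a := by
          rw [mul_comm, Nat.mul_add_div hqd, Nat.div_eq_of_lt hb, add_zero]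
        have e2 : (a * q ^ d + b) % q ^ d = b := by
          rw [mul_comm, Nat.mul_add_mod, Nat.mod_eq_of_lt hb]
        rw [e1, e2]
        refine kron_congr hb fun j hj => ?_
        rw [(h3 _ (mul_add_lt (mul_add_lt hA ha) hj)).2]
        have f1 : ((A * q + a) * p ^ d + j) / p ^ d = A * q + a := by
          rw [mul_comm, Nat.mul_add_div hpd, Nat.div_eq_of_lt hj, add_zero]
        have f2 : ((A * q + a) * p ^ d + j) % p ^ d = j := by
          rw [mul_comm, Nat.mul_add_mod, Nat.mod_eq_of_lt hj]
        have f3 : (A * q + a) / q = A := by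
          rw [mul_comm, Nat.mul_add_div hq0, Nat.div_eq_of_lt ha, add_zero]
        have f4 : (A * q + a) % q = a := by
          rw [mul_comm, Nat.mul_add_mod, Nat.mod_eq_of_lt ha]
        rw [f1, f2, f3, f4]
        refine Finset.sum_congr rfl fun b _ => ?_
        congr 3
        ring
    · rintro s' - - ⟨-, -, h1, h2⟩ i hi
      simp only [Nat.sub_self, pow_zero, mul_one] at h1 h2
      refine ⟨h1 i hi, ?_⟩
      simpa [kron] using h2 i hi 0 (by simp)
  · simp only [Prog.time, cost_add, cost_const, cost_reg, cost_load, cost_mod, cost_mul, cost_div]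
    nlinarith [Nat.zero_le (L * B), Nat.zero_le (L * B * p), Nat.zero_le (L * p), Nat.zero_le (B*p)]
end

/-- A bilinear algorithm for matrices of order `n`. -/
structure MulAlg where
  n : ℕ
  r : ℕ
  D : ℕ
  α : ℕ → ℕ → ℤ
  β : ℕ → ℕ → ℤ
  γ : ℕ → ℕ → ℤ
  two_le : 2 ≤ n
  sq_le : n * n ≤ r
  pos : 0 < D
  alg : IsBilinearAlgorithm n r D α β γ

/-- The modulus for the multiplication of matrices of order `n ^ L`. -/
def MulAlg.mod (a : MulAlg) (L : ℕ) : ℕ := a.D * a.n ^ L + 1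

/-- The state holds the tables for the multiplication of matrices of order `n ^ L`. -/
structure MulEnv (w : ℕ) (a : MulAlg) (L : ℕ) (s : State) : Prop where
  mod_lt : a.mod L * a.mod L + a.mod L < 2 ^ w
  pow_lt : a.r ^ L < 2 ^ w
  table_lt : a.r * (a.n * a.n) < 2 ^ w
  r4 : s.reg 4 = a.n ^ L
  r5 : s.reg 5 = L
  r6 : s.reg 6 = (a.n * a.n) ^ L
  r7 : s.reg 7 = a.r ^ L
  r8 : s.reg 8 = a.mod L
  m7 : ∀ i < a.n ^ L, s.mem 7 i = spread a.n L i
  m8 : ∀ q < a.r, ∀ x < a.n * a.n, s.mem 8 (q * (a.n * a.n) + x) < a.mod L ∧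
    (s.mem 8 (q * (a.n * a.n) + x) : ZMod (a.mod L)) = -((a.n ^ L : ℕ) : ZMod (a.mod L)) * a.α q x
  m9 : ∀ q < a.r, ∀ x < a.n * a.n, s.mem 9 (q * (a.n * a.n) + x) < a.mod L ∧
    (s.mem 9 (q * (a.n * a.n) + x) : ZMod (a.mod L)) = -((a.n ^ L : ℕ) : ZMod (a.mod L)) * a.β q x
  m10 : ∀ x < a.n * a.n, ∀ q < a.r, s.mem 10 (x * a.r + q) < a.mod L ∧
    (s.mem 10 (x * a.r + q) : ZMod (a.mod L)) = -((a.n ^ L : ℕ) : ZMod (a.mod L)) * a.γ q x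

theorem MulEnv.w_ne {w : ℕ} {a : MulAlg} {L : ℕ} {s : State} (h : MulEnv w a L s) : w ≠ 0 := by
  rintro rfl
  have := h.mod_lt
  simp [MulAlg.mod] at this

/-- Registers and arrays below `20` hold persistent data. The search writes from `20` on only, so
that its environment survives by a look at the numbers written. -/
theorem MulEnv.congr {w : ℕ} {a : MulAlg} {L : ℕ} {s s' : State} (h : MulEnv w a L s)
    (hr : ∀ r < 20, s'.reg r = s.reg r) (hm : ∀ r < 20, s'.mem r = s.mem r) : MulEnv w a L s' where
  mod_lt := h.mod_lt
  pow_lt := h.pow_lt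
  table_lt := h.table_lt
  r4 := by rw [hr 4 (by omega)]; exact h.r4
  r5 := by rw [hr 5 (by omega)]; exact h.r5
  r6 := by rw [hr 6 (by omega)]; exact h.r6
  r7 := by rw [hr 7 (by omega)]; exact h.r7
  r8 := by rw [hr 8 (by omega)]; exact h.r8
  m7 := by rw [hm 7 (by omega)]; exact h.m7
  m8 := by rw [hm 8 (by omega)]; exact h.m8
  m9 := by rw [hm 9 (by omega)]; exact h.m9
  m10 := by rw [hm 10 (by omega)]; exact h.m10

/-- Multiplies the Boolean matrices in the arrays `25` and `26`. -/
def boolMul (a : MulAlg) : Prog :=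
  xform 25 8 (a.n * a.n) a.r 6 ;;
  xform 26 9 (a.n * a.n) a.r 6 ;;
  forTo 43 (reg 7) (store 25 (reg 43) (load 25 (reg 43) * load 26 (reg 43) % reg 8)) ;;
  xform 25 10 a.r (a.n * a.n) 7

/-- A bound for the time of `boolMul`. -/
def MulAlg.unit (a : MulAlg) (L : ℕ) : ℕ := (L + 1) * (a.r ^ L + 1)

/-- Used with `B = r`: because `n * n ≤ r`, no intermediate array of the Kronecker power is longer
than `r ^ L`. -/
theorem pow_mul_pow_sub_le {a b t L : ℕ} (h : t ≤ L) {B : ℕ} (ha : a ≤ B) (hb : b ≤ B) :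
    a ^ t * b ^ (L - t) ≤ B ^ L := by
  calc a ^ t * b ^ (L - t) ≤ B ^ t * B ^ (L - t) :=
        Nat.mul_le_mul (Nat.pow_le_pow_left ha _) (Nat.pow_le_pow_left hb _)
    _ = B ^ L := by rw [← pow_add]; congr 1; omega

/-- The arithmetic modulo `D * n ^ L + 1` yields the residue of the integer product. Its entries are
at most `n ^ L`, so they equal their residues, and such an entry is nonzero exactly if the Boolean
product is true. -/
theorem boolMul_runs {w L : ℕ} {a : MulAlg} {s : State} (h : MulEnv w a L s)
    (hx : ∀ i < (a.n * a.n) ^ L, s.mem 25 i ≤ 1) (hy : ∀ i < (a.n * a.n) ^ L, s.mem 26 i ≤ 1) :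
    Runs w (boolMul a) s (a.unit L * (a.r * 200 + 400)) fun s' =>
      ∀ i < a.n ^ L, ∀ k < a.n ^ L, s'.mem 25 (addr a.n L i k) ≠ 0 ↔
        ∃ j < a.n ^ L, s.mem 25 (addr a.n L i j) ≠ 0 ∧ s.mem 26 (addr a.n L j k) ≠ 0 := by
  have hn := a.two_le
  have hnn : 0 < a.n * a.n := by positivity
  have hr : 0 < a.r := hnn.trans_le a.sq_le
  have hN : 0 < a.n ^ L := by positivity
  have hMd : 1 < a.mod L := by
    have := Nat.mul_pos a.pos hN
    rw [MulAlg.mod]; omega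
  have hNM : a.n ^ L < a.mod L := by
    have := Nat.le_mul_of_pos_left (a.n ^ L) a.pos
    rw [MulAlg.mod]; omega
  have hrw : a.r < 2 ^ w := (Nat.le_mul_of_pos_right _ hnn).trans_lt h.table_lt
  have hnw : a.n * a.n < 2 ^ w := (Nat.le_mul_of_pos_left _ hr).trans_lt h.table_lt
  have htw : a.n * a.n * a.r < 2 ^ w := by rw [mul_comm]; exact h.table_lt
  have hB : ∀ t ≤ L, a.r ^ t * (a.n * a.n) ^ (L - t) ≤ a.r ^ L := fun t ht =>
    pow_mul_pow_sub_le ht le_rfl a.sq_le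
  have hB' : ∀ t ≤ L, (a.n * a.n) ^ t * a.r ^ (L - t) ≤ a.r ^ L := fun t ht =>
    pow_mul_pow_sub_le ht a.sq_le le_rfl
  apply Runs.time_le
  · apply Runs.seq
    · exact xform_runs (L := L) (B := a.r ^ L) (Md := a.mod L)
        (c := fun q x => s.mem 8 (q * (a.n * a.n) + x))
        (by norm_num) (by norm_num) (by norm_num) (by omega) h.r8 h.mod_lt h.r5 h.r6 h.table_lt
        hnw hrw hnn hr hB h.pow_lt (fun _ _ _ _ => rfl) (fun q hq x hx => (h.m8 q hq x hx).1)
        (fun i hi => (hx i hi).trans_lt hMd)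
    intro s1 hS1 h1
    have E1 := h.congr (s' := s1) (fun r hr => hS1.1 r (by simp [xform, xformStep, xformEntry, forTo, Prog.wr]; omega))
      (fun r hr => hS1.2 r (by simp [xform, xformStep, xformEntry, forTo, Prog.wm]; omega))
    have e26 : s1.mem 26 = s.mem 26 := hS1.2 26 rfl
    apply Runs.seq
    · exact xform_runs (L := L) (B := a.r ^ L) (Md := a.mod L)
        (c := fun q x => s1.mem 9 (q * (a.n * a.n) + x))
        (by norm_num) (by norm_num) (by norm_num) (by omega) E1.r8 h.mod_lt E1.r5 E1.r6 h.table_lt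
        hnw hrw hnn hr hB h.pow_lt (fun _ _ _ _ => rfl) (fun q hq x hx => (E1.m9 q hq x hx).1)
        (fun i hi => by rw [e26]; exact (hy i hi).trans_lt hMd)
    intro s2 hS2 h2
    have E2 := E1.congr (s' := s2) (fun r hr => hS2.1 r (by simp [xform, xformStep, xformEntry, forTo, Prog.wr]; omega))
      (fun r hr => hS2.2 r (by simp [xform, xformStep, xformEntry, forTo, Prog.wm]; omega))
    have e25 : s2.mem 25 = s1.mem 25 := hS2.2 25 rfl
    rw [← e25] at h1
    rw [e26] at h2
    apply Runs.seq
    · apply Runs.for_const (m := a.r ^ L) (I := fun i s' =>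
        (∀ j < i, s'.mem 25 j = s2.mem 25 j * s2.mem 26 j % a.mod L) ∧
        ∀ j, i ≤ j → s'.mem 25 j = s2.mem 25 j)
      · rfl
      · exact fun s' hS => ⟨trivial, (hS.1 7 rfl).trans E2.r7⟩
      · exact fun _ _ _ h => h
      · simp
      · rintro i s' hi h43 hS ⟨hI, hI'⟩
        have e26 := hS.2 26 rfl
        have e8 : s'.reg 8 = a.mod L := (hS.1 8 rfl).trans E2.r8
        have f1 := (h1 i hi).1
        have f2 := (h2 i hi).1
        have f3 := Nat.mul_le_mul f1.le f2.le
        have := h.mod_lt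
        refine Runs.straight ⟨trivial, ?_, ?_, ?_⟩
        · simp only [safe_mod, safe_mul, safe_load, safe_reg, val_load, val_reg, h43, e26, true_and,
            and_true, hI' i le_rfl]
          omega
        · intro j hj
          simp only [setMem_mem, val_reg, h43, val_mod, val_mul, val_load, e26, true_and, e8,
            hI' i le_rfl]
          split_ifs with hji
          · rw [hji]
          · exact hI j (by omega)
        · intro j hj
          simp only [setMem_mem, val_reg, h43, true_and]
          rw [if_neg (by omega)]
          exact hI' j (by omega)
      · exact fun s' _ _ h => h.1
    intro s3 hS3 h3
    have E3 := E2.congr (s' := s3) (fun r hr => hS3.1 r (by simp [forTo, Prog.wr]; omega))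
      (fun r hr => hS3.2 r (by simp [forTo, Prog.wm]; omega))
    refine Runs.mono (xform_runs (L := L) (B := a.r ^ L) (Md := a.mod L)
        (c := fun x q => s3.mem 10 (x * a.r + q))
        (by norm_num) (by norm_num) (by norm_num) (by omega) E3.r8 h.mod_lt E3.r5 E3.r7 htw
        hrw hnw hr hnn hB' h.pow_lt (fun _ _ _ _ => rfl) (fun x hx q hq => (E3.m10 x hx q hq).1)
        (fun i hi => by rw [h3 i hi]; exact Nat.mod_lt _ (by omega))) le_rfl ?_
    intro s4 hS4 h4 i hi k hk
    obtain ⟨g1, g2⟩ := h4 _ (addr_lt hi hk)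
    have g3 : (s4.mem 25 (addr a.n L i k) : ZMod (a.mod L)) =
        ((∑ j ∈ Finset.range (a.n ^ L), s.mem 25 (addr a.n L i j) * s.mem 26 (addr a.n L j k) : ℕ) :
          ZMod (a.mod L)) := by
      push_cast
      rw [g2]
      rw [kron_congr (addr_lt hi hk) (y := fun q =>
        kron (a.n * a.n) a.r (fun q x => ((s.mem 8 (q * (a.n * a.n) + x) : ℕ) : ZMod (a.mod L))) L
          (fun j => (s.mem 25 j : ZMod (a.mod L))) q *
        kron (a.n * a.n) a.r (fun q x => ((s1.mem 9 (q * (a.n * a.n) + x) : ℕ) : ZMod (a.mod L))) L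
          (fun j => (s.mem 26 j : ZMod (a.mod L))) q) (fun j hj => by
            rw [h3 j hj, ZMod.natCast_mod, Nat.cast_mul, (h1 j hj).2, (h2 j hj).2])]
      refine kron_mul (α := fun q x => ((s.mem 8 (q * (a.n * a.n) + x) : ℕ) : ZMod (a.mod L)))
        (β := fun q x => ((s1.mem 9 (q * (a.n * a.n) + x) : ℕ) : ZMod (a.mod L)))
        (γ := fun x q => ((s3.mem 10 (x * a.r + q) : ℕ) : ZMod (a.mod L))) (by omega) ?_ hi hk
        (fun j => (s.mem 25 j : ZMod (a.mod L))) (fun j => (s.mem 26 j : ZMod (a.mod L)))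
      intro i hi j hj j' hj' k hk i' hi' k' hk'
      refine Eq.trans (Finset.sum_congr rfl fun q hq => ?_)
        (a.alg.map_zmod (N := a.n ^ L) i hi j hj j' hj' k hk i' hi' k' hk')
      have hq := Finset.mem_range.1 hq
      rw [(h.m8 q hq _ (mul_add_lt hi hj)).2, (E1.m9 q hq _ (mul_add_lt hj' hk)).2,
        (E3.m10 _ (mul_add_lt hi' hk') q hq).2]
      rfl
    -- At most `n ^ L` summands, each at most `1`: the sum is below the modulus and nothing is lost
    -- by the reduction.
    have g4 : (∑ j ∈ Finset.range (a.n ^ L), s.mem 25 (addr a.n L i j) * s.mem 26 (addr a.n L j k))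
        < a.mod L := by
      refine lt_of_le_of_lt (Finset.sum_le_card_nsmul _ _ 1 fun j hj => ?_) (by simpa using hNM)
      have hj := Finset.mem_range.1 hj
      exact Nat.mul_le_mul (hx _ (addr_lt hi hj)) (hy _ (addr_lt hj hk))
    have g5 := (ZMod.natCast_eq_natCast_iff' _ _ _).1 g3
    rw [Nat.mod_eq_of_lt g1, Nat.mod_eq_of_lt g4] at g5
    rw [g5, Ne, Finset.sum_eq_zero_iff]
    simp
  · simp only [MulAlg.unit, Prog.time, cost_add, cost_const, cost_reg, cost_load, cost_mod, cost_mul, cost_div]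
    have := a.sq_le
    generalize a.r ^ L = X
    have h1 : (L + 1) * (X + 1) * (a.n * a.n * 60 + 120) ≤ (L + 1) * (X + 1) * (a.r * 60 + 120) :=
      Nat.mul_le_mul_left _ (by omega)
    have h2 : (X + 1) * 20 ≤ (L + 1) * (X + 1) * 20 := 
      Nat.mul_le_mul_right _ (Nat.le_mul_of_pos_left _ (by omega))
    nlinarith

/-! ### Blocks -/

/-- A graph on the positions below `n`, given by adjacency lists. The positions below `s` form the
separator; the others are divided into consecutive blocks, between which there are no edges. The
boundaries of the blocks are `bs 1, …, bs m`; block `0` stands for the separator itself. -/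
structure Layout (N : ℕ) where
  n : ℕ
  s : ℕ
  m : ℕ
  E : ℕ → ℕ → Prop
  bs : ℕ → ℕ
  loc : ℕ → ℕ
  dg : ℕ → ℕ
  nb : ℕ → ℕ → ℕ
  symm : ∀ {p q}, E p q → E q p
  lt : ∀ {p q}, E p q → p < n
  nbr : ∀ {p q}, p < n → (E p q ↔ ∃ e < dg p, nb p e = q)
  bs_zero : bs 0 = 0
  bs_one : bs 1 = s
  bs_m : bs m = n
  two_le : 2 ≤ m
  mono : ∀ b < m, bs b ≤ bs (b + 1)
  sep : ∀ {b p q}, 1 ≤ b → b ≤ m → s ≤ p → p < bs b → bs b ≤ q → ¬ E p q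
  s_le : s ≤ N
  size : ∀ b, 1 ≤ b → b < m → s + (bs (b + 1) - bs b) ≤ N
  loc_sep : ∀ p < s, loc p = p
  loc_block : ∀ b p, 1 ≤ b → b < m → bs b ≤ p → p < bs (b + 1) → loc p = s + (p - bs b)
  dg_le : ∀ p, p < n → dg p ≤ n
  dg_le' : ∀ p, s ≤ p → p < n → dg p ≤ N

namespace Layout
variable {N : ℕ} (Y : Layout N)

theorem lt' {p q : ℕ} (h : Y.E p q) : q < Y.n := Y.lt (Y.symm h)

theorem bs_le {b c : ℕ} (hbc : b ≤ c) (hc : c ≤ Y.m) : Y.bs b ≤ Y.bs c := by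
  induction c, hbc using Nat.le_induction with
  | base => exact le_rfl
  | succ c _ ih => exact (ih (by omega)).trans (Y.mono c (by omega))

theorem bs_le_n {b : ℕ} (hb : b ≤ Y.m) : Y.bs b ≤ Y.n := Y.bs_m ▸ Y.bs_le hb le_rfl

theorem s_le_n : Y.s ≤ Y.n := Y.bs_one ▸ Y.bs_le_n (by have := Y.two_le; omega)

theorem s_le_bs {b : ℕ} (h1 : 1 ≤ b) (hb : b ≤ Y.m) : Y.s ≤ Y.bs b := Y.bs_one ▸ Y.bs_le h1 hb

/-- The first position of block `b` outside of the separator. -/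
def bl (b : ℕ) : ℕ := Y.bs b + (Y.s - Y.bs b)

/-- The number of vertices of block `b`, with the separator. -/
def sz (b : ℕ) : ℕ := Y.s + (Y.bs (b + 1) - Y.bl b)

/-- The position with local number `x` in block `b`. -/
def vert (b x : ℕ) : ℕ := if x < Y.s then x else Y.bl b + (x - Y.s)

/-- The position `p` belongs to the separator or block `b`. -/
def InB (b p : ℕ) : Prop := p < Y.s ∨ Y.bs b ≤ p ∧ p < Y.bs (b + 1)

/-- The edges of block `b`: those whose later endpoint is in the block. -/
def EB (b p q : ℕ) : Prop := Y.E p q ∧ Y.bs b ≤ max p q ∧ max p q < Y.bs (b + 1)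

variable {Y}

/-- Block `0` starts at position `0`, inside of the separator. The truncated difference in `bl`
moves the start to `s`, so that this block consists of the separator only and its vertices are not
counted twice. -/
theorem bl_zero : Y.bl 0 = Y.s := by simp [bl, Y.bs_zero]

theorem bl_eq {b : ℕ} (h1 : 1 ≤ b) (hb : b < Y.m) : Y.bl b = Y.bs b := by
  have := Y.s_le_bs h1 hb.le
  simp only [bl]; omega

theorem s_le_bl {b : ℕ} : Y.s ≤ Y.bl b := by simp only [bl]; omega

theorem bl_le {b : ℕ} (hb : b < Y.m) : Y.bl b ≤ Y.bs (b + 1) := by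
  have := Y.mono b hb
  have := Y.s_le_bs (b := b + 1) (by omega) hb
  simp only [bl]; omega

theorem s_le_sz {b : ℕ} : Y.s ≤ Y.sz b := by simp only [sz]; omega

theorem sz_le {b : ℕ} (hb : b < Y.m) : Y.sz b ≤ N := by
  rcases Nat.eq_zero_or_pos b with rfl | h1
  · simp only [sz, bl_zero, Y.bs_one, zero_add]; have := Y.s_le; omega
  · rw [sz, bl_eq h1 hb]; exact Y.size b h1 hb

theorem inB_vert {b x : ℕ} (hb : b < Y.m) (hx : x < Y.sz b) : Y.InB b (Y.vert b x) := by
  have := bl_le hb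
  simp only [InB, vert]
  split_ifs with h
  · exact .inl h
  · right
    simp only [sz] at hx
    simp only [bl] at *
    omega

theorem loc_vert {b x : ℕ} (hb : b < Y.m) (hx : x < Y.sz b) : Y.loc (Y.vert b x) = x := by
  have := bl_le hb
  simp only [vert]
  split_ifs with h
  · exact Y.loc_sep x h
  · have h1 : 1 ≤ b := by
      by_contra h1
      obtain rfl : b = 0 := by omega
      simp only [sz, bl_zero, Y.bs_one, zero_add] at hx
      omega
    simp only [sz, bl_eq h1 hb] at *
    rw [Y.loc_block b _ h1 hb (by omega) (by omega)]
    omega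

theorem vert_loc {b p : ℕ} (hb : b < Y.m) (hp : Y.InB b p) :
    Y.loc p < Y.sz b ∧ Y.vert b (Y.loc p) = p := by
  by_cases h : p < Y.s
  · rw [Y.loc_sep p h, vert, if_pos h]
    exact ⟨h.trans_le s_le_sz, rfl⟩
  · obtain ⟨h2, h3⟩ := hp.resolve_left h
    have h1 : 1 ≤ b := by
      by_contra h1
      obtain rfl : b = 0 := by omega
      simp only [zero_add, Y.bs_one] at h3
      omega
    rw [Y.loc_block b p h1 hb h2 h3, vert, sz, bl_eq h1 hb, if_neg (by omega)]
    omega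

theorem vert_sep {b x : ℕ} (hx : x < Y.s) : Y.vert b x = x := if_pos hx

theorem vert_lt {b x : ℕ} (hb : b < Y.m) (hx : x < Y.sz b) : Y.vert b x < Y.n := by
  have h1 := Y.s_le_n
  have h2 := Y.bs_le_n (b := b + 1) hb
  rcases inB_vert hb hx with h | h <;> omega

theorem s_le_vert {b x : ℕ} : Y.s ≤ Y.vert b x ↔ Y.s ≤ x := by
  have := Y.s_le_bl (b := b)
  simp only [vert]
  split_ifs <;> omega

theorem EB.symm {b p q : ℕ} (h : Y.EB b p q) : Y.EB b q p := by
  rw [EB, max_comm]; exact ⟨Y.symm h.1, h.2⟩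

/-- An endpoint that is neither in the separator nor in the block would lie in an earlier block, and
the edge would cross the start of block `b` outside of the separator. -/
theorem EB.inB {b p q : ℕ} (hb : b < Y.m) (h : Y.EB b p q) : Y.InB b p := by
  obtain ⟨h0, h1, h2⟩ := h
  by_cases hp : p < Y.s
  · exact .inl hp
  · refine .inr ⟨?_, by omega⟩
    by_contra hlt
    rcases Nat.eq_zero_or_pos b with rfl | hb1
    · simp [Y.bs_zero] at hlt
    · exact Y.sep hb1 hb.le (by omega) (by omega) (by omega : Y.bs b ≤ q) h0

theorem EB.inB' {b p q : ℕ} (hb : b < Y.m) (h : Y.EB b p q) : Y.InB b q := h.symm.inB hb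

/-- Local edges from the adjacency lists of the positions of a block. -/
theorem eB_vert_iff {b x y : ℕ} (hb : b < Y.m) :
    (x < Y.sz b ∧ y < Y.sz b ∧ Y.EB b (Y.vert b x) (Y.vert b y)) ↔
      ∃ p q, Y.bs b ≤ p ∧ p < Y.bs (b + 1) ∧ Y.E p q ∧ q < Y.bs (b + 1) ∧
        (x = Y.loc p ∧ y = Y.loc q ∨ x = Y.loc q ∧ y = Y.loc p) := by
  constructor
  · rintro ⟨hx, hy, h⟩
    have h1 := h.2
    -- The edge is found in the adjacency list of its larger endpoint: this one is in the interval
    -- of the block by the definition of `EB`, while the other one may be in the separator, whose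
    -- long lists need not be read again.
    rcases le_total (Y.vert b x) (Y.vert b y) with hle | hle
    · rw [max_eq_right hle] at h1
      exact ⟨_, _, h1.1, h1.2, Y.symm h.1, by omega, .inr ⟨(loc_vert hb hx).symm,
        (loc_vert hb hy).symm⟩⟩
    · rw [max_eq_left hle] at h1
      exact ⟨_, _, h1.1, h1.2, h.1, by omega, .inl ⟨(loc_vert hb hx).symm,
        (loc_vert hb hy).symm⟩⟩
  · rintro ⟨p, q, hp, hp', hE, hq, h⟩
    have h1 : Y.EB b p q := ⟨hE, by omega, by omega⟩
    obtain ⟨a1, a2⟩ := vert_loc hb (h1.inB hb)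
    obtain ⟨b1, b2⟩ := vert_loc hb (h1.inB' hb)
    rcases h with ⟨rfl, rfl⟩ | ⟨rfl, rfl⟩
    · rw [a2, b2]; exact ⟨a1, b1, h1⟩
    · rw [a2, b2]; exact ⟨b1, a1, h1.symm⟩

theorem exists_block {p : ℕ} (hp : p < Y.n) : ∃ b < Y.m, Y.bs b ≤ p ∧ p < Y.bs (b + 1) := by
  have h : ∃ b, b ≤ Y.m ∧ p < Y.bs b := ⟨Y.m, le_rfl, by rw [Y.bs_m]; exact hp⟩
  classical
  obtain ⟨h1, h2⟩ := Nat.find_spec h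
  have h0 : Nat.find h ≠ 0 := fun h0 => by rw [h0, Y.bs_zero] at h2; omega
  refine ⟨Nat.find h - 1, by omega, ?_, by rwa [Nat.sub_add_cancel (by omega)]⟩
  by_contra hlt
  exact Nat.find_min h (m := Nat.find h - 1) (by omega) ⟨by omega, by omega⟩

theorem exists_eB {p q : ℕ} (h : Y.E p q) : ∃ b < Y.m, Y.EB b p q := by
  obtain ⟨b, hb, h1, h2⟩ := exists_block (Y := Y) (p := max p q) (by simp [Y.lt h, Y.lt' h])
  exact ⟨b, hb, h, h1, h2⟩

/-- The block of a position outside of the separator is unique. -/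
theorem block_unique {b c p : ℕ} (hb : b < Y.m) (hc : c < Y.m) (h1 : Y.bs b ≤ p)
    (h2 : p < Y.bs (b + 1)) (h3 : Y.bs c ≤ p) (h4 : p < Y.bs (c + 1)) : b = c := by
  rcases lt_trichotomy b c with h | h | h
  · have := Y.bs_le (b := b + 1) (c := c) h hc.le; omega
  · exact h
  · have := Y.bs_le (b := c + 1) (c := b) h hb.le; omega

/-! ### Walks inside a block -/

variable (Y)

/-- There is a walk with `t` edges in block `b` from `p`, of colour `i`, to `q` such that the
colours increase modulo `l` along the walk and only `p` may belong to the separator. -/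
def BW (l : ℕ) (col : ℕ → ℕ) (b i : ℕ) : ℕ → ℕ → ℕ → Prop
  | 0, p, q => p = q ∧ Y.InB b p ∧ col p = i
  | t + 1, p, q => (∃ u, BW l col b i t p u ∧ Y.EB b u q ∧ col q = (i + (t + 1)) % l) ∧ Y.s ≤ q

/-- Like `BW` with `t + 1` edges, but the last vertex may belong to the separator, too. -/
def Ext (l : ℕ) (col : ℕ → ℕ) (b i t p q : ℕ) : Prop :=
  ∃ u, Y.BW l col b i t p u ∧ Y.EB b u q ∧ col q = (i + (t + 1)) % l

/-- `Ext` for local numbers. -/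
def ExtL (l : ℕ) (col : ℕ → ℕ) (b i t x y : ℕ) : Prop :=
  x < Y.sz b ∧ y < Y.sz b ∧ Y.Ext l col b i t (Y.vert b x) (Y.vert b y)

/-- `BW` for local numbers. -/
def BWL (l : ℕ) (col : ℕ → ℕ) (b i t x y : ℕ) : Prop :=
  x < Y.sz b ∧ y < Y.sz b ∧ Y.BW l col b i t (Y.vert b x) (Y.vert b y)

variable {Y}
variable {l : ℕ} {col : ℕ → ℕ} {b i t p q x y : ℕ}

theorem BW.inB (hb : b < Y.m) (h : Y.BW l col b i t p q) : Y.InB b p ∧ Y.InB b q := by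
  induction t generalizing q with
  | zero => obtain ⟨rfl, h, -⟩ := h; exact ⟨h, h⟩
  | succ t ih => obtain ⟨⟨u, h1, h2, -⟩, -⟩ := h; exact ⟨(ih h1).1, h2.inB' hb⟩

theorem bWL_zero (hb : b < Y.m) : Y.BWL l col b i 0 x y ↔ x = y ∧ x < Y.sz b ∧
    col (Y.vert b x) = i := by
  constructor
  · rintro ⟨hx, hy, h1, -, h2⟩
    exact ⟨by rw [← loc_vert hb hx, h1, loc_vert hb hy], hx, h2⟩
  · rintro ⟨rfl, hx, h⟩
    exact ⟨hx, hx, rfl, inB_vert hb hx, h⟩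

theorem bWL_succ : Y.BWL l col b i (t + 1) x y ↔ Y.ExtL l col b i t x y ∧ Y.s ≤ y := by
  rw [BWL, ExtL, ← s_le_vert (Y := Y) (b := b) (x := y)]
  simp only [BW, Ext, and_assoc]

/-- Appending an edge is a Boolean product of the matrix of walks with the adjacency matrix of the
block, followed by a filter on the colour of the last vertex. -/
theorem extL_iff (hb : b < Y.m) : Y.ExtL l col b i t x y ↔
    (∃ u < N, Y.BWL l col b i t x u ∧
      (u < Y.sz b ∧ y < Y.sz b ∧ Y.EB b (Y.vert b u) (Y.vert b y))) ∧
      y < Y.sz b ∧ col (Y.vert b y) = (i + (t + 1)) % l := by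
  constructor
  · rintro ⟨hx, hy, u, h1, h2, h3⟩
    obtain ⟨h4, h5⟩ := vert_loc hb (h1.inB hb).2
    exact ⟨⟨Y.loc u, h4.trans_le (sz_le hb), ⟨hx, h4, by rwa [h5]⟩, h4, hy, by rwa [h5]⟩, hy, h3⟩
  · rintro ⟨⟨u, -, ⟨hx, hu, h1⟩, -, hy, h2⟩, -, h3⟩
    exact ⟨hx, hy, _, h1, h2, h3⟩

end Layout

/-- The state holds a graph on positions, and the tables for the multiplication of matrices. -/
structure Env (w : ℕ) (a : MulAlg) (l L : ℕ) (Y : Layout (a.n ^ L)) (s : State) : Prop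
    extends MulEnv w a L s where
  cells_lt : (l + 1) * (l + 1) * (a.n * a.n) ^ L < 2 ^ w
  n_lt : Y.n + 1 < 2 ^ w
  m_lt : Y.m + 1 < 2 ^ w
  r0 : s.reg 0 = Y.n
  r1 : s.reg 1 = Y.s
  r3 : s.reg 3 = Y.m
  vertex_lt : ∀ p < Y.n, s.mem 3 p + 1 < 2 ^ w
  degree : ∀ p < Y.n, s.mem 0 (s.mem 3 p + 1) - s.mem 0 (s.mem 3 p) = Y.dg p
  nbr_lt : ∀ p < Y.n, ∀ e < Y.dg p, s.mem 0 (s.mem 3 p) + e < 2 ^ w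
  nbr : ∀ p < Y.n, ∀ e < Y.dg p, s.mem 4 (s.mem 1 (s.mem 0 (s.mem 3 p) + e)) = Y.nb p e
  m5 : ∀ b ≤ Y.m, s.mem 5 b = Y.bs b
  m6 : ∀ p < Y.n, s.mem 6 p = Y.loc p

theorem Env.of_same {w : ℕ} {a : MulAlg} {l L : ℕ} {Y : Layout (a.n ^ L)} {s s' : State}
    (h : Env w a l L Y s) {R A : List ℕ} (hS : Same R A s s')
    (hR : R.all (20 ≤ ·) = true) (hA : A.all (20 ≤ ·) = true) : Env w a l L Y s' := by
  have hr : ∀ r < 20, s'.reg r = s.reg r := fun r hr => hS.1 r (by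
    by_contra h'
    simp only [List.all_eq_true, List.elem_eq_contains, Bool.not_eq_false, List.contains_iff_mem] at *
    have := hR r h'
    simp at this
    omega)
  have hm : ∀ r < 20, s'.mem r = s.mem r := fun r hr => hS.2 r (by
    by_contra h'
    simp only [List.all_eq_true, List.elem_eq_contains, Bool.not_eq_false, List.contains_iff_mem] at *
    have := hA r h'
    simp at this
    omega)
  exact
  { toMulEnv := h.toMulEnv.congr hr hm
    cells_lt := h.cells_lt
    n_lt := h.n_lt
    m_lt := h.m_lt
    r0 := by rw [hr 0 (by omega)]; exact h.r0
    r1 := by rw [hr 1 (by omega)]; exact h.r1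
    r3 := by rw [hr 3 (by omega)]; exact h.r3
    vertex_lt := by rw [hm 3 (by omega)]; exact h.vertex_lt
    degree := by rw [hm 3 (by omega), hm 0 (by omega)]; exact h.degree
    nbr_lt := by rw [hm 3 (by omega), hm 0 (by omega)]; exact h.nbr_lt
    nbr := by rw [hm 3 (by omega), hm 0 (by omega), hm 4 (by omega), hm 1 (by omega)]; exact h.nbr
    m5 := by rw [hm 5 (by omega)]; exact h.m5
    m6 := by rw [hm 6 (by omega)]; exact h.m6 }


/-! ### Loops that fill arrays -/

/-- A loop whose body sets cell `i` of array `A` to `f i` in iteration `i`. -/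
theorem Runs.fill {w r A m T : ℕ} {e : Expr} {p : Prog} {s : State} (f : ℕ → ℕ)
    (hr : p.wr.elem r = false)
    (he : ∀ s', Same (r :: p.wr) p.wm s s' → e.safe w s' ∧ e.val s' = m)
    (hs : ∀ i s', i < m → s'.reg r = i → Same (r :: p.wr) p.wm s s' →
      (∀ j, i ≤ j → s'.mem A j = s.mem A j) →
      Runs w p s' T fun s'' => s''.mem A i = f i ∧ ∀ j, j ≠ i → s''.mem A j = s'.mem A j) :
    Runs w (forTo r e p) s ((m + 1) * (T + (e.cost + 7))) fun s' =>
      (∀ j < m, s'.mem A j = f j) ∧ ∀ j, m ≤ j → s'.mem A j = s.mem A j := by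
  refine Runs.for_const (I := fun i s' =>
      (∀ j < i, s'.mem A j = f j) ∧ ∀ j, i ≤ j → s'.mem A j = s.mem A j) hr he
    (fun _ _ _ h => h) (by simp) ?_ (fun s' _ _ h => h)
  rintro i s' hi hri hS ⟨h1, h2⟩
  refine (hs i s' hi hri hS h2).mono le_rfl ?_
  rintro s'' - ⟨h3, h4⟩
  refine ⟨fun j hj => ?_, fun j hj => ?_⟩
  · rcases Nat.lt_succ_iff_lt_or_eq.1 hj with hj | rfl
    · rw [h4 j (by omega), h1 j hj]
    · exact h3
  · rw [h4 j (by omega), h2 j (by omega)]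

/-- Two nested loops over the numbers below the value of register `4`. -/
def forSq (p : Prog) : Prog := forTo 31 (reg 4) (forTo 32 (reg 4) p)

theorem Runs.forSq {w N T : ℕ} {p : Prog} {s : State} {Q : State → Prop}
    (I : ℕ → ℕ → State → Prop) (h31 : p.wr.elem 31 = false) (h32 : p.wr.elem 32 = false)
    (h4 : p.wr.elem 4 = false) (hN : s.reg 4 = N)
    (hI : ∀ i j s x, I i j s → I i j (s.setReg 31 x) ∧ I i j (s.setReg 32 x))
    (hI' : ∀ i s, I i N s → I (i + 1) 0 s) (h0 : I 0 0 s)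
    (hs : ∀ x y s', x < N → y < N → s'.reg 31 = x → s'.reg 32 = y →
      Same (WordRAM.forSq p).wr p.wm s s' → I x y s' → Runs w p s' T (I x (y + 1)))
    (hQ : ∀ s', Same (WordRAM.forSq p).wr p.wm s s' → I N 0 s' → Q s') :
    Runs w (forSq p) s ((N + 1) * ((N + 1) * (T + 8) + 8)) Q := by
  have e4 : (WordRAM.forSq p).wr.elem 4 = false := by
    simpa [WordRAM.forSq, forTo, Prog.wr] using h4
  have e4' : (32 :: p.wr).elem 4 = false := by simpa using h4
  have e31 : (32 :: p.wr).elem 31 = false := by simpa using h31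
  have hsub : ∀ {s s'}, Same (31 :: (forTo 32 (reg 4) p).wr) (forTo 32 (reg 4) p).wm s s' →
      Same (WordRAM.forSq p).wr p.wm s s' := fun h => h.mono
    (fun _ h => by simp [WordRAM.forSq, forTo, Prog.wr] at h ⊢; tauto)
    (fun _ h => by simpa [forTo, Prog.wm] using h)
  refine Runs.for_const (T := (N + 1) * (T + 8)) (m := N) (I := fun x s' => I x 0 s')
    (by simpa [forTo, Prog.wr] using h31)
    (fun s' hS => ⟨trivial, ((hsub hS).1 4 e4).trans hN⟩) (fun _ _ _ h => (hI _ _ _ _ h).1) h0 ?_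
    (fun s' hS _ h => hQ s' (hsub hS) h)
  intro x s1 hx h1 hS1 hI1
  have hS1' := hsub hS1
  refine Runs.for_const (T := T) (m := N) (I := fun y s' => I x y s') h32
    (fun s' hS => ⟨trivial, ((hS.1 4 e4').trans (hS1'.1 4 e4)).trans hN⟩)
    (fun _ _ _ h => (hI _ _ _ _ h).2) hI1 ?_ (fun s' _ _ h => hI' _ _ h)
  intro y s2 hy h2 hS2 hI2
  exact hs x y s2 hx hy ((hS2.1 31 e31).trans h1) h2
    (hS1'.trans (hS2.mono (fun _ h => by simp [WordRAM.forSq, forTo, Prog.wr] at h ⊢; tauto)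
      (fun _ h => h))) hI2

/-! ### The adjacency matrix of a block -/

/-- The address of an entry of a matrix. -/
def addrE (n : ℕ) (x y : Expr) : Expr := const n * load 7 x + load 7 y

theorem addrE_spec {w : ℕ} {a : MulAlg} {l L : ℕ} {Y : Layout (a.n ^ L)} {s : State}
    (h : Env w a l L Y s) {ex ey : Expr} {x y : ℕ} (hx : ex.val s = x) (hy : ey.val s = y)
    (hx' : ex.safe w s) (hy' : ey.safe w s) (hxN : x < a.n ^ L) (hyN : y < a.n ^ L) :
    (addrE a.n ex ey).safe w s ∧ (addrE a.n ex ey).val s = addr a.n L x y := by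
  have h1 := addr_lt hxN hyN
  have h2 : (a.n * a.n) ^ L ≤ (l + 1) * (l + 1) * (a.n * a.n) ^ L :=
    Nat.le_mul_of_pos_left _ (by positivity)
  have h3 := h.cells_lt
  have h4 : a.n ≤ a.n * a.n := Nat.le_mul_of_pos_left _ (by have := a.two_le; omega)
  have h5 : a.n * a.n ≤ a.r * (a.n * a.n) :=
    Nat.le_mul_of_pos_left _ (by have := a.sq_le; have := a.two_le; nlinarith)
  have h6 := h.table_lt
  have h7 : (addrE a.n ex ey).val s = addr a.n L x y := by
    simp only [addrE, val_add, val_mul, val_load, val_const, hx, hy, h.m7 x hxN, h.m7 y hyN, addr]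
  refine ⟨?_, h7⟩
  simp only [addr] at h1
  simp only [addrE, safe_add, safe_mul, safe_const, safe_load, hx', hy', val_add, val_mul, val_load,
    val_const, hx, hy, h.m7 x hxN, h.m7 y hyN, true_and]
  omega

/-- Reads the boundaries of the block in register `23`. -/
def blockInit : Prog :=
  assign 24 (load 5 (reg 23)) ;;
  assign 25 (load 5 (reg 23 + const 1)) ;;
  assign 26 (reg 24 + (reg 1 - reg 24)) ;;
  assign 27 (reg 1 + (reg 25 - reg 26))

/-- Enters the edge between the positions in registers `32` and `37`. -/
def addEdge (n : ℕ) : Prog :=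
  assign 38 (load 6 (reg 32)) ;;
  assign 39 (load 6 (reg 37)) ;;
  store 28 (addrE n (reg 38) (reg 39)) (const 1) ;;
  store 28 (addrE n (reg 39) (reg 38)) (const 1)

/-- Reads the adjacency list of the position in register `32` up to register `36`. -/
def listInit : Prog :=
  assign 33 (load 3 (reg 32)) ;;
  assign 34 (load 0 (reg 33)) ;;
  assign 35 (load 0 (reg 33 + const 1))

/-- Computes the adjacency matrix of the block. -/
def buildAdj (n : ℕ) : Prog :=
  forTo 31 (reg 6) (store 28 (reg 31) (const 0)) ;;
  forTo 31 (reg 25 - reg 24)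
    (assign 32 (reg 24 + reg 31) ;;
    listInit ;;
    forTo 36 (reg 35 - reg 34)
      (assign 37 (load 4 (load 1 (reg 34 + reg 36))) ;;
      Prog.ite ((reg 37).less (reg 25)) (addEdge n) skip))

section
variable {w l L : ℕ} {a : MulAlg} {Y : Layout (a.n ^ L)} {s : State}

theorem listInit_runs (h : Env w a l L Y s) {p : ℕ} (hp : p < Y.n) (h32 : s.reg 32 = p) :
    Runs w listInit s 13 fun s' => s'.reg 32 = p ∧
      s'.reg 34 = s.mem 0 (s.mem 3 p) ∧ s'.reg 35 - s'.reg 34 = Y.dg p := by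
  refine (Runs.straight (p := listInit) ?_).time_le (by simp [listInit, Prog.time])
  have h1 := h.vertex_lt p hp
  simp only [listInit, Prog.wp, safe_load, safe_reg, val_load, val_reg, safe_add, safe_const,
    val_add, val_const, setReg_reg, setReg_mem, if_true, true_and, h32]
  simp [h1, h32, h.degree p hp, h.w_ne]

theorem blockInit_runs (h : Env w a l L Y s) {b : ℕ} (hb : b < Y.m) (h23 : s.reg 23 = b) :
    Runs w blockInit s 30 fun s' => s'.reg 24 = Y.bs b ∧ s'.reg 25 = Y.bs (b + 1) ∧
      s'.reg 26 = Y.bl b ∧ s'.reg 27 = Y.sz b := by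
  refine (Runs.straight (p := blockInit) ?_).time_le (by simp [blockInit, Prog.time])
  have h1 := h.m5 b hb.le
  have h2 := h.m5 (b + 1) hb
  have h3 := h.m_lt
  have h4 := h.n_lt
  have h5 := Y.bs_le_n hb
  have h6 := Y.bs_le_n hb.le
  have h7 := Y.s_le_n
  have h8 := Layout.bl_le hb
  have h9 := h.w_ne
  simp [blockInit, Prog.wp, h23, h1, h2, h.r1, Layout.bl, Layout.sz, h9] at *
  omega

/-- Array `28` is the matrix of the edges in `P`, in local numbers. -/
def AdjInv (Y : Layout (a.n ^ L)) (P : ℕ → ℕ → Prop) (s : State) : Prop :=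
  (∀ i < (a.n * a.n) ^ L, s.mem 28 i ≤ 1) ∧ ∀ x < a.n ^ L, ∀ y < a.n ^ L,
    s.mem 28 (addr a.n L x y) ≠ 0 ↔
      ∃ p q, P p q ∧ (x = Y.loc p ∧ y = Y.loc q ∨ x = Y.loc q ∧ y = Y.loc p)

theorem AdjInv.congr {P P' : ℕ → ℕ → Prop} (h : AdjInv Y P s) (hP : ∀ p q, P p q ↔ P' p q) :
    AdjInv Y P' s := by
  have : P = P' := funext fun p => funext fun q => propext (hP p q)
  exact this ▸ h

theorem addEdge_runs (h : Env w a l L Y s) {p q : ℕ} (hp : p < Y.n) (hq : q < Y.n)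
    (hp' : Y.loc p < a.n ^ L) (hq' : Y.loc q < a.n ^ L) (h32 : s.reg 32 = p) (h37 : s.reg 37 = q)
    {P : ℕ → ℕ → Prop} (hP : AdjInv Y P s) :
    Runs w (addEdge a.n) s (addEdge a.n).time
      (AdjInv Y fun p' q' => P p' q' ∨ p' = p ∧ q' = q) := by
  refine Runs.straight ?_
  have e1 := h.m6 p hp
  have e2 := h.m6 q hq
  refine ⟨trivial, trivial, ?_⟩
  simp only [val_load, val_reg, setReg_reg, setReg_mem, h32, h37, e1, e2]
  norm_num
  simp only [h37, e2]
  set s1 := (s.setReg 38 (Y.loc p)).setReg 39 (Y.loc q) with hs1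
  have E1 : Env w a l L Y s1 := h.of_same (s' := s1) (R := [38, 39]) (A := [])
    ⟨fun r hr => by simp at hr; simp [s1, hr], fun _ _ => rfl⟩ rfl rfl
  have f1 : s1.reg 38 = Y.loc p := by simp [s1]
  have f2 : s1.reg 39 = Y.loc q := by simp [s1]
  obtain ⟨g1, g2⟩ := addrE_spec E1 (ex := reg 38) (ey := reg 39) f1 f2 trivial trivial hp' hq'
  refine ⟨g1, by simpa using h.w_ne, ?_⟩
  simp only [g2, val_const]
  have E2 : Env w a l L Y (s1.setMem 28 (addr a.n L (Y.loc p) (Y.loc q)) 1) :=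
    E1.of_same (R := []) (A := [28])
      ⟨fun r hr => rfl, fun b hb => by
        have : b ≠ 28 := by rintro rfl; simp at hb
        funext i; simp [this]⟩ rfl rfl
  obtain ⟨g3, g4⟩ := addrE_spec E2 (ex := reg 39) (ey := reg 38) f2 f1 trivial trivial hq' hp'
  refine ⟨g3, by simpa using h.w_ne, ?_⟩
  simp only [g4, val_const]
  refine ⟨fun i hi => ?_, fun x hx y hy => ?_⟩
  · simp only [setMem_mem, true_and]
    split_ifs
    · rfl
    · rfl
    · exact hP.1 i hi
  · simp only [setMem_mem, true_and, addr_inj hx hy hp' hq', addr_inj hx hy hq' hp']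
    have := hP.2 x hx y hy
    split_ifs with h1 h2
    · simp only [ne_eq, one_ne_zero, not_false_eq_true, true_iff]
      exact ⟨p, q, .inr ⟨rfl, rfl⟩, .inr h1⟩
    · simp only [ne_eq, one_ne_zero, not_false_eq_true, true_iff]
      exact ⟨p, q, .inr ⟨rfl, rfl⟩, .inl h2⟩
    · refine Iff.trans this ⟨fun ⟨p', q', h3, h4⟩ => ⟨p', q', .inl h3, h4⟩, ?_⟩
      rintro ⟨p', q', h3 | ⟨rfl, rfl⟩, h4⟩
      · exact ⟨p', q', h3, h4⟩
      · tauto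

/-- Neighbours beyond the end of the block are skipped, since these edges belong to the block of the
other endpoint. The bound `d` on the list lengths is a parameter because the lists of block `0` may
have length `n`, those of the other blocks at most `N`. -/
theorem buildAdj_runs (h : Env w a l L Y s) {b : ℕ} (hb : b < Y.m) (h24 : s.reg 24 = Y.bs b)
    (h25 : s.reg 25 = Y.bs (b + 1)) {d : ℕ}
    (hd : ∀ p, Y.bs b ≤ p → p < Y.bs (b + 1) → Y.dg p ≤ d) :
    Runs w (buildAdj a.n) s
      (((a.n * a.n) ^ L + 1) * 20 +
        (Y.bs (b + 1) - Y.bs b + 1) * ((d + 1) * ((addEdge a.n).time + 100))) fun s' =>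
      (∀ i < (a.n * a.n) ^ L, s'.mem 28 i ≤ 1) ∧ ∀ x < a.n ^ L, ∀ y < a.n ^ L,
        s'.mem 28 (addr a.n L x y) ≠ 0 ↔
          x < Y.sz b ∧ y < Y.sz b ∧ Y.EB b (Y.vert b x) (Y.vert b y) := by
  have hhi := Y.bs_le_n (b := b + 1) hb
  apply Runs.time_le
  · apply Runs.seq
    · apply Runs.fill (A := 28) (m := (a.n * a.n) ^ L) (f := fun _ => 0)
      · rfl
      · exact fun s' hS => ⟨trivial, (hS.1 6 rfl).trans h.r6⟩
      · intro i s' hi h31 hS _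
        refine Runs.straight ⟨trivial, by simp, ?_⟩
        simp [h31]
        intro j hj hj'
        exact absurd hj' hj
    rintro s1 hS1 ⟨hz, -⟩
    have E1 := h.of_same hS1 rfl rfl
    have f24 := (hS1.1 24 rfl).trans h24
    have f25 := (hS1.1 25 rfl).trans h25
    apply Runs.for_const (T := (d + 1) * ((addEdge a.n).time + 80))
      (m := Y.bs (b + 1) - Y.bs b) (I := fun t s' => AdjInv Y (fun p q =>
        Y.bs b ≤ p ∧ p < Y.bs b + t ∧ Y.E p q ∧ q < Y.bs (b + 1)) s')
    · rfl
    · intro s' hS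
      refine ⟨⟨trivial, trivial, trivial⟩, ?_⟩
      simp only [val_sub, val_reg, (hS.1 24 rfl).trans f24, (hS.1 25 rfl).trans f25]
    · exact fun _ _ _ h => h
    · refine ⟨fun i hi => by simp [hz i hi], fun x hx y hy => ?_⟩
      rw [hz _ (addr_lt hx hy)]
      simp only [ne_eq, not_true_eq_false, false_iff]
      rintro ⟨p, q, h1, -⟩
      omega
    · intro t s2 ht h31 hS2 hI
      have E2 := E1.of_same hS2 rfl rfl
      have f24 := (hS2.1 24 rfl).trans f24
      have f25 := (hS2.1 25 rfl).trans f25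
      have hp : Y.bs b + t < Y.n := by omega
      have hnw := h.n_lt
      have hdt := hd (Y.bs b + t) (by omega) (by omega)
      apply Runs.time_le
      · apply Runs.wp_seq
        refine ⟨by simp [f24, h31]; omega, ?_⟩
        simp only [val_add, val_reg, f24, h31]
        have E3 : Env w a l L Y (s2.setReg 32 (Y.bs b + t)) := E2.of_same (R := [32]) (A := [])
          ⟨fun r hr => by simp at hr; simp [hr], fun _ _ => rfl⟩ rfl rfl
        apply Runs.seq
        · exact listInit_runs E3 hp (by simp)
        rintro s3 hS3 ⟨g32, g34, g35⟩
        have E4 := E3.of_same hS3 rfl rfl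
        have e28 : s3.mem 28 = s2.mem 28 := hS3.2 28 rfl
        have e0 : s3.mem 0 = s2.mem 0 := hS3.2 0 rfl
        have e3 : s3.mem 3 = s2.mem 3 := hS3.2 3 rfl
        have f25 : s3.reg 25 = Y.bs (b + 1) := (hS3.1 25 rfl).trans (by simpa using f25)
        simp only [setReg_mem, ← e0, ← e3] at g34
        apply Runs.for_const (T := (addEdge a.n).time + 50) (m := Y.dg (Y.bs b + t))
          (I := fun e s' => AdjInv Y (fun p q =>
            (Y.bs b ≤ p ∧ p < Y.bs b + t ∧ Y.E p q ∧ q < Y.bs (b + 1)) ∨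
            (p = Y.bs b + t ∧ q < Y.bs (b + 1) ∧ ∃ e' < e, Y.nb p e' = q)) s')
        · rfl
        · intro s' hS
          refine ⟨⟨trivial, trivial, trivial⟩, ?_⟩
          simp only [val_sub, val_reg, hS.1 35 rfl, hS.1 34 rfl, g35]
        · exact fun _ _ _ h => h
        · have : AdjInv Y (fun p q =>
              Y.bs b ≤ p ∧ p < Y.bs b + t ∧ Y.E p q ∧ q < Y.bs (b + 1)) s3 := by
            unfold AdjInv; rw [e28]; exact hI
          refine this.congr fun p q => ?_
          simp
        · intro e s4 he h36 hS4 hI4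
          have E5 := E4.of_same hS4 rfl rfl
          have f25 := (hS4.1 25 rfl).trans f25
          have g32 := (hS4.1 32 rfl).trans g32
          have g34 := (hS4.1 34 rfl).trans g34
          have e0 := hS4.2 0 rfl
          have e3 := hS4.2 3 rfl
          rw [← e0, ← e3] at g34
          have hnb := E5.nbr _ hp e he
          have hlt := E5.nbr_lt _ hp e he
          have hE : Y.E (Y.bs b + t) (Y.nb (Y.bs b + t) e) := (Y.nbr hp).2 ⟨e, he, rfl⟩
          apply Runs.time_le
          · apply Runs.wp_seq
            refine ⟨by simpa [g34, h36] using hlt, ?_⟩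
            simp only [val_load, val_add, val_reg, g34, h36, hnb]
            apply Runs.ite
            · exact ⟨trivial, trivial, trivial⟩
            · intro hc
              simp [f25] at hc
              have hEB : Y.EB b (Y.bs b + t) (Y.nb (Y.bs b + t) e) := ⟨hE, by omega, by omega⟩
              have E6 : Env w a l L Y (s4.setReg 37 (Y.nb (Y.bs b + t) e)) :=
                E5.of_same (R := [37]) (A := [])
                ⟨fun r hr => by simp at hr; simp [hr], fun _ _ => rfl⟩ rfl rfl
              refine (addEdge_runs E6 hp (Y.lt' hE)
                ((Layout.vert_loc hb (hEB.inB hb)).1.trans_le (Layout.sz_le hb))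
                ((Layout.vert_loc hb (hEB.inB' hb)).1.trans_le (Layout.sz_le hb))
                (by simpa using g32) (by simp)
                (P := fun p q =>
                  (Y.bs b ≤ p ∧ p < Y.bs b + t ∧ Y.E p q ∧ q < Y.bs (b + 1)) ∨
                  (p = Y.bs b + t ∧ q < Y.bs (b + 1) ∧ ∃ e' < e, Y.nb p e' = q)) hI4).mono
                (T' := (addEdge a.n).time + 1) (by omega) ?_
              rintro s5 - hI5
              refine hI5.congr fun p q => ?_
              constructor
              · rintro ((h1 | ⟨h1, h2, e', he', h3⟩) | ⟨rfl, rfl⟩)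
                · exact .inl h1
                · exact .inr ⟨h1, h2, e', by omega, h3⟩
                · exact .inr ⟨rfl, hc, e, by omega, rfl⟩
              · rintro (h1 | ⟨rfl, h2, e', he', rfl⟩)
                · exact .inl (.inl h1)
                · rcases Nat.lt_succ_iff_lt_or_eq.1 he' with h4 | rfl
                  · exact .inl (.inr ⟨rfl, h2, e', h4, rfl⟩)
                  · exact .inr ⟨rfl, rfl⟩
            · intro hc
              simp [f25] at hc
              refine Runs.time_le (Runs.straight ?_) (by simp [Prog.time])
              refine AdjInv.congr (show AdjInv Y _ (s4.setReg 37 _) from hI4) fun p q => ?_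
              refine or_congr Iff.rfl ?_
              constructor
              · rintro ⟨h1, h2, e', he', h3⟩
                exact ⟨h1, h2, e', by omega, h3⟩
              · rintro ⟨rfl, h2, e', he', rfl⟩
                rcases Nat.lt_succ_iff_lt_or_eq.1 he' with h4 | rfl
                · exact ⟨rfl, h2, e', h4, rfl⟩
                · omega
          · simp [Prog.time]
            omega
        · rintro s' - - hI'
          refine hI'.congr fun p q => ?_
          constructor
          · rintro (⟨h1, h2, h3⟩ | ⟨rfl, h1, h2⟩)
            · exact ⟨h1, by omega, h3⟩
            · exact ⟨by omega, by omega, (Y.nbr hp).2 h2, h1⟩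
          · rintro ⟨h1, h2, h3, h4⟩
            rcases Nat.lt_succ_iff_lt_or_eq.1 (show p < (Y.bs b + t) + 1 by omega) with h5 | rfl
            · exact .inl ⟨h1, h5, h3, h4⟩
            · exact .inr ⟨rfl, h4, (Y.nbr hp).1 h3⟩
      · simp [Prog.time]
        nlinarith
    · rintro s' - - ⟨h1, h2⟩
      refine ⟨h1, fun x hx y hy => ?_⟩
      rw [h2 x hx y hy, Layout.eB_vert_iff hb]
      refine exists_congr fun p => exists_congr fun q => ?_
      constructor
      · rintro ⟨⟨a1, a2, a3, a4⟩, a5⟩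
        exact ⟨a1, by omega, a3, a4, a5⟩
      · rintro ⟨a1, a2, a3, a4, a5⟩
        exact ⟨⟨a1, by omega, a3, a4⟩, a5⟩
  · simp [Prog.time]
    refine Nat.add_le_add (Nat.mul_le_mul_left _ (by norm_num)) (Nat.mul_le_mul_left _ ?_)
    nlinarith

end

/-! ### Walks in a block -/

/-- Stores the colours of the vertices of the block by local numbers. -/
def localColours (l : ℕ) : Prog :=
  forTo 31 (reg 4)
    (Prog.ite ((reg 31).less (reg 1)) (store 29 (reg 31) (load 21 (reg 31)))
      (Prog.ite ((reg 31).less (reg 27))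
        (store 29 (reg 31) (load 21 (reg 26 + (reg 31 - reg 1))))
        (store 29 (reg 31) (const l))))

/-- Reads the block in register `23`. -/
def blockPrep (n l : ℕ) : Prog := blockInit ;; buildAdj n ;; localColours l

/-- The state holds the data of block `b`. -/
structure BlockEnv (w : ℕ) (a : MulAlg) (l L : ℕ) (Y : Layout (a.n ^ L)) (col : ℕ → ℕ) (b : ℕ)
    (s : State) : Prop extends Env w a l L Y s where
  b_lt : b < Y.m
  r23 : s.reg 23 = b
  r26 : s.reg 26 = Y.bl b
  adj_le : ∀ i < (a.n * a.n) ^ L, s.mem 28 i ≤ 1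
  adj : ∀ x < a.n ^ L, ∀ y < a.n ^ L, s.mem 28 (addr a.n L x y) ≠ 0 ↔
    x < Y.sz b ∧ y < Y.sz b ∧ Y.EB b (Y.vert b x) (Y.vert b y)
  colour : ∀ x < a.n ^ L, s.mem 29 x = if x < Y.sz b then col (Y.vert b x) else l

section
variable {w l L : ℕ} {a : MulAlg} {Y : Layout (a.n ^ L)} {s : State} {col : ℕ → ℕ} {b : ℕ}

theorem BlockEnv.of_same {s' : State} (h : BlockEnv w a l L Y col b s) {R A : List ℕ}
    (hS : Same R A s s') (hR : R.all (fun r => 20 ≤ r && (r < 23 || 28 ≤ r)) = true)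
    (hA : A.all (fun r => 20 ≤ r && (r != 28 && r != 29)) = true) :
    BlockEnv w a l L Y col b s' := by
  simp only [List.all_eq_true, Bool.and_eq_true, Bool.or_eq_true, decide_eq_true_eq, bne_iff_ne] at hR hA
  have hr : ∀ r, 23 ≤ r → r < 28 → s'.reg r = s.reg r := fun r h1 h2 => hS.1 r (by
    by_contra h'
    simp only [List.elem_eq_contains, Bool.not_eq_false, List.contains_iff_mem] at h'
    have := hR r h'
    omega)
  have hm : ∀ r, r = 28 ∨ r = 29 → s'.mem r = s.mem r := fun r h1 => hS.2 r (by
    by_contra h'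
    simp only [List.elem_eq_contains, Bool.not_eq_false, List.contains_iff_mem] at h'
    have := hA r h'
    omega)
  exact
  { toEnv := h.toEnv.of_same hS (by simp; exact fun r h => (hR r h).1)
      (by simp; exact fun r h => (hA r h).1)
    b_lt := h.b_lt
    r23 := by rw [hr 23 (by omega) (by omega)]; exact h.r23
    r26 := by rw [hr 26 (by omega) (by omega)]; exact h.r26
    adj_le := by rw [hm 28 (by omega)]; exact h.adj_le
    adj := by rw [hm 28 (by omega)]; exact h.adj
    colour := by rw [hm 29 (by omega)]; exact h.colour }

theorem Env.const_lt (h : Env w a l L Y s) : l + 1 < 2 ^ w ∧ (a.n * a.n) ^ L < 2 ^ w := by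
  have h1 := h.cells_lt
  have h2 : 0 < (a.n * a.n) ^ L := by have := a.two_le; positivity
  have h3 : (l + 1) * (l + 1) ≤ (l + 1) * (l + 1) * (a.n * a.n) ^ L := Nat.le_mul_of_pos_right _ h2
  have h4 : (a.n * a.n) ^ L ≤ (l + 1) * (l + 1) * (a.n * a.n) ^ L :=
    Nat.le_mul_of_pos_left _ (by positivity)
  constructor
  · nlinarith
  · omega

theorem blockPrep_runs (h : Env w a l L Y s) (hb : b < Y.m) (h23 : s.reg 23 = b)
    (hcol : ∀ p < Y.n, s.mem 21 p = col p) {d : ℕ}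
    (hd : ∀ p, Y.bs b ≤ p → p < Y.bs (b + 1) → Y.dg p ≤ d) :
    Runs w (blockPrep a.n l) s ((((a.n * a.n) ^ L + 1) * 20 +
        (Y.bs (b + 1) - Y.bs b + 1) * ((d + 1) * ((addEdge a.n).time + 100))) +
          (a.n ^ L + 1) * 100 + 30) (BlockEnv w a l L Y col b) := by
  have hsn := Y.s_le_n
  apply Runs.time_le
  · apply Runs.seq
    · exact blockInit_runs h hb h23
    rintro s1 hS1 ⟨f24, f25, f26, f27⟩
    have E1 := h.of_same hS1 rfl rfl
    have h23 := (hS1.1 23 rfl).trans h23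
    have hcol : ∀ p < Y.n, s1.mem 21 p = col p := by rw [hS1.2 21 rfl]; exact hcol
    apply Runs.seq
    · exact buildAdj_runs E1 hb f24 f25 hd
    rintro s2 hS2 ⟨hadj, hadj'⟩
    have E2 := E1.of_same hS2 rfl rfl
    have h23 := (hS2.1 23 rfl).trans h23
    have f26 := (hS2.1 26 rfl).trans f26
    have f27 := (hS2.1 27 rfl).trans f27
    have hcol : ∀ p < Y.n, s2.mem 21 p = col p := by rw [hS2.2 21 rfl]; exact hcol
    refine Runs.mono (Runs.fill (A := 29) (m := a.n ^ L)
      (f := fun x => if x < Y.sz b then col (Y.vert b x) else l)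
      (T := 40) rfl (fun s' hS => ⟨trivial, (hS.1 4 rfl).trans E2.r4⟩) ?_) le_rfl ?_
    · intro x s3 hx h31 hS3 _
      have E3 := E2.of_same hS3 rfl rfl
      have f26 := (hS3.1 26 rfl).trans f26
      have f27 := (hS3.1 27 rfl).trans f27
      have e21 := hS3.2 21 rfl
      have hl := E3.const_lt.1
      have hw := E3.n_lt
      have h0 : x < Y.sz b → s2.mem 21 (Y.vert b x) = col (Y.vert b x) := fun h =>
        hcol _ (Layout.vert_lt hb h)
      have h1 : x < Y.sz b → Y.vert b x < Y.n := fun h => Layout.vert_lt hb h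
      have h2 := Layout.s_le_sz (Y := Y) (b := b)
      refine (Runs.straight ?_).time_le (by simp [Prog.time])
      simp only [Prog.wp, safe_less, safe_reg, val_less, val_reg, h31, E3.r1, f26, f27, safe_load,
        val_load, safe_const, setMem_mem, true_and, e21, safe_add, val_add, val_sub, safe_sub,
        val_const, if_true]
      simp only [Layout.vert] at h0 h1 ⊢
      refine ⟨fun hc => ?_, fun hc => ⟨fun hc' => ?_, fun hc' => ?_⟩⟩
      · have hc : x < Y.s := by by_contra h; simp [h] at hc
        rw [if_pos (by omega), if_pos hc]
        rw [if_pos hc] at h0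
        exact ⟨h0 (by omega), fun j hj => if_neg hj⟩
      · have hc : ¬ x < Y.s := fun h => by simp [h] at hc
        have hc' : x < Y.sz b := by by_contra h; simp [h] at hc'
        rw [if_neg hc] at h0 h1 ⊢
        have := h1 hc'
        rw [if_pos hc']
        exact ⟨by omega, h0 hc', fun j hj => if_neg hj⟩
      · have hc' : ¬ x < Y.sz b := fun h => by simp [h] at hc'
        rw [if_neg hc']
        exact ⟨by omega, rfl, fun j hj => if_neg hj⟩
    · rintro s4 hS4 ⟨hc, -⟩
      exact
      { toEnv := E2.of_same hS4 rfl rfl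
        b_lt := hb
        r23 := (hS4.1 23 rfl).trans h23
        r26 := (hS4.1 26 rfl).trans f26
        adj_le := by rw [hS4.2 28 rfl]; exact hadj
        adj := by rw [hS4.2 28 rfl]; exact hadj'
        colour := hc }
  · simp
    omega

/-- Sets the matrix of walks of length `0`. -/
def startWalk (n : ℕ) : Prog :=
  forSq (store 25 (addrE n (reg 31) (reg 32))
    ((reg 31).same (reg 32) * (load 29 (reg 31)).same (reg 28)))

/-- The matrix in array `25` is the indicator of `P`. -/
def IsMat (a : MulAlg) (L : ℕ) (P : ℕ → ℕ → Prop) (s : State) : Prop :=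
  (∀ i < (a.n * a.n) ^ L, s.mem 25 i ≤ 1) ∧
    ∀ x < a.n ^ L, ∀ y < a.n ^ L, s.mem 25 (addr a.n L x y) ≠ 0 ↔ P x y

/-- Every cell of the array is the address of some entry, so bounds on the entries are bounds on all
cells. -/
theorem isMat_of {P : ℕ → ℕ → Prop} (h : ∀ x < a.n ^ L, ∀ y < a.n ^ L,
    s.mem 25 (addr a.n L x y) ≤ 1 ∧ (s.mem 25 (addr a.n L x y) ≠ 0 ↔ P x y)) : IsMat a L P s := by
  refine ⟨fun i hi => ?_, fun x hx y hy => (h x hx y hy).2⟩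
  obtain ⟨x, hx, y, hy, rfl⟩ := exists_eq_addr hi
  exact (h x hx y hy).1

theorem startWalk_runs (h : BlockEnv w a l L Y col b s) {i : ℕ} (hi : i < l) (h28 : s.reg 28 = i) :
    Runs w (startWalk a.n) s ((a.n ^ L + 1) * ((a.n ^ L + 1) * 30 + 8))
      (IsMat a L (Y.BWL l col b i 0)) := by
  refine Runs.forSq (T := 22) (I := fun x y s' => ∀ x' < a.n ^ L, ∀ y' < a.n ^ L,
    (x' < x ∨ x' = x ∧ y' < y) → s'.mem 25 (addr a.n L x' y') ≤ 1 ∧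
      (s'.mem 25 (addr a.n L x' y') ≠ 0 ↔ Y.BWL l col b i 0 x' y')) rfl rfl rfl h.r4
    (fun _ _ _ _ h => ⟨h, h⟩) ?_ ?_ ?_ ?_
  · intro x s' hI x' hx' y' hy' h'
    exact hI x' hx' y' hy' (by omega)
  · intro x' _ y' _ h'
    omega
  · intro x y s1 hx hy h31 h32 hS hI
    have E := h.of_same hS rfl rfl
    have f28 := (hS.1 28 rfl).trans h28
    obtain ⟨g1, g2⟩ := addrE_spec E.toEnv (ex := reg 31) (ey := reg 32) h31 h32 trivial trivial hx hy
    refine Runs.time_le (T := Prog.time (store 25 (addrE a.n (reg 31) (reg 32))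
      ((reg 31).same (reg 32) * (load 29 (reg 31)).same (reg 28))))
      (Runs.straight ⟨g1, ?_, ?_⟩) (by simp [Prog.time, addrE])
    · simp [h31, h32, f28]
      split_ifs <;> simp [E.w_ne]
    · intro x' hx' y' hy' h'
      simp only [g2, setMem_mem, true_and, addr_inj hx' hy' hx hy, val_mul, val_same, val_reg,
        val_load, h31, h32, f28, E.colour x hx]
      by_cases h1 : x' = x ∧ y' = y
      · obtain ⟨rfl, rfl⟩ := h1
        rw [if_pos ⟨rfl, rfl⟩, Layout.bWL_zero h.b_lt]
        rcases eq_or_ne x' y' with rfl | e1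
        · by_cases e2 : x' < Y.sz b
          · by_cases e3 : col (Y.vert b x') = i <;> simp [e2, e3]
          · simp [e2, hi.ne']
        · simp [e1]
      · rw [if_neg h1]
        exact hI x' hx' y' hy' (by omega)
  · intro s' _ hI
    exact isMat_of fun x hx y hy => hI x hx y hy (.inl hx)

end

/-! ### Recording the walks of a block -/

@[simp] theorem one_sub_ite (p : Prop) [Decidable p] :
    (1 - if p then 1 else 0) = if p then 0 else 1 := by split_ifs <;> rfl

/-- The cell of the counter for walks from `x`, at position `i` of the cycle, to `y`, at
position `j`. -/
def cell (a : MulAlg) (l L i j x y : ℕ) : ℕ := (i * (l + 1) + j) * (a.n * a.n) ^ L + addr a.n L x y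

section
variable {w l L : ℕ} {a : MulAlg} {Y : Layout (a.n ^ L)} {s : State} {col : ℕ → ℕ} {b : ℕ}

theorem cell_inj {i j x y i' j' x' y' : ℕ} (hj : j ≤ l) (hj' : j' ≤ l) (hx : x < a.n ^ L)
    (hy : y < a.n ^ L) (hx' : x' < a.n ^ L) (hy' : y' < a.n ^ L) :
    cell a l L i j x y = cell a l L i' j' x' y' ↔ i = i' ∧ j = j' ∧ x = x' ∧ y = y' := by
  rw [cell, cell, mul_add_inj (addr_lt hx hy) (addr_lt hx' hy'), mul_add_inj (by omega) (by omega),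
    addr_inj hx hy hx' hy', and_assoc]

theorem cell_lt {i j x y : ℕ} (hi : i ≤ l) (hj : j ≤ l) (hx : x < a.n ^ L) (hy : y < a.n ^ L) :
    cell a l L i j x y < (l + 1) * (l + 1) * (a.n * a.n) ^ L :=
  mul_add_lt (mul_add_lt (by omega) (by omega)) (addr_lt hx hy)

open Classical in
/-- The counters, marks and the result after the walks of block `b` for the indices in `D` have been
recorded, starting from state `s`. -/
structure Acc (l L : ℕ) (a : MulAlg) (Y : Layout (a.n ^ L)) (col : ℕ → ℕ) (b : ℕ)
    (D : ℕ → ℕ → ℕ → ℕ → Prop) (s s' : State) : Prop where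
  cnt : ∀ i j x y, i < j → j ≤ l → x < Y.s → y < Y.s →
    s'.mem 23 (cell a l L i j x y) = s.mem 23 (cell a l L i j x y) +
      if D i j x y ∧ Y.ExtL l col b i (j - i - 1) x y then 1 else 0
  keep : ∀ b', s'.mem 22 b' ≠ 0 ↔ s.mem 22 b' ≠ 0 ∨ b' = b ∧ ∃ i j x y, i < j ∧ j ≤ l ∧ x < Y.s ∧
    y < Y.s ∧ D i j x y ∧ Y.ExtL l col b i (j - i - 1) x y ∧ s.mem 23 (cell a l L i j x y) < l
  sound : s'.reg 21 = s.reg 21 ∧ s'.reg 22 = s.reg 22 ∨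
    s'.reg 21 = 1 ∧ s'.reg 22 < Y.n ∧ Y.Ext l col b 0 (l - 1) (s'.reg 22) (s'.reg 22)
  compl : ∀ x, Y.s ≤ x → x < a.n ^ L → D 0 l x x → Y.ExtL l col b 0 (l - 1) x x → s'.reg 21 = 1

theorem Acc.congr {D D' : ℕ → ℕ → ℕ → ℕ → Prop} {s s' : State} (h : Acc l L a Y col b D s s')
    (hD : ∀ i j x y, i < j → j ≤ l → x < a.n ^ L → y < a.n ^ L → (D i j x y ↔ D' i j x y))
    (hl : 0 < l) : Acc l L a Y col b D' s s' where
  cnt i j x y hij hj hx hy := by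
    rw [h.cnt i j x y hij hj hx hy, hD i j x y hij hj (hx.trans_le Y.s_le) (hy.trans_le Y.s_le)]
  keep b' := by
    rw [h.keep b']
    refine or_congr Iff.rfl (and_congr Iff.rfl ?_)
    constructor
    · rintro ⟨i, j, x, y, h1, h2, h3, h4, h5, h6⟩
      exact ⟨i, j, x, y, h1, h2, h3, h4,
        (hD i j x y h1 h2 (h3.trans_le Y.s_le) (h4.trans_le Y.s_le)).1 h5, h6⟩
    · rintro ⟨i, j, x, y, h1, h2, h3, h4, h5, h6⟩
      exact ⟨i, j, x, y, h1, h2, h3, h4,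
        (hD i j x y h1 h2 (h3.trans_le Y.s_le) (h4.trans_le Y.s_le)).2 h5, h6⟩
  sound := h.sound
  compl x hx hx' h1 := h.compl x hx hx' ((hD 0 l x x hl le_rfl hx' hx').2 h1)

theorem Acc.refl (s : State) : Acc l L a Y col b (fun _ _ _ _ => False) s s where
  cnt := by simp
  keep := by simp
  sound := .inl ⟨rfl, rfl⟩
  compl := by simp

open Classical in
/-- Recording one more walk. -/
theorem Acc.step {D : ℕ → ℕ → ℕ → ℕ → Prop} {s s' s'' : State} (h : Acc l L a Y col b D s s')
    (hb : b < Y.m) {i j x y : ℕ} (hij : i < j) (hj : j ≤ l) (hx : x < a.n ^ L) (hy : y < a.n ^ L)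
    (hD : ¬ D i j x y)
    (h23 : ∀ c, s''.mem 23 c = s'.mem 23 c + if Y.ExtL l col b i (j - i - 1) x y ∧ x < Y.s ∧
      y < Y.s ∧ c = cell a l L i j x y then 1 else 0)
    (h22 : ∀ b', s''.mem 22 b' = if Y.ExtL l col b i (j - i - 1) x y ∧ x < Y.s ∧ y < Y.s ∧
      s'.mem 23 (cell a l L i j x y) < l ∧ b' = b then 1 else s'.mem 22 b')
    (h21 : if Y.ExtL l col b i (j - i - 1) x y ∧ i = 0 ∧ j = l ∧ x = y ∧ Y.s ≤ x then
      s''.reg 21 = 1 ∧ s''.reg 22 = Y.vert b x else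
      s''.reg 21 = s'.reg 21 ∧ s''.reg 22 = s'.reg 22) :
    Acc l L a Y col b
      (fun i' j' x' y' => D i' j' x' y' ∨ i' = i ∧ j' = j ∧ x' = x ∧ y' = y) s s'' where
  cnt i' j' x' y' hij' hj' hx' hy' := by
    rw [h23, h.cnt i' j' x' y' hij' hj' hx' hy', add_assoc]
    congr 1
    simp only [cell_inj hj' hj (hx'.trans_le Y.s_le) (hy'.trans_le Y.s_le) hx hy]
    by_cases he : i' = i ∧ j' = j ∧ x' = x ∧ y' = y
    · obtain ⟨rfl, rfl, rfl, rfl⟩ := he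
      simp [hD, hx', hy']
    · simp [he]
  keep b' := by
    rw [h22]
    have hk := h.keep b'
    by_cases hc : Y.ExtL l col b i (j - i - 1) x y ∧ x < Y.s ∧ y < Y.s ∧
      s'.mem 23 (cell a l L i j x y) < l ∧ b' = b
    · rw [if_pos hc]
      obtain ⟨c1, c2, c3, c4, c5⟩ := hc
      -- The index is not yet in `D`, so the counter still has the value from before this block;
      -- this is the value that decides whether the block is kept.
      rw [h.cnt i j x y hij hj c2 c3, if_neg (fun h => hD h.1), add_zero] at c4
      simp only [ne_eq, one_ne_zero, not_false_eq_true, true_iff]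
      exact .inr ⟨c5, i, j, x, y, hij, hj, c2, c3, .inr ⟨rfl, rfl, rfl, rfl⟩, c1, c4⟩
    · rw [if_neg hc, hk]
      refine or_congr Iff.rfl ⟨?_, ?_⟩
      · rintro ⟨e, i', j', x', y', h1, h2, h3, h4, h5, h6⟩
        exact ⟨e, i', j', x', y', h1, h2, h3, h4, .inl h5, h6⟩
      · rintro ⟨e, i', j', x', y', h1, h2, h3, h4, h5 | ⟨rfl, rfl, rfl, rfl⟩, h6, h7⟩
        · exact ⟨e, i', j', x', y', h1, h2, h3, h4, h5, h6, h7⟩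
        · refine absurd ⟨h6, h3, h4, ?_, e⟩ hc
          rwa [h.cnt i' j' x' y' h1 h2 h3 h4, if_neg (fun h => hD h.1), add_zero]
  sound := by
    split_ifs at h21 with hc
    · obtain ⟨c1, rfl, rfl, rfl, c5⟩ := hc
      refine .inr ⟨h21.1, ?_⟩
      rw [h21.2]
      exact ⟨Layout.vert_lt hb c1.1, by simpa using c1.2.2⟩
    · rw [h21.1, h21.2]; exact h.sound
  compl x' hx' hx'' := by
    rintro (h1 | ⟨rfl, rfl, rfl, rfl⟩) h2
    · split_ifs at h21 with hc
      · exact h21.1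
      · rw [h21.1]; exact h.compl x' hx' hx'' h1 h2
    · rw [if_pos ⟨by simpa using h2, rfl, rfl, rfl, hx'⟩] at h21
      exact h21.1

/-- Counts a walk between two vertices of the separator. -/
def recordWalk (l : ℕ) : Prog :=
  assign 34 ((reg 28 * const (l + 1) + reg 30) * reg 6 + reg 33) ;;
  Prog.ite ((load 23 (reg 34)).less (const l)) (store 22 (reg 23) (const 1)) skip ;;
  store 23 (reg 34) (load 23 (reg 34) + const 1)

/-- Reports a cycle inside of a block. -/
def recordCycle : Prog :=
  assign 21 (const 1) ;; assign 22 (reg 26 + (reg 31 - reg 1))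

/-- Treats an entry of the matrix of walks. -/
def entry (n l : ℕ) : Prog :=
  assign 33 (addrE n (reg 31) (reg 32)) ;;
  Prog.ite ((const 0).less (load 25 (reg 33)) * (load 29 (reg 32)).same (reg 30 % const l))
    (Prog.ite ((reg 31).less (reg 1) * (reg 32).less (reg 1)) (recordWalk l) skip ;;
    Prog.ite ((reg 28).same (const 0) * ((reg 30).same (const l) * ((reg 31).same (reg 32) *
      (const 1 - (reg 31).less (reg 1))))) recordCycle skip ;;
    store 25 (reg 33) (const 1 - (reg 32).less (reg 1)))
    (store 25 (reg 33) (const 0))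

/-- An entry of the matrix product survives in array `25` only if the colour of `y` fits and `y` is
outside of the separator: a separator vertex may end a recorded walk, but no walk is continued
through it. Counters are at most the number of blocks seen, by `hcnt`, hence do not overflow. -/
theorem entry_runs (h : BlockEnv w a l L Y col b s) (hl : 0 < l) {s0 : State}
    {D : ℕ → ℕ → ℕ → ℕ → Prop} (hA : Acc l L a Y col b D s0 s)
    (hcnt : ∀ i j x y, i < j → j ≤ l → x < Y.s → y < Y.s → s0.mem 23 (cell a l L i j x y) ≤ b)
    {i j x y : ℕ} (hij : i < j) (hj : j ≤ l) (hx : x < a.n ^ L) (hy : y < a.n ^ L)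
    (hD : ¬ D i j x y) (h28 : s.reg 28 = i) (h30 : s.reg 30 = j) (h31 : s.reg 31 = x)
    (h32 : s.reg 32 = y)
    (h25 : s.mem 25 (addr a.n L x y) ≠ 0 ↔ ∃ u < a.n ^ L, Y.BWL l col b i (j - i - 1) x u ∧
      (u < Y.sz b ∧ y < Y.sz b ∧ Y.EB b (Y.vert b u) (Y.vert b y))) :
    Runs w (entry a.n l) s (entry a.n l).time fun s' =>
      Acc l L a Y col b
        (fun i' j' x' y' => D i' j' x' y' ∨ i' = i ∧ j' = j ∧ x' = x ∧ y' = y) s0 s' ∧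
      s'.mem 25 (addr a.n L x y) ≤ 1 ∧
      (s'.mem 25 (addr a.n L x y) ≠ 0 ↔ Y.BWL l col b i (j - i) x y) ∧
      ∀ c, c ≠ addr a.n L x y → s'.mem 25 c = s.mem 25 c := by
  classical
  refine Runs.straight ?_
  obtain ⟨g1, g2⟩ := addrE_spec h.toEnv (ex := reg 31) (ey := reg 32) h31 h32 trivial trivial hx hy
  have hji : j - i = (j - i - 1) + 1 := by omega
  have hww := h.w_ne
  have hlw := h.const_lt.1
  have hlw' : l < 2 ^ w := by omega
  have hb := h.b_lt
  -- Local numbers without a vertex carry the colour `l`, which is no residue modulo `l`. The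
  -- comparison of colours therefore excludes them, too.
  have key : Y.ExtL l col b i (j - i - 1) x y ↔ s.mem 25 (addr a.n L x y) ≠ 0 ∧
      s.mem 29 y = j % l := by
    rw [Layout.extL_iff hb, h25, h.colour y hy, ← hji, show i + (j - i) = j by omega]
    refine and_congr_right fun _ => ?_
    split_ifs with hc
    · simp [hc]
    · have := Nat.mod_lt j hl
      simp [hc]; omega
  rw [hji, Layout.bWL_succ]
  refine ⟨g1, ?_⟩
  rw [g2]
  refine ⟨by simp [h30, hww]; constructor; omega; split_ifs <;> simp [hww], ?_, ?_⟩
  · intro hc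
    have hE : Y.ExtL l col b i (j - i - 1) x y := by
      rw [key]
      simp [h30, h32] at hc
      exact ⟨hc.2, hc.1⟩
    have hxz := hE.1
    have hvx := Layout.vert_lt hb hxz
    have hnw := h.n_lt
    refine ⟨by simp; split_ifs <;> simp [hww], ?_, ?_⟩
    · intro hc2
      have hxy : x < Y.s ∧ y < Y.s := by
        simp [h31, h32, h.r1] at hc2; exact ⟨hc2.2, hc2.1⟩
      have hcl := cell_lt (i := i) (j := j) (l := l) (by omega) hj hx hy
      have hcw := h.cells_lt
      have h8 : s.mem 23 (cell a l L i j x y) ≤ b := by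
        rw [hA.cnt i j x y hij hj hxy.1 hxy.2, if_neg (fun h => hD h.1), add_zero]
        exact hcnt i j x y hij hj hxy.1 hxy.2
      have hmw := h.m_lt
      have h9 : (i * (l + 1) + j) * (a.n * a.n) ^ L + addr a.n L x y = cell a l L i j x y := rfl
      have hnn : 0 < (a.n * a.n) ^ L := by have := a.two_le; positivity
      have h10 : i * (l + 1) + j ≤ (i * (l + 1) + j) * (a.n * a.n) ^ L :=
        Nat.le_mul_of_pos_right _ hnn
      refine ⟨?_, ?_⟩
      · simp only [safe_add, safe_mul, safe_reg, safe_const, val_reg, val_mul, val_add, val_const,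
          setReg_reg, h28, h30, h.r6]
        simp [h28, h30, h.r6]
        omega
      have h11 : ((reg 28 * const (l + 1) + reg 30) * reg 6 + reg 33).val
          (s.setReg 33 (addr a.n L x y)) = cell a l L i j x y := by
        simp [h28, h30, h.r6, cell]
      rw [h11]
      refine ⟨⟨trivial, by simp; omega, trivial⟩, fun hc3 => ?_, fun hc3 => ?_⟩
      · have hc3 : s.mem 23 (cell a l L i j x y) < l := by
          by_contra h'; simp [h'] at hc3
        refine ⟨trivial, by simp [hww], ?_⟩
        refine ⟨trivial, by simp [hww]; omega, ?_⟩
        refine ⟨by simp [hww, hlw']; split_ifs <;> simp [hww, hlw'], ?_, ?_⟩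
        · intro hc4
          exfalso
          simp [h31, h.r1] at hc4
          omega
        · intro hc4
          refine ⟨trivial, by simp [hww], ?_⟩
          refine ⟨hA.step hb hij hj hx hy hD ?_ ?_ ?_, ?_, ?_, ?_⟩
          · intro c
            simp [hE, hxy]
            split_ifs with hcc <;> simp [hcc]
          · intro b'
            simp [hE, hxy, hc3, h.r23]
          · rw [if_neg (by omega)]
            simp
          · simp [h32, h.r1]; split_ifs <;> simp
          · simp [h32, h.r1, hE]
          · intro c hcc
            simp [hcc]
      · have hc3 : ¬ s.mem 23 (cell a l L i j x y) < l := by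
          intro h'; simp [h'] at hc3
        refine ⟨trivial, by simp [hww]; omega, ?_⟩
        refine ⟨by simp [hww, hlw']; split_ifs <;> simp [hww, hlw'], ?_, ?_⟩
        · intro hc4
          exfalso
          simp [h31, h.r1] at hc4
          omega
        · intro hc4
          refine ⟨trivial, by simp [hww], ?_⟩
          refine ⟨hA.step hb hij hj hx hy hD ?_ ?_ ?_, ?_, ?_, ?_⟩
          · intro c
            simp [hE, hxy]
            split_ifs with hcc <;> simp [hcc]
          · intro b'
            simp [hc3]
          · rw [if_neg (by omega)]
            simp
          · simp [h32, h.r1]; split_ifs <;> simp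
          · simp [h32, h.r1, hE]
          · intro c hcc
            simp [hcc]
    · intro hc2
      have hxy : ¬ (x < Y.s ∧ y < Y.s) := by
        intro h'; simp [h31, h32, h.r1, h'] at hc2
      refine ⟨by simp [hww, hlw']; split_ifs <;> simp [hww, hlw'], ?_, ?_⟩
      · intro hc4
        have hc4 : i = 0 ∧ j = l ∧ x = y ∧ Y.s ≤ x := by
          simp [h28, h30, h31, h32, h.r1] at hc4
          omega
        have hv : Y.vert b x = Y.bl b + (x - Y.s) := by
          rw [Layout.vert, if_neg (by omega)]
        refine ⟨by simp [hww], by simp [h.r26, h31, h.r1]; omega, trivial, by simp [hww], ?_⟩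
        refine ⟨hA.step hb hij hj hx hy hD ?_ ?_ ?_, ?_, ?_, ?_⟩
        · intro c
          simp
          omega
        · intro b'
          simp
          omega
        · rw [if_pos ⟨hE, hc4⟩]
          simp [h.r26, h31, h.r1, hv]
        · simp [h32, h.r1]; split_ifs <;> simp
        · simp [h32, h.r1, hE]
        · intro c hcc
          simp [hcc]
      · intro hc4
        have hc4 : ¬ (i = 0 ∧ j = l ∧ x = y ∧ Y.s ≤ x) := by
          intro h'
          have := h'.2.2.2
          simp [h28, h30, h31, h32, h.r1] at hc4
          omega
        refine ⟨trivial, by simp [hww], ?_⟩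
        refine ⟨hA.step hb hij hj hx hy hD ?_ ?_ ?_, ?_, ?_, ?_⟩
        · intro c
          simp
          omega
        · intro b'
          simp
          omega
        · rw [if_neg (by tauto)]
          simp
        · simp [h32, h.r1]; split_ifs <;> simp
        · simp [h32, h.r1, hE]
        · intro c hcc
          simp [hcc]
  · intro hc
    have hE : ¬ Y.ExtL l col b i (j - i - 1) x y := by
      rw [key]
      intro h'
      simp [h30, h32, h'.1, h'.2] at hc
    refine ⟨trivial, by simp [hww], ?_⟩
    refine ⟨hA.step hb hij hj hx hy hD ?_ ?_ ?_, ?_, ?_, ?_⟩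
    · intro c
      simp [hE]
    · intro b'
      simp [hE]
    · rw [if_neg (by tauto)]
      simp
    · simp
    · simp [hE]
    · intro c hcc
      simp [hcc]

end

section
variable {w l L : ℕ} {a : MulAlg} {Y : Layout (a.n ^ L)} {s : State} {col : ℕ → ℕ} {b : ℕ}

theorem Acc.same {D : ℕ → ℕ → ℕ → ℕ → Prop} {s s' s'' : State} (h : Acc l L a Y col b D s s')
    (h1 : s''.reg 21 = s'.reg 21) (h2 : s''.reg 22 = s'.reg 22) (h3 : s''.mem 22 = s'.mem 22)
    (h4 : s''.mem 23 = s'.mem 23) : Acc l L a Y col b D s s'' where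
  cnt := by rw [h4]; exact h.cnt
  keep := by rw [h3]; exact h.keep
  sound := by rw [h1, h2]; exact h.sound
  compl := by rw [h1]; exact h.compl

theorem sq_le_unit : (a.n * a.n) ^ L + 1 ≤ a.unit L := by
  have := Nat.pow_le_pow_left a.sq_le L
  rw [MulAlg.unit]
  nlinarith [Nat.zero_le (L * (a.r ^ L + 1))]

theorem add_one_mul_le_unit : (a.n ^ L + 1) * (a.n ^ L + 1) ≤ 4 * a.unit L := by
  have h := sq_le_unit (a := a) (L := L)
  rw [mul_pow] at h
  have h0 : 0 < a.n ^ L := by have := a.two_le; positivity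
  nlinarith

theorem add_one_le_unit : a.n ^ L + 1 ≤ a.unit L := by
  have h := sq_le_unit (a := a) (L := L)
  rw [mul_pow] at h
  have h0 : 0 < a.n ^ L := by have := a.two_le; positivity
  nlinarith

/-- Copies the adjacency matrix of the block to array `26`. -/
def copyAdj : Prog := forTo 31 (reg 6) (store 26 (reg 31) (load 28 (reg 31)))

/-- Extends all walks by one edge. -/
def extendWalks (a : MulAlg) (l : ℕ) : Prog := copyAdj ;; boolMul a ;; forSq (entry a.n l)

/-- The invariant of the double loop splits the entries of array `25`: those already treated hold
walks with one more edge, the others still hold the raw matrix product that `entry` has to inspect.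
-/
theorem extendWalks_runs (h : BlockEnv w a l L Y col b s) (hl : 0 < l) {s0 : State}
    {D : ℕ → ℕ → ℕ → ℕ → Prop} (hA : Acc l L a Y col b D s0 s)
    (hcnt : ∀ i j x y, i < j → j ≤ l → x < Y.s → y < Y.s → s0.mem 23 (cell a l L i j x y) ≤ b)
    {i j : ℕ} (hij : i < j) (hj : j ≤ l) (hD : ∀ x y, ¬ D i j x y) (h28 : s.reg 28 = i)
    (h30 : s.reg 30 = j) (hM : IsMat a L (Y.BWL l col b i (j - i - 1)) s) :
    Runs w (extendWalks a l) s (a.unit L * (a.r * 200 + 10 * (entry a.n l).time + 1000)) fun s' =>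
      Acc l L a Y col b (fun i' j' x' y' => D i' j' x' y' ∨ i' = i ∧ j' = j) s0 s' ∧
        IsMat a L (Y.BWL l col b i (j - i)) s' := by
  apply Runs.time_le
  · apply Runs.seq
    · refine Runs.fill (A := 26) (m := (a.n * a.n) ^ L) (f := s.mem 28) (T := 4) rfl
        (fun s' hS => ⟨trivial, (hS.1 6 rfl).trans h.r6⟩) ?_
      intro x s3 hx h31 hS3 _
      refine Runs.time_le (T := Prog.time (store 26 (reg 31) (load 28 (reg 31))))
        (Runs.straight ?_) le_rfl
      refine ⟨trivial, trivial, ?_, ?_⟩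
      · simp [h31, hS3.2 28 rfl]
      · intro j hj; simp [h31, hj]
    rintro s1 hS1 ⟨h26, -⟩
    have E1 := h.of_same hS1 rfl rfl
    have h28 := (hS1.1 28 rfl).trans h28
    have h30 := (hS1.1 30 rfl).trans h30
    have hA1 := hA.same (hS1.1 21 rfl) (hS1.1 22 rfl) (hS1.2 22 rfl) (hS1.2 23 rfl)
    have hM : IsMat a L (Y.BWL l col b i (j - i - 1)) s1 := by rw [IsMat, hS1.2 25 rfl]; exact hM
    apply Runs.seq
    · exact boolMul_runs E1.toMulEnv hM.1 fun i hi => by rw [h26 i hi]; exact h.adj_le i hi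
    rintro s2 hS2 h25
    have E2 := E1.of_same hS2 rfl rfl
    have h28 := (hS2.1 28 rfl).trans h28
    have h30 := (hS2.1 30 rfl).trans h30
    have hA2 := hA1.same (hS2.1 21 rfl) (hS2.1 22 rfl) (hS2.2 22 rfl) (hS2.2 23 rfl)
    have h25 : ∀ x < a.n ^ L, ∀ y < a.n ^ L, s2.mem 25 (addr a.n L x y) ≠ 0 ↔
        ∃ u < a.n ^ L, Y.BWL l col b i (j - i - 1) x u ∧
          (u < Y.sz b ∧ y < Y.sz b ∧ Y.EB b (Y.vert b u) (Y.vert b y)) := by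
      intro x hx y hy
      rw [h25 x hx y hy]
      refine exists_congr fun u => and_congr_right fun hu => ?_
      rw [hM.2 x hx u hu, h26 _ (addr_lt hu hy), h.adj u hu y hy]
    refine Runs.forSq (T := (entry a.n l).time) (I := fun x y s' =>
      Acc l L a Y col b (fun i' j' x' y' => D i' j' x' y' ∨ i' = i ∧ j' = j ∧
        (x' < x ∨ x' = x ∧ y' < y)) s0 s' ∧
      ∀ x' < a.n ^ L, ∀ y' < a.n ^ L, ((x' < x ∨ x' = x ∧ y' < y) →
        s'.mem 25 (addr a.n L x' y') ≤ 1 ∧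
        (s'.mem 25 (addr a.n L x' y') ≠ 0 ↔ Y.BWL l col b i (j - i) x' y')) ∧
        (¬ (x' < x ∨ x' = x ∧ y' < y) →
          s'.mem 25 (addr a.n L x' y') = s2.mem 25 (addr a.n L x' y'))) rfl rfl rfl E2.r4
      (fun _ _ _ _ h => ⟨⟨h.1.same rfl rfl rfl rfl, h.2⟩, ⟨h.1.same rfl rfl rfl rfl, h.2⟩⟩)
      ?_ ?_ ?_ ?_
    · rintro x s' ⟨h1, h2⟩
      refine ⟨h1.congr (fun i' j' x' y' _ _ hx hy => ?_) hl, fun x' hx' y' hy' => ?_⟩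
      · refine or_congr Iff.rfl (and_congr Iff.rfl (and_congr Iff.rfl ?_)); omega
      · obtain ⟨h3, h4⟩ := h2 x' hx' y' hy'
        exact ⟨fun h => h3 (by omega), fun h => h4 (by omega)⟩
    · refine ⟨hA2.congr (fun i' j' x' y' _ _ hx hy => ?_) hl, fun x' hx' y' hy' =>
        ⟨fun h => by omega, fun h => rfl⟩⟩
      simp
    · rintro x y s3 hx hy h31 h32 hS3 ⟨h1, h2⟩
      have E3 := E2.of_same hS3 rfl rfl
      refine (entry_runs E3 hl h1 hcnt hij hj hx hy ?_ ((hS3.1 28 rfl).trans h28)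
        ((hS3.1 30 rfl).trans h30) h31 h32 ?_).mono le_rfl ?_
      · rintro (h3 | h3)
        · exact hD _ _ h3
        · omega
      · rw [(h2 x hx y hy).2 (by omega)]
        exact h25 x hx y hy
      · rintro s4 - ⟨g1, g2, g3, g4⟩
        refine ⟨g1.congr (fun i' j' x' y' _ _ hx hy => ?_) hl, fun x' hx' y' hy' => ?_⟩
        · rw [or_assoc]
          refine or_congr Iff.rfl ?_
          constructor
          · rintro (⟨rfl, rfl, h⟩ | ⟨rfl, rfl, h⟩)
            · exact ⟨rfl, rfl, by omega⟩
            · exact ⟨rfl, rfl, by omega⟩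
          · rintro ⟨rfl, rfl, h⟩
            by_cases h' : x' < x ∨ x' = x ∧ y' < y
            · exact .inl ⟨rfl, rfl, h'⟩
            · exact .inr ⟨rfl, rfl, by omega⟩
        · by_cases he : x' = x ∧ y' = y
          · obtain ⟨rfl, rfl⟩ := he
            exact ⟨fun _ => ⟨g2, g3⟩, fun h => by omega⟩
          · rw [g4 _ (by rw [Ne, addr_inj hx' hy' hx hy]; exact he)]
            obtain ⟨h3, h4⟩ := h2 x' hx' y' hy'
            exact ⟨fun h => h3 (by omega), fun h => h4 (by omega)⟩
    · rintro s3 - ⟨h1, h2⟩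
      refine ⟨h1.congr (fun i' j' x' y' _ _ hx hy => ?_) hl,
        isMat_of fun x hx y hy => (h2 x hx y hy).1 (.inl hx)⟩
      simp [hx]
  · have h1 := sq_le_unit (a := a) (L := L)
    have h2 := add_one_mul_le_unit (a := a) (L := L)
    have h3 := add_one_le_unit (a := a) (L := L)
    simp only [cost_reg]
    generalize (entry a.n l).time = E at *
    have h5 : (a.n ^ L + 1) * (E + 8) * (a.n ^ L + 1) ≤ 4 * a.unit L * (E + 8) := by
      nlinarith
    nlinarith

/-- Records all walks of the block. -/
def recordBlock (a : MulAlg) (l : ℕ) : Prog :=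
  forTo 28 (const l) (startWalk a.n ;;
    forTo 29 (const l - reg 28) (assign 30 (reg 28 + const 1 + reg 29) ;; extendWalks a l))

/-- For each starting colour `i` the walks are grown edge by edge. In round `t` the last colour has
index `j = i + 1 + t`, so every pair `i < j ≤ l` is treated exactly once. -/
theorem recordBlock_runs (h : BlockEnv w a l L Y col b s) (hl : 0 < l)
    (hcnt : ∀ i j x y, i < j → j ≤ l → x < Y.s → y < Y.s → s.mem 23 (cell a l L i j x y) ≤ b) :
    Runs w (recordBlock a l) s
      (a.unit L * ((l + 1) * ((l + 1) * (a.r * 200 + 10 * (entry a.n l).time + 1100) + 200)))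
      (Acc l L a Y col b (fun _ _ _ _ => True) s) := by
  have hlw := h.const_lt.1
  apply Runs.time_le
  · refine Runs.for_const (m := l)
      (T := (a.n ^ L + 1) * ((a.n ^ L + 1) * 30 + 8) + (l + 1) *
        (6 + a.unit L * (a.r * 200 + 10 * (entry a.n l).time + 1000) + 10))
      (I := fun i => Acc l L a Y col b (fun i' _ _ _ => i' < i) s)
      rfl (fun s' hS => ⟨show l < 2 ^ w by omega, rfl⟩)
      (fun _ _ _ h => h.same rfl rfl rfl rfl) ((Acc.refl s).congr (by simp) hl) ?_ ?_
    · intro i s1 hi h28 hS1 hA1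
      have E1 := h.of_same hS1 rfl rfl
      apply Runs.seq
      · exact startWalk_runs E1 hi h28
      intro s2 hS2 hM2
      have E2 := E1.of_same hS2 rfl rfl
      have h28 := (hS2.1 28 rfl).trans h28
      have hA2 := hA1.same (hS2.1 21 rfl) (hS2.1 22 rfl) (hS2.2 22 rfl) (hS2.2 23 rfl)
      refine Runs.time_le (Runs.for_const (m := l - i)
        (T := 6 + a.unit L * (a.r * 200 + 10 * (entry a.n l).time + 1000))
        (I := fun t s' => Acc l L a Y col b (fun i' j' _ _ => i' < i ∨ i' = i ∧ j' ≤ i + t) s s' ∧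
          IsMat a L (Y.BWL l col b i t) s')
        rfl (fun s' hS => ⟨by simp; omega, by simp [(hS.1 28 rfl).trans h28]⟩)
        (fun _ _ _ h => ⟨h.1.same rfl rfl rfl rfl, h.2⟩) ⟨?_, hM2⟩ ?_ ?_)
        (Nat.mul_le_mul (by omega) (by simp))
      · exact hA2.congr (fun i' j' _ _ h1 _ _ _ => by omega) hl
      · rintro t s3 ht h29 hS3 ⟨hA3, hM3⟩
        have E3 := E2.of_same hS3 rfl rfl
        have h28 := (hS3.1 28 rfl).trans h28
        refine Runs.wp_seq ⟨by simp [h28, h29, h.w_ne]; omega, ?_⟩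
        have hS4 : Same [30] [] s3 (s3.setReg 30 ((reg 28 + const 1 + reg 29).val s3)) := by
          refine ⟨fun r hr => ?_, fun _ _ => rfl⟩
          have : r ≠ 30 := by rintro rfl; simp at hr
          simp [this]
        refine (extendWalks_runs (E3.of_same hS4 rfl rfl) hl
          (hA3.same (by simp) (by simp) rfl rfl) hcnt (i := i) (j := i + 1 + t)
          (by omega) (by omega) (by omega) (by simp [h28]) (by simp [h28, h29]) ?_).mono le_rfl ?_
        · rw [show i + 1 + t - i - 1 = t by omega]
          exact hM3
        · rintro s5 - ⟨g1, g2⟩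
          refine ⟨g1.congr (fun i' j' _ _ h1 _ _ _ => by omega) hl, ?_⟩
          rw [show i + 1 + t - i = t + 1 by omega] at g2
          exact g2
      · rintro s3 - - ⟨g1, -⟩
        exact g1.congr (fun i' j' _ _ h1 _ _ _ => by omega) hl
    · intro s' _ _ hA
      exact hA.congr (fun i' j' _ _ h1 _ _ _ => by simp; omega) hl
  · have h2 := add_one_mul_le_unit (a := a) (L := L)
    have h3 := add_one_le_unit (a := a) (L := L)
    simp only [cost_reg, cost_sub, cost_const]
    generalize hK : a.r * 200 + 10 * (entry a.n l).time = K
    have h4 : 1 ≤ a.unit L := by omega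
    have h5 : (a.n ^ L + 1) * ((a.n ^ L + 1) * 30 + 8) ≤ a.unit L * 130 := by
      nlinarith
    have h6 : 6 + a.unit L * (K + 1000) + 10 ≤ a.unit L * (K + 1016) := by nlinarith
    calc _ ≤ (l + 1) * (a.unit L * 130 + (l + 1) * (a.unit L * (K + 1016)) + 8) := by gcongr
      _ ≤ (l + 1) * (a.unit L * ((l + 1) * (K + 1100) + 200)) := by gcongr; nlinarith
      _ = _ := by ring

end

/-! ### All blocks -/

namespace Layout
variable {N : ℕ} (Y : Layout N)

open Classical in
/-- The number of blocks before `b` that contain a walk from `x` to `y` with the colours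
from `i` to `j`. -/
noncomputable def count (l : ℕ) (col : ℕ → ℕ) (b i j x y : ℕ) : ℕ :=
  ((Finset.range b).filter fun b' => Y.Ext l col b' i (j - i - 1) x y).card

/-- Block `b` is one of the first `l` blocks that contain some walk between vertices of the
separator. -/
def Kept (l : ℕ) (col : ℕ → ℕ) (b : ℕ) : Prop :=
  ∃ i j x y, i < j ∧ j ≤ l ∧ x < Y.s ∧ y < Y.s ∧ Y.Ext l col b i (j - i - 1) x y ∧
    Y.count l col b i j x y < l

variable {Y} {l : ℕ} {col : ℕ → ℕ} {b i j t x y : ℕ}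

theorem count_le : Y.count l col b i j x y ≤ b := by
  classical
  exact (Finset.card_filter_le _ _).trans (by simp)

open Classical in
theorem count_succ : Y.count l col (b + 1) i j x y =
    Y.count l col b i j x y + if Y.Ext l col b i (j - i - 1) x y then 1 else 0 := by
  classical
  rw [count, count, Finset.range_add_one, Finset.filter_insert]
  split_ifs with h
  · rw [Finset.card_insert_of_notMem (by simp)]
  · rfl

theorem count_ne_zero : Y.count l col b i j x y ≠ 0 ↔
    ∃ b' < b, Y.Ext l col b' i (j - i - 1) x y := by
  classical
  rw [count, Finset.card_ne_zero]
  simp [Finset.Nonempty]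

theorem extL_sep (hx : x < Y.s) (hy : y < Y.s) :
    Y.ExtL l col b i t x y ↔ Y.Ext l col b i t x y := by
  simp [ExtL, vert_sep, hx, hy, hx.trans_le s_le_sz, hy.trans_le s_le_sz]

end Layout

/-- Treats all blocks. -/
def allBlocks (a : MulAlg) (l : ℕ) : Prog :=
  forTo 31 (const ((l + 1) * (l + 1)) * reg 6) (store 23 (reg 31) (const 0)) ;;
    forTo 23 (reg 3) (blockPrep a.n l ;; recordBlock a l)

/-- The state after all blocks have been treated. -/
structure BlocksDone (l L : ℕ) (a : MulAlg) (Y : Layout (a.n ^ L)) (col : ℕ → ℕ) (b : ℕ)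
    (s s' : State) : Prop where
  cnt : ∀ i j x y, i < j → j ≤ l → x < Y.s → y < Y.s →
    s'.mem 23 (cell a l L i j x y) = Y.count l col b i j x y
  keep : ∀ b', s'.mem 22 b' ≠ 0 ↔ s.mem 22 b' ≠ 0 ∨ b' < b ∧ Y.Kept l col b'
  sound : s'.reg 21 = s.reg 21 ∧ s'.reg 22 = s.reg 22 ∨ s'.reg 21 = 1 ∧ s'.reg 22 < Y.n ∧
    ∃ b < Y.m, Y.Ext l col b 0 (l - 1) (s'.reg 22) (s'.reg 22)
  compl : ∀ b' < b, ∀ p, Y.s ≤ p → Y.Ext l col b' 0 (l - 1) p p → s'.reg 21 = 1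

section
variable {w l L : ℕ} {a : MulAlg} {Y : Layout (a.n ^ L)} {s : State} {col : ℕ → ℕ} {b : ℕ}

theorem BlocksDone.same {s' s'' : State} (h : BlocksDone l L a Y col b s s')
    (h1 : s''.reg 21 = s'.reg 21) (h2 : s''.reg 22 = s'.reg 22) (h3 : s''.mem 22 = s'.mem 22)
    (h4 : s''.mem 23 = s'.mem 23) : BlocksDone l L a Y col b s s'' where
  cnt := by rw [h4]; exact h.cnt
  keep := by rw [h3]; exact h.keep
  sound := by rw [h1, h2]; exact h.sound
  compl := by rw [h1]; exact h.compl

theorem BlocksDone.step {s' s'' : State} (h : BlocksDone l L a Y col b s s') (hb : b < Y.m)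
    (hA : Acc l L a Y col b (fun _ _ _ _ => True) s' s'') :
    BlocksDone l L a Y col (b + 1) s s'' where
  cnt i j x y hij hj hx hy := by
    classical
    rw [hA.cnt i j x y hij hj hx hy, h.cnt i j x y hij hj hx hy, Layout.count_succ]
    simp only [true_and, Layout.extL_sep hx hy]
  keep b' := by
    rw [hA.keep, h.keep, or_assoc]
    refine or_congr Iff.rfl ?_
    have hK : (b' = b ∧ ∃ i j x y, i < j ∧ j ≤ l ∧ x < Y.s ∧ y < Y.s ∧ True ∧
        Y.ExtL l col b i (j - i - 1) x y ∧ s'.mem 23 (cell a l L i j x y) < l) ↔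
        b' = b ∧ Y.Kept l col b' := by
      refine and_congr_right ?_
      rintro rfl
      refine exists_congr fun i => exists_congr fun j => exists_congr fun x => exists_congr fun y =>
        and_congr_right fun h1 => and_congr_right fun h2 => and_congr_right fun h3 =>
        and_congr_right fun h4 => ?_
      rw [h.cnt i j x y h1 h2 h3 h4, Layout.extL_sep h3 h4]
      simp
    rw [hK, ← or_and_right]
    refine and_congr_left fun _ => ?_
    omega
  sound := by
    rcases hA.sound with ⟨h1, h2⟩ | ⟨h1, h2, h3⟩
    · rw [h1, h2]; exact h.sound
    · exact .inr ⟨h1, h2, b, hb, h3⟩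
  compl b' hb' p hp hE := by
    rcases Nat.lt_succ_iff_lt_or_eq.1 hb' with h1 | rfl
    · have h2 := h.compl b' h1 p hp hE
      rcases hA.sound with ⟨h3, -⟩ | ⟨h3, -⟩
      · rw [h3, h2]
      · exact h3
    · have hin : Y.InB b' p := by
        obtain ⟨u, h1, -⟩ := hE
        exact (h1.inB hb).1
      obtain ⟨h1, h2⟩ := Layout.vert_loc hb hin
      refine hA.compl (Y.loc p) ?_ (h1.trans_le (Layout.sz_le hb)) trivial ?_
      · rw [← Layout.s_le_vert (b := b'), h2]; exact hp
      · exact ⟨h1, h1, by rwa [h2]⟩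

/-- The constant depends on the small algorithm and on `l` only, not on the word size, the exponent
`L` or the graph. Each block costs one unit of matrix multiplication up to a constant; the term with
`Y.s` and `Y.n` pays for the lists of the separator. -/
theorem exists_allBlocks_runs (a : MulAlg) {l : ℕ} (hl : 0 < l) : ∃ K, ∀ {w L : ℕ}
    {Y : Layout (a.n ^ L)} {s : State} {col : ℕ → ℕ}, Env w a l L Y s →
    (∀ p < Y.n, s.mem 21 p = col p) →
    Runs w (allBlocks a l) s (K * (Y.m * a.unit L + (Y.s + 1) * (Y.n + 1)))
      (BlocksDone l L a Y col Y.m s) := by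
  set K1 := (l + 1) * ((l + 1) * (a.r * 200 + 10 * (entry a.n l).time + 1100) + 200) with hK1
  set K2 := (addEdge a.n).time + 100 with hK2
  refine ⟨K1 + 4 * K2 + 300 + (l + 1) * (l + 1) * 20 + K2, ?_⟩
  intro w L Y s col h hcol
  have hcw := h.cells_lt
  have hlw := h.const_lt
  have hm2 := Y.two_le
  have hnn : 0 < (a.n * a.n) ^ L := by have := a.two_le; positivity
  have hU := sq_le_unit (a := a) (L := L)
  have hU1 := add_one_le_unit (a := a) (L := L)
  have hU2 := add_one_mul_le_unit (a := a) (L := L)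
  apply Runs.time_le
  · apply Runs.seq
    · refine Runs.fill (A := 23) (m := (l + 1) * (l + 1) * (a.n * a.n) ^ L) (f := fun _ => 0)
        (T := 3) rfl (fun s' hS => ⟨?_, ?_⟩) ?_
      · simp only [safe_mul, safe_const, safe_reg, val_const, val_reg, (hS.1 6 rfl).trans h.r6]
        exact ⟨(Nat.le_mul_of_pos_right _ hnn).trans_lt hcw, trivial, hcw⟩
      · simp [(hS.1 6 rfl).trans h.r6]
      · intro x s3 hx h31 hS3 _
        refine Runs.time_le (T := Prog.time (store 23 (reg 31) (const 0)))
          (Runs.straight ?_) le_rfl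
        refine ⟨trivial, by simp, ?_, ?_⟩
        · simp [h31]
        · intro j hj; simp [h31, hj]
    rintro s1 hS1 ⟨h23, -⟩
    have E1 := h.of_same hS1 rfl rfl
    have hcol1 : ∀ p < Y.n, s1.mem 21 p = col p := by rw [hS1.2 21 rfl]; exact hcol
    refine Runs.for_loop (m := Y.m)
      -- Only block `0` has long adjacency lists, which are read once.
      (T := fun b => (K1 + 4 * K2 + 290) * a.unit L + if b = 0 then (Y.s + 1) * (Y.n + 1) * K2 else 0)
      (I := fun b => BlocksDone l L a Y col b s) rfl
      (fun s' hS => ⟨trivial, (hS.1 3 rfl).trans E1.r3⟩)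
      (fun _ _ _ h => h.same rfl rfl rfl rfl) ?_ ?_ ?_
    · exact
      { cnt := fun i j x y hij hj hx hy => by
          rw [h23 _ (cell_lt (by omega) hj (hx.trans_le Y.s_le) (hy.trans_le Y.s_le))]
          simp [Layout.count]
        keep := by simp [hS1.2 22 rfl]
        sound := .inl ⟨hS1.1 21 rfl, hS1.1 22 rfl⟩
        compl := by simp }
    · intro b s2 hb h23 hS2 hI
      have E2 := E1.of_same hS2 rfl rfl
      have hcol2 : ∀ p < Y.n, s2.mem 21 p = col p := by rw [hS2.2 21 rfl]; exact hcol1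
      apply Runs.time_le
      · apply Runs.seq
        · refine blockPrep_runs E2 hb h23 hcol2 (d := if b = 0 then Y.n else a.n ^ L) ?_
          intro p h1 h2
          have h3 := Y.bs_le_n (b := b + 1) hb
          split_ifs with h0
          · exact Y.dg_le p (by omega)
          · have := Y.s_le_bs (b := b) (by omega) hb.le
            exact Y.dg_le' p (by omega) (by omega)
        · intro s3 hS3 E3
          have hI3 := hI.same (hS3.1 21 rfl) (hS3.1 22 rfl) (hS3.2 22 rfl) (hS3.2 23 rfl)
          refine (recordBlock_runs E3 hl ?_).mono le_rfl fun s4 _ hA => hI3.step hb hA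
          intro i j x y hij hj hx hy
          rw [hI3.cnt i j x y hij hj hx hy]
          exact Layout.count_le
      · rw [← hK1, ← hK2]
        rcases Nat.eq_zero_or_pos b with rfl | h1
        · simp only [if_true, zero_add, Y.bs_one, Y.bs_zero, Nat.sub_zero]
          nlinarith
        · have h4 := Y.size b h1 hb
          rw [if_neg (by omega), if_neg (by omega)]
          have h5 : (Y.bs (b + 1) - Y.bs b + 1) * ((a.n ^ L + 1) * K2) ≤ 4 * a.unit L * K2 := by
            calc _ ≤ (a.n ^ L + 1) * ((a.n ^ L + 1) * K2) := by gcongr; omega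
              _ = (a.n ^ L + 1) * (a.n ^ L + 1) * K2 := by ring
              _ ≤ _ := by gcongr
          nlinarith
    · intro s' _ _ h; exact h
  · simp only [cost_mul, cost_const, cost_reg]
    rw [Finset.sum_add_distrib, Finset.sum_const, Finset.card_range, smul_eq_mul,
      Finset.sum_ite_eq' (Finset.range Y.m) 0, if_pos (by simp; omega)]
    have h6 : a.unit L ≤ Y.m * a.unit L := Nat.le_mul_of_pos_left _ (by omega)
    have h7 : Y.m ≤ Y.m * a.unit L := Nat.le_mul_of_pos_right _ (by omega)
    have h8 : (l + 1) * (l + 1) * (a.n * a.n) ^ L + 1 ≤ (l + 1) * (l + 1) * (Y.m * a.unit L) := by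
      calc (l + 1) * (l + 1) * (a.n * a.n) ^ L + 1 ≤ (l + 1) * (l + 1) * ((a.n * a.n) ^ L + 1) := by
            nlinarith
        _ ≤ _ := by gcongr; omega
    generalize (l + 1) * (l + 1) = X at *
    generalize (Y.s + 1) * (Y.n + 1) = P at *
    have h9 : Y.m * ((K1 + 4 * K2 + 290) * a.unit L) = (K1 + 4 * K2 + 290) * (Y.m * a.unit L) := by
      ring
    rw [h9]
    generalize Y.m * a.unit L = V at *
    have h10 : (K1 + 4 * K2 + 300 + X * 20 + K2) * (V + P) = (K1 + 4 * K2 + 290) * V + 10 * V +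
      20 * (X * V) + K2 * V + (K1 + 4 * K2 + 300 + X * 20) * P + P * K2 := by ring
    rw [h10]
    have := Nat.zero_le ((K1 + 4 * K2 + 300 + X * 20) * P)
    have := Nat.zero_le (K2 * V)
    omega

end

/-! ### Closed walks through the separator -/

namespace Layout
variable {N : ℕ} (Y : Layout N)

/-- There is a walk from `p` to `q` with `j` edges such that its vertices have the
colours `0, 1, …`, modulo `l`. -/
inductive LR (l : ℕ) (col : ℕ → ℕ) (p : ℕ) : ℕ → ℕ → Prop
  | zero : p < Y.n → col p = 0 → LR l col p 0 p
  | step {j u q : ℕ} : LR l col p j u → Y.E u q → col q = (j + 1) % l → LR l col p (j + 1) q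

/-- Like `LR` for vertices of the separator. -/
inductive SW (l : ℕ) (col : ℕ → ℕ) (x : ℕ) : ℕ → ℕ → Prop
  | zero : x < Y.s → col x = 0 → SW l col x 0 x
  | step {i j u y b : ℕ} : SW l col x i u → i < j → j ≤ l → b < Y.m → y < Y.s →
      Y.Ext l col b i (j - i - 1) u y → SW l col x j y

variable {Y} {l : ℕ} {col : ℕ → ℕ} {b i j t x y p q u : ℕ}

theorem SW.lt (h : Y.SW l col x j y) : x < Y.s ∧ y < Y.s := by
  induction h with
  | zero h => exact ⟨h, h⟩
  | step _ _ _ _ h _ ih => exact ⟨ih.1, h⟩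

theorem sW_zero : Y.SW l col x 0 y ↔ x = y ∧ x < Y.s ∧ col x = 0 := by
  constructor
  · intro h
    cases h with
    | zero h1 h2 => exact ⟨rfl, h1, h2⟩
    | step _ h => exact absurd h (by omega)
  · rintro ⟨rfl, h1, h2⟩
    exact .zero h1 h2

/-- The walk is split at its last visit `i` of the separator before `j`. The matrix for `j` is thus
a Boolean sum over `i` of products with the matrices of nonzero counters. -/
theorem sW_iff (hj : 0 < j) (hjl : j ≤ l) : Y.SW l col x j y ↔
    ∃ i < j, ∃ u, Y.SW l col x i u ∧ u < Y.s ∧ y < Y.s ∧ Y.count l col Y.m i j u y ≠ 0 := by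
  simp only [count_ne_zero]
  constructor
  · intro h
    cases h with
    | zero h => omega
    | step h1 h2 h3 h4 h5 h6 => exact ⟨_, h2, _, h1, h1.lt.2, h5, _, h4, h6⟩
  · rintro ⟨i, hi, u, h1, h2, h3, b, h4, h5⟩
    exact .step h1 hi hjl h4 h3 h5

theorem LR.bW (h : Y.LR l col p i u) (hw : Y.BW l col b i t u q) : Y.LR l col p (i + t) q := by
  induction t generalizing q with
  | zero => obtain ⟨rfl, -⟩ := hw; exact h
  | succ t ih =>
    obtain ⟨⟨v, h1, h2, h3⟩, -⟩ := hw
    exact .step (ih h1) h2.1 h3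

theorem LR.ext (h : Y.LR l col p i u) (hw : Y.Ext l col b i t u q) :
    Y.LR l col p (i + t + 1) q := by
  obtain ⟨v, h1, h2, h3⟩ := hw
  exact .step (h.bW h1) h2.1 h3

/-- Soundness needs no blocks: a composed walk is a walk in the whole graph with the right colours.
Only `LR` is used later to recover a cycle. -/
theorem SW.lR (h : Y.SW l col x j y) : Y.LR l col x j y := by
  induction h with
  | zero h1 h2 => exact .zero (h1.trans_le Y.s_le_n) h2
  | step h1 h2 h3 h4 h5 h6 ih =>
    have := ih.ext h6
    rwa [show ∀ i j : ℕ, i < j → i + (j - i - 1) + 1 = j by omega] at this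
    exact h2

theorem BW.col_start (h : Y.BW l col b i t p q) : col p = i := by
  induction t generalizing q with
  | zero => exact h.2.2
  | succ t ih => obtain ⟨⟨u, h1, -⟩, -⟩ := h; exact ih h1

theorem Ext.lR (hl : 0 < l) (hp : p < Y.n) (h : Y.Ext l col b 0 (l - 1) p p) :
    Y.LR l col p l p := by
  have h1 : col p = 0 := by obtain ⟨u, h1, -⟩ := h; exact h1.col_start
  have := (LR.zero (Y := Y) (l := l) hp h1).ext h
  rwa [show 0 + (l - 1) + 1 = l by omega] at this

end Layout

/-- Loops that fill a matrix. -/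
theorem Runs.fillSq {w L l A c : ℕ} {a : MulAlg} {Y : Layout (a.n ^ L)} {s : State}
    (h : Env w a l L Y s) {off e : Expr} (f : ℕ → ℕ → ℕ) (hA : 20 ≤ A)
    (hc : c + (a.n * a.n) ^ L ≤ 2 ^ w)
    (he : ∀ x y s', x < a.n ^ L → y < a.n ^ L → s'.reg 31 = x → s'.reg 32 = y →
      Same [31, 32] [A] s s' → s'.mem A (c + addr a.n L x y) = s.mem A (c + addr a.n L x y) →
      off.safe w s' ∧ off.val s' = c ∧ e.safe w s' ∧ e.val s' = f x y) :
    Runs w (WordRAM.forSq (store A (off + addrE a.n (reg 31) (reg 32)) e)) s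
      ((a.n ^ L + 1) * (a.n ^ L + 1) * (off.cost + e.cost + 30)) fun s' =>
      (∀ x < a.n ^ L, ∀ y < a.n ^ L, s'.mem A (c + addr a.n L x y) = f x y) ∧
      ∀ i, (∀ x < a.n ^ L, ∀ y < a.n ^ L, i ≠ c + addr a.n L x y) → s'.mem A i = s.mem A i := by
  apply Runs.time_le
  · refine Runs.forSq (T := off.cost + e.cost + 10) (I := fun x y s' =>
      (∀ x' < a.n ^ L, ∀ y' < a.n ^ L, ((x' < x ∨ x' = x ∧ y' < y) →
        s'.mem A (c + addr a.n L x' y') = f x' y') ∧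
        (¬ (x' < x ∨ x' = x ∧ y' < y) →
        s'.mem A (c + addr a.n L x' y') = s.mem A (c + addr a.n L x' y'))) ∧
      ∀ i, (∀ x < a.n ^ L, ∀ y < a.n ^ L, i ≠ c + addr a.n L x y) → s'.mem A i = s.mem A i)
      rfl rfl rfl h.r4 (fun _ _ _ _ h => ⟨h, h⟩) ?_ ?_ ?_ ?_
    · rintro x s' ⟨h1, h2⟩
      refine ⟨fun x' hx' y' hy' => ?_, h2⟩
      obtain ⟨h3, h4⟩ := h1 x' hx' y' hy'
      exact ⟨fun h => h3 (by omega), fun h => h4 (by omega)⟩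
    · exact ⟨fun x' hx' y' hy' => ⟨fun h => by omega, fun _ => rfl⟩, fun _ _ => rfl⟩
    · rintro x y s1 hx hy h31 h32 hS ⟨h1, h2⟩
      have hS' : Same [31, 32] [A] s s1 := hS.mono
        (fun _ h => by simp [WordRAM.forSq, forTo, Prog.wr] at h ⊢; tauto) (fun _ h => h)
      have E := h.of_same hS' rfl (by simpa using hA)
      obtain ⟨g1, g2⟩ := addrE_spec E (ex := reg 31) (ey := reg 32) h31 h32 trivial trivial hx hy
      obtain ⟨k1, k2, k3, k4⟩ := he x y s1 hx hy h31 h32 hS' ((h1 x hx y hy).2 (by omega))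
      have hlt := addr_lt hx hy
      refine (Runs.straight (p := store A (off + addrE a.n (reg 31) (reg 32)) e)
        ⟨⟨k1, g1, show off.val s1 + (addrE a.n (reg 31) (reg 32)).val s1 < 2 ^ w by
          rw [k2, g2]; omega⟩, k3, ?_⟩).time_le
        (by
          simp only [Prog.time, addrE, cost_add, cost_mul, cost_const, cost_load, cost_reg]
          omega)
      simp only [val_add, k2, g2, k4]
      refine ⟨fun x' hx' y' hy' => ?_, fun i hi => ?_⟩
      · simp only [setMem_mem, true_and, add_right_inj, addr_inj hx' hy' hx hy]
        obtain ⟨h3, h4⟩ := h1 x' hx' y' hy'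
        by_cases h5 : x' = x ∧ y' = y
        · obtain ⟨rfl, rfl⟩ := h5
          simp
        · rw [if_neg h5]
          exact ⟨fun h => h3 (by omega), fun h => h4 (by omega)⟩
      · rw [setMem_mem, if_neg (fun h => hi x hx y hy h.2)]
        exact h2 i hi
    · rintro s1 - ⟨h1, h2⟩
      exact ⟨fun x hx y hy => (h1 x hx y hy).1 (.inl hx), h2⟩
  · generalize off.cost + e.cost = K
    nlinarith [Nat.zero_le (a.n ^ L)]


theorem ind_mul (p q : Prop) [Decidable p] [Decidable q] :
    (if p then 1 else 0) * (if q then 1 else 0) = if p ∧ q then 1 else 0 := by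
  split_ifs <;> simp_all

theorem ind_congr {p q : Prop} [Decidable p] [Decidable q] (h : p ↔ q) :
    (if p then 1 else 0) = if q then 1 else 0 := by
  simp only [h]

theorem val_less_le (s : State) (e f : Expr) : (e.less f).val s ≤ 1 := by
  rw [val_less]; split_ifs <;> simp

theorem mul_le_one_of_le {x y : ℕ} (hx : x ≤ 1) (hy : y ≤ 1) : x * y ≤ 1 :=
  (Nat.mul_le_mul hx hy).trans_eq (one_mul 1)

theorem lt_word {w x : ℕ} (hw : w ≠ 0) (hx : x ≤ 1) : x < 2 ^ w :=
  hx.trans_lt (Nat.one_lt_two_pow hw)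

theorem ind_spec (p : Prop) [Decidable p] :
    (if p then 1 else 0) ≤ 1 ∧ ((if p then 1 else 0) ≠ 0 ↔ p) := by
  split_ifs with h <;> simp [h]

/-- The state of the search for closed walks through the separator: array `24` holds the
matrices for lengths `≤ j`. -/
structure Closed (l L : ℕ) (a : MulAlg) (Y : Layout (a.n ^ L)) (col : ℕ → ℕ) (j : ℕ)
    (s : State) : Prop where
  cnt : ∀ i j x y, i < j → j ≤ l → x < Y.s → y < Y.s →
    s.mem 23 (cell a l L i j x y) = Y.count l col Y.m i j x y
  mat : ∀ i ≤ j, ∀ x < a.n ^ L, ∀ y < a.n ^ L, s.mem 24 (cell a l L 0 i x y) ≤ 1 ∧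
    (s.mem 24 (cell a l L 0 i x y) ≠ 0 ↔ Y.SW l col x i y)

/-- Sets the matrix for walks of length `0`. -/
def closedInit (n : ℕ) : Prog :=
  forSq (store 24 (const 0 + addrE n (reg 31) (reg 32))
    ((reg 31).same (reg 32) * ((reg 31).less (reg 1) * (load 21 (reg 31)).same (const 0))))

/-- Adds the walks that consist of a walk of length `i`, from register `29`, and a walk inside of
a block. -/
def closedAdd (a : MulAlg) (l : ℕ) : Prog :=
  forSq (store 25 (const 0 + addrE a.n (reg 31) (reg 32))
    (load 24 (reg 29 * reg 6 + addrE a.n (reg 31) (reg 32)))) ;;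
  forSq (store 26 (const 0 + addrE a.n (reg 31) (reg 32))
    (((reg 31).less (reg 1) * (reg 32).less (reg 1)) * (const 0).less
      (load 23 ((reg 29 * const (l + 1) + (reg 28 + const 1)) * reg 6 +
        addrE a.n (reg 31) (reg 32))))) ;;
  boolMul a ;;
  forSq (store 24 ((reg 28 + const 1) * reg 6 + addrE a.n (reg 31) (reg 32))
    ((const 0).less (load 24 ((reg 28 + const 1) * reg 6 + addrE a.n (reg 31) (reg 32)) +
      (const 0).less (load 25 (const 0 + addrE a.n (reg 31) (reg 32))))))

/-- Computes all matrices. -/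
def closedWalks (a : MulAlg) (l : ℕ) : Prog :=
  closedInit a.n ;;
  forTo 28 (const l) (
    forSq (store 24 ((reg 28 + const 1) * reg 6 + addrE a.n (reg 31) (reg 32)) (const 0)) ;;
    forTo 29 (reg 28 + const 1) (closedAdd a l))

section
variable {w l L : ℕ} {a : MulAlg} {Y : Layout (a.n ^ L)} {s : State} {col : ℕ → ℕ} {b : ℕ}

theorem cell_zero {j x y : ℕ} : cell a l L 0 j x y = j * (a.n * a.n) ^ L + addr a.n L x y := by
  simp [cell]

theorem Closed.congr {j : ℕ} {s' : State} (h : Closed l L a Y col j s) (h1 : s'.mem 23 = s.mem 23)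
    (h2 : s'.mem 24 = s.mem 24) : Closed l L a Y col j s' where
  cnt := by rw [h1]; exact h.cnt
  mat := by rw [h2]; exact h.mat

/-- The cells of the counters are far from the end of the memory. -/
theorem Env.cell_lt' (h : Env w a l L Y s) {i j : ℕ} (hi : i ≤ l) (hj : j ≤ l) :
    (i * (l + 1) + j) * (a.n * a.n) ^ L + (a.n * a.n) ^ L ≤ 2 ^ w := by
  have h1 : i * (l + 1) + j + 1 ≤ (l + 1) * (l + 1) := by nlinarith
  have h2 := Nat.mul_le_mul_right ((a.n * a.n) ^ L) h1
  have h3 := h.cells_lt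
  rw [add_one_mul] at h2
  omega

theorem le_mul_sq (i : ℕ) : i ≤ i * (a.n * a.n) ^ L :=
  Nat.le_mul_of_pos_right _ (by have := a.two_le; positivity)

theorem closedInit_runs (h : Env w a l L Y s) (hcol : ∀ p < Y.n, s.mem 21 p = col p)
    (hcnt : ∀ i j x y, i < j → j ≤ l → x < Y.s → y < Y.s →
      s.mem 23 (cell a l L i j x y) = Y.count l col Y.m i j x y) :
    Runs w (closedInit a.n) s ((a.n ^ L + 1) * (a.n ^ L + 1) * 50) (Closed l L a Y col 0) := by
  classical
  have hE := h.cell_lt' (i := 0) (j := 0) (by omega) (by omega)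
  refine (Runs.fillSq (A := 24) (c := 0) h
    (f := fun x y => if x = y ∧ x < Y.s ∧ col x = 0 then 1 else 0) (by omega)
    (by simpa using hE) ?_).mono (by gcongr; simp) ?_
  · intro x y s1 hx hy h31 h32 hS _
    have hsn := Y.s_le_n
    have e1 := (hS.1 1 rfl).trans h.r1
    refine ⟨by simp, rfl, ?_, ?_⟩
    · simp [h31, h32, e1, hS.2 21 rfl]
      split_ifs <;> simp [h.w_ne]
    · simp only [val_mul, val_same, val_less, val_reg, h31, h32, e1, val_load, hS.2 21 rfl,
        val_const]
      rw [ind_mul, ind_mul]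
      refine ind_congr (and_congr Iff.rfl (and_congr_right fun h1 => ?_))
      rw [hcol x (by omega)]
  · rintro s1 hS ⟨h1, -⟩
    refine ⟨by rw [hS.2 23 rfl]; exact hcnt, ?_⟩
    intro i hi x hx y hy
    obtain rfl : i = 0 := by omega
    rw [cell_zero, zero_mul, h1 x hx y hy, Layout.sW_zero]
    exact ind_spec _

/-- One summand of `Layout.sW_iff`, for the last separator visit `i`: the counters for `i` and `j +
1`, restricted to the separator and turned into truth values, form the second factor of the product.
-/
theorem closedAdd_runs (h : Env w a l L Y s) {i j : ℕ} (hi : i ≤ j) (hj : j < l)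
    (h28 : s.reg 28 = j) (h29 : s.reg 29 = i)
    (hC : Closed l L a Y col j s)
    (hW : ∀ x < a.n ^ L, ∀ y < a.n ^ L, s.mem 24 (cell a l L 0 (j + 1) x y) ≤ 1 ∧
      (s.mem 24 (cell a l L 0 (j + 1) x y) ≠ 0 ↔ ∃ i' < i, ∃ u, Y.SW l col x i' u ∧ u < Y.s ∧
        y < Y.s ∧ Y.count l col Y.m i' (j + 1) u y ≠ 0)) :
    Runs w (closedAdd a l) s (a.unit L * (a.r * 200 + 2000)) fun s' => Closed l L a Y col j s' ∧
      ∀ x < a.n ^ L, ∀ y < a.n ^ L, s'.mem 24 (cell a l L 0 (j + 1) x y) ≤ 1 ∧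
        (s'.mem 24 (cell a l L 0 (j + 1) x y) ≠ 0 ↔ ∃ i' < i + 1, ∃ u, Y.SW l col x i' u ∧
          u < Y.s ∧ y < Y.s ∧ Y.count l col Y.m i' (j + 1) u y ≠ 0) := by
  classical
  have hww := h.w_ne
  have hE := h.cell_lt' (i := 0) (j := 0) (by omega) (by omega)
  have hEi := h.cell_lt' (i := 0) (j := i) (by omega) (by omega)
  have hEj := h.cell_lt' (i := 0) (j := j + 1) (by omega) (by omega)
  have hEij := h.cell_lt' (i := i) (j := j + 1) (by omega) (by omega)
  simp only [zero_mul, zero_add] at hE hEi hEj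
  have hlw := h.const_lt
  have hNs := Y.s_le
  apply Runs.time_le
  · apply Runs.seq
    · refine Runs.fillSq (A := 25) (c := 0) h
        (f := fun x y => s.mem 24 (cell a l L 0 i x y)) (by omega) (by simpa using hE) ?_
      intro x y s1 hx hy h31 h32 hS _
      have E := h.of_same hS rfl rfl
      obtain ⟨g1, g2⟩ := addrE_spec E (ex := reg 31) (ey := reg 32) h31 h32 trivial trivial hx hy
      have e29 := (hS.1 29 rfl).trans h29
      have hlt := addr_lt hx hy
      refine ⟨by simp, rfl, ?_, ?_⟩
      · simp only [safe_load, safe_add, safe_mul, safe_reg, val_mul, val_reg, e29, E.r6, g1, g2,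
          true_and]
        omega
      · simp only [val_load, val_add, val_mul, val_reg, e29, E.r6, g2, cell_zero, hS.2 24 rfl]
    rintro s1 hS1 ⟨h25, -⟩
    simp only [zero_add] at h25
    have E1 := h.of_same hS1 rfl rfl
    have h28 := (hS1.1 28 rfl).trans h28
    have h29 := (hS1.1 29 rfl).trans h29
    have hC1 := hC.congr (hS1.2 23 rfl) (hS1.2 24 rfl)
    rw [← hS1.2 24 rfl] at hW h25
    apply Runs.seq
    · refine Runs.fillSq (A := 26) (c := 0) E1 (f := fun x y => if x < Y.s ∧ y < Y.s ∧
        Y.count l col Y.m i (j + 1) x y ≠ 0 then 1 else 0) (by omega) (by simpa using hE) ?_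
      intro x y s2 hx hy h31 h32 hS _
      have E := E1.of_same hS rfl rfl
      obtain ⟨g1, g2⟩ := addrE_spec E (ex := reg 31) (ey := reg 32) h31 h32 trivial trivial hx hy
      have e29 := (hS.1 29 rfl).trans h29
      have e28 := (hS.1 28 rfl).trans h28
      have hlt := addr_lt hx hy
      have k1 := le_mul_sq (a := a) (L := L) (i * (l + 1) + (j + 1))
      refine ⟨by simp, rfl, ?_, ?_⟩
      · simp only [safe_load, safe_add, safe_mul, safe_reg, safe_const, safe_less,
          val_mul, val_reg, val_add, val_const, e28, e29, E.r6, g1, g2, true_and]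
        refine ⟨lt_word hww (mul_le_one_of_le (val_less_le _ _ _) (val_less_le _ _ _)),
          ⟨by simp, ?_⟩, lt_word hww (mul_le_one_of_le (mul_le_one_of_le (val_less_le _ _ _)
            (val_less_le _ _ _)) (val_less_le _ _ _))⟩
        have : i * (l + 1) ≤ i * (l + 1) + (j + 1) := by omega
        omega
      · simp only [val_load, val_less, val_add, val_mul, val_reg, val_const, e28, e29, h31, h32,
          E.r6, E.r1, g2, hS.2 23 rfl]
        have e : (i * (l + 1) + (j + 1)) * (a.n * a.n) ^ L + addr a.n L x y =
          cell a l L i (j + 1) x y := rfl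
        rw [e]
        rw [ind_mul, ind_mul]
        refine ind_congr (and_assoc.trans <| and_congr_right fun h1 => and_congr_right fun h2 => ?_)
        rw [hC1.cnt i (j + 1) x y (by omega) (by omega) h1 h2, Nat.pos_iff_ne_zero]
    rintro s2 hS2 ⟨h26, -⟩
    simp only [zero_add] at h26
    have E2 := E1.of_same hS2 rfl rfl
    have h28 := (hS2.1 28 rfl).trans h28
    have h29 := (hS2.1 29 rfl).trans h29
    have hC2 := hC1.congr (hS2.2 23 rfl) (hS2.2 24 rfl)
    rw [← hS2.2 24 rfl] at hW h25
    rw [← hS2.2 25 rfl] at h25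
    apply Runs.seq
    · refine boolMul_runs E2.toMulEnv (fun k hk => ?_) fun k hk => ?_
      · obtain ⟨x, hx, y, hy, rfl⟩ := exists_eq_addr hk
        rw [h25 x hx y hy]
        exact (hC2.mat i hi x hx y hy).1
      · obtain ⟨x, hx, y, hy, rfl⟩ := exists_eq_addr hk
        rw [h26 x hx y hy]
        split_ifs <;> simp
    rintro s3 hS3 hM
    have E3 := E2.of_same hS3 rfl rfl
    have h28 := (hS3.1 28 rfl).trans h28
    have hC3 := hC2.congr (hS3.2 23 rfl) (hS3.2 24 rfl)
    rw [← hS3.2 24 rfl] at hW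
    have hM' : ∀ x < a.n ^ L, ∀ y < a.n ^ L, s3.mem 25 (addr a.n L x y) ≠ 0 ↔
        ∃ u, Y.SW l col x i u ∧ u < Y.s ∧ y < Y.s ∧ Y.count l col Y.m i (j + 1) u y ≠ 0 := by
      intro x hx y hy
      rw [hM x hx y hy]
      constructor
      · rintro ⟨u, hu, h1, h2⟩
        rw [h25 x hx u hu, (hC2.mat i hi x hx u hu).2] at h1
        rw [h26 u hu y hy] at h2
        simp only [ne_eq, ite_eq_right_iff, one_ne_zero, imp_false, not_not] at h2
        exact ⟨u, h1, h2⟩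
      · rintro ⟨u, h1, h2⟩
        have hu : u < a.n ^ L := by omega
        refine ⟨u, hu, ?_, ?_⟩
        · rw [h25 x hx u hu, (hC2.mat i hi x hx u hu).2]; exact h1
        · rw [h26 u hu y hy, if_pos h2]; simp
    refine (Runs.fillSq (A := 24) (c := (j + 1) * (a.n * a.n) ^ L) E3 (f := fun x y =>
      if s3.mem 24 (cell a l L 0 (j + 1) x y) ≠ 0 ∨ s3.mem 25 (addr a.n L x y) ≠ 0 then 1 else 0)
      (by omega) hEj ?_).mono le_rfl ?_
    · intro x y s4 hx hy h31 h32 hS hm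
      have E := E3.of_same hS rfl rfl
      obtain ⟨g1, g2⟩ := addrE_spec E (ex := reg 31) (ey := reg 32) h31 h32 trivial trivial hx hy
      have e28 := (hS.1 28 rfl).trans h28
      have hlt := addr_lt hx hy
      have k1 := le_mul_sq (a := a) (L := L) (j + 1)
      have hle := (hW x hx y hy).1
      have hl1 : l + 1 < 2 ^ w := hlw.1
      have h1w : 1 < 2 ^ w := by omega
      have hif : (if 0 < s4.mem 25 (0 + addr a.n L x y) then 1 else 0) ≤ 1 := by split_ifs <;> simp
      rw [cell_zero] at hle
      simp only [safe_load, safe_add, safe_mul, safe_reg, safe_const, safe_less, val_less,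
        val_mul, val_reg, val_add, val_const, e28, E.r6, g1, g2, true_and, val_load, cell_zero]
      rw [hm]
      refine ⟨by omega, ⟨by omega, by omega, by omega, ?_⟩, ?_⟩
      · have : s3.mem 24 ((j + 1) * (a.n * a.n) ^ L + addr a.n L x y) +
          (if 0 < s4.mem 25 (0 + addr a.n L x y) then 1 else 0) ≤ l + 1 := by omega
        omega
      · rw [zero_add, hS.2 25 rfl]
        congr 1
        rw [eq_iff_iff]
        constructor
        · intro h'
          by_contra h''
          push Not at h''
          rw [h''.1, h''.2] at h'
          simp at h'
        · rintro (h' | h')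
          · omega
          · rw [if_pos (by omega : 0 < s3.mem 25 (addr a.n L x y))]
            omega
    · rintro s4 hS4 ⟨h24, h24'⟩
      refine ⟨⟨by rw [hS4.2 23 rfl]; exact hC3.cnt, ?_⟩, ?_⟩
      · intro k hk x hx y hy
        rw [h24' _ (fun x' hx' y' hy' => ?_)]
        · exact hC3.mat k hk x hx y hy
        · rw [← cell_zero (l := l), Ne, cell_inj (by omega) (by omega) hx hy hx' hy']
          omega
      · intro x hx y hy
        rw [cell_zero, h24 x hx y hy]
        refine ⟨(ind_spec _).1, (ind_spec _).2.trans ?_⟩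
        rw [(hW x hx y hy).2, hM' x hx y hy]
        constructor
        · rintro (⟨i', h1, h2⟩ | h2)
          · exact ⟨i', by omega, h2⟩
          · exact ⟨i, by omega, h2⟩
        · rintro ⟨i', h1, h2⟩
          rcases Nat.lt_succ_iff_lt_or_eq.1 h1 with h1 | rfl
          · exact .inl ⟨i', h1, h2⟩
          · exact .inr h2
  · have h2 := add_one_mul_le_unit (a := a) (L := L)
    simp only [addrE, cost_add, cost_mul, cost_const, cost_load, cost_reg, cost_less]
    generalize (a.n ^ L + 1) * (a.n ^ L + 1) = M at *
    have e1 := mul_add (a.unit L) (a.r * 200) 400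
    have e2 := mul_add (a.unit L) (a.r * 200) 2000
    omega

theorem closedWalks_runs (h : Env w a l L Y s) (hcol : ∀ p < Y.n, s.mem 21 p = col p)
    (hcnt : ∀ i j x y, i < j → j ≤ l → x < Y.s → y < Y.s →
      s.mem 23 (cell a l L i j x y) = Y.count l col Y.m i j x y) :
    Runs w (closedWalks a l) s
      (a.unit L * (l + 2) * ((l + 2) * (a.r * 200 + 2020) + 400)) (Closed l L a Y col l) := by
  have hlw := h.const_lt
  apply Runs.time_le
  · apply Runs.seq
    · exact closedInit_runs h hcol hcnt
    intro s1 hS1 hC1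
    have E1 := h.of_same hS1 rfl rfl
    refine Runs.for_const (m := l) (T := (a.n ^ L + 1) * (a.n ^ L + 1) * 50 +
        (l + 1) * (a.unit L * (a.r * 200 + 2000) + 12))
      (I := fun j => Closed l L a Y col j) rfl
      (fun s' hS => ⟨show l < 2 ^ w by omega, rfl⟩)
      (fun _ _ _ h => h.congr rfl rfl) hC1 ?_ (fun _ _ _ h => h)
    intro j s2 hj h28 hS2 hC2
    have E2 := E1.of_same hS2 rfl rfl
    have hEj := h.cell_lt' (i := 0) (j := j + 1) (by omega) (by omega)
    simp only [zero_mul, zero_add] at hEj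
    have k1 := le_mul_sq (a := a) (L := L) (j + 1)
    have hnn := hlw.2
    apply Runs.time_le
    · apply Runs.seq
      · refine Runs.fillSq (A := 24) (c := (j + 1) * (a.n * a.n) ^ L) E2 (f := fun _ _ => 0)
          (by omega) hEj ?_
        intro x y s4 hx hy h31 h32 hS hm
        have e28 := (hS.1 28 rfl).trans h28
        have e6 := (hS.1 6 rfl).trans E2.r6
        have hpos : 0 < (a.n * a.n) ^ L := by have := a.two_le; positivity
        simp only [safe_add, safe_mul, safe_reg, safe_const, val_mul, val_reg, val_add, val_const,
          e28, e6, true_and, and_true]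
        omega
      rintro s3 hS3 ⟨h24, h24'⟩
      have E3 := E2.of_same hS3 rfl rfl
      have h28 := (hS3.1 28 rfl).trans h28
      have hC3 : Closed l L a Y col j s3 := by
        refine ⟨by rw [hS3.2 23 rfl]; exact hC2.cnt, ?_⟩
        intro k hk x hx y hy
        rw [h24' _ (fun x' hx' y' hy' => ?_)]
        · exact hC2.mat k hk x hx y hy
        · rw [← cell_zero (l := l), Ne, cell_inj (by omega) (by omega) hx hy hx' hy']
          omega
      refine Runs.for_const (m := j + 1) (T := a.unit L * (a.r * 200 + 2000))
        (I := fun i s' => Closed l L a Y col j s' ∧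
          ∀ x < a.n ^ L, ∀ y < a.n ^ L, s'.mem 24 (cell a l L 0 (j + 1) x y) ≤ 1 ∧
          (s'.mem 24 (cell a l L 0 (j + 1) x y) ≠ 0 ↔ ∃ i' < i, ∃ u, Y.SW l col x i' u ∧
          u < Y.s ∧ y < Y.s ∧ Y.count l col Y.m i' (j + 1) u y ≠ 0)) rfl
        (fun s' hS => ?_) (fun _ _ _ h => ⟨h.1.congr rfl rfl, h.2⟩) ⟨hC3, ?_⟩ ?_ ?_
      · have e28 := (hS.1 28 rfl).trans h28
        simp [e28, h.w_ne]
        omega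
      · intro x hx y hy
        rw [cell_zero, h24 x hx y hy]
        simp
      · rintro i s4 hi h29 hS4 ⟨hC4, hW⟩
        exact closedAdd_runs (E3.of_same hS4 rfl rfl) (by omega) hj ((hS4.1 28 rfl).trans h28) h29
          hC4 hW
      · rintro s4 - - ⟨hC4, hW⟩
        refine ⟨hC4.cnt, fun k hk x hx y hy => ?_⟩
        rcases Nat.lt_succ_iff_lt_or_eq.1 (Nat.lt_succ_of_le hk) with h1 | rfl
        · exact hC4.mat k (by omega) x hx y hy
        · rw [Layout.sW_iff (by omega) (by omega)]
          exact hW x hx y hy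
    · simp only [addrE, cost_add, cost_mul, cost_const, cost_reg]
      gcongr ?_ + ?_
      · gcongr; simp
      · apply Nat.mul_le_mul <;> omega
  · have h2 := add_one_mul_le_unit (a := a) (L := L)
    have h3 := add_one_le_unit (a := a) (L := L)
    have h4 : 1 ≤ a.unit L := by omega
    simp only [cost_const]
    generalize a.r * 200 = K
    generalize (a.n ^ L + 1) * (a.n ^ L + 1) = M at *
    have h5 : a.unit L * (K + 2000) + 12 ≤ a.unit L * (K + 2020) := by nlinarith
    calc _ ≤ 4 * a.unit L * 50 + (l + 1) * (4 * a.unit L * 50 + (l + 1) * (a.unit L * (K + 2020)) +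
          (1 + 7)) := by gcongr
      _ ≤ 200 * a.unit L + (l + 1) * (200 * a.unit L + (l + 1) * (a.unit L * (K + 2020)) +
          8 * a.unit L) := by nlinarith
      _ = a.unit L * (200 + (l + 1) * (208 + (l + 1) * (K + 2020))) := by ring
      _ ≤ a.unit L * ((l + 2) * (400 + (l + 2) * (K + 2020))) := by gcongr; nlinarith
      _ = _ := by ring

end

/-- Reports closed walks through the separator. -/
def reportClosed (n l : ℕ) : Prog :=
  forTo 31 (reg 1) (Prog.ite (load 24 (const l * reg 6 + addrE n (reg 31) (reg 31)))
    (assign 21 (const 1) ;; assign 22 (reg 31)) skip)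

/-- Searches for cycles with the colours in array `21`. -/
def tryColours (a : MulAlg) (l : ℕ) : Prog := allBlocks a l ;; closedWalks a l ;; reportClosed a.n l

/-- The state after the search with some colours. -/
structure Tried {N : ℕ} (l : ℕ) (Y : Layout N) (col : ℕ → ℕ) (s s' : State) : Prop where
  keep : ∀ b, s'.mem 22 b ≠ 0 ↔ s.mem 22 b ≠ 0 ∨ b < Y.m ∧ Y.Kept l col b
  sound : s'.reg 21 = s.reg 21 ∧ s'.reg 22 = s.reg 22 ∨
    s'.reg 21 = 1 ∧ Y.LR l col (s'.reg 22) l (s'.reg 22)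
  inside : ∀ b < Y.m, ∀ p, Y.s ≤ p → Y.Ext l col b 0 (l - 1) p p → s'.reg 21 = 1
  through : ∀ x, Y.SW l col x l x → s'.reg 21 = 1

set_option maxHeartbeats 1000000 in
theorem exists_tryColours_runs (a : MulAlg) {l : ℕ} (hl : 0 < l) : ∃ K, ∀ {w L : ℕ}
    {Y : Layout (a.n ^ L)} {s : State} {col : ℕ → ℕ}, Env w a l L Y s →
    (∀ p < Y.n, s.mem 21 p = col p) →
    Runs w (tryColours a l) s (K * (Y.m * a.unit L + (Y.s + 1) * (Y.n + 1))) (Tried l Y col s) := by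
  obtain ⟨K, hK⟩ := exists_allBlocks_runs a hl
  obtain ⟨X, hX⟩ : ∃ X, X = (l + 2) * (a.r * 200 + 2020) + 400 := ⟨_, rfl⟩
  refine ⟨K + (l + 2) * X + 100, ?_⟩
  intro w L Y s col h hcol
  have hlw := h.const_lt
  have hC := h.cell_lt' (i := 0) (j := l) (by omega) le_rfl
  simp only [zero_mul, zero_add] at hC
  apply Runs.time_le
  · apply Runs.seq
    · exact hK h hcol
    intro s1 hS1 hB
    have E1 := h.of_same hS1 rfl rfl
    have hcol1 : ∀ p < Y.n, s1.mem 21 p = col p := by rw [hS1.2 21 rfl]; exact hcol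
    apply Runs.seq
    · exact closedWalks_runs E1 hcol1 hB.cnt
    intro s2 hS2 hW
    have E2 := E1.of_same hS2 rfl rfl
    have hB2 := hB.same (hS2.1 21 rfl) (hS2.1 22 rfl) (hS2.2 22 rfl) (hS2.2 23 rfl)
    have hsound : s2.reg 21 = s.reg 21 ∧ s2.reg 22 = s.reg 22 ∨
        s2.reg 21 = 1 ∧ Y.LR l col (s2.reg 22) l (s2.reg 22) := by
      rcases hB2.sound with h1 | ⟨h1, h2, b, _, h3⟩
      · exact .inl h1
      · exact .inr ⟨h1, h3.lR hl h2⟩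
    refine Runs.for_const (m := Y.s) (T := 30) (I := fun x s' =>
      (s'.reg 21 = s.reg 21 ∧ s'.reg 22 = s.reg 22 ∨
        s'.reg 21 = 1 ∧ Y.LR l col (s'.reg 22) l (s'.reg 22)) ∧ s'.mem 22 = s2.mem 22 ∧
      (s2.reg 21 = 1 → s'.reg 21 = 1) ∧ ∀ x' < x, Y.SW l col x' l x' → s'.reg 21 = 1) rfl
      (fun s' hS => ⟨trivial, (hS.1 1 rfl).trans E2.r1⟩)
      (fun _ _ _ h => by simpa using h) ⟨hsound, rfl, fun h => h, by simp⟩ ?_ ?_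
    · rintro x s3 hx h31 hS3 ⟨g1, g2, g3, g4⟩
      have E3 := E2.of_same hS3 rfl rfl
      have hxN := hx.trans_le Y.s_le
      obtain ⟨k1, k2⟩ := addrE_spec E3 (ex := reg 31) (ey := reg 31) h31 h31 trivial trivial hxN hxN
      have hv : (load 24 (const l * reg 6 + addrE a.n (reg 31) (reg 31))).val s3 =
          s2.mem 24 (cell a l L 0 l x x) := by
        simp only [val_load, val_add, val_mul, val_const, val_reg, E3.r6, k2, cell_zero,
          hS3.2 24 rfl]
      have hM := (hW.mat l le_rfl x hxN x hxN).2
      refine (Runs.straight ?_).time_le (by simp [Prog.time, addrE])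
      have hlt := addr_lt (n := a.n) hxN hxN
      refine ⟨?_, ?_, ?_⟩
      · simp only [safe_load, safe_add, safe_mul, safe_reg, safe_const, val_mul, val_reg,
          val_const, E3.r6, k1, k2, true_and]
        omega
      · intro hc
        rw [hv, hM] at hc
        refine ⟨by simp [h.w_ne], trivial, .inr ⟨by simp, ?_⟩, g2, by simp, by simp⟩
        simpa [h31] using hc.lR
      · intro hc
        refine ⟨g1, g2, g3, fun x' hx' hSW => ?_⟩
        rcases Nat.lt_succ_iff_lt_or_eq.1 hx' with h1 | rfl
        · exact g4 x' h1 hSW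
        · rw [hv] at hc
          exact absurd hc (hM.2 hSW)
    · rintro s3 - - ⟨g1, g2, g3, g4⟩
      exact
      { keep := by rw [g2]; exact hB2.keep
        sound := g1
        inside := fun b hb p hp hE => g3 (hB2.compl b hb p hp hE)
        through := fun x hx => g4 x hx.lt.1 hx }
  · have h1 : a.unit L ≤ Y.m * a.unit L := Nat.le_mul_of_pos_left _ (by have := Y.two_le; omega)
    have h2 : Y.s + 1 ≤ (Y.s + 1) * (Y.n + 1) := Nat.le_mul_of_pos_right _ (by omega)
    simp only [cost_reg]
    rw [← hX]
    clear hX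
    generalize hV : (l + 2) * X = V
    rw [show a.unit L * (l + 2) * X = a.unit L * V by rw [← hV]; ring]
    generalize (Y.s + 1) * (Y.n + 1) = P at *
    have h3 : a.unit L * V ≤ Y.m * a.unit L * V := Nat.mul_le_mul_right _ h1
    generalize Y.m * a.unit L = M at *
    have h4 : (K + V + 100) * (M + P) = K * (M + P) + M * V + V * P + 100 * M + 100 * P := by ring
    rw [h4]
    omega


/-! ### Cycles and blocks -/

namespace Layout
variable {N : ℕ} {Y : Layout N} {l : ℕ} {col : ℕ → ℕ} {b i j t p q : ℕ} {v : ℕ → ℕ}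

theorem BW.of_fun (hl : 0 < l) {f : ℕ → ℕ} (h0 : Y.InB b (f 0)) (hi : col (f 0) = i)
    (hE : ∀ k < t, Y.EB b (f k) (f (k + 1)))
    (hc : ∀ k, 1 ≤ k → k ≤ t → Y.s ≤ f k ∧ col (f k) = (i + k) % l) :
    Y.BW l col b i t (f 0) (f t) := by
  induction t with
  | zero => exact ⟨rfl, h0, hi⟩
  | succ t ih =>
    obtain ⟨h1, h2⟩ := hc (t + 1) (by omega) le_rfl
    exact ⟨⟨f t, ih (fun k hk => hE k (by omega)) fun k h h' => hc k h (by omega),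
      hE t (by omega), h2⟩, h1⟩

theorem Ext.of_fun (hl : 0 < l) {f : ℕ → ℕ} (h0 : Y.InB b (f 0)) (hi : col (f 0) = i)
    (hE : ∀ k ≤ t, Y.EB b (f k) (f (k + 1)))
    (hc : ∀ k, 1 ≤ k → k ≤ t → Y.s ≤ f k ∧ col (f k) = (i + k) % l)
    (hc' : col (f (t + 1)) = (i + (t + 1)) % l) :
    Y.Ext l col b i t (f 0) (f (t + 1)) :=
  ⟨f t, .of_fun hl h0 hi (fun k hk => hE k hk.le) hc, hE t le_rfl, hc'⟩

theorem BW.exists_fun (h : Y.BW l col b i t p q) : ∃ f : ℕ → ℕ, f 0 = p ∧ f t = q ∧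
    (∀ k < t, Y.EB b (f k) (f (k + 1))) ∧
    ∀ k, 1 ≤ k → k ≤ t → Y.s ≤ f k ∧ col (f k) = (i + k) % l := by
  induction t generalizing q with
  | zero => exact ⟨fun _ => p, rfl, h.1, by simp, by omega⟩
  | succ t ih =>
    obtain ⟨⟨u, h1, h2, h3⟩, h4⟩ := h
    obtain ⟨f, f0, ft, fE, fc⟩ := ih h1
    refine ⟨fun k => if k ≤ t then f k else q, by simp [f0], by simp, fun k hk => ?_, fun k h1 h2 => ?_⟩
    · rcases Nat.lt_succ_iff_lt_or_eq.1 hk with hk | rfl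
      · simp only [if_pos hk.le, if_pos (Nat.succ_le_of_lt hk)]; exact fE k hk
      · simp only [le_rfl, if_true, add_le_iff_nonpos_right, Nat.le_zero, one_ne_zero, if_false, ft]
        exact h2
    · by_cases hk : k ≤ t
      · simp only [if_pos hk]; exact fc k h1 hk
      · obtain rfl : k = t + 1 := by omega
        simp only [hk, if_false]; exact ⟨h4, h3⟩

theorem Ext.exists_fun (h : Y.Ext l col b i t p q) : ∃ f : ℕ → ℕ, f 0 = p ∧ f (t + 1) = q ∧
    (∀ k ≤ t, Y.EB b (f k) (f (k + 1))) ∧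
    ∀ k, 1 ≤ k → k ≤ t → Y.s ≤ f k ∧ col (f k) = (i + k) % l := by
  obtain ⟨u, h1, h2, -⟩ := h
  obtain ⟨f, f0, ft, fE, fc⟩ := h1.exists_fun
  refine ⟨fun k => if k ≤ t then f k else q, by simp [f0], by simp, fun k hk => ?_, fun k h1 h2 => ?_⟩
  · rcases Nat.lt_or_eq_of_le hk with hk | rfl
    · simp only [if_pos hk.le, if_pos (Nat.succ_le_of_lt hk)]; exact fE k hk
    · simp only [le_rfl, if_true, add_le_iff_nonpos_right, Nat.le_zero, one_ne_zero, if_false, ft]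
      exact h2
  · simp only [if_pos h2]; exact fc k h1 h2

/-- The map `v` runs around a cycle of length `l`. -/
structure Cyc (Y : Layout N) (l : ℕ) (v : ℕ → ℕ) : Prop where
  per : ∀ i, v (i + l) = v i
  adj : ∀ i, Y.E (v i) (v (i + 1))
  inj : ∀ i < l, ∀ j < l, v i = v j → i = j

theorem Cyc.lt (h : Y.Cyc l v) (i : ℕ) : v i < Y.n := Y.lt (h.adj i)

theorem Cyc.mod (h : Y.Cyc l v) (i : ℕ) : v (i % l) = v i := by
  conv_rhs => rw [← Nat.mod_add_div i l]
  generalize i % l = k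
  induction i / l with
  | zero => simp
  | succ d ih => rw [mul_add_one, ← add_assoc, h.per]; exact ih

theorem Cyc.eq_iff (h : Y.Cyc l v) (hl : 0 < l) {i j : ℕ} : v i = v j ↔ i % l = j % l := by
  rw [← h.mod i, ← h.mod j]
  exact ⟨fun e => h.inj _ (Nat.mod_lt _ hl) _ (Nat.mod_lt _ hl) e, fun e => by rw [e]⟩

theorem Cyc.rotate (h : Y.Cyc l v) (hl : 0 < l) (k : ℕ) : Y.Cyc l fun i => v (i + k) where
  per i := by rw [add_right_comm, h.per]
  adj i := by rw [add_right_comm]; exact h.adj _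
  inj i hi j hj e := by
    rw [h.eq_iff hl] at e
    have h1 : i ≡ j [MOD l] := Nat.ModEq.add_right_cancel' k e
    rwa [Nat.ModEq, Nat.mod_eq_of_lt hi, Nat.mod_eq_of_lt hj] at h1

/-- Some block contains the edge; if an endpoint is outside of the separator, that block is the one
of this endpoint. -/
theorem eB_of_inB (hb : b < Y.m) (hE : Y.E p q) (h : Y.s ≤ p ∧ Y.InB b p ∨ Y.s ≤ q ∧ Y.InB b q) :
    Y.EB b p q := by
  obtain ⟨c, hc, h'⟩ := exists_eB hE
  rcases h with ⟨hp, hpb⟩ | ⟨hp, hpb⟩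
  · have h1 := (h'.inB hc).resolve_left (by omega)
    have h2 := hpb.resolve_left (by omega)
    rwa [block_unique hb hc h2.1 h2.2 h1.1 h1.2]
  · have h1 := (h'.inB' hc).resolve_left (by omega)
    have h2 := hpb.resolve_left (by omega)
    rwa [block_unique hb hc h2.1 h2.2 h1.1 h1.2]

/-- A walk outside of the separator cannot change its block, neither forwards nor backwards from
`c`. -/
theorem inB_segment (hb : b < Y.m) (hE : ∀ k, Y.E (v k) (v (k + 1))) {c : ℕ} (hij : i ≤ c) (hcj : c ≤ j)
    (hs : ∀ k, i ≤ k → k ≤ j → Y.s ≤ v k) (hc : Y.InB b (v c)) {k : ℕ} (hk : i ≤ k) (hk' : k ≤ j) :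
    Y.InB b (v k) := by
  have up : ∀ d, c + d ≤ j → Y.InB b (v (c + d)) := by
    intro d
    induction d with
    | zero => exact fun _ => hc
    | succ d ih =>
      intro hd
      exact (eB_of_inB hb (hE (c + d)) (.inl ⟨hs _ (by omega) (by omega), ih (by omega)⟩)).inB' hb
  have down : ∀ d, i + d ≤ c → Y.InB b (v (c - d)) := by
    intro d
    induction d with
    | zero => exact fun _ => hc
    | succ d ih =>
      intro hd
      have h1 := hE (c - (d + 1))
      rw [show c - (d + 1) + 1 = c - d by omega] at h1
      exact (eB_of_inB hb h1 (.inr ⟨hs _ (by omega) (by omega), ih (by omega)⟩)).inB hb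
  rcases le_total c k with h | h
  · have := up (k - c) (by omega); rwa [Nat.add_sub_cancel' h] at this
  · have := down (c - k) (by omega); rwa [Nat.sub_sub_self h] at this

/-- A cycle that avoids the separator is found inside of a block. -/
theorem Cyc.ext_inside (h : Y.Cyc l v) (hl : 0 < l) (hs : ∀ i < l, Y.s ≤ v i) :
    ∃ b < Y.m, (∀ i, Y.InB b (v i)) ∧
      ∀ col : ℕ → ℕ, (∀ i < l, col (v i) = i) → Y.Ext l col b 0 (l - 1) (v 0) (v 0) := by
  have hs' : ∀ i, Y.s ≤ v i := fun i => by rw [← h.mod i]; exact hs _ (Nat.mod_lt _ hl)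
  obtain ⟨b, hb, h1, h2⟩ := exists_block (Y := Y) (h.lt 0)
  have hin : ∀ i, Y.InB b (v i) := fun i =>
    inB_segment (i := 0) (j := i) (c := 0) hb h.adj le_rfl (by omega) (fun k _ _ => hs' k)
      (.inr ⟨h1, h2⟩) (by omega) le_rfl
  refine ⟨b, hb, hin, fun col hc => ?_⟩
  have hcol : ∀ k, col (v k) = k % l := fun k => by rw [← h.mod k, hc _ (Nat.mod_lt _ hl)]
  have := Ext.of_fun (Y := Y) (b := b) (col := col) (t := l - 1) (i := 0) hl (f := v) (hin 0)
    (hc 0 hl) (fun k _ => eB_of_inB hb (h.adj k) (.inl ⟨hs' k, hin k⟩))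
    (fun k _ _ => ⟨hs' k, by rw [hcol, zero_add]⟩) (by rw [hcol, zero_add])
  rwa [Nat.sub_add_cancel hl, show v l = v 0 by simpa using h.per 0] at this

/-- A segment of a cycle between two vertices of the separator. -/
theorem ext_segment (hl : 0 < l) (hE : ∀ k, Y.E (v k) (v (k + 1))) (hij : i < j) (hil : i < l)
    (hi : v i < Y.s) (hj : v j < Y.s) (hs : ∀ k, i < k → k < j → Y.s ≤ v k) :
    ∃ b < Y.m, (∀ k, i ≤ k → k ≤ j → Y.InB b (v k)) ∧
      ∀ col : ℕ → ℕ, (∀ k, i ≤ k → k ≤ j → col (v k) = k % l) →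
        Y.Ext l col b i (j - i - 1) (v i) (v j) := by
  obtain ⟨b, hb, hB⟩ := exists_eB (hE i)
  have hin : ∀ k, i ≤ k → k ≤ j → Y.InB b (v k) := by
    intro k h1 h2
    rcases Nat.lt_or_eq_of_le h1 with h1 | rfl
    · rcases Nat.lt_or_eq_of_le h2 with h2 | rfl
      · exact inB_segment (i := i + 1) (j := j - 1) (c := i + 1) hb hE (by omega) (by omega)
          (fun k _ _ => hs k (by omega) (by omega)) (hB.inB' hb) (by omega) (by omega)
      · exact .inl hj
    · exact .inl hi
  have hEB : ∀ k, i ≤ k → k < j → Y.EB b (v k) (v (k + 1)) := by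
    intro k h1 h2
    rcases Nat.lt_or_eq_of_le h1 with h1 | rfl
    · exact eB_of_inB hb (hE k) (.inl ⟨hs k h1 h2, hin k h1.le h2.le⟩)
    · exact hB
  refine ⟨b, hb, hin, fun col hc => ?_⟩
  have := Ext.of_fun (Y := Y) (b := b) (col := col) (t := j - i - 1) (i := i) hl
    (f := fun k => v (i + k)) (hin i le_rfl hij.le)
    (by rw [add_zero, hc i le_rfl hij.le, Nat.mod_eq_of_lt hil])
    (fun k hk => hEB (i + k) (by omega) (by omega))
    (fun k _ _ => ⟨hs _ (by omega) (by omega), hc _ (by omega) (by omega)⟩)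
    (hc _ (by omega) (by omega))
  simpa [show i + (j - i - 1 + 1) = j by omega] using this

/-- A cycle through the separator is found if its colours are right. -/
theorem Cyc.sW (h : Y.Cyc l v) (hl : 0 < l) (h0 : v 0 < Y.s) (hc : ∀ i < l, col (v i) = i) :
    Y.SW l col (v 0) l (v 0) := by
  have hcol : ∀ k, col (v k) = k % l := fun k => by rw [← h.mod k, hc _ (Nat.mod_lt _ hl)]
  have key : ∀ j ≤ l, v j < Y.s → Y.SW l col (v 0) j (v j) := by
    intro j
    induction j using Nat.strong_induction_on with
    | _ j ih =>
      intro hj hjs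
      rcases Nat.eq_zero_or_pos j with rfl | hpos
      · exact .zero h0 (by rw [hcol, Nat.zero_mod])
      · classical
        have hex : ∃ i, i < j ∧ v i < Y.s := ⟨0, hpos, h0⟩
        -- The last visit of the separator before `j`; between `i` and `j` the cycle stays in one
        -- block.
        obtain ⟨i, ⟨hij, hi⟩, hmax⟩ : ∃ i, (i < j ∧ v i < Y.s) ∧ ∀ k, k < j → v k < Y.s → k ≤ i := by
          refine ⟨Nat.findGreatest (fun i => i < j ∧ v i < Y.s) j,
            Nat.findGreatest_spec (P := fun i => i < j ∧ v i < Y.s) (Nat.zero_le j) ⟨hpos, h0⟩,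
            fun k h1 h2 => Nat.le_findGreatest h1.le ⟨h1, h2⟩⟩
        obtain ⟨b, hb, -, hext⟩ := ext_segment (l := l) hl h.adj hij (by omega) hi hjs
          (fun k h1 h2 => by
            by_contra h3
            have := hmax k h2 (by omega)
            omega)
        exact .step (ih i hij (by omega) hi) hij hj hb hjs (hext col fun k _ _ => hcol k)
  have := key l le_rfl (by rw [show v l = v 0 by simpa using h.per 0]; exact h0)
  rwa [show v l = v 0 by simpa using h.per 0] at this

/-- As long as the counter is below `l`, each block that raises it satisfies the condition on the
right. So if the counter reaches `l`, there are at least `l` such blocks, all of them kept. -/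
theorem le_card_kept {x y : ℕ} : min l (Y.count l col b i j x y) ≤
    Set.ncard {b' | b' < b ∧ Y.Ext l col b' i (j - i - 1) x y ∧ Y.count l col b' i j x y < l} := by
  classical
  have hfin : ∀ b, {b' | b' < b ∧ Y.Ext l col b' i (j - i - 1) x y ∧
      Y.count l col b' i j x y < l}.Finite := fun b => (Set.finite_Iio b).subset fun _ h => h.1
  induction b with
  | zero => simp [count]
  | succ b ih =>
    rw [count_succ]
    have hsub : {b' | b' < b ∧ Y.Ext l col b' i (j - i - 1) x y ∧ Y.count l col b' i j x y < l} ⊆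
      {b' | b' < b + 1 ∧ Y.Ext l col b' i (j - i - 1) x y ∧ Y.count l col b' i j x y < l} :=
      fun _ h => ⟨by have := h.1; omega, h.2⟩
    by_cases h : Y.Ext l col b i (j - i - 1) x y ∧ Y.count l col b i j x y < l
    · have h1 : insert b {b' | b' < b ∧ Y.Ext l col b' i (j - i - 1) x y ∧
          Y.count l col b' i j x y < l} ⊆
        {b' | b' < b + 1 ∧ Y.Ext l col b' i (j - i - 1) x y ∧ Y.count l col b' i j x y < l} := by
        rintro b' (rfl | h')
        · exact ⟨by omega, h⟩
        · exact hsub h'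
      have h2 := Set.ncard_le_ncard h1 (hfin _)
      rw [Set.ncard_insert_of_notMem (by simp) (hfin b)] at h2
      rw [if_pos h.1]
      omega
    · have h2 := Set.ncard_le_ncard hsub (hfin _)
      split_ifs with h3
      · have : ¬ Y.count l col b i j x y < l := fun h4 => h ⟨h3, h4⟩
        omega
      · omega

end Layout
-- Moving a cycle into the kept blocks.
namespace Layout
variable {N : ℕ} {Y : Layout N} {l : ℕ} {v : ℕ → ℕ}

theorem Cyc.of_fun (hl : 0 < l) {u : ℕ → ℕ} (hE : ∀ r < l, Y.E (u r) (u (r + 1))) (h0 : u l = u 0)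
    (hinj : ∀ i < l, ∀ j < l, u i = u j → i = j) : Y.Cyc l fun t => u (t % l) where
  per t := by simp
  adj t := by
    have h1 := Nat.mod_lt t hl
    have h2 := hE _ h1
    rcases Nat.lt_or_eq_of_le (Nat.succ_le_of_lt h1) with h3 | h3
    · rwa [← Nat.mod_add_mod, Nat.mod_eq_of_lt h3]
    · have h4 : t % l + 1 = l := h3
      rw [h4, h0] at h2
      rwa [← Nat.mod_add_mod, h4, Nat.mod_self]
  inj i hi j hj e := by
    simp only [Nat.mod_eq_of_lt hi, Nat.mod_eq_of_lt hj] at e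
    exact hinj i hi j hj e

/-- The position lies in the separator or in a block with the property `K`. -/
def Good (Y : Layout N) (K : ℕ → Prop) (p : ℕ) : Prop :=
  p < Y.n ∧ (Y.s ≤ p → ∃ b < Y.m, Y.bs b ≤ p ∧ p < Y.bs (b + 1) ∧ K b)

/-- A family of colourings of the numbers below `U` such that all ways to give different colours
to a few numbers occur. -/
def Rich (l U Z : ℕ) (C : ℕ → ℕ → ℕ) : Prop :=
  ∀ (I : Finset ℕ) (x : ℕ → ℕ), (∀ i ∈ I, i < l) → (∀ i ∈ I, x i < U) → Set.InjOn x I →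
    ∃ z < Z, ∀ i ∈ I, C z (x i) = i

/-- Every cycle can be moved to the kept blocks. -/
theorem Cyc.exists_good_of_sep (hl : 0 < l) {U Z : ℕ} {C : ℕ → ℕ → ℕ} (hC : Rich l U Z C)
    (hN : N ≤ U) {K : ℕ → Prop}
    (hK : ∀ b < Y.m, ∀ z < Z, Y.Kept l (fun p => C z (Y.loc p)) b → K b) (d : ℕ) :
    ∀ v : ℕ → ℕ, Y.Cyc l v → v 0 < Y.s → Set.ncard {i | i < l ∧ ¬ Y.Good K (v i)} ≤ d →
      ∃ v', Y.Cyc l v' ∧ ∀ i, Y.Good K (v' i) := by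
  classical
  -- `d` bounds the number of bad indices of the cycle. An exchange repairs the index `c` and makes
  -- no other index bad.
  induction d with
  | zero =>
    intro v h _ hd
    refine ⟨v, h, fun i => ?_⟩
    have hfin : {i | i < l ∧ ¬ Y.Good K (v i)}.Finite :=
      (Set.finite_Iio l).subset fun _ h => h.1
    rw [Nat.le_zero, Set.ncard_eq_zero hfin] at hd
    by_contra hi
    rw [← h.mod i] at hi
    exact (Set.eq_empty_iff_forall_notMem.1 hd) _ ⟨Nat.mod_lt i hl, hi⟩
  | succ d ih =>
    intro v h h0 hd
    by_cases hall : ∀ i, Y.Good K (v i)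
    · exact ⟨v, h, hall⟩
    obtain ⟨c, hcl, hc⟩ : ∃ c < l, ¬ Y.Good K (v c) := by
      push Not at hall
      obtain ⟨i, hi⟩ := hall
      exact ⟨i % l, Nat.mod_lt i hl, by rwa [h.mod]⟩
    have hl0 : v l = v 0 := by simpa using h.per 0
    have hcs : Y.s ≤ v c := by
      by_contra h1
      exact hc ⟨h.lt c, fun h2 => absurd h2 h1⟩
    -- `i` and `j` are the visits of the separator just before and just after the bad vertex `v c`.
    -- The segment between them lies in a single block `b`.
    obtain ⟨i, hic, his, himax⟩ : ∃ i, i < c ∧ v i < Y.s ∧ ∀ k, i < k → k ≤ c → Y.s ≤ v k := by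
      have h1 := Nat.findGreatest_spec (P := fun i => v i < Y.s) (Nat.zero_le c) h0
      refine ⟨Nat.findGreatest (fun i => v i < Y.s) c, ?_, h1, fun k h2 h3 => ?_⟩
      · refine lt_of_le_of_ne (Nat.findGreatest_le c) fun e => ?_
        rw [e] at h1; omega
      · exact not_lt.1 (Nat.findGreatest_is_greatest (P := fun i => v i < Y.s) h2 h3)
    obtain ⟨j, hcj, hjl, hjs, hjmin⟩ : ∃ j, c < j ∧ j ≤ l ∧ v j < Y.s ∧
        ∀ k, c ≤ k → k < j → Y.s ≤ v k := by
      have hex : ∃ j, c ≤ j ∧ v j < Y.s := ⟨l, hcl.le, by rw [hl0]; exact h0⟩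
      obtain ⟨h1, h2⟩ := Nat.find_spec hex
      refine ⟨Nat.find hex, lt_of_le_of_ne h1 fun e => ?_, Nat.find_min' hex ⟨hcl.le, by rw [hl0]; exact h0⟩,
        h2, fun k h3 h4 => ?_⟩
      · rw [← e] at h2; omega
      · have := Nat.find_min hex h4
        by_contra h5
        exact this ⟨h3, not_le.1 h5⟩
    obtain ⟨b, hb, hin, hext⟩ := ext_segment (l := l) (i := i) (j := j) hl h.adj (by omega) (by omega)
      his hjs (fun k h1 h2 => by
        rcases le_total k c with h3 | h3
        · exact himax k h1 h3
        · exact hjmin k h3 h2)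
    have hbK : ¬ K b := by
      intro hK'
      have := (hin c hic.le hcj.le).resolve_left (by omega)
      exact hc ⟨h.lt c, fun _ => ⟨b, hb, this.1, this.2, hK'⟩⟩
    -- Inside of one block, local numbers are distinct, so some colouring of the first pass gives
    -- the whole segment its colours. Indices are taken modulo `l` because `i = 0` and `j = l` may
    -- denote the same vertex.
    obtain ⟨z, hz, hz'⟩ := hC ((Finset.Icc i j).image (· % l)) (fun k => Y.loc (v k))
      (fun k hk => by
        obtain ⟨k', -, rfl⟩ := Finset.mem_image.1 hk
        exact Nat.mod_lt _ hl)
      (fun k hk => by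
        obtain ⟨k', hk', rfl⟩ := Finset.mem_image.1 hk
        rw [Finset.mem_Icc] at hk'
        have := (vert_loc hb (hin k' hk'.1 hk'.2)).1
        simp only [h.mod]
        exact (this.trans_le (sz_le hb)).trans_le hN)
      (fun k hk k' hk' e => by
        obtain ⟨k, hk1, rfl⟩ := Finset.mem_image.1 hk
        obtain ⟨k', hk1', rfl⟩ := Finset.mem_image.1 hk'
        rw [Finset.mem_Icc] at hk1 hk1'
        simp only [h.mod] at e
        have h1 := (vert_loc hb (hin k hk1.1 hk1.2)).2
        have h2 := (vert_loc hb (hin k' hk1'.1 hk1'.2)).2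
        rw [e, h2] at h1
        exact ((h.eq_iff hl).1 h1).symm)
    set col : ℕ → ℕ := fun p => C z (Y.loc p) with hcol
    have hE := hext col (fun k h1 h2 => by
      have := hz' (k % l) (Finset.mem_image_of_mem _ (Finset.mem_Icc.2 ⟨h1, h2⟩))
      simpa only [h.mod] using this)
    have hnk : ¬ Y.Kept l col b := fun h' => hbK (hK b hb z hz h')
    -- Block `b` contains the segment but is not kept, so at least `l` earlier blocks contain a
    -- segment of this kind.
    have hcount : l ≤ Y.count l col b i j (v i) (v j) := by
      by_contra hlt
      exact hnk ⟨i, j, v i, v j, by omega, hjl, his, hjs, hE, not_le.1 hlt⟩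
    have hG := le_card_kept (Y := Y) (l := l) (col := col) (b := b) (i := i) (j := j) (x := v i)
      (y := v j)
    rw [min_eq_left hcount] at hG
    choose blk hblk using fun k => exists_block (Y := Y) (h.lt k)
    -- The `l - 1` vertices of the cycle other than `v c` meet at most `l - 1` blocks, so one of the
    -- `l` candidates is missed by all of them. It differs from the block of `v c`, too, because it
    -- precedes `b`.
    have hT : (((Finset.range l).erase c).image blk : Set ℕ).ncard < l := by
      rw [Set.ncard_coe_finset]
      refine Finset.card_image_le.trans_lt ?_
      rw [Finset.card_erase_of_mem (Finset.mem_range.2 hcl), Finset.card_range]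
      omega
    obtain ⟨b', ⟨hb'b, hE', hcnt'⟩, hb'T⟩ := Set.exists_mem_notMem_of_ncard_lt_ncard
      (hT.trans_le hG) (Finset.finite_toSet _)
    have hb'm : b' < Y.m := by omega
    have hKb' : K b' := hK b' hb'm z hz
      ⟨i, j, v i, v j, by omega, hjl, his, hjs, hE', hcnt'⟩
    have hfree : ∀ t < l, Y.s ≤ v t → ¬ (Y.bs b' ≤ v t ∧ v t < Y.bs (b' + 1)) := by
      rintro t ht hts ⟨h1, h2⟩
      obtain ⟨g1, g2, g3⟩ := hblk t
      have e := block_unique hb'm g1 h1 h2 g2 g3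
      by_cases htc : t = c
      · subst htc
        have h3 := (hin t hic.le hcj.le).resolve_left (by omega)
        have := block_unique hb'm hb h1 h2 h3.1 h3.2
        omega
      · exact hb'T (by
          rw [Finset.mem_coe, Finset.mem_image]
          exact ⟨t, Finset.mem_erase.2 ⟨htc, Finset.mem_range.2 ht⟩, e.symm⟩)
    obtain ⟨f, f0, fj, fE, fc⟩ := hE'.exists_fun
    rw [show j - i - 1 + 1 = j - i by omega] at fj
    have fB : ∀ k, 1 ≤ k → k < j - i → Y.bs b' ≤ f k ∧ f k < Y.bs (b' + 1) := fun k h1 h2 =>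
      ((fE k (by omega)).inB hb'm).resolve_left (by have := (fc k h1 (by omega)).1; omega)
    -- The cycle with its segment from `i` to `j` replaced by the one in block `b'`.
    set u : ℕ → ℕ := fun r => if i < r ∧ r < j then f (r - i) else v r with hu
    have u_in : ∀ r, i ≤ r → r ≤ j → u r = f (r - i) := by
      intro r h1 h2
      simp only [hu]
      split_ifs with h3
      · rfl
      · rcases Nat.lt_or_eq_of_le h1 with h1 | rfl
        · obtain rfl : r = j := by omega
          exact fj.symm
        · simp [f0]
    have u_out : ∀ r, ¬ (i < r ∧ r < j) → u r = v r := fun r h => if_neg h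
    have u0 : u 0 = v 0 := u_out 0 (by omega)
    have hcyc := Cyc.of_fun (Y := Y) hl (u := u) (fun r hr => by
        by_cases hm : i ≤ r ∧ r < j
        · rw [u_in r hm.1 hm.2.le, u_in (r + 1) (by omega) (by omega),
            show r + 1 - i = r - i + 1 by omega]
          exact (fE (r - i) (by omega)).1
        · rw [u_out r (by omega), u_out (r + 1) (by omega)]
          exact h.adj r) (by rw [u_out l (by omega), u0, hl0]) (by
        -- A new vertex differs from an old one because the old ones outside of the separator avoid
        -- `b'`. Two new vertices differ because their colours do.
        have mid : ∀ r < l, ∀ r' < l, i < r ∧ r < j → ¬ (i < r' ∧ r' < j) → u r ≠ u r' := by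
          intro r hr r' hr' hm hm' e
          rw [u_in r hm.1.le hm.2.le, u_out r' hm'] at e
          have h1 := fB (r - i) (by omega) (by omega)
          have h2 := (fc (r - i) (by omega) (by omega)).1
          rw [e] at h1 h2
          exact hfree r' hr' h2 h1
        intro r hr r' hr' e
        by_cases hm : i < r ∧ r < j <;> by_cases hm' : i < r' ∧ r' < j
        · rw [u_in r hm.1.le hm.2.le, u_in r' hm'.1.le hm'.2.le] at e
          have h1 := (fc (r - i) (by omega) (by omega)).2
          have h2 := (fc (r' - i) (by omega) (by omega)).2
          rw [Nat.mod_eq_of_lt (by omega)] at h1 h2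
          rw [e] at h1
          omega
        · exact absurd e (mid r hr r' hr' hm hm')
        · exact absurd e.symm (mid r' hr' r hr hm' hm)
        · rw [u_out r hm, u_out r' hm'] at e
          exact h.inj r hr r' hr' e)
    refine ih _ hcyc (by simpa [u0] using h0) ?_
    have hlt : Set.ncard {r | r < l ∧ ¬ Y.Good K (u (r % l))} <
        Set.ncard {r | r < l ∧ ¬ Y.Good K (v r)} := by
      refine Set.ncard_lt_ncard ?_ ((Set.finite_Iio l).subset fun _ h => h.1)
      have hmid : ∀ r, i < r ∧ r < j → Y.Good K (u r) := by
        intro r hm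
        rw [u_in r hm.1.le hm.2.le]
        have h1 := fB (r - i) (by omega) (by omega)
        exact ⟨Y.lt (fE (r - i) (by omega)).1, fun _ => ⟨b', hb'm, h1.1, h1.2, hKb'⟩⟩
      refine ⟨fun r hr => ?_, fun hsub => ?_⟩
      · obtain ⟨h1, h2⟩ := hr
        rw [Nat.mod_eq_of_lt h1] at h2
        by_cases hm : i < r ∧ r < j
        · exact absurd (hmid r hm) h2
        · rw [u_out r hm] at h2
          exact ⟨h1, h2⟩
      · have := (hsub ⟨hcl, hc⟩).2
        rw [Nat.mod_eq_of_lt hcl] at this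
        exact this (hmid c ⟨hic, hcj⟩)
    omega

/-- A cycle that avoids the separator lies in one block, where some colouring by local numbers
reveals it, contrary to `hno`. Any other cycle is rotated to start in the separator and then moved
by exchanges. -/
theorem Cyc.exists_good (h : Y.Cyc l v) (hl : 0 < l) {U Z : ℕ} {C : ℕ → ℕ → ℕ}
    (hC : Rich l U Z C) (hN : N ≤ U) {K : ℕ → Prop}
    (hno : ∀ z < Z, ∀ b < Y.m, ∀ p, Y.s ≤ p →
      ¬ Y.Ext l (fun p => C z (Y.loc p)) b 0 (l - 1) p p)
    (hK : ∀ b < Y.m, ∀ z < Z, Y.Kept l (fun p => C z (Y.loc p)) b → K b) :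
    ∃ v', Y.Cyc l v' ∧ ∀ i, Y.Good K (v' i) := by
  by_cases hs : ∀ i < l, Y.s ≤ v i
  · obtain ⟨b, hb, hin, hext⟩ := h.ext_inside hl hs
    obtain ⟨z, hz, hz'⟩ := hC (Finset.range l) (fun k => Y.loc (v k))
      (fun k hk => Finset.mem_range.1 hk)
      (fun k _ => ((vert_loc hb (hin k)).1.trans_le (sz_le hb)).trans_le hN)
      (fun k hk k' hk' e => by
        have h1 := (vert_loc hb (hin k)).2
        simp only at e
        rw [e, (vert_loc hb (hin k')).2] at h1
        exact h.inj k (by simpa using hk) k' (by simpa using hk') h1.symm)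
    exact absurd (hext (fun p => C z (Y.loc p)) fun i hi => hz' i (Finset.mem_range.2 hi))
      (hno z hz b hb _ (hs 0 hl))
  · push Not at hs
    obtain ⟨i, -, hi⟩ := hs
    exact Cyc.exists_good_of_sep hl hC hN hK _ _ (h.rotate hl i) (by simpa using hi) le_rfl

/-- A cycle in the kept blocks is found. -/
theorem Cyc.exists_colour (h : Y.Cyc l v) (hl : 0 < l) {U Z : ℕ} {C : ℕ → ℕ → ℕ}
    (hC : Rich l U Z C) {K : ℕ → Prop} (hv : ∀ i, Y.Good K (v i)) {id : ℕ → ℕ}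
    (hid : ∀ p, Y.Good K p → id p < U) (hinj : ∀ p q, Y.Good K p → Y.Good K q → id p = id q → p = q) :
    ∃ z < Z, (∃ b < Y.m, ∃ p, Y.s ≤ p ∧ Y.Ext l (fun p => C z (id p)) b 0 (l - 1) p p) ∨
      ∃ x, Y.SW l (fun p => C z (id p)) x l x := by
  have key : ∀ v, Y.Cyc l v → (∀ i, Y.Good K (v i)) → ∃ z < Z, ∀ i < l, C z (id (v i)) = i := by
    intro v h hv
    obtain ⟨z, hz, hz'⟩ := hC (Finset.range l) (fun k => id (v k))
      (fun k hk => Finset.mem_range.1 hk) (fun k _ => hid _ (hv k))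
      (fun k hk k' hk' e => h.inj k (by simpa using hk) k' (by simpa using hk')
        (hinj _ _ (hv k) (hv k') e))
    exact ⟨z, hz, fun i hi => hz' i (Finset.mem_range.2 hi)⟩
  by_cases hs : ∀ i < l, Y.s ≤ v i
  · obtain ⟨b, hb, -, hext⟩ := h.ext_inside hl hs
    obtain ⟨z, hz, hz'⟩ := key v h hv
    exact ⟨z, hz, .inl ⟨b, hb, _, hs 0 hl, hext _ hz'⟩⟩
  · push Not at hs
    obtain ⟨i, -, hi⟩ := hs
    have h' := h.rotate hl i
    obtain ⟨z, hz, hz'⟩ := key _ h' fun k => hv _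
    exact ⟨z, hz, .inr ⟨_, h'.sW hl (by simpa using hi) hz'⟩⟩

end Layout

/-! ### Hashing -/

/-- The value at `a` of the polynomial whose coefficients are the first `d` digits of `x` in
base `b`. -/
def hashF (b : ℕ) : ℕ → ℕ → ℕ → ℕ
  | 0, _, _ => 0
  | d + 1, a, x => x % b + a * hashF b d a (x / b)

/-- The position of the first digit of `y` in base `R` that equals `h`, among `d` digits. -/
def colF (R : ℕ) : ℕ → ℕ → ℕ → ℕ
  | 0, _, _ => 0
  | d + 1, y, h => if y % R = h then 0 else 1 + colF R d (y / R) h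

/-- The colour of `x` for the number `z` of a colouring. -/
def colour (l A b R Dg z x : ℕ) : ℕ := colF R l (z / A) (hashF b Dg (z % A) x)

theorem hashF_lt {b d a x : ℕ} (hb : 0 < b) : hashF b d a x < b * (a + 1) ^ d := by
  induction d generalizing x with
  | zero => simpa [hashF] using hb
  | succ d ih =>
    have h1 := ih (x := x / b)
    have h2 := Nat.mod_lt x hb
    have h3 : 1 ≤ (a + 1) ^ d := Nat.one_le_pow _ _ (by omega)
    have h4 : a * hashF b d a (x / b) ≤ a * (b * (a + 1) ^ d) := Nat.mul_le_mul_left _ h1.le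
    have h5 : b ≤ b * (a + 1) ^ d := Nat.le_mul_of_pos_right _ h3
    have h6 : b * (a + 1) ^ (d + 1) = a * (b * (a + 1) ^ d) + b * (a + 1) ^ d := by ring
    rw [hashF, h6]
    omega

theorem colF_le {R d y h : ℕ} : colF R d y h ≤ d := by
  induction d generalizing y with
  | zero => simp [colF]
  | succ d ih =>
    rw [colF]
    have := ih (y := y / R)
    split_ifs <;> omega

open Polynomial in
/-- The polynomial of the first `d` digits. -/
noncomputable def digitPoly (b : ℕ) : ℕ → ℕ → ℤ[X]
  | 0, _ => 0
  | d + 1, x => C ((x % b : ℕ) : ℤ) + X * digitPoly b d (x / b)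

theorem eval_digitPoly {b d a x : ℕ} : (digitPoly b d x).eval (a : ℤ) = hashF b d a x := by
  induction d generalizing x with
  | zero => simp [digitPoly, hashF]
  | succ d ih => simp [digitPoly, hashF, ih]

theorem natDegree_digitPoly_le {b d x : ℕ} : (digitPoly b d x).natDegree ≤ d := by
  induction d generalizing x with
  | zero => simp [digitPoly]
  | succ d ih =>
    rw [digitPoly]
    refine (Polynomial.natDegree_add_le _ _).trans (max_le (by simp) ?_)
    exact (Polynomial.natDegree_mul_le).trans (by
      have := ih (x := x / b)
      have := Polynomial.natDegree_X_le (R := ℤ)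
      omega)

/-- Digits are coefficients, and a number below `b ^ d` is determined by `d` digits. -/
theorem digitPoly_inj {b d x y : ℕ} (hx : x < b ^ d) (hy : y < b ^ d)
    (h : digitPoly b d x = digitPoly b d y) : x = y := by
  induction d generalizing x y with
  | zero => simp at hx hy; omega
  | succ d ih =>
    have h0 := congrArg (Polynomial.coeff · 0) h
    simp only [digitPoly, Polynomial.coeff_add, Polynomial.coeff_C_zero,
      Polynomial.mul_coeff_zero, Polynomial.coeff_X_zero, zero_mul, add_zero, Nat.cast_inj] at h0
    simp only [digitPoly, h0, add_right_inj] at h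
    have h1 := mul_left_cancel₀ Polynomial.X_ne_zero h
    have h2 := ih (Nat.div_lt_of_lt_mul (by rwa [pow_succ'] at hx))
      (Nat.div_lt_of_lt_mul (by rwa [pow_succ'] at hy)) h1
    rw [← Nat.mod_add_div x b, ← Nat.mod_add_div y b, h0, h2]

/-- Two different numbers have the same hash value for few parameters only. -/
theorem card_hashF_eq_le {b d x y : ℕ} (hx : x < b ^ d) (hy : y < b ^ d) (h : x ≠ y) (A : ℕ) :
    ((Finset.range A).filter fun a => hashF b d a x = hashF b d a y).card ≤ d := by
  classical
  -- Every parameter that identifies `x` and `y` is a root of this nonzero polynomial. The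
  -- evaluation is over the integers, without reduction, so no prime modulus has to be found.
  set P := digitPoly b d x - digitPoly b d y with hP
  have hP0 : P ≠ 0 := sub_ne_zero.2 fun e => h (digitPoly_inj hx hy e)
  have hdeg : P.natDegree ≤ d := (Polynomial.natDegree_sub_le _ _).trans
    (max_le natDegree_digitPoly_le natDegree_digitPoly_le)
  refine le_trans ?_ (le_trans (Multiset.toFinset_card_le P.roots)
    ((Polynomial.card_roots' P).trans hdeg))
  refine Finset.card_le_card_of_injOn (fun a => (a : ℤ)) (fun a ha => ?_)
    (fun a _ a' _ e => Nat.cast_injective (R := ℤ) e)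
  have ha : hashF b d a x = hashF b d a y := by simpa using (Finset.mem_filter.1 ha).2
  rw [Finset.mem_coe, Multiset.mem_toFinset, Polynomial.mem_roots hP0, Polynomial.IsRoot, hP,
    Polynomial.eval_sub, eval_digitPoly, eval_digitPoly, ha, sub_self]

/-- Union bound: at most `l * l` pairs, and each spoils at most `d` of the `A` parameters. -/
theorem exists_hashF_injOn {l b d A : ℕ} (hA : d * (l * l) < A) (I : Finset ℕ) (x : ℕ → ℕ)
    (hI : ∀ i ∈ I, i < l) (hx : ∀ i ∈ I, x i < b ^ d) (hinj : Set.InjOn x I) :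
    ∃ a < A, Set.InjOn (fun i => hashF b d a (x i)) I := by
  classical
  have hIl : I.card ≤ l := by
    simpa using Finset.card_le_card (show I ⊆ Finset.range l from fun i hi => Finset.mem_range.2 (hI i hi))
  by_contra! hno
  have hsub : Finset.range A ⊆ I.offDiag.biUnion fun p =>
      (Finset.range A).filter fun a => hashF b d a (x p.1) = hashF b d a (x p.2) := by
    intro a ha
    have h1 := hno a (Finset.mem_range.1 ha)
    simp only [Set.InjOn, Finset.mem_coe] at h1
    push Not at h1
    obtain ⟨i, hi, j, hj, e, hij⟩ := h1
    rw [Finset.mem_biUnion]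
    exact ⟨(i, j), Finset.mem_offDiag.2 ⟨hi, hj, hij⟩, Finset.mem_filter.2 ⟨ha, e⟩⟩
  have h2 := Finset.card_le_card hsub
  rw [Finset.card_range] at h2
  have h3 := h2.trans (Finset.card_biUnion_le_card_mul _ _ d fun p hp => by
    obtain ⟨h4, h5, h6⟩ := Finset.mem_offDiag.1 hp
    exact card_hashF_eq_le (hx _ h4) (hx _ h5) (fun e => h6 (hinj h4 h5 e)) A)
  have h4 : I.offDiag.card ≤ l * l := by
    rw [Finset.offDiag_card]
    exact (Nat.sub_le _ _).trans (Nat.mul_le_mul hIl hIl)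
  have h5 := Nat.mul_le_mul_right d h4
  nlinarith

/-- The digits of `y` are `g 0, g 1, …`; the colour of a value is the place of its first occurrence.
-/
theorem exists_digits {R : ℕ} (l : ℕ) (g : ℕ → ℕ) (hg : ∀ i, g i < R) : ∃ y < R ^ l,
    ∀ i < l, (∀ i' < i, g i' ≠ g i) → colF R l y (g i) = i := by
  induction l generalizing g with
  | zero => exact ⟨0, by simp, by simp⟩
  | succ l ih =>
    obtain ⟨y, hy, h⟩ := ih (fun i => g (i + 1)) fun i => hg _
    have h0 := hg 0
    have e1 : (g 0 + R * y) % R = g 0 := by rw [Nat.add_mul_mod_self_left, Nat.mod_eq_of_lt h0]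
    have e2 : (g 0 + R * y) / R = y := by
      rw [Nat.add_mul_div_left _ _ (by omega), Nat.div_eq_of_lt h0, zero_add]
    refine ⟨g 0 + R * y, ?_, fun i hi hne => ?_⟩
    · rw [pow_succ']
      nlinarith
    · rw [colF, e1, e2]
      rcases i with - | i
      · simp
      · rw [if_neg (hne 0 (by omega)), h i (by omega) fun i' hi' => hne (i' + 1) (by omega)]
        omega

/-- The number of a colouring encodes a hash parameter `a`, which makes the hash values distinct,
and a number `y` whose digit `i` is the hash value that gets colour `i`. -/
theorem rich_colour {l b d A R : ℕ} (hb : 0 < b) (hA : d * (l * l) < A) (hR : b * A ^ d < R) :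
    Layout.Rich l (b ^ d) (A * R ^ l) (colour l A b R d) := by
  classical
  intro I x hI hx hinj
  obtain ⟨a, ha, hainj⟩ := exists_hashF_injOn hA I x hI hx hinj
  have hlt : ∀ y, hashF b d a y < b * A ^ d := fun y => (hashF_lt hb).trans_le (by
    gcongr; omega)
  -- Colours outside of `I` get the dummy digit `b * A ^ d`, which is no hash value. This is why `R`
  -- has to exceed it.
  obtain ⟨y, hy, hcol⟩ := exists_digits (R := R) l
    (fun i => if i ∈ I then hashF b d a (x i) else b * A ^ d) (fun i => by
      have := hlt (x i)
      split_ifs <;> omega)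
  refine ⟨y * A + a, ?_, fun i hi => ?_⟩
  · nlinarith
  · have h1 : (y * A + a) / A = y := by
      rw [mul_comm, Nat.mul_add_div (by omega), Nat.div_eq_of_lt ha, add_zero]
    have h2 : (y * A + a) % A = a := by
      rw [mul_comm, Nat.mul_add_mod, Nat.mod_eq_of_lt ha]
    rw [colour, h1, h2]
    have := hcol i (hI i hi) fun i' hi' => by
      rw [if_pos hi]
      split_ifs with h3
      · exact fun e => by have := hainj h3 hi e; omega
      · exact (hlt _).ne'
    rwa [if_pos hi] at this

/-! ### The search -/

/-- The hash value of the number in register `33` for the parameter in register `35`. -/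
def hashE : ℕ → Expr → Expr
  | 0, _ => const 0
  | d + 1, x => x % reg 9 + reg 35 * hashE d (x / reg 9)

/-- The colour for the hash value in register `34`. -/
def colE : ℕ → Expr → Expr
  | 0, _ => const 0
  | d + 1, y => (const 1 - (y % reg 10).same (reg 34)) * (const 1 + colE d (y / reg 10))

theorem hashE_spec {w d a b x : ℕ} {s : State} {e : Expr} (hw : w ≠ 0) (hb : 0 < b)
    (h9 : s.reg 9 = b) (h35 : s.reg 35 = a)
    (he : e.safe w s) (hx : e.val s = x) (hlt : b * (a + 1) ^ d < 2 ^ w) :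
    (hashE d e).safe w s ∧ (hashE d e).val s = hashF b d a x := by
  induction d generalizing e x with
  | zero => exact ⟨by simp [hashE], rfl⟩
  | succ d ih =>
    have h1 := hashF_lt (b := b) (d := d + 1) (a := a) (x := x) hb
    have h6 : b * (a + 1) ^ (d + 1) = a * (b * (a + 1) ^ d) + b * (a + 1) ^ d := by ring
    obtain ⟨h2, h3⟩ := ih (e := e / reg 9) (x := x / b) (by simpa using he)
      (by simp [hx, h9]) (by omega)
    rw [hashF] at h1
    refine ⟨?_, ?_⟩
    · simp only [hashE, safe_add, safe_mod, safe_mul, safe_reg, val_mod, val_mul, val_reg, he, h2,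
        h3, hx, h9, h35, true_and]
      omega
    · simp only [hashE, val_add, val_mod, val_mul, val_reg, h3, hx, h9, h35, hashF]

theorem colE_spec {w d R h y : ℕ} {s : State} {e : Expr} (hw : w ≠ 0) (hlw : d + 1 < 2 ^ w)
    (h10 : s.reg 10 = R) (h34 : s.reg 34 = h) (he : e.safe w s) (hy : e.val s = y) :
    (colE d e).safe w s ∧ (colE d e).val s = colF R d y h := by
  induction d generalizing e y with
  | zero => exact ⟨by simp [colE], rfl⟩
  | succ d ih =>
    obtain ⟨h2, h3⟩ := ih (e := e / reg 10) (y := y / R) (by omega) (by simpa using he)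
      (by simp [hy, h10])
    have hle := colF_le (R := R) (d := d) (y := y / R) (h := h)
    refine ⟨?_, ?_⟩
    · simp only [colE, safe_mul, safe_sub, safe_const, safe_same, safe_mod, safe_reg, safe_add,
        val_sub, val_const, val_same, val_mod, val_reg, val_add, he, h2, h3, hy, h10, h34, true_and,
        and_true, one_sub_ite]
      refine ⟨by omega, by omega, ?_⟩
      split_ifs <;> omega
    · simp only [colE, val_mul, val_sub, val_const, val_same, val_mod, val_reg, val_add, h3, hy,
        h10, h34, one_sub_ite, colF]
      split_ifs <;> simp


/-! ### The number of kept blocks. -/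

namespace Layout
variable {N : ℕ} {Y : Layout N} {l : ℕ} {col col' : ℕ → ℕ} {b i j x y p q : ℕ}

theorem LR.lt (h : Y.LR l col p j q) : q < Y.n := by
  cases h with
  | zero h => exact h
  | step _ h => exact Y.lt' h

theorem LR.congr (h : Y.LR l col p j q) (hc : ∀ p < Y.n, col p = col' p) : Y.LR l col' p j q := by
  induction h with
  | zero h1 h2 => exact .zero h1 (by rw [← hc _ h1]; exact h2)
  | step h1 h2 h3 ih => exact .step ih h2 (by rw [← hc _ (Y.lt' h2)]; exact h3)

theorem count_lt_count {b' : ℕ} (hb : b < b') (h : Y.Ext l col b i (j - i - 1) x y) :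
    Y.count l col b i j x y < Y.count l col b' i j x y := by
  classical
  refine Finset.card_lt_card ⟨Finset.filter_subset_filter _ (Finset.range_mono hb.le), fun hsub => ?_⟩
  have := hsub (Finset.mem_filter.2 ⟨Finset.mem_range.2 hb, h⟩)
  simp at this

/-- For fixed `i`, `j`, `x`, `y` the counter increases strictly along the blocks that contain such a
segment, so those with a value below `l` inject into `range l`. The bound does not involve the
number of blocks. -/
theorem card_kept_le {m : ℕ} [DecidablePred (Y.Kept l col)] :
    ((Finset.range m).filter (Y.Kept l col)).card ≤ (l + 1) * (l + 1) * (Y.s * Y.s) * l := by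
  classical
  set I := (Finset.range (l + 1) ×ˢ Finset.range (l + 1)) ×ˢ (Finset.range Y.s ×ˢ Finset.range Y.s)
    with hI
  have hsub : (Finset.range m).filter (Y.Kept l col) ⊆ I.biUnion fun k =>
      (Finset.range m).filter fun b => Y.Ext l col b k.1.1 (k.1.2 - k.1.1 - 1) k.2.1 k.2.2 ∧
        Y.count l col b k.1.1 k.1.2 k.2.1 k.2.2 < l := by
    intro b hb
    obtain ⟨h1, i, j, x, y, h2, h3, h4, h5, h6⟩ := Finset.mem_filter.1 hb
    rw [Finset.mem_biUnion]
    refine ⟨((i, j), (x, y)), ?_, Finset.mem_filter.2 ⟨h1, h6⟩⟩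
    simp [hI]
    omega
  refine (Finset.card_le_card hsub).trans ((Finset.card_biUnion_le_card_mul _ _ l ?_).trans ?_)
  · rintro ⟨⟨i, j⟩, x, y⟩ -
    refine le_of_le_of_eq ?_ (Finset.card_range l)
    refine Finset.card_le_card_of_injOn (fun b => Y.count l col b i j x y) (fun b hb => ?_) ?_
    · exact Finset.mem_coe.2 (Finset.mem_range.2 (Finset.mem_filter.1 hb).2.2)
    · intro b hb b' hb' e
      have h1 := (Finset.mem_filter.1 hb).2.1
      have h2 := (Finset.mem_filter.1 hb').2.1
      rcases lt_trichotomy b b' with h | h | h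
      · exact absurd e (count_lt_count h h1).ne
      · exact h
      · exact absurd e (count_lt_count h h2).ne'
  · simp [hI]

end Layout

/-- Counting loop with a summary of what the body writes. -/
theorem Runs.for_frame {w r m T : ℕ} {e : Expr} {p : Prog} {s : State} {Q : State → Prop}
    (R A : List ℕ) (I : ℕ → State → Prop) (hR : p.wr ⊆ R) (hA : p.wm ⊆ A) (hr : R.elem r = false)
    (he : ∀ s', Same (r :: R) A s s' → e.safe w s' ∧ e.val s' = m)
    (hI : ∀ i s x, I i s → I i (s.setReg r x)) (h0 : I 0 s)
    (hs : ∀ i s', i < m → s'.reg r = i → Same (r :: R) A s s' → I i s' →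
      Runs w p s' T (I (i + 1)))
    (hQ : ∀ s', Same (r :: R) A s s' → s'.reg r = m → I m s' → Q s') :
    Runs w (forTo r e p) s ((m + 1) * (T + (e.cost + 7))) Q := by
  have hmono : ∀ {s'}, Same (r :: p.wr) p.wm s s' → Same (r :: R) A s s' := fun h =>
    h.mono (List.cons_subset_cons r hR) hA
  refine Runs.for_const I ?_ (fun s' hS => he s' (hmono hS)) hI h0
    (fun i s' h1 h2 hS => hs i s' h1 h2 (hmono hS)) (fun s' hS => hQ s' (hmono hS))
  by_contra h
  rw [Bool.not_eq_false, List.elem_iff] at h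
  have := List.elem_iff.2 (hR h)
  rw [hr] at this
  exact absurd this (by simp)

/-- Used to replace the write set of a large program, by computation, with an interval, so that
later frames need not unfold it. -/
theorem subset_range' {L : List ℕ} {a d : ℕ} (h : L.all (fun r => Nat.ble a r && Nat.blt r (a + d)) = true) :
    L ⊆ List.range' a d := by
  intro r hr
  have := List.all_eq_true.1 h r hr
  simp only [Bool.and_eq_true, Nat.ble_eq, Nat.blt_eq] at this
  simp only [List.mem_range'_1]
  exact this

theorem tryColours_wr (a : MulAlg) (l : ℕ) : (tryColours a l).wr ⊆ List.range' 21 25 :=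
  subset_range' rfl

theorem tryColours_wm (a : MulAlg) (l : ℕ) : (tryColours a l).wm ⊆ List.range' 22 8 :=
  subset_range' rfl

/-- The state holds the parameters of the colourings, too. -/
structure SearchEnv (w : ℕ) (a : MulAlg) (l L : ℕ) (Y : Layout (a.n ^ L)) (A Dg b R Z : ℕ)
    (s : State) : Prop extends Env w a l L Y s where
  b_pos : 0 < b
  hA : Dg * (l * l) < A
  hR : b * A ^ Dg < R
  hZ : Z = A * R ^ l
  R_lt : R < 2 ^ w
  Z_lt : Z < 2 ^ w
  id_lt : (Y.m + 1) * a.n ^ L < 2 ^ w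
  ids : (Z * ((l + 1) * (l + 1) * (Y.s * Y.s) * l) + 1) * a.n ^ L ≤ b ^ Dg
  r9 : s.reg 9 = b
  r10 : s.reg 10 = R
  r11 : s.reg 11 = Z

section
variable {w l L : ℕ} {a : MulAlg} {Y : Layout (a.n ^ L)} {s : State} {A Dg b R Z : ℕ}

theorem SearchEnv.of_same {s' : State}
    (h : SearchEnv w a l L Y A Dg b R Z s) {R' A' : List ℕ} (hS : Same R' A' s s')
    (hR : R'.all (20 ≤ ·) = true) (hA : A'.all (20 ≤ ·) = true) :
    SearchEnv w a l L Y A Dg b R Z s' := by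
  have hr : ∀ r < 20, s'.reg r = s.reg r := fun r hr => hS.1 r (by
    by_contra h'
    simp only [List.all_eq_true, List.elem_eq_contains, Bool.not_eq_false, List.contains_iff_mem] at *
    have := hR r h'
    simp at this
    omega)
  exact
  { toEnv := h.toEnv.of_same hS hR hA
    b_pos := h.b_pos
    hA := h.hA
    hR := h.hR
    hZ := h.hZ
    R_lt := h.R_lt
    Z_lt := h.Z_lt
    id_lt := h.id_lt
    ids := h.ids
    r9 := by rw [hr 9 (by omega)]; exact h.r9
    r10 := by rw [hr 10 (by omega)]; exact h.r10
    r11 := by rw [hr 11 (by omega)]; exact h.r11 }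

theorem SearchEnv.A_le (h : SearchEnv w a l L Y A Dg b R Z s) : A < 2 ^ w := by
  have h1 := h.Z_lt
  have h2 := h.hR
  rw [h.hZ] at h1
  exact (Nat.le_mul_of_pos_right A (Nat.pow_pos (by omega))).trans_lt h1

theorem SearchEnv.rich (h : SearchEnv w a l L Y A Dg b R Z s) :
    Layout.Rich l (b ^ Dg) Z (colour l A b R Dg) := by
  rw [h.hZ]; exact rich_colour h.b_pos h.hA h.hR

/-- Computes the colours for the number in register `20`. -/
def setColours (l A Dg : ℕ) : Prog :=
  assign 35 (reg 20 % const A) ;;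
  forTo 31 (reg 0) (assign 34 (hashE Dg (load 20 (reg 31))) ;;
    store 21 (reg 31) (colE l (reg 20 / const A)))

theorem setColours_runs (h : SearchEnv w a l L Y A Dg b R Z s) {z : ℕ} (hz : s.reg 20 = z)
    {id : ℕ → ℕ} (hid : ∀ p < Y.n, s.mem 20 p = id p) :
    Runs w (setColours l A Dg) s (4 + (Y.n + 1) * (Prog.time (assign 34 (hashE Dg (load 20 (reg 31))) ;;
        store 21 (reg 31) (colE l (reg 20 / const A))) + 8))
      fun s' => ∀ p < Y.n, s'.mem 21 p = colour l A b R Dg z (id p) := by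
  have hA := h.A_le
  have hA0 : 0 < A := by have := h.hA; omega
  have hlw := h.const_lt.1
  refine Runs.wp_seq (p := assign 35 (reg 20 % const A)) ⟨by simpa using hA, ?_⟩
  set s1 := s.setReg 35 ((reg 20 % const A).val s) with hs1
  have hS1 : Same [35] [] s s1 := by
    refine ⟨fun r hr => ?_, fun _ _ => rfl⟩
    have : r ≠ 35 := by rintro rfl; simp at hr
    simp [hs1, this]
  have h35 : s1.reg 35 = z % A := by simp [hs1, hz]
  have E1 := h.of_same hS1 rfl rfl
  change Runs w _ s1 _ _
  refine Runs.mono (Runs.fill (A := 21) (m := Y.n) (T := Prog.time (assign 34 (hashE Dg (load 20 (reg 31))) ;;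
      store 21 (reg 31) (colE l (reg 20 / const A)))) (f := fun p => colour l A b R Dg z (id p)) rfl
    (fun s' hS => ⟨trivial, (hS.1 0 rfl).trans E1.r0⟩) ?_) ?_ (fun _ _ h => h.1)
  · intro p s2 hp h31 hS2 _
    have E2 := E1.of_same hS2 rfl rfl
    have f35 := (hS2.1 35 rfl).trans h35
    have f20 : s2.reg 20 = z := ((hS2.1 20 rfl).trans (hS1.1 20 rfl)).trans hz
    have fid : s2.mem 20 p = id p := by rw [hS2.2 20 rfl]; exact hid p hp
    -- The hash parameter is below `A`, so hash values are below `R` and fit into words.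
    have hle : b * (z % A + 1) ^ Dg < 2 ^ w := by
      refine lt_of_le_of_lt ?_ (h.hR.trans h.R_lt)
      gcongr
      exact Nat.mod_lt z hA0
    obtain ⟨g1, g2⟩ := hashE_spec (e := load 20 (reg 31)) (x := id p) (d := Dg) E2.w_ne E2.b_pos E2.r9 f35
      trivial (by simp [h31, fid]) hle
    refine Runs.straight ⟨g1, ?_⟩
    rw [g2]
    obtain ⟨k1, k2⟩ := colE_spec (w := w) (s := s2.setReg 34 (hashF b Dg (z % A) (id p))) (d := l) (R := R)
      (h := hashF b Dg (z % A) (id p)) (e := reg 20 / const A) (y := z / A) E2.w_ne hlw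
      (by simp [E2.r10]) (by simp) (by simpa using hA) (by simp [f20])
    refine ⟨trivial, k1, ?_, ?_⟩
    · rw [k2]
      simp [h31, colour]
    · intro q hq
      simp [h31, hq]
  · simp

/-- Searches for cycles with the colouring with the number in register `20`. -/
def passStep (a : MulAlg) (l A Dg : ℕ) : Prog :=
  Prog.ite ((reg 21).same (const 0)) (setColours l A Dg ;; tryColours a l) skip

/-- Searches for cycles with all colourings. -/
def pass (a : MulAlg) (l A Dg : ℕ) : Prog := forTo 20 (reg 11) (passStep a l A Dg)

theorem passStep_wr (a : MulAlg) (l A Dg : ℕ) : (passStep a l A Dg).wr ⊆ List.range' 21 25 := by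
  have h1 := tryColours_wr a l
  simp only [passStep, Prog.wr, List.append_subset, List.nil_subset, and_true]
  exact ⟨subset_range' rfl, h1⟩

theorem passStep_wm (a : MulAlg) (l A Dg : ℕ) : (passStep a l A Dg).wm ⊆ List.range' 21 9 := by
  have h1 := tryColours_wm a l
  simp only [passStep, Prog.wm, List.append_subset, List.nil_subset, and_true]
  exact ⟨subset_range' rfl, fun r hr => by have := h1 hr; simp only [List.mem_range'_1] at this ⊢; omega⟩

theorem pass_wr (a : MulAlg) (l A Dg : ℕ) : (pass a l A Dg).wr ⊆ List.range' 20 26 := by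
  have h1 := passStep_wr a l A Dg
  simp only [pass, forTo, Prog.wr, List.append_subset]
  exact ⟨subset_range' rfl, fun r hr => by have := h1 hr; simp only [List.mem_range'_1] at this ⊢; omega,
    subset_range' rfl⟩

theorem pass_wm (a : MulAlg) (l A Dg : ℕ) : (pass a l A Dg).wm ⊆ List.range' 21 9 := by
  simpa only [pass, forTo, Prog.wm, List.append_nil, List.nil_append] using passStep_wm a l A Dg

/-- The result of a pass for the numbers below `z`. -/
structure Passed {N : ℕ} (l : ℕ) (Y : Layout N) (C : ℕ → ℕ → ℕ) (z : ℕ) (s s' : State) : Prop where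
  sound : s'.reg 21 = 0 ∨ s'.reg 21 = 1 ∧ Y.LR l (s'.mem 21) (s'.reg 22) l (s'.reg 22)
  inside : s'.reg 21 = 0 → ∀ z' < z, ∀ b < Y.m, ∀ p, Y.s ≤ p → ¬ Y.Ext l (C z') b 0 (l - 1) p p
  through : s'.reg 21 = 0 → ∀ z' < z, ∀ x, ¬ Y.SW l (C z') x l x
  keep : s'.reg 21 = 0 → ∀ b, s'.mem 22 b ≠ 0 ↔ s.mem 22 b ≠ 0 ∨ b < Y.m ∧ ∃ z' < z, Y.Kept l (C z') b

/-- The numbering `id` is arbitrary: local numbers in the first pass, numbers of kept vertices in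
the second. After a success the remaining colourings are skipped, so that array `21` still holds the
colouring that revealed the cycle. -/
theorem exists_pass_runs (a : MulAlg) {l : ℕ} (hl : 0 < l) (A Dg : ℕ) : ∃ K, ∀ {w L : ℕ}
    {Y : Layout (a.n ^ L)} {s : State} {b R Z : ℕ} {id : ℕ → ℕ}, SearchEnv w a l L Y A Dg b R Z s →
    s.reg 21 = 0 → (∀ p < Y.n, s.mem 20 p = id p) →
    Runs w (pass a l A Dg) s (K * ((Z + 1) * (Y.m * a.unit L + (Y.s + 1) * (Y.n + 1))))
      (Passed l Y (fun z p => colour l A b R Dg z (id p)) Z s) := by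
  obtain ⟨K, hK⟩ := exists_tryColours_runs a hl
  obtain ⟨X, hX⟩ : ∃ X, X = Prog.time (assign 34 (hashE Dg (load 20 (reg 31))) ;;
        store 21 (reg 31) (colE l (reg 20 / const A))) + 8 := ⟨_, rfl⟩
  refine ⟨K + X + 30, ?_⟩
  intro w L Y s b R Z id h h21 hid
  set C : ℕ → ℕ → ℕ := fun z p => colour l A b R Dg z (id p) with hC
  set V := Y.m * a.unit L + (Y.s + 1) * (Y.n + 1) with hV
  apply Runs.time_le
  · refine Runs.for_frame (List.range' 21 25) (List.range' 21 9) (m := Z)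
      (T := 4 + (4 + (Y.n + 1) * X + K * V))
      (I := fun z s' => Passed l Y C z s s')
      (passStep_wr a l A Dg) (passStep_wm a l A Dg) rfl
      (fun s' hS => ⟨trivial, (hS.1 11 rfl).trans h.r11⟩)
      (fun z s' x h => ⟨by simpa using h.sound, by simpa using h.inside, by simpa using h.through,
        by simpa using h.keep⟩) ⟨.inl h21, by simp, by simp, by simp⟩ ?_ (fun _ _ _ h => h)
    intro z s1 hz h20 hS1 hP
    have E1 := h.of_same hS1 rfl rfl
    have hid1 : ∀ p < Y.n, s1.mem 20 p = id p := by rw [hS1.2 20 rfl]; exact hid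
    refine Runs.ite (by simp) (fun hc => ?_) (fun hc => ?_)
    · have hc : s1.reg 21 = 0 := by by_contra h'; simp [h'] at hc
      apply Runs.seq
      · rw [hX]; exact setColours_runs E1 h20 hid1
      intro s2 hS2 hcol
      have E2 := E1.of_same hS2 rfl rfl
      have f21 : s2.reg 21 = 0 := (hS2.1 21 rfl).trans hc
      refine (hK E2.toEnv (col := C z) hcol).mono le_rfl ?_
      intro s3 hS3 hT
      have m21 : s3.mem 21 = s2.mem 21 :=
        (hS3.mono (tryColours_wr a l) (tryColours_wm a l)).2 21 rfl
      refine ⟨?_, ?_, ?_, ?_⟩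
      · rcases hT.sound with ⟨h1, -⟩ | ⟨h1, h2⟩
        · exact .inl (h1.trans f21)
        · exact .inr ⟨h1, h2.congr fun p hp => by rw [m21, hcol p hp]⟩
      · intro h0 z' hz' b' hb' p hp hE
        rcases Nat.lt_succ_iff_lt_or_eq.1 hz' with h1 | rfl
        · exact hP.inside hc z' h1 b' hb' p hp hE
        · have := hT.inside b' hb' p hp hE; omega
      · intro h0 z' hz' x hE
        rcases Nat.lt_succ_iff_lt_or_eq.1 hz' with h1 | rfl
        · exact hP.through hc z' h1 x hE
        · have := hT.through x hE; omega
      · intro h0 b'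
        rw [hT.keep, hS2.2 22 rfl, hP.keep hc, or_assoc, ← and_or_left]
        refine or_congr Iff.rfl (and_congr_right fun hb' => ?_)
        constructor
        · rintro (⟨z', h1, h2⟩ | h2)
          · exact ⟨z', by omega, h2⟩
          · exact ⟨z, by omega, h2⟩
        · rintro ⟨z', h1, h2⟩
          rcases Nat.lt_succ_iff_lt_or_eq.1 h1 with h1 | rfl
          · exact .inl ⟨z', h1, h2⟩
          · exact .inr h2
    · have hc : s1.reg 21 ≠ 0 := by intro h'; simp [h'] at hc
      refine (Runs.straight (p := skip) ?_).time_le (by simp [Prog.time]; omega)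
      exact ⟨hP.sound, fun h => absurd h hc, fun h => absurd h hc, fun h => absurd h hc⟩
  · have h1 : (Y.n + 1) ≤ V := by
      rw [hV]; nlinarith [Nat.zero_le (Y.m * a.unit L), Nat.zero_le (Y.s * (Y.n + 1))]
    have h2 : (Y.n + 1) * X ≤ V * X := Nat.mul_le_mul_right _ h1
    simp only [cost_reg]
    calc _ ≤ (Z + 1) * ((K + X + 30) * V) := by gcongr; nlinarith
      _ = _ := by ring

end

/-! ### Numbering the vertices of the kept blocks. -/

namespace Layout
variable {N : ℕ} {Y : Layout N} {l : ℕ} {p : ℕ}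

theorem loc_lt (hp : p < Y.n) : Y.loc p < N := by
  obtain ⟨b, hb, h1, h2⟩ := exists_block hp
  exact (vert_loc hb (.inr ⟨h1, h2⟩)).1.trans_le (sz_le hb)

theorem size_le {b : ℕ} (hb : b < Y.m) : Y.bs (b + 1) - Y.bs b ≤ N := by
  rcases Nat.eq_zero_or_pos b with rfl | h
  · rw [zero_add, Y.bs_one]; have := Y.s_le; omega
  · have := Y.size b h hb; omega

theorem count_kept_le {C : ℕ → ℕ → ℕ} {Z b : ℕ} {K : ℕ → Prop} [DecidablePred K] (hb : b ≤ Y.m)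
    (hK : ∀ b < Y.m, K b → ∃ z < Z, Y.Kept l (C z) b) :
    Nat.count K b ≤ Z * ((l + 1) * (l + 1) * (Y.s * Y.s) * l) := by
  classical
  rw [Nat.count_eq_card_filter_range]
  have hsub : (Finset.range b).filter K ⊆
      (Finset.range Z).biUnion fun z => (Finset.range Y.m).filter (Y.Kept l (C z)) := by
    intro b' hb'
    obtain ⟨h1, h2⟩ := Finset.mem_filter.1 hb'
    rw [Finset.mem_range] at h1
    obtain ⟨z, hz, h3⟩ := hK b' (by omega) h2
    exact Finset.mem_biUnion.2 ⟨z, Finset.mem_range.2 hz,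
      Finset.mem_filter.2 ⟨Finset.mem_range.2 (by omega), h3⟩⟩
  refine (Finset.card_le_card hsub).trans ((Finset.card_biUnion_le_card_mul _ _ _ fun z _ =>
    card_kept_le).trans ?_)
  simp

/-- The numbers of the second pass distinguish all vertices of kept blocks. -/
theorem good_ids {K : ℕ → Prop} [DecidablePred K] {id : ℕ → ℕ}
    (hid : ∀ b < Y.m, ∀ p, Y.bs b ≤ p → p < Y.bs (b + 1) → id p = Y.loc p + Nat.count K b * N)
    {U M : ℕ} (hM : ∀ b < Y.m, Nat.count K b ≤ M) (hU : (M + 1) * N ≤ U) :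
    (∀ p, Y.Good K p → id p < U) ∧
      ∀ p q, Y.Good K p → Y.Good K q → id p = id q → p = q := by
  have hm := Y.two_le
  have key : ∀ p, Y.Good K p → ∃ b < Y.m, (p < Y.s ∧ b = 0 ∨ Y.s ≤ p ∧ K b ∧ Y.bs b ≤ p ∧
      p < Y.bs (b + 1)) ∧ id p = Y.loc p + Nat.count K b * N := by
    rintro p ⟨hp, h⟩
    by_cases hs : p < Y.s
    · exact ⟨0, by omega, .inl ⟨hs, rfl⟩, hid 0 (by omega) p (by simp [Y.bs_zero])
        (by simpa [Y.bs_one] using hs)⟩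
    · obtain ⟨b, hb, h1, h2, h3⟩ := h (by omega)
      exact ⟨b, hb, .inr ⟨by omega, h3, h1, h2⟩, hid b hb p h1 h2⟩
  constructor
  · intro p hp
    obtain ⟨b, hb, -, h1⟩ := key p hp
    have h2 := loc_lt hp.1
    have h3 := Nat.mul_le_mul_right N (hM b hb)
    rw [add_one_mul] at hU
    omega
  · intro p q hp hq e
    obtain ⟨b, hb, h1, h2⟩ := key p hp
    obtain ⟨c, hc, h1', h2'⟩ := key q hq
    have hlp := loc_lt hp.1
    have hlq := loc_lt hq.1
    -- Equal numbers give equal local numbers and equally many kept blocks before. A local number is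
    -- below `s` exactly for separator vertices, and among kept blocks the count determines the
    -- block.
    rw [h2, h2', add_comm, add_comm (Y.loc q), mul_add_inj hlp hlq] at e
    obtain ⟨e1, e2⟩ := e
    rcases h1 with ⟨h1, rfl⟩ | ⟨h1, hKb, h3, h4⟩ <;> rcases h1' with ⟨h1', rfl⟩ | ⟨h1', hKc, h3', h4'⟩
    · rw [← Y.loc_sep p h1, ← Y.loc_sep q h1', e2]
    · have hc1 : 1 ≤ c := by
        by_contra h
        obtain rfl : c = 0 := by omega
        rw [zero_add, Y.bs_one] at h4'
        omega
      rw [Y.loc_sep p h1, Y.loc_block c q hc1 hc h3' h4'] at e2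
      omega
    · have hb1 : 1 ≤ b := by
        by_contra h
        obtain rfl : b = 0 := by omega
        rw [zero_add, Y.bs_one] at h4
        omega
      rw [Y.loc_sep q h1', Y.loc_block b p hb1 hb h3 h4] at e2
      omega
    · obtain rfl := Nat.count_injective hKb hKc e1
      have g1 := (vert_loc hb (.inr ⟨h3, h4⟩)).2
      have g2 := (vert_loc hb (.inr ⟨h3', h4'⟩)).2
      rw [← g1, ← g2, e2]

end Layout

/-- Numbers the vertices of the kept blocks. -/
def numberKept : Prog :=
  assign 36 (const 0) ;;
  forTo 23 (reg 3) (
    forTo 31 (load 5 (reg 23 + const 1) - load 5 (reg 23))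
      (store 20 (load 5 (reg 23) + reg 31) (load 6 (load 5 (reg 23) + reg 31) + reg 36 * reg 4)) ;;
    Prog.ite (load 22 (reg 23)) (assign 36 (reg 36 + const 1)) skip)

section
variable {w l L : ℕ} {a : MulAlg} {Y : Layout (a.n ^ L)} {s : State} {A Dg b R Z : ℕ}

/-- A block that is not kept shares its numbers with other blocks. This is harmless: completeness
needs distinct numbers on the separator and in kept blocks only, and soundness does not depend on
the numbers. -/
theorem numberKept_runs (h : SearchEnv w a l L Y A Dg b R Z s) :
    Runs w numberKept s ((Y.m + 1) * (a.n ^ L + 1) * 60) fun s' =>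
      ∀ b < Y.m, ∀ p, Y.bs b ≤ p → p < Y.bs (b + 1) →
        s'.mem 20 p = Y.loc p + Nat.count (fun b => s.mem 22 b ≠ 0) b * a.n ^ L := by
  set K : ℕ → Prop := fun b => s.mem 22 b ≠ 0 with hK
  have hmw := h.m_lt
  have hnw := h.n_lt
  have hid := h.id_lt
  have hNpos : 0 < a.n ^ L := by have := a.two_le; positivity
  have hcount : ∀ b ≤ Y.m, Nat.count K b ≤ Y.m := fun b hb => le_trans (by
      rw [Nat.count_eq_card_filter_range]
      exact (Finset.card_filter_le _ _).trans_eq (Finset.card_range b)) hb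
  have hlt : ∀ b ≤ Y.m, ∀ p < Y.n, Nat.count K b * a.n ^ L < 2 ^ w ∧
      Y.loc p + Nat.count K b * a.n ^ L < 2 ^ w := by
    intro b hb p hp
    have h1 := Nat.mul_le_mul_right (a.n ^ L) (hcount b hb)
    have h2 := Layout.loc_lt hp
    rw [add_one_mul] at hid
    omega
  apply Runs.time_le
  · apply Runs.seq
    · exact Runs.straight (Q := fun s' => s'.reg 36 = 0) ⟨by simp, by simp⟩
    intro s1 hS1 h36
    have E1 := h.of_same hS1 rfl rfl
    refine Runs.for_const (m := Y.m) (T := (a.n ^ L + 1) * 40)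
      (I := fun b s' => (∀ b' < b, ∀ p, Y.bs b' ≤ p → p < Y.bs (b' + 1) →
        s'.mem 20 p = Y.loc p + Nat.count K b' * a.n ^ L) ∧ s'.reg 36 = Nat.count K b) rfl
      (fun s' hS => ⟨trivial, (hS.1 3 rfl).trans E1.r3⟩) (fun _ _ _ h => by simpa using h)
      (by simpa using h36) ?_ (fun _ _ _ h => h.1)
    rintro b s2 hb h23 hS2 ⟨hI, h36⟩
    have E2 := E1.of_same hS2 rfl rfl
    have hbn := Y.bs_le_n (b := b + 1) hb
    have hmono := Y.mono b hb
    apply Runs.time_le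
    · apply Runs.seq
      · refine Runs.for_const (m := Y.bs (b + 1) - Y.bs b) (T := 20) (Q := fun s' =>
            (∀ p, Y.bs b ≤ p → p < Y.bs (b + 1) → s'.mem 20 p = Y.loc p + Nat.count K b * a.n ^ L) ∧
            ∀ p < Y.bs b, s'.mem 20 p = s2.mem 20 p)
          (I := fun i s' => (∀ p, Y.bs b ≤ p → p < Y.bs b + i →
            s'.mem 20 p = Y.loc p + Nat.count K b * a.n ^ L) ∧
            ∀ p < Y.bs b, s'.mem 20 p = s2.mem 20 p) rfl (fun s' hS => ?_) (fun _ _ _ h => h)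
          ⟨fun p h1 h2 => by omega, fun _ _ => rfl⟩ ?_ ?_
        · have f23 := (hS.1 23 rfl).trans h23
          have E := E2.of_same hS rfl rfl
          simp [f23, E.m5 b hb.le, E.m5 (b + 1) hb, h.w_ne]
          omega
        · rintro i s3 hi h31 hS3 ⟨hI3, hI3'⟩
          have E3 := E2.of_same hS3 rfl rfl
          have f23 := (hS3.1 23 rfl).trans h23
          have f36 := (hS3.1 36 rfl).trans h36
          have hp : Y.bs b + i < Y.n := by omega
          obtain ⟨g1, g2⟩ := hlt b hb.le _ hp
          refine Runs.time_le (T := Prog.time (store 20 (load 5 (reg 23) + reg 31)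
            (load 6 (load 5 (reg 23) + reg 31) + reg 36 * reg 4))) (Runs.straight ⟨?_, ?_, ?_⟩)
            (by simp [Prog.time])
          · simp [f23, E3.m5 b hb.le, h31]; omega
          · simp only [safe_add, safe_load, safe_reg, safe_mul, val_add, val_load, val_reg, val_mul, f23,
              E3.m5 b hb.le, h31, f36, E3.r4, E3.m6 _ hp, true_and]
            omega
          · simp only [val_add, val_load, val_reg, val_mul, f23, E3.m5 b hb.le, h31, f36, E3.r4,
              E3.m6 _ hp, setMem_mem, true_and]
            refine ⟨fun p h1 h2 => ?_, fun p h1 => ?_⟩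
            · split_ifs with h3
              · rw [h3]
              · exact hI3 p h1 (by omega)
            · rw [if_neg (by omega)]; exact hI3' p h1
        · rintro s3 - - ⟨h1, h2⟩
          exact ⟨fun p h3 h4 => h1 p h3 (by omega), h2⟩
      · rintro s3 hS3 ⟨h1, h2⟩
        have f23 := (hS3.1 23 rfl).trans h23
        have f36 := (hS3.1 36 rfl).trans h36
        have f22 : s3.mem 22 b = s.mem 22 b := by rw [hS3.2 22 rfl, hS2.2 22 rfl, hS1.2 22 rfl]
        have hall : ∀ b' < b + 1, ∀ p, Y.bs b' ≤ p → p < Y.bs (b' + 1) →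
            s3.mem 20 p = Y.loc p + Nat.count K b' * a.n ^ L := by
          intro b' hb' p h3 h4
          rcases Nat.lt_succ_iff_lt_or_eq.1 hb' with h5 | rfl
          · have := Y.bs_le (b := b' + 1) (c := b) h5 hb.le
            rw [h2 p (by omega)]
            exact hI b' h5 p h3 h4
          · exact h1 p h3 h4
        have hc := hcount b hb.le
        refine Runs.straight ⟨trivial, fun hc' => ?_, fun hc' => ?_⟩
        · refine ⟨by simp [f36, h.w_ne]; omega, by simpa using hall, ?_⟩
          rw [val_load, val_reg, f23, f22] at hc'
          rw [Nat.count_succ, if_pos hc']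
          simp [f36]
        · refine ⟨hall, ?_⟩
          rw [val_load, val_reg, f23, f22] at hc'
          rw [Nat.count_succ, if_neg (fun h => h hc')]
          simp [f36]
    · have h1 := Layout.size_le hb
      simp [Prog.time]
      nlinarith
  · simp [Prog.time]
    have : (Y.m + 1) * ((a.n ^ L + 1) * 40 + 8) ≤ (Y.m + 1) * (a.n ^ L + 1) * 48 := by
      rw [mul_assoc]; gcongr; omega
    have : 1 ≤ (Y.m + 1) * (a.n ^ L + 1) := Nat.mul_pos (by omega) (by omega)
    omega

/-- Searches for a cycle. -/
def search (a : MulAlg) (l A Dg : ℕ) : Prog :=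
  assign 21 (const 0) ;;
  forTo 31 (reg 3) (store 22 (reg 31) (const 0)) ;;
  forTo 31 (reg 0) (store 20 (reg 31) (load 6 (reg 31))) ;;
  pass a l A Dg ;;
  Prog.ite ((reg 21).same (const 0)) (numberKept ;; pass a l A Dg) skip

theorem search_wr (a : MulAlg) (l A Dg : ℕ) : (search a l A Dg).wr ⊆ List.range' 20 26 := by
  have h1 := pass_wr a l A Dg
  simp only [search, Prog.wr, List.append_subset]
  exact ⟨subset_range' rfl, subset_range' rfl, subset_range' rfl, h1, ⟨subset_range' rfl, h1⟩,
    List.nil_subset _⟩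

theorem search_wm (a : MulAlg) (l A Dg : ℕ) : (search a l A Dg).wm ⊆ List.range' 20 10 := by
  have h1 : (pass a l A Dg).wm ⊆ List.range' 20 10 := fun r hr => by
    have := pass_wm a l A Dg hr
    simp only [List.mem_range'_1] at this ⊢; omega
  simp only [search, Prog.wm, List.append_subset]
  exact ⟨List.nil_subset _, subset_range' rfl, subset_range' rfl, h1, ⟨subset_range' rfl, h1⟩,
    List.nil_subset _⟩

/-- If the first pass fails, there is no cycle that avoids the separator, and array `22` marks
precisely the kept blocks. Any cycle could then be moved into them and would be found in the second
pass, whose numbers are distinct there. -/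
theorem exists_search_runs (a : MulAlg) {l : ℕ} (hl : 0 < l) (A Dg : ℕ) : ∃ K, ∀ {w L : ℕ}
    {Y : Layout (a.n ^ L)} {s : State} {b R Z : ℕ}, SearchEnv w a l L Y A Dg b R Z s →
    Runs w (search a l A Dg) s (K * ((Z + 1) * (Y.m * a.unit L + (Y.s + 1) * (Y.n + 1)))) fun s' =>
      s'.reg 21 = 1 ∧ Y.LR l (s'.mem 21) (s'.reg 22) l (s'.reg 22) ∨
        s'.reg 21 = 0 ∧ ¬ ∃ v, Y.Cyc l v := by
  classical
  obtain ⟨K, hK⟩ := exists_pass_runs a hl A Dg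
  refine ⟨2 * K + 300, ?_⟩
  intro w L Y s b R Z h
  obtain ⟨V, hV⟩ : ∃ V, V = (Z + 1) * (Y.m * a.unit L + (Y.s + 1) * (Y.n + 1)) := ⟨_, rfl⟩
  rw [← hV]
  apply Runs.time_le
  · apply Runs.seq
    · exact Runs.straight (Q := fun s' => s'.reg 21 = 0) ⟨by simp, by simp⟩
    intro s1 hS1 h21
    have E1 := h.of_same hS1 rfl rfl
    apply Runs.seq
    · refine Runs.fill (A := 22) (m := Y.m) (f := fun _ => 0) (T := 3) rfl
        (fun s' hS => ⟨trivial, (hS.1 3 rfl).trans E1.r3⟩) ?_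
      intro x s3 hx h31 hS3 _
      refine Runs.time_le (T := Prog.time (store 22 (reg 31) (const 0)))
        (Runs.straight ?_) le_rfl
      refine ⟨trivial, by simp, by simp [h31], ?_⟩
      intro j hj; simp [h31, hj]
    rintro s2 hS2 ⟨h22, -⟩
    have E2 := E1.of_same hS2 rfl rfl
    have h21 := (hS2.1 21 rfl).trans h21
    apply Runs.seq
    · refine Runs.fill (A := 20) (m := Y.n) (f := Y.loc) (T := 4) rfl
        (fun s' hS => ⟨trivial, (hS.1 0 rfl).trans E2.r0⟩) ?_
      intro x s3 hx h31 hS3 _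
      refine Runs.time_le (T := Prog.time (store 20 (reg 31) (load 6 (reg 31))))
        (Runs.straight ?_) le_rfl
      have E3 := E2.of_same hS3 rfl rfl
      refine ⟨trivial, trivial, by simp [h31, E3.m6 x hx], ?_⟩
      intro j hj; simp [h31, hj]
    rintro s3 hS3 ⟨hid, -⟩
    have E3 := E2.of_same hS3 rfl rfl
    have h21 := (hS3.1 21 rfl).trans h21
    rw [← hS3.2 22 rfl] at h22
    apply Runs.seq
    · exact (hV ▸ hK E3 h21 hid :)
    intro s4 hS4 hP
    have hS4 := hS4.mono (pass_wr a l A Dg) (pass_wm a l A Dg)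
    have E4 := E3.of_same hS4 rfl rfl
    have hkeep : s4.reg 21 = 0 → ∀ b' < Y.m, s4.mem 22 b' ≠ 0 ↔
        ∃ z < Z, Y.Kept l (fun p => colour l A b R Dg z (Y.loc p)) b' := by
      intro h0 b' hb'
      rw [hP.keep h0 b', h22 b' hb']
      simp [hb']
    refine Runs.ite (by simp) (T := (Y.m + 1) * (a.n ^ L + 1) * 60 + K * V) (fun hc => ?_) (fun hc => ?_)
    · have hc : s4.reg 21 = 0 := by by_contra h'; simp [h'] at hc
      apply Runs.seq
      · exact numberKept_runs E4
      intro s5 hS5 hid5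
      have E5 := E4.of_same hS5 rfl rfl
      refine (hK E5 ((hS5.1 21 rfl).trans hc) (id := s5.mem 20) fun _ _ => rfl).mono (by rw [hV]) ?_
      intro s6 hS6 hP6
      rcases hP6.sound with h0 | h1
      · refine .inr ⟨h0, ?_⟩
        rintro ⟨v, hv⟩
        have hids := h.ids
        have hNU : a.n ^ L ≤ b ^ Dg := by
          refine le_trans ?_ hids
          exact Nat.le_mul_of_pos_left _ (by omega)
        -- Here the exchange argument uses the colourings by local numbers; below, the moved cycle
        -- is coloured by the new numbers.
        obtain ⟨v', hv', hgood⟩ := hv.exists_good hl h.rich hNU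
          (K := fun b => s4.mem 22 b ≠ 0) (hP.inside hc)
          (fun b' hb' z hz hk => (hkeep hc b' hb').2 ⟨z, hz, hk⟩)
        obtain ⟨i1, i2⟩ := Layout.good_ids (K := fun b => s4.mem 22 b ≠ 0) (id := s5.mem 20) hid5
          (fun b' hb' => Layout.count_kept_le
            (C := fun z p => colour l A b R Dg z (Y.loc p)) hb'.le
            (fun b' hb' hk => (hkeep hc b' hb').1 hk)) hids
        obtain ⟨z, hz, ⟨b', hb', p, hp, hE⟩ | ⟨x, hx⟩⟩ :=
          hv'.exists_colour hl h.rich hgood i1 i2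
        · exact hP6.inside h0 z hz b' hb' p hp hE
        · exact hP6.through h0 z hz x hx
      · exact .inl h1
    · have hc : s4.reg 21 ≠ 0 := by intro h'; simp [h'] at hc
      refine (Runs.straight (p := skip) ?_).time_le (by
        have : 1 ≤ (Y.m + 1) * (a.n ^ L + 1) := Nat.mul_pos (by omega) (by omega)
        simp [Prog.time]; omega)
      exact .inl (hP.sound.resolve_left hc)
  · have hU := sq_le_unit (a := a) (L := L)
    have hU1 := add_one_le_unit (a := a) (L := L)
    have hm := Y.two_le
    have h1 : Y.m * a.unit L + (Y.s + 1) * (Y.n + 1) ≤ V := hV ▸ Nat.le_mul_of_pos_left _ (by omega)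
    have h2 : Y.n + 1 ≤ (Y.s + 1) * (Y.n + 1) := Nat.le_mul_of_pos_left _ (by omega)
    have h3 : Y.m ≤ Y.m * a.unit L := Nat.le_mul_of_pos_right _ (by omega)
    have h4 : (Y.m + 1) * (a.n ^ L + 1) ≤ 2 * (Y.m * a.unit L) := by
      calc _ ≤ (2 * Y.m) * a.unit L := Nat.mul_le_mul (by omega) hU1
        _ = _ := by ring
    simp only [Prog.time, cost_const, cost_reg, cost_same]
    generalize (Y.m + 1) * (a.n ^ L + 1) = G at *
    have h5 : (2 * K + 300) * V = K * V + K * V + 300 * V := by ring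
    rw [h5]
    omega

end

/-! ### Recovering a cycle from the successful colouring. -/

namespace Layout
variable {N : ℕ}

/-- The table `T` describes walks from `p`: if cell `i * n + q` is not `0`, then `q` can be the
vertex number `i`, and the cell determines its predecessor. The table is complete for the edges
in `D`. -/
structure Layers (Y : Layout N) (l : ℕ) (col : ℕ → ℕ) (p : ℕ) (T : ℕ → ℕ)
    (D : ℕ → ℕ → ℕ → Prop) : Prop where
  base : ∀ q < Y.n, T q ≠ 0 ↔ q = p
  sound : ∀ i < l, ∀ q < Y.n, T ((i + 1) * Y.n + q) ≠ 0 →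
    Y.E (T ((i + 1) * Y.n + q) - 1) q ∧ T (i * Y.n + (T ((i + 1) * Y.n + q) - 1)) ≠ 0 ∧
      col q = (i + 1) % l
  complete : ∀ i < l, ∀ x < Y.n, ∀ e < Y.dg x, D i x e → T (i * Y.n + x) ≠ 0 →
    col (Y.nb x e) = (i + 1) % l → T ((i + 1) * Y.n + Y.nb x e) ≠ 0

variable {Y : Layout N} {l p : ℕ} {col T T' : ℕ → ℕ} {D D' : ℕ → ℕ → ℕ → Prop}

theorem Layers.mono (h : Y.Layers l col p T D)
    (hD : ∀ i < l, ∀ x < Y.n, ∀ e < Y.dg x, T (i * Y.n + x) ≠ 0 →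
      col (Y.nb x e) = (i + 1) % l → D' i x e → D i x e) :
    Y.Layers l col p T D' :=
  ⟨h.base, h.sound, fun i hi x hx e he hd h0 => fun h1 =>
    h.complete i hi x hx e he (hD i hi x hx e he h0 h1 hd) h0 h1⟩

theorem nb_lt {x e : ℕ} (hx : x < Y.n) (he : e < Y.dg x) : Y.nb x e < Y.n :=
  Y.lt' ((Y.nbr hx).2 ⟨e, he, rfl⟩)

/-- Cells hold a predecessor plus one, so that `0` means unreached. While layer `j` is scanned only
layer `j + 1` is written; overwriting one predecessor by another keeps every cell valid. -/
theorem Layers.step (h : Y.Layers l col p T D) {j x e : ℕ} (hx : x < Y.n)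
    (he : e < Y.dg x) (h0 : T (j * Y.n + x) ≠ 0) (hc : col (Y.nb x e) = (j + 1) % l)
    (hT : ∀ i, T' i = if i = (j + 1) * Y.n + Y.nb x e then x + 1 else T i)
    (hD : ∀ i < l, ∀ x' < Y.n, ∀ e' < Y.dg x', D' i x' e' →
      i ≤ j ∧ (D i x' e' ∨ i = j ∧ x' = x ∧ e' = e)) :
    Y.Layers l col p T' D' := by
  have hq := nb_lt hx he
  have h1 : ∀ i, T i ≠ 0 → T' i ≠ 0 := by
    intro i hi
    rw [hT]; split_ifs <;> simp [hi]
  have h2 : ∀ i q, i ≤ j → q < Y.n → T' (i * Y.n + q) = T (i * Y.n + q) := by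
    intro i q hi hq'
    rw [hT, if_neg]
    rw [mul_add_inj hq' hq]; omega
  refine ⟨fun q hq => ?_, fun i hi q hq' h3 => ?_, fun i hi x' hx' e' he' hd h3 h4 => ?_⟩
  · rw [← h.base q hq]
    have := h2 0 q (Nat.zero_le j) hq
    rw [zero_mul, zero_add] at this
    rw [this]
  · rw [hT] at h3 ⊢
    split_ifs at h3 ⊢ with h4
    · obtain ⟨h5, rfl⟩ := (mul_add_inj hq' hq).1 h4
      obtain rfl : i = j := by omega
      exact ⟨(Y.nbr hx).2 ⟨e, he, rfl⟩, h1 _ h0, hc⟩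
    · obtain ⟨h5, h6, h7⟩ := h.sound i hi q hq' h3
      exact ⟨h5, h1 _ h6, h7⟩
  · obtain ⟨hij, hd'⟩ := hD i hi x' hx' e' he' hd
    rw [h2 i x' hij hx'] at h3
    rcases hd' with hd' | ⟨rfl, rfl, rfl⟩
    · exact h1 _ (h.complete i hi x' hx' e' he' hd' h3 h4)
    · rw [hT, if_pos rfl]; omega

theorem Layers.of_lR (h : Y.Layers l col p T fun _ _ _ => True) {j q : ℕ} (hj : j ≤ l)
    (hq : Y.LR l col p j q) : T (j * Y.n + q) ≠ 0 := by
  induction hq with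
  | zero h1 h2 => rw [zero_mul, zero_add, h.base _ h1]
  | step h1 h2 h3 ih =>
    obtain ⟨e, he, rfl⟩ := (Y.nbr (Y.lt h2)).1 h2
    exact h.complete _ (by omega) _ (Y.lt h2) _ he trivial (ih (by omega)) h3

/-- The closed walk that ends in `p`, in reverse order. -/
def back (T : ℕ → ℕ) (n l p : ℕ) : ℕ → ℕ
  | 0 => p
  | t + 1 => T ((l - t) * n + back T n l p t) - 1

theorem Layers.back (h : Y.Layers l col p T fun _ _ _ => True) (hp : Y.LR l col p l p) {t : ℕ}
    (ht : t ≤ l) : back T Y.n l p t < Y.n ∧ T ((l - t) * Y.n + back T Y.n l p t) ≠ 0 := by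
  induction t with
  | zero => exact ⟨hp.lt, h.of_lR le_rfl hp⟩
  | succ t ih =>
    obtain ⟨h1, h2⟩ := ih (by omega)
    obtain ⟨i, hi⟩ : ∃ i, l - t = i + 1 := ⟨l - t - 1, by omega⟩
    rw [hi] at h2
    obtain ⟨h3, h4, -⟩ := h.sound i (by omega) _ h1 h2
    rw [show l - (t + 1) = i by omega, Layout.back, hi]
    exact ⟨Y.lt h3, h4⟩

/-- A cycle that starts with the position `u 0`. -/
structure Closed (Y : Layout N) (l : ℕ) (u : ℕ → ℕ) : Prop where
  adj : ∀ i < l, Y.E (u i) (u (i + 1))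
  eq : u l = u 0
  inj : ∀ i < l, ∀ j < l, u i = u j → i = j

/-- Following predecessors from `p` in layer `l` ends in layer `0`, where only `p` is marked, so the
walk closes. Its vertices have the colours `0, …, l - 1` and are therefore distinct. -/
theorem Layers.closed (h : Y.Layers l col p T fun _ _ _ => True) (hp : Y.LR l col p l p)
    (hl : 0 < l) : Y.Closed l fun i => Layout.back T Y.n l p (l - i) := by
  have hs : ∀ i < l, Y.E (Layout.back T Y.n l p (l - i)) (Layout.back T Y.n l p (l - (i + 1))) ∧
      col (Layout.back T Y.n l p (l - (i + 1))) = (i + 1) % l := by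
    intro i hi
    obtain ⟨h1, h2⟩ := h.back hp (show l - (i + 1) ≤ l by omega)
    rw [show l - (l - (i + 1)) = i + 1 by omega] at h2
    obtain ⟨h3, -, h5⟩ := h.sound i hi _ h1 h2
    refine ⟨?_, h5⟩
    rw [show l - i = l - (i + 1) + 1 by omega, Layout.back,
      show l - (l - (i + 1)) = i + 1 by omega]
    exact h3
  have h0 : Layout.back T Y.n l p l = p := by
    obtain ⟨h1, h2⟩ := h.back hp le_rfl
    rwa [Nat.sub_self, zero_mul, zero_add, h.base _ h1] at h2
  have hcol : ∀ i < l, col (Layout.back T Y.n l p (l - i)) = i := by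
    intro i hi
    -- The colour of `p` itself is obtained from the last step of the walk, as `l % l = 0`.
    rcases i with _ | i
    · obtain ⟨m, hm⟩ : ∃ m, l = m + 1 := ⟨l - 1, by omega⟩
      have := (hs m (by omega)).2
      rw [← hm, Nat.sub_self, Nat.mod_self] at this
      rw [Nat.sub_zero, h0]; exact this
    · rw [(hs i (by omega)).2, Nat.mod_eq_of_lt hi]
  refine ⟨fun i hi => (hs i hi).1, ?_, fun i hi j hj e => ?_⟩
  · rw [Nat.sub_self, Nat.sub_zero, h0]; rfl
  · have h1 := hcol i hi
    have h2 := hcol j hj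
    rw [e] at h1
    omega

end Layout

/-- Follows the edges at vertex `reg 24` in layer `reg 23`. -/
def layerEdges (l : ℕ) : Prog :=
  forTo 25 (load 0 (load 3 (reg 24) + const 1) - load 0 (load 3 (reg 24))) (
    assign 26 (load 4 (load 1 (load 0 (load 3 (reg 24)) + reg 25))) ;;
    Prog.ite ((load 21 (reg 26)).same ((reg 23 + const 1) % const l))
      (store 32 ((reg 23 + const 1) * reg 0 + reg 26) (reg 24 + const 1)) skip)

/-- Computes the table of walks that start in vertex `reg 22`. -/
def makeLayers (l : ℕ) : Prog :=
  forTo 31 (const (l + 1) * reg 0) (store 32 (reg 31) (const 0)) ;;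
  store 32 (reg 22) (const 1) ;;
  forTo 23 (const l) (forTo 24 (reg 0)
    (Prog.ite (load 32 (reg 23 * reg 0 + reg 24)) (layerEdges l) skip))

/-- Writes the vertices of a cycle to array `0`. -/
def writeCycle (l : ℕ) : Prog :=
  assign 33 (reg 22) ;;
  forTo 23 (const l) (
    assign 33 (load 32 ((const l - reg 23) * reg 0 + reg 33) - const 1) ;;
    store 0 (const l - (reg 23 + const 1)) (load 3 (reg 33)))

section
variable {w l L : ℕ} {a : MulAlg} {Y : Layout (a.n ^ L)} {s : State}

theorem layerEdges_runs {j x p : ℕ} (h : Env w a l L Y s) (hw : (l + 1) * (Y.n + 1) < 2 ^ w)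
    (hj : j < l) (hx : x < Y.n) (h23 : s.reg 23 = j) (h24 : s.reg 24 = x)
    (hT : Y.Layers l (s.mem 21) p (s.mem 32) fun i x' _ => i < j ∨ i = j ∧ x' < x)
    (h0 : s.mem 32 (j * Y.n + x) ≠ 0) :
    Runs w (layerEdges l) s ((Y.dg x + 1) * 60) fun s' =>
      Y.Layers l (s'.mem 21) p (s'.mem 32) fun i x' _ => i < j ∨ i = j ∧ x' < x + 1 := by
  have hnw := h.n_lt
  have hb : ∀ q < Y.n, (j + 1) * Y.n + q < 2 ^ w ∧ j + 1 < 2 ^ w ∧ l < 2 ^ w ∧ (j + 1) * Y.n < 2 ^ w := by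
    intro q hq
    have h1 : (j + 1) * Y.n ≤ l * Y.n := Nat.mul_le_mul_right _ hj
    have h2 : (l + 1) * (Y.n + 1) = l * Y.n + Y.n + l + 1 := by ring
    omega
  refine (Runs.for_const (m := Y.dg x) (T := 40)
    (I := fun e s' => s'.mem 21 = s.mem 21 ∧ s'.mem 32 (j * Y.n + x) ≠ 0 ∧
      Y.Layers l (s.mem 21) p (s'.mem 32) fun i x' e' =>
        i < j ∨ i = j ∧ (x' < x ∨ x' = x ∧ e' < e)) rfl
    (fun s' hS => ?_) (fun _ _ _ h => h) ⟨rfl, h0, hT.mono fun _ _ _ _ _ _ _ _ => by omega⟩ ?_ ?_).time_le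
    (by simp; try omega)
  · have E := h.of_same hS rfl rfl
    have f24 := (hS.1 24 rfl).trans h24
    have h1 := E.vertex_lt x hx
    have h2 := E.degree x hx
    simp [f24, h2, h.w_ne]
    exact h1
  · rintro e s1 he h25 hS ⟨h21, h1, hT1⟩
    have E := h.of_same hS rfl rfl
    have f24 := (hS.1 24 rfl).trans h24
    have f23 := (hS.1 23 rfl).trans h23
    have h2 := E.nbr_lt x hx e he
    have h3 := E.nbr x hx e he
    have hq := Layout.nb_lt hx he
    obtain ⟨b1, b2, b3, b4⟩ := hb _ hq
    refine Runs.time_le (T := Prog.time (assign 26 (load 4 (load 1 (load 0 (load 3 (reg 24)) + reg 25))) ;;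
      Prog.ite ((load 21 (reg 26)).same ((reg 23 + const 1) % const l))
      (store 32 ((reg 23 + const 1) * reg 0 + reg 26) (reg 24 + const 1)) skip))
      (Runs.straight ?_) (by simp [Prog.time])
    refine ⟨by simpa [f24, h25] using h2, by simp [f23, h.w_ne, b3]; exact b2, fun hc => ?_, fun hc => ?_⟩
    · have hc : s.mem 21 (Y.nb x e) = (j + 1) % l := by
        by_contra h'
        simp [f24, h25, h3, h21, f23, h'] at hc
      refine ⟨?_, ?_, ?_, ?_, ?_⟩
      · simp [f24, h25, h3, f23, E.r0, h.w_ne]; exact ⟨⟨b2, b4⟩, b1⟩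
      · simp [f24, h.w_ne]; omega
      · funext i; simp [h21]
      · simp only [setMem_mem, setReg_mem, true_and]
        split_ifs <;> simp [h1]
      · refine hT1.step (T' := State.mem _ 32) (j := j) hx he h1 hc (fun i => ?_) ?_
        · simp [f24, h25, h3, f23, E.r0]
        · intro i _ x' _ e' _ hd; omega
    · refine ⟨by simp [h21], by simpa using h1, ?_⟩
      refine hT1.mono fun i _ x' _ e' _ _ hcol hd => ?_
      by_contra hne
      obtain ⟨rfl, rfl, rfl⟩ : i = j ∧ x' = x ∧ e' = e := by omega
      simp [f24, h25, h3, h21, f23, hcol] at hc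
  · rintro s1 - - ⟨h21, h1, hT1⟩
    rw [h21]
    exact hT1.mono fun i _ x' hx' e' he' _ _ hd => by
      rcases hd with hd | ⟨h3, h4⟩
      · exact .inl hd
      · rcases Nat.lt_succ_iff_lt_or_eq.1 h4 with h5 | rfl
        · exact .inr ⟨h3, .inl h5⟩
        · exact .inr ⟨h3, .inr ⟨rfl, he'⟩⟩

/-- Lists of the separator vertices have length at most `n`, the others at most `N`. This bounds the
time of one sweep over all edges. -/
theorem Layout.sum_dg_le {N : ℕ} (Y : Layout N) :
    ∑ x ∈ Finset.range Y.n, (Y.dg x + 1) ≤ (Y.s + 1) * (Y.n + 1) + Y.n * N := by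
  have h1 : ∀ x ∈ Finset.range Y.n, Y.dg x + 1 ≤ (if x < Y.s then Y.n else 0) + (N + 1) := by
    intro x hx
    have hx := Finset.mem_range.1 hx
    split_ifs with h
    · have := Y.dg_le x hx; omega
    · have := Y.dg_le' x (by omega) hx; omega
  refine (Finset.sum_le_sum h1).trans ?_
  rw [Finset.sum_add_distrib, ← Finset.sum_filter, Finset.sum_const, Finset.sum_const,
    Finset.card_range]
  have h2 : ((Finset.range Y.n).filter (· < Y.s)).card ≤ Y.s := by
    refine (Finset.card_le_card (t := Finset.range Y.s) fun x hx => ?_).trans_eq (by simp)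
    simp at hx ⊢; omega
  have := Nat.mul_le_mul_right Y.n h2
  simp only [smul_eq_mul]
  nlinarith

theorem Layout.n_le {N : ℕ} (Y : Layout N) : Y.n ≤ Y.m * N := by
  have : ∀ b ≤ Y.m, Y.bs b ≤ b * N := by
    intro b hb
    induction b with
    | zero => simp [Y.bs_zero]
    | succ b ih =>
      have h1 := ih (by omega)
      have h2 := size_le (Y := Y) (b := b) (by omega)
      rw [add_one_mul]; omega
  exact Y.bs_m ▸ this _ le_rfl

theorem makeLayers_runs {p : ℕ} (h : Env w a l L Y s) (hw : (l + 1) * (Y.n + 1) < 2 ^ w)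
    (hl : 0 < l) (h22 : s.reg 22 = p) (hp : Y.LR l (s.mem 21) p l p) :
    Runs w (makeLayers l) s ((l + 1) * ((Y.s + 1) * (Y.n + 1) + Y.n * a.n ^ L) * 200) fun s' =>
      Y.Layers l (s.mem 21) p (s'.mem 32) fun _ _ _ => True := by
  have hnw := h.n_lt
  have hpn := hp.lt
  have e1 : (l + 1) * (Y.n + 1) = l * Y.n + Y.n + l + 1 := by ring
  have e2 : (l + 1) * Y.n = l * Y.n + Y.n := by ring
  apply Runs.time_le
  · apply Runs.seq
    · refine Runs.fill (A := 32) (m := (l + 1) * Y.n) (f := fun _ => 0) (T := 3) rfl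
        (fun s' hS => ⟨?_, ?_⟩) ?_
      · have E := h.of_same hS rfl rfl
        simp [E.r0]; omega
      · have E := h.of_same hS rfl rfl
        simp [E.r0]
      intro x s3 hx h31 hS3 _
      refine Runs.time_le (T := Prog.time (store 32 (reg 31) (const 0))) (Runs.straight ?_) le_rfl
      refine ⟨trivial, by simp, by simp [h31], ?_⟩
      intro j hj; simp [h31, hj]
    rintro s1 hS1 ⟨hz, -⟩
    have E1 := h.of_same hS1 rfl rfl
    apply Runs.seq
    · refine Runs.straight (Q := fun s' => Y.Layers l (s.mem 21) p (s'.mem 32) fun i x' _ =>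
        i < 0 ∨ i = 0 ∧ x' < 0) ⟨trivial, by simp [h.w_ne], ?_⟩
      have h22 := (hS1.1 22 rfl).trans h22
      have hc : ∀ i ≤ l, ∀ q < Y.n, i * Y.n + q < (l + 1) * Y.n := by
        intro i hi q hq
        have := Nat.mul_le_mul_right Y.n hi
        omega
      refine ⟨fun q hq => ?_, fun i hi q hq h0 => ?_, fun _ _ _ _ _ _ h' => by omega⟩
      · have := hz q (by simpa using hc 0 (Nat.zero_le l) q hq)
        simp [h22, this]
      · have := hz _ (hc (i + 1) hi q hq)
        rw [add_one_mul] at this h0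
        simp only [val_const, val_reg, setMem_mem, h22, true_and, this] at h0
        rw [if_neg (by omega)] at h0
        exact absurd rfl h0
    intro s2 hS2 hT
    have E2 := E1.of_same hS2 rfl rfl
    have f21 : s2.mem 21 = s.mem 21 := (hS2.2 21 rfl).trans (hS1.2 21 rfl)
    refine Runs.for_const (m := l) (T := (((Y.s + 1) * (Y.n + 1) + Y.n * a.n ^ L) * 100))
      (I := fun j s' => Y.Layers l (s.mem 21) p (s'.mem 32) fun i x' _ =>
        i < j ∨ i = j ∧ x' < 0) rfl (fun s' hS => ⟨by simp; omega, rfl⟩) (fun _ _ _ h => h) hT ?_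
      (fun s3 _ _ h3 => h3.mono fun i hi _ _ _ _ _ _ _ => .inl hi)
    intro j s3 hj h23 hS3 hT3
    have E3 := E2.of_same hS3 rfl rfl
    have hjn : j * Y.n ≤ l * Y.n := Nat.mul_le_mul_right _ hj.le
    refine (Runs.for_loop (m := Y.n) (fun x => (Y.dg x + 1) * 60 + 10)
      (I := fun x s' => Y.Layers l (s.mem 21) p (s'.mem 32) fun i x' _ =>
        i < j ∨ i = j ∧ x' < x) rfl (fun s' hS => ?_) (fun _ _ _ h => h) hT3 ?_
      (fun s3 _ _ h3 => h3.mono fun i _ x hx _ _ _ _ hd => ?_)).time_le ?_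
    · have E := E3.of_same hS rfl rfl
      exact ⟨trivial, E.r0⟩
    · intro x s4 hx h24 hS4 hT4
      have E4 := E3.of_same hS4 rfl rfl
      have f23 := (hS4.1 23 rfl).trans h23
      have f21 : s4.mem 21 = s.mem 21 := (hS4.2 21 rfl).trans ((hS3.2 21 rfl).trans f21)
      refine (Runs.ite (T := (Y.dg x + 1) * 60) ?_ (fun hc => ?_) (fun hc => ?_)).time_le ?_
      · simp [f23, E4.r0, h24]; omega
      · simp only [val_load, val_add, val_mul, val_reg, f23, E4.r0, h24] at hc
        refine (layerEdges_runs E4 hw hj hx f23 h24 (f21 ▸ hT4) hc).mono le_rfl fun s5 hS5 h5 => ?_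
        have : s5.mem 21 = s.mem 21 := (hS5.2 21 rfl).trans f21
        exact this ▸ h5
      · simp only [val_load, val_add, val_mul, val_reg, f23, E4.r0, h24] at hc
        refine Runs.time_le (T := Prog.time skip) (Runs.straight ?_) (by simp [Prog.time]; omega)
        refine hT4.mono fun i _ x' _ _ _ h0 _ hd => ?_
        by_contra hne
        obtain ⟨rfl, rfl⟩ : i = j ∧ x' = x := by omega
        exact h0 hc
      · simp; omega
    · omega
    · have h1 := Y.sum_dg_le
      have h2 : ∑ x ∈ Finset.range Y.n, ((Y.dg x + 1) * 60 + 10) =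
          (∑ x ∈ Finset.range Y.n, (Y.dg x + 1)) * 60 + Y.n * 10 := by
        rw [Finset.sum_add_distrib, Finset.sum_mul, Finset.sum_const, Finset.card_range, smul_eq_mul]
      have h3 : Y.n + 1 ≤ (Y.s + 1) * (Y.n + 1) := Nat.le_mul_of_pos_left _ (by omega)
      rw [h2]
      simp only [cost_reg]
      omega
  · have h3 : Y.n + 1 ≤ (Y.s + 1) * (Y.n + 1) := Nat.le_mul_of_pos_left _ (by omega)
    obtain ⟨V, hV⟩ : ∃ V, V = (Y.s + 1) * (Y.n + 1) + Y.n * a.n ^ L := ⟨_, rfl⟩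
    have h4 : (l + 1) * Y.n ≤ (l + 1) * V := Nat.mul_le_mul_left _ (by omega)
    have h5 : (l + 1) * 1 ≤ (l + 1) * V := Nat.mul_le_mul_left _ (by omega)
    rw [← hV]
    simp only [Prog.time, cost_const, cost_reg, cost_mul]
    have e3 : (l + 1) * (V * 100 + (1 + 7)) = (l + 1) * V * 100 + (l + 1) * 8 := by ring
    rw [e3]
    generalize (l + 1) * V = G at *
    generalize (l + 1) * Y.n = H at *
    omega

/-- The predecessors come in reverse order, hence the target cell `l - (t + 1)`. The output destroys
the adjacency offsets in array `0`, but the loop reads only arrays `3` and `32`. -/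
theorem writeCycle_runs {p : ℕ} (h : Env w a l L Y s) (hw : (l + 1) * (Y.n + 1) < 2 ^ w)
    (hl : 0 < l) (h22 : s.reg 22 = p) (hp : Y.LR l (s.mem 21) p l p)
    (hT : Y.Layers l (s.mem 21) p (s.mem 32) fun _ _ _ => True) :
    Runs w (writeCycle l) s ((l + 1) * 60) fun s' =>
      ∃ u, Y.Closed l u ∧ ∀ i < l, s'.mem 0 i = s.mem 3 (u i) := by
  have hnw := h.n_lt
  have e1 : (l + 1) * (Y.n + 1) = l * Y.n + Y.n + l + 1 := by ring
  apply Runs.time_le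
  · apply Runs.seq
    · exact Runs.straight (Q := fun s' => s'.reg 33 = p) ⟨trivial, by simp [h22]⟩
    intro s1 hS1 h33
    refine Runs.for_const (m := l) (T := 24) (I := fun t s' =>
        s'.reg 33 = Layout.back (s.mem 32) Y.n l p t ∧
        ∀ t' < t, s'.mem 0 (l - (t' + 1)) = s.mem 3 (Layout.back (s.mem 32) Y.n l p (t' + 1))) rfl
      (fun s' hS => ⟨by simp; omega, rfl⟩) (fun _ _ _ h => by simpa using h) ⟨h33, by simp⟩ ?_ ?_
    · rintro t s2 ht h23 hS2 ⟨h33, hI⟩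
      have E2 := (h.of_same hS1 rfl rfl)
      have f0 : s2.reg 0 = Y.n := (hS2.1 0 rfl).trans E2.r0
      have f3 : s2.mem 3 = s.mem 3 := (hS2.2 3 rfl).trans (hS1.2 3 rfl)
      have f32 : s2.mem 32 = s.mem 32 := (hS2.2 32 rfl).trans (hS1.2 32 rfl)
      have hb := (hT.back hp (show t ≤ l by omega)).1
      have hln : (l - t) * Y.n ≤ l * Y.n := Nat.mul_le_mul_right _ (by omega)
      refine Runs.time_le (T := Prog.time (
        assign 33 (load 32 ((const l - reg 23) * reg 0 + reg 33) - const 1) ;;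
        store 0 (const l - (reg 23 + const 1)) (load 3 (reg 33)))) (Runs.straight ?_)
        (by simp [Prog.time])
      have hl2 : l < 2 ^ w := by omega
      refine ⟨?_, ?_, trivial, ?_, fun t' ht' => ?_⟩
      · simp [h23, f0, h33, h.w_ne, hl2]; omega
      · simp [h23, h.w_ne, hl2]; omega
      · simp [h23, f0, h33, f32, Layout.back]
      · simp only [val_sub, val_const, val_add, val_mul, val_reg, val_load, setReg_mem, setReg_reg,
          setMem_mem, h23, true_and, if_true, f0, h33, f32, f3, show ¬ (23 = 33) by decide, if_false]
        split_ifs with h1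
        · obtain rfl : t' = t := by omega
          rfl
        · exact hI t' (by omega)
    · rintro s2 - - ⟨-, hI⟩
      refine ⟨_, hT.closed hp hl, fun i hi => ?_⟩
      have := hI (l - i - 1) (by omega)
      rwa [show l - (l - i - 1 + 1) = i by omega, show l - i - 1 + 1 = l - i by omega] at this
  · simp [Prog.time]; omega

/-- Searches for a cycle and writes it to array `0`. -/
def findCycle (a : MulAlg) (l A Dg : ℕ) : Prog :=
  search a l A Dg ;;
  Prog.ite (reg 21) (makeLayers l ;; writeCycle l ;; assign 0 (const 1)) (assign 0 (const 0))

theorem exists_findCycle_runs (a : MulAlg) {l : ℕ} (hl : 0 < l) (A Dg : ℕ) : ∃ K, ∀ {w L : ℕ}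
    {Y : Layout (a.n ^ L)} {s : State} {b R Z : ℕ}, SearchEnv w a l L Y A Dg b R Z s →
    (l + 1) * (Y.n + 1) < 2 ^ w →
    Runs w (findCycle a l A Dg) s (K * ((Z + 1) * (Y.m * a.unit L + (Y.s + 1) * (Y.n + 1)))) fun s' =>
      s'.reg 0 = 1 ∧ (∃ u, Y.Closed l u ∧ ∀ i < l, s'.mem 0 i = s.mem 3 (u i)) ∨
        s'.reg 0 = 0 ∧ ¬ ∃ v, Y.Cyc l v := by
  obtain ⟨K, hK⟩ := exists_search_runs a hl A Dg
  refine ⟨K + ((l + 1) * 260 + 10), ?_⟩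
  intro w L Y s b R Z h hw
  apply Runs.time_le
  · apply Runs.seq
    · exact hK h
    intro s1 hS1 hc
    have hS1 := hS1.mono (search_wr a l A Dg) (search_wm a l A Dg)
    have E1 := h.of_same hS1 rfl rfl
    have f3 := hS1.2 3 rfl
    refine Runs.ite (T := (l + 1) * ((Y.s + 1) * (Y.n + 1) + Y.n * a.n ^ L) * 200 + ((l + 1) * 60 + 2))
      trivial (fun h0 => ?_) (fun h0 => ?_)
    · have hp := (hc.resolve_right fun h' => h0 h'.1).2
      apply Runs.seq
      · exact makeLayers_runs E1.toEnv hw hl rfl hp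
      intro s2 hS2 hT
      have E2 := E1.of_same hS2 rfl rfl
      have f21 := hS2.2 21 rfl
      have f22 := hS2.1 22 rfl
      have f3 := (hS2.2 3 rfl).trans f3
      apply Runs.seq
      · exact writeCycle_runs E2.toEnv hw hl f22 (f21 ▸ hp) (f21 ▸ hT)
      rintro s3 hS3 ⟨u, hu, hm⟩
      refine Runs.straight (p := assign 0 (const 1)) ⟨by simp [h.w_ne], .inl ⟨by simp, u, hu, ?_⟩⟩
      intro i hi
      rw [← f3]; exact hm i hi
    · have hp := (hc.resolve_left fun h' => by simp [h'.1] at h0).2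
      exact (Runs.straight (p := assign 0 (const 0)) ⟨by simp, .inr ⟨by simp, hp⟩⟩).time_le
        (by simp [Prog.time]; omega)
  · have hU := sq_le_unit (a := a) (L := L)
    rw [mul_pow] at hU
    have hm := Y.two_le
    obtain ⟨V, hV⟩ : ∃ V, V = (Z + 1) * (Y.m * a.unit L + (Y.s + 1) * (Y.n + 1)) := ⟨_, rfl⟩
    have h1 : Y.m * a.unit L + (Y.s + 1) * (Y.n + 1) ≤ V := hV ▸ Nat.le_mul_of_pos_left _ (by omega)
    have h2 : 1 ≤ (Y.s + 1) * (Y.n + 1) := Nat.mul_pos (by omega) (by omega)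
    have h3 : Y.n * a.n ^ L ≤ Y.m * a.unit L := by
      calc _ ≤ Y.m * a.n ^ L * a.n ^ L := Nat.mul_le_mul_right _ Y.n_le
        _ = Y.m * (a.n ^ L * a.n ^ L) := by ring
        _ ≤ _ := Nat.mul_le_mul_left _ (by omega)
    have h4 : (l + 1) * ((Y.s + 1) * (Y.n + 1) + Y.n * a.n ^ L) ≤ (l + 1) * V :=
      Nat.mul_le_mul_left _ (by omega)
    have h5 : l + 1 ≤ (l + 1) * V := Nat.le_mul_of_pos_right _ (by omega)
    rw [← hV]
    have h6 : (K + ((l + 1) * 260 + 10)) * V = K * V + (l + 1) * V * 260 + 10 * V := by ring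
    rw [h6, cost_reg]
    generalize (l + 1) * V = G at *
    generalize (l + 1) * ((Y.s + 1) * (Y.n + 1) + Y.n * a.n ^ L) = H at *
    generalize K * V = J at *
    omega

end

/-! ### Graphs on numbers -/

/-- Adjacency, for vertices given as numbers. -/
def AdjN {n : ℕ} (G : SimpleGraph (Fin n)) (u v : ℕ) : Prop :=
  ∃ (hu : u < n) (hv : v < n), G.Adj ⟨u, hu⟩ ⟨v, hv⟩

/-- Membership, for vertices given as numbers. -/
def MemN {n : ℕ} (S : Finset (Fin n)) (u : ℕ) : Prop := ∃ h : u < n, (⟨u, h⟩ : Fin n) ∈ S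

section
variable {n k : ℕ} {G : SimpleGraph (Fin n)} {S : Finset (Fin n)} {u v : ℕ}

theorem AdjN.symm (h : AdjN G u v) : AdjN G v u := ⟨h.2.1, h.1, h.2.2.symm⟩

/-- The vertex `u` belongs to the component `K`. -/
def InComp (K : (G.induce ((S : Set (Fin n))ᶜ)).ConnectedComponent) (u : ℕ) : Prop :=
  ∃ (h : u < n) (h' : (⟨u, h⟩ : Fin n) ∈ ((S : Set (Fin n))ᶜ : Set (Fin n))),
    (G.induce ((S : Set (Fin n))ᶜ)).connectedComponentMk ⟨_, h'⟩ = K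

theorem InComp.exists (hu : u < n) (h : ¬ MemN S u) :
    ∃ K : (G.induce ((S : Set (Fin n))ᶜ)).ConnectedComponent, InComp K u :=
  ⟨_, hu, fun h' => h ⟨hu, h'⟩, rfl⟩

theorem InComp.adj {K : (G.induce ((S : Set (Fin n))ᶜ)).ConnectedComponent} (h : InComp K u)
    (ha : AdjN G u v) (hv : ¬ MemN S v) : InComp K v := by
  obtain ⟨h1, h2, rfl⟩ := h
  obtain ⟨h3, h4, h5⟩ := ha
  refine ⟨h4, fun h' => hv ⟨h4, h'⟩, (SimpleGraph.ConnectedComponent.sound ?_)⟩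
  exact SimpleGraph.Adj.reachable (by simpa using h5.symm)

theorem _root_.IsSeparator.card_le (h : IsSeparator G k S)
    (K : (G.induce ((S : Set (Fin n))ᶜ)).ConnectedComponent) {T : Finset ℕ} (f : ℕ → ℕ)
    (hf : Set.InjOn f T) (hT : ∀ x ∈ T, InComp K (f x)) : T.card ≤ k - S.card := by
  have h1 : ((T.image f : Finset ℕ) : Set ℕ) ⊆ (fun v : ((S : Set (Fin n))ᶜ : Set (Fin n)) => (v.1 : ℕ)) '' K.supp := by
    intro y hy
    obtain ⟨x, hx, rfl⟩ := Finset.mem_image.1 (Finset.mem_coe.1 hy)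
    obtain ⟨h1, h2, h3⟩ := hT x hx
    exact ⟨⟨_, h2⟩, h3, rfl⟩
  have h2 := Set.ncard_le_ncard h1 (Set.toFinite _)
  rw [Set.ncard_coe_finset, Finset.card_image_of_injOn hf] at h2
  exact h2.trans ((Set.ncard_image_le (Set.toFinite _)).trans (h.2 K))

/-- The neighbours are in `S` or in the component of `v`: at most `|S| + (k - |S|)` vertices. -/
theorem _root_.IsSeparator.degree_le (h : IsSeparator G k S) (hv : ¬ MemN S v) (hn : v < n) {T : Finset ℕ}
    (hT : ∀ x ∈ T, AdjN G v x) : T.card ≤ k := by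
  classical
  obtain ⟨K, hK⟩ := InComp.exists (G := G) hn hv
  have h1 := h.card_le K (T := T.filter (¬ MemN S ·)) id (Function.injective_id.injOn) (fun x hx => by
    obtain ⟨h1, h2⟩ := Finset.mem_filter.1 hx
    exact hK.adj (hT x h1) h2)
  have h2 : (T.filter (MemN S ·)).card ≤ S.card := by
    rw [← Finset.card_image_of_injective S Fin.val_injective]
    refine Finset.card_le_card fun x hx => ?_
    obtain ⟨h1, h2, h3⟩ := Finset.mem_filter.1 hx
    exact Finset.mem_image.2 ⟨_, h3, rfl⟩
  have h3 := Finset.card_filter_add_card_filter_not (s := T) (MemN S ·)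
  have := h.1
  omega

/-- The vertices in the order of a graph search outside of the separator: `ord p` is the vertex
at position `p`, where the separator comes first, and `root` marks the positions where new
components start. -/
structure Ordering (G : SimpleGraph (Fin n)) (S : Finset (Fin n)) (ord pos root : ℕ → ℕ) :
    Prop where
  lt : ∀ p < n, ord p < n
  pos_lt : ∀ v < n, pos v < n
  pos_ord : ∀ p < n, pos (ord p) = p
  ord_pos : ∀ v < n, ord (pos v) = v
  sep : ∀ p < n, p < S.card ↔ MemN S (ord p)
  edge : ∀ p q, S.card ≤ p → p < q → q < n → AdjN G (ord p) (ord q) →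
    ∀ r, p < r → r ≤ q → root r = 0
  parent : ∀ p, S.card ≤ p → p < n → root p = 0 → ∃ p', S.card ≤ p' ∧ p' < p ∧
    AdjN G (ord p') (ord p) ∧ ∀ r, p' < r → r ≤ p → root r = 0

variable {ord pos root : ℕ → ℕ}

theorem Ordering.inj (h : Ordering G S ord pos root) {p q : ℕ} (hp : p < n) (hq : q < n)
    (e : ord p = ord q) : p = q := by rw [← h.pos_ord p hp, e, h.pos_ord q hq]

/-- Following parents leads from each position back to a marked position of the same component, with
no mark in between. Positions of an interval without inner marks reach the same one, so they all lie
in one component. -/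
theorem Ordering.run_le (h : Ordering G S ord pos root) (hS : IsSeparator G k S) {p q : ℕ}
    (hp : S.card ≤ p) (hpq : p ≤ q) (hq : q < n) (hr : ∀ r, p < r → r ≤ q → root r = 0) :
    q + 1 - p ≤ k - S.card := by
  have key : ∀ x, S.card ≤ x → x < n → ∃ y K, root y ≠ 0 ∧ y ≤ x ∧ (∀ r, y < r → r ≤ x → root r = 0) ∧
      InComp (G := G) (S := S) K (ord x) ∧ InComp K (ord y) := by
    intro x
    induction x using Nat.strong_induction_on with
    | _ x ih =>
      intro h1 h2
      have hx : ¬ MemN S (ord x) := fun h' => by have := (h.sep x h2).2 h'; omega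
      by_cases h3 : root x = 0
      · obtain ⟨x', g1, g2, g3, g4⟩ := h.parent x h1 h2 h3
        obtain ⟨y, K, e1, e2, e3, e4, e5⟩ := ih x' g2 g1 (by omega)
        refine ⟨y, K, e1, by omega, fun r r1 r2 => ?_, e4.adj g3 hx, e5⟩
        by_cases hrx : r ≤ x'
        · exact e3 r r1 hrx
        · exact g4 r (by omega) r2
      · obtain ⟨K, hK⟩ := InComp.exists (G := G) (h.lt x h2) hx
        exact ⟨x, K, h3, le_rfl, fun r r1 r2 => by omega, hK, hK⟩
  obtain ⟨y, K, h1, h2, h3, h4, h5⟩ := key p hp (by omega)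
  have := hS.card_le K (T := Finset.Icc p q) ord (fun x hx x' hx' e => by
    simp only [Finset.coe_Icc, Set.mem_Icc] at hx hx'
    exact h.inj (by omega) (by omega) e) (fun x hx => by
    obtain ⟨g1, g2⟩ := Finset.mem_Icc.1 hx
    obtain ⟨y', K', e1, e2, e3, e4, e5⟩ := key x (by omega) (by omega)
    have : y' ≤ p := by
      by_contra hlt
      exact e1 (hr y' (by omega) (by omega))
    obtain rfl : y = y' := by
      rcases lt_trichotomy y y' with hlt | rfl | hlt
      · exact absurd (h3 y' hlt this) e1
      · rfl
      · exact absurd (e3 y hlt (by omega)) h1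
    obtain ⟨a1, a2, rfl⟩ := h5
    obtain ⟨b1, b2, rfl⟩ := e5
    exact e4)
  simpa using this

/-- Adjacency lists: the list of `v` has length `deg v` and entries `nb v e`. -/
structure Lists (G : SimpleGraph (Fin n)) (deg : ℕ → ℕ) (nb : ℕ → ℕ → ℕ) : Prop where
  adj : ∀ v < n, ∀ u, AdjN G v u ↔ ∃ e < deg v, nb v e = u
  inj : ∀ v < n, ∀ e < deg v, ∀ e' < deg v, nb v e = nb v e' → e = e'

variable {deg : ℕ → ℕ} {nb : ℕ → ℕ → ℕ}

theorem Lists.deg_le_card (h : Lists G deg nb) (hv : v < n) {T : Finset ℕ} {f : ℕ → ℕ}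
    (hf : Set.InjOn f (Set.Iio n)) (hT : ∀ u, AdjN G v u → f u ∈ T) : deg v ≤ T.card := by
  have hlt : ∀ e < deg v, nb v e < n := fun e he => ((h.adj v hv _).2 ⟨e, he, rfl⟩).2.1
  calc deg v = (Finset.range (deg v)).card := by simp
    _ ≤ T.card := Finset.card_le_card_of_injOn (fun e => f (nb v e))
      (fun e he => hT _ ((h.adj v hv _).2 ⟨e, by simpa using he, rfl⟩))
      (fun e he e' he' e0 => by
        simp only [Finset.coe_range, Set.mem_Iio] at he he'
        exact h.inj v hv e he e' he' (hf (hlt e he) (hlt e' he') e0))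

theorem Lists.deg_le (h : Lists G deg nb) (hv : v < n) : deg v ≤ n := by
  simpa using h.deg_le_card hv (T := Finset.range n) (f := id) Function.injective_id.injOn
    fun u hu => by simpa using hu.2.1

theorem Lists.deg_le_of_isSeparator (h : Lists G deg nb) (hS : IsSeparator G k S) (hv : v < n)
    (hvS : ¬ MemN S v) : deg v ≤ k := by
  classical
  refine (h.deg_le_card hv (T := (Finset.range n).filter (AdjN G v)) (f := id)
    Function.injective_id.injOn fun u hu => by simpa using ⟨hu.2.1, hu⟩).trans ?_
  exact hS.degree_le hvS hv fun x hx => (Finset.mem_filter.1 hx).2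

/-- A partition of the positions into blocks. -/
structure Blocks (n s N : ℕ) (root : ℕ → ℕ) (m : ℕ) (bs loc : ℕ → ℕ) : Prop where
  bs_zero : bs 0 = 0
  bs_one : bs 1 = s
  bs_m : bs m = n
  two_le : 2 ≤ m
  mono : ∀ b < m, bs b ≤ bs (b + 1)
  root : ∀ b, 2 ≤ b → b < m → root (bs b) ≠ 0
  s_le : s ≤ N
  size : ∀ b, 1 ≤ b → b < m → s + (bs (b + 1) - bs b) ≤ N
  loc_sep : ∀ p < s, loc p = p
  loc_block : ∀ b p, 1 ≤ b → b < m → bs b ≤ p → p < bs (b + 1) → loc p = s + (p - bs b)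

theorem Blocks.exists_block {s N m : ℕ} {bs loc : ℕ → ℕ} (h : Blocks n s N root m bs loc) {p : ℕ}
    (hp : s ≤ p) (hpn : p < n) : ∃ b, 1 ≤ b ∧ b < m ∧ bs b ≤ p ∧ p < bs (b + 1) := by
  by_contra hne
  push Not at hne
  have : ∀ b, 1 ≤ b → b ≤ m → bs b ≤ p := by
    intro b hb
    induction b, hb using Nat.le_induction with
    | base => intro _; rw [h.bs_one]; exact hp
    | succ b hb ih => intro hbm; exact hne b hb (by omega) (ih (by omega))
  have := this m (by have := h.two_le; omega) le_rfl
  rw [h.bs_m] at this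
  omega

/-- Inner boundaries of blocks are marked as starts of components, and by `edge` no edge passes over
such a mark. -/
theorem Blocks.not_adj {s N m : ℕ} {bs loc : ℕ → ℕ} (h : Blocks n s N root m bs loc)
    (hO : Ordering G S ord pos root) (hs : S.card = s) {b p q : ℕ} (hb : 1 ≤ b) (hbm : b ≤ m)
    (hp : s ≤ p) (hpb : p < bs b) (hq : bs b ≤ q) (hqn : q < n) : ¬ AdjN G (ord p) (ord q) := by
  intro ha
  have h1 := hO.edge p q (by omega) (by omega) hqn ha (bs b) hpb hq
  rcases Nat.lt_or_eq_of_le hbm with h2 | rfl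
  · rcases Nat.lt_or_eq_of_le hb with h3 | rfl
    · exact h.root b h3 h2 h1
    · rw [h.bs_one] at hpb; omega
  · rw [h.bs_m] at hq; omega

/-- The layout of a graph. -/
def Ordering.layout {s N m : ℕ} {bs loc : ℕ → ℕ} (hO : Ordering G S ord pos root)
    (h : Blocks n s N root m bs loc) (hs : S.card = s) (hL : Lists G deg nb) : Layout N where
  n := n
  s := s
  m := m
  E p q := p < n ∧ q < n ∧ AdjN G (ord p) (ord q)
  bs := bs
  loc := loc
  dg p := deg (ord p)
  nb p e := pos (nb (ord p) e)
  symm h := ⟨h.2.1, h.1, h.2.2.symm⟩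
  lt h := h.1
  nbr {p q} hp := by
    constructor
    · rintro ⟨-, hq, ha⟩
      obtain ⟨e, he, h1⟩ := (hL.adj _ (hO.lt p hp) _).1 ha
      exact ⟨e, he, by rw [h1, hO.pos_ord q hq]⟩
    · rintro ⟨e, he, rfl⟩
      have ha := (hL.adj _ (hO.lt p hp) _).2 ⟨e, he, rfl⟩
      exact ⟨hp, hO.pos_lt _ ha.2.1, by rwa [hO.ord_pos _ ha.2.1]⟩
  bs_zero := h.bs_zero
  bs_one := h.bs_one
  bs_m := h.bs_m
  two_le := h.two_le
  mono := h.mono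
  sep hb hbm hp hpb hq ha := h.not_adj hO hs hb hbm hp hpb hq ha.2.1 ha.2.2
  s_le := h.s_le
  size := h.size
  loc_sep := h.loc_sep
  loc_block := h.loc_block
  dg_le p hp := hL.deg_le (hO.lt p hp)
  dg_le' p hp hpn := by
    obtain ⟨b, hb1, hbm, h1, h2⟩ := h.exists_block hp hpn
    -- All neighbours are in the separator or in the same block, which has room for `N` vertices
    -- including the separator.
    refine (hL.deg_le_card (hO.lt p hpn) (T := Finset.range s ∪ Finset.Ico (bs b) (bs (b + 1)))
      (f := pos) (fun x hx y hy e => ?_) fun u hu => ?_).trans ?_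
    · rw [← hO.ord_pos x hx, e, hO.ord_pos y hy]
    · have hu1 := hu.2.1
      have hu2 := hO.pos_lt u hu1
      rw [← hO.ord_pos u hu1] at hu
      simp only [Finset.mem_union, Finset.mem_range, Finset.mem_Ico]
      by_contra hne
      push Not at hne
      by_cases h3 : bs b ≤ pos u
      · exact h.not_adj hO hs (b := b + 1) (by omega) (by omega) hp h2 (hne.2 h3) hu2 hu
      · exact h.not_adj hO hs hb1 hbm.le hne.1 (by omega) h1 hpn hu.symm
    · refine (Finset.card_union_le _ _).trans ?_
      simpa using h.size b hb1 hbm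

/-! ### Cycles -/

theorem exists_walk {V : Type*} {G : SimpleGraph V} {l : ℕ} {f : ℕ → V}
    (h : ∀ i < l, G.Adj (f i) (f (i + 1))) :
    ∃ p : G.Walk (f 0) (f l), p.length = l ∧ ∀ i ≤ l, p.getVert i = f i := by
  induction l generalizing f with
  | zero => exact ⟨.nil, rfl, fun i hi => by obtain rfl : i = 0 := by omega
                                             rfl⟩
  | succ l ih =>
    obtain ⟨p, h1, h2⟩ := ih (f := fun i => f (i + 1)) fun i hi => h (i + 1) (by omega)
    refine ⟨.cons (h 0 (by omega)) p, by simp [h1], fun i hi => ?_⟩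
    rcases i with _ | i
    · rfl
    · rw [SimpleGraph.Walk.getVert_cons_succ]; exact h2 i (by omega)

theorem exists_cycle {l : ℕ} (hl : 3 ≤ l) {u : ℕ → ℕ} (hu : ∀ i < l, AdjN G (u i) (u (i + 1)))
    (h0 : u l = u 0) (hinj : ∀ i < l, ∀ j < l, u i = u j → i = j) :
    ∃ (v : Fin n) (p : G.Walk v v), p.IsCycle ∧ p.length = l ∧ ∀ i < l, u i = (p.getVert i : ℕ) := by
  have hlt : ∀ i, i ≤ l → u i < n := fun i hi => by
    rcases Nat.lt_or_eq_of_le hi with h | rfl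
    · exact (hu i h).1
    · rw [h0]; exact (hu 0 (by omega)).1
  have hn : 0 < n := (Nat.zero_le _).trans_lt (hlt 0 (by omega))
  obtain ⟨p, h1, h2⟩ := exists_walk (G := G) (l := l)
    (f := fun i => if h : u i < n then ⟨u i, h⟩ else ⟨0, hn⟩) (fun i hi => by
      simp only [hlt i hi.le, hlt (i + 1) hi, dif_pos]
      exact (hu i hi).2.2)
  have h3 : ∀ i ≤ l, u i = (p.getVert i : ℕ) := fun i hi => by rw [h2 i hi]; simp [hlt i hi]
  have e : (if h : u l < n then (⟨u l, h⟩ : Fin n) else ⟨0, hn⟩) =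
      if h : u 0 < n then ⟨u 0, h⟩ else ⟨0, hn⟩ := by simp [h0]
  refine ⟨_, p.copy rfl e, ?_, by simpa using h1, fun i hi => by simpa using h3 i hi.le⟩
  rw [SimpleGraph.Walk.isCycle_iff_isPath_tail_and_le_length]
  refine ⟨?_, by simpa [h1] using hl⟩
  rw [← SimpleGraph.Walk.IsPath.getVert_injOn_iff]
  intro i hi j hj hij
  have h4 : (p.copy rfl e).tail.length + 1 = l := by
    rw [SimpleGraph.Walk.length_tail_add_one]
    · simpa using h1
    · rw [SimpleGraph.Walk.not_nil_iff_lt_length]; simp [h1]; omega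
  simp only [Set.mem_setOf_eq, SimpleGraph.Walk.getVert_tail, SimpleGraph.Walk.getVert_copy] at hi hj hij
  have h5 : u (i + 1) = u (j + 1) :=
    (h3 _ (by omega)).trans ((congrArg Fin.val hij).trans (h3 _ (by omega)).symm)
  have key : ∀ i j, i + 1 ≤ l → j + 1 ≤ l → i < j → u (i + 1) ≠ u (j + 1) := by
    intro i j hi hj hij e
    rcases Nat.lt_or_eq_of_le hj with h6 | h6
    · have := hinj _ (by omega) _ h6 e; omega
    · rw [h6, h0] at e
      have := hinj _ (by omega) 0 (by omega) e; omega
  rcases lt_trichotomy i j with h6 | h6 | h6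
  · exact absurd h5 (key i j (by omega) (by omega) h6)
  · exact h6
  · exact absurd h5.symm (key j i (by omega) (by omega) h6)

variable {s N m : ℕ} {bs loc : ℕ → ℕ}

theorem Ordering.exists_cycle {l : ℕ} (hl : 3 ≤ l) (hO : Ordering G S ord pos root)
    (h : Blocks n s N root m bs loc) (hs : S.card = s) (hL : Lists G deg nb) {u : ℕ → ℕ}
    (hu : (hO.layout h hs hL).Closed l u) : ∃ (v : Fin n) (p : G.Walk v v), p.IsCycle ∧
      p.length = l ∧ ∀ i < l, ord (u i) = (p.getVert i : ℕ) :=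
  WordRAM.exists_cycle hl (u := fun i => ord (u i)) (fun i hi => (hu.adj i hi).2.2)
    (congrArg ord hu.eq) fun i hi j hj e => hu.inj i hi j hj
      (hO.inj (hu.adj i hi).1 (hu.adj j hj).1 e)

theorem Ordering.exists_cyc {l : ℕ} (hO : Ordering G S ord pos root)
    (h : Blocks n s N root m bs loc) (hs : S.card = s) (hL : Lists G deg nb) {v : Fin n}
    {p : G.Walk v v} (hp : p.IsCycle) (hpl : p.length = l) : ∃ u, (hO.layout h hs hL).Cyc l u := by
  have hl := hp.three_le_length
  refine ⟨_, Layout.Cyc.of_fun (by omega) (u := fun i => pos (p.getVert i)) (fun i hi => ?_) ?_ ?_⟩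
  · have := p.adj_getVert_succ (i := i) (by omega)
    refine ⟨hO.pos_lt _ (Fin.is_lt _), hO.pos_lt _ (Fin.is_lt _), ?_⟩
    rw [hO.ord_pos _ (Fin.is_lt _), hO.ord_pos _ (Fin.is_lt _)]
    exact ⟨Fin.is_lt _, Fin.is_lt _, this⟩
  · simp [← hpl]
  · intro i hi j hj e
    have e : (p.getVert i : ℕ) = p.getVert j := by
      rw [← hO.ord_pos _ (p.getVert i).2, e, hO.ord_pos _ (p.getVert j).2]
    exact hp.getVert_injOn' (by simp; omega) (by simp; omega) (Fin.ext e)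

end

/-- The length of the adjacency list of `v`. -/
def State.deg (s : State) (v : ℕ) : ℕ := s.mem 0 (v + 1) - s.mem 0 v

/-- The entry `e` of the adjacency list of `v`. -/
def State.nb (s : State) (v e : ℕ) : ℕ := s.mem 1 (s.mem 0 v + e)

/-! ### Graph search: the separator first, then the components as intervals. -/

section
variable {n k w : ℕ} {G : SimpleGraph (Fin n)} {S : Finset (Fin n)}

theorem IsInput.lists {s : State} (h : IsInput w G S s) : Lists G s.deg s.nb where
  adj v hv u := by
    have hb := h.adj ⟨v, hv⟩
    constructor
    · rintro ⟨_, hu, ha⟩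
      obtain ⟨i, ⟨h1, h2⟩, h3⟩ := hb.surjOn ⟨⟨u, hu⟩, ha, rfl⟩
      dsimp only at h1 h2 h3
      refine ⟨i - s.mem 0 v, by rw [State.deg]; omega, ?_⟩
      rw [State.nb, show s.mem 0 v + (i - s.mem 0 v) = i by omega, h3]
    · rintro ⟨e, he, rfl⟩
      rw [State.deg] at he
      obtain ⟨u, hu, h3⟩ := hb.mapsTo (x := s.mem 0 v + e) ⟨Nat.le_add_right _ _, by dsimp only; omega⟩
      rw [State.nb, ← h3]
      exact ⟨hv, u.2, hu⟩
  inj v hv e he e' he' h1 := by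
    rw [State.deg] at he he'
    have hj := (h.adj ⟨v, hv⟩).injOn
    have := @hj (s.mem 0 v + e) ⟨Nat.le_add_right _ _, by dsimp only; omega⟩ (s.mem 0 v + e')
      ⟨Nat.le_add_right _ _, by dsimp only; omega⟩ h1
    omega

/-- The invariant of graph search: positions before `head` are processed, and so are the first `e`
edges of position `head`. -/
structure Visited (G : SimpleGraph (Fin n)) (S : Finset (Fin n)) (deg : ℕ → ℕ) (nb : ℕ → ℕ → ℕ)
    (ord pos root mark : ℕ → ℕ) (head tail v e : ℕ) : Prop where
  s_le : S.card ≤ head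
  head_le : head ≤ tail
  v_le : v ≤ n
  lt : ∀ p < tail, ord p < n
  pos_ord : ∀ p < tail, pos (ord p) = p
  mark_iff : ∀ u < n, mark u ≠ 0 ↔ ∃ p < tail, ord p = u
  mem : ∀ p < tail, p < S.card ↔ MemN S (ord p)
  sep : ∀ u, MemN S u → ∃ p < S.card, ord p = u
  edge : ∀ p, S.card ≤ p → p < tail → ∀ e' < deg (ord p), p < head ∨ p = head ∧ e' < e →
    ∃ q < tail, ord q = nb (ord p) e' ∧ ∀ r, p < r → r ≤ q → root r = 0
  queue : ∀ p, head < p → p < tail → root p = 0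
  parent : ∀ p, S.card ≤ p → p < tail → root p = 0 → ∃ p', S.card ≤ p' ∧ p' < p ∧
    AdjN G (ord p') (ord p) ∧ ∀ r, p' < r → r ≤ p → root r = 0
  done : ∀ u < v, ∃ p < tail, ord p = u
  e_le : head < tail → e ≤ deg (ord head)
  e_zero : head = tail → e = 0

variable {deg : ℕ → ℕ} {nb : ℕ → ℕ → ℕ} {ord pos root mark ord' pos' root' mark' : ℕ → ℕ}
  {head tail v e u c : ℕ}

theorem Visited.tail_le (h : Visited G S deg nb ord pos root mark head tail v e) : tail ≤ n := by
  have := Finset.card_le_card_of_injOn (s := Finset.range tail) (t := Finset.range n) ord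
    (fun p hp => by simpa using h.lt p (by simpa using hp))
    (fun p hp q hq e => by
      rw [← h.pos_ord p (by simpa using hp), e, h.pos_ord q (by simpa using hq)])
  simpa using this

/-- The two cases of `hc`: the vertex is discovered from the head of the queue and gets no mark, or
the queue is empty and the vertex is marked as the start of a new component. -/
theorem Visited.push (h : Visited G S deg nb ord pos root mark head tail v e) (hu : u < n)
    (hm : mark u = 0) (hc : c = 0 ∧ head < tail ∧ AdjN G (ord head) u ∨ c ≠ 0 ∧ head = tail)
    (h1 : ∀ i, ord' i = if i = tail then u else ord i)
    (h2 : ∀ i, pos' i = if i = u then tail else pos i)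
    (h3 : ∀ i, root' i = if i = tail then c else root i)
    (h4 : ∀ i, mark' i = if i = u then 1 else mark i) :
    Visited G S deg nb ord' pos' root' mark' head (tail + 1) v e ∧
      ∀ p < tail, ord' p = ord p := by
  have ho : ∀ p < tail, ord' p = ord p := fun p hp => by rw [h1, if_neg hp.ne]
  have hot : ord' tail = u := by rw [h1, if_pos rfl]
  have hr : ∀ p < tail, root' p = root p := fun p hp => by rw [h3, if_neg hp.ne]
  have hne : ∀ p < tail, ord p ≠ u := fun p hp hpu =>
    (h.mark_iff u hu).2 ⟨p, hp, hpu⟩ hm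
  have hs := h.s_le
  have hh := h.head_le
  have hrr : ∀ a b, b < tail → (∀ r, a < r → r ≤ b → root r = 0) →
      ∀ r, a < r → r ≤ b → root' r = 0 := fun a b hb h r r1 r2 => by
    rw [hr r (by omega)]; exact h r r1 r2
  have split : ∀ p < tail + 1, p < tail ∨ p = tail := fun p hp => by omega
  refine ⟨?_, ho⟩
  constructor
  case s_le => exact hs
  case head_le => omega
  case v_le => exact h.v_le
  case lt =>
    intro p hp
    rcases split p hp with hp | rfl
    · rw [ho p hp]; exact h.lt p hp
    · rw [hot]; exact hu
  case pos_ord =>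
    intro p hp
    rcases split p hp with hp | rfl
    · rw [ho p hp, h2, if_neg (hne p hp)]; exact h.pos_ord p hp
    · rw [hot, h2, if_pos rfl]
  case mark_iff =>
    intro x hx
    rw [h4]
    split_ifs with hxu
    · exact ⟨fun _ => ⟨tail, by omega, hot.trans hxu.symm⟩, fun _ => one_ne_zero⟩
    · rw [h.mark_iff x hx]
      constructor
      · rintro ⟨p, hp, e⟩; exact ⟨p, by omega, (ho p hp).trans e⟩
      · rintro ⟨p, hp, e⟩
        rcases split p hp with hp | rfl
        · exact ⟨p, hp, (ho p hp).symm.trans e⟩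
        · exact absurd (e.symm.trans hot) hxu
  case mem =>
    intro p hp
    rcases split p hp with hp | rfl
    · rw [ho p hp]; exact h.mem p hp
    · rw [hot]
      refine ⟨fun h => by omega, fun h' => ?_⟩
      obtain ⟨q, hq, e⟩ := h.sep u h'
      exact absurd e (hne q (by omega))
  case sep =>
    intro x hx
    obtain ⟨p, hp, e⟩ := h.sep x hx
    exact ⟨p, hp, (ho p (by omega)).trans e⟩
  case edge =>
    intro p hp hpt e' he' hd
    have hpt : p < tail := by
      rcases hd with hd | ⟨rfl, hd⟩
      · omega
      · by_contra hlt
        have := h.e_zero (by omega)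
        omega
    rw [ho p hpt] at he' ⊢
    obtain ⟨q, hq, e1, e2⟩ := h.edge p hp hpt e' he' hd
    exact ⟨q, by omega, (ho q hq).trans e1, hrr p q hq e2⟩
  case queue =>
    intro p hp hpt
    rcases split p hpt with hpt | rfl
    · rw [hr p hpt]; exact h.queue p hp hpt
    · rw [h3, if_pos rfl]; omega
  case parent =>
    intro p hp hpt h0
    rcases split p hpt with hpt | rfl
    · rw [hr p hpt] at h0
      obtain ⟨p', g1, g2, g3, g4⟩ := h.parent p hp hpt h0
      exact ⟨p', g1, g2, by rwa [ho p (by omega), ho p' (by omega)], hrr p' p hpt g4⟩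
    · rw [h3, if_pos rfl] at h0
      obtain ⟨-, h5, h6⟩ := hc.resolve_right fun h => h.1 h0
      refine ⟨head, hs, h5, by rwa [hot, ho _ h5], fun r r1 r2 => ?_⟩
      rw [h3]
      split_ifs with h7
      · exact h0
      · exact h.queue r r1 (by omega)
  case done =>
    intro x hx
    obtain ⟨p, hp, e⟩ := h.done x hx
    exact ⟨p, by omega, (ho p hp).trans e⟩
  case e_le =>
    intro _
    rcases Nat.lt_or_eq_of_le hh with h5 | h5
    · rw [ho _ h5]; exact h.e_le h5
    · rw [h.e_zero h5]; exact Nat.zero_le _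
  case e_zero => intro h5; omega

/-- If the other end of the edge is already placed, it stands at or before the head, or waits in the
queue; the queue behind the head contains no marks, so there is none between the two ends. -/
theorem Visited.next_edge (h : Visited G S deg nb ord pos root mark head tail v e)
    (hht : head < tail) (he : e < deg (ord head)) (hn : nb (ord head) e < n)
    (hm : mark (nb (ord head) e) ≠ 0) :
    Visited G S deg nb ord pos root mark head tail v (e + 1) :=
  { h with
    edge := by
      intro p hp hpt e' he' hd
      by_cases hd' : p < head ∨ p = head ∧ e' < e
      · exact h.edge p hp hpt e' he' hd'
      · obtain ⟨rfl, rfl⟩ : p = head ∧ e' = e := by omega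
        obtain ⟨q, hq, e1⟩ := (h.mark_iff _ hn).1 hm
        exact ⟨q, hq, e1, fun r r1 r2 => h.queue r r1 (by omega)⟩
    e_le := fun _ => he
    e_zero := fun h => by omega }

theorem Visited.next_head (h : Visited G S deg nb ord pos root mark head tail v e)
    (hht : head < tail) (he : deg (ord head) ≤ e) :
    Visited G S deg nb ord pos root mark (head + 1) tail v 0 :=
  { h with
    s_le := h.s_le.trans (Nat.le_succ _)
    head_le := hht
    edge := by
      intro p hp hpt e' he' hd
      refine h.edge p hp hpt e' he' ?_
      rcases Nat.lt_or_ge p head with h1 | h1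
      · exact .inl h1
      · obtain rfl : p = head := by omega
        exact .inr ⟨rfl, by omega⟩
    queue := fun p hp => h.queue p (by omega)
    e_le := fun _ => Nat.zero_le _
    e_zero := fun _ => rfl }

theorem Visited.next_vertex (h : Visited G S deg nb ord pos root mark head tail v e)
    (hv : v < n) (hm : mark v ≠ 0) :
    Visited G S deg nb ord pos root mark head tail (v + 1) e :=
  { h with
    v_le := hv
    done := by
      intro x hx
      rcases Nat.lt_succ_iff_lt_or_eq.1 hx with h1 | rfl
      · exact h.done x h1
      · exact (h.mark_iff _ hv).1 hm }

theorem Visited.ordering (h : Visited G S deg nb ord pos root mark tail tail n e)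
    (hL : Lists G deg nb) : Ordering G S ord pos root := by
  have ht : tail = n := by
    refine le_antisymm h.tail_le ?_
    have := Finset.card_le_card (s := Finset.range n) (t := (Finset.range tail).image ord)
      fun x hx => by
        obtain ⟨p, hp, e⟩ := h.done x (by simpa using hx)
        exact Finset.mem_image.2 ⟨p, by simpa using hp, e⟩
    simpa using this.trans Finset.card_image_le
  subst ht
  have hinj : ∀ p < tail, ∀ q < tail, ord p = ord q → p = q := fun p hp q hq e => by
    rw [← h.pos_ord p hp, e, h.pos_ord q hq]
  refine ⟨h.lt, fun x hx => ?_, h.pos_ord, fun x hx => ?_, h.mem, fun p q hp hpq hq ha => ?_,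
    h.parent⟩
  · obtain ⟨p, hp, rfl⟩ := h.done x hx
    rwa [h.pos_ord p hp]
  · obtain ⟨p, hp, rfl⟩ := h.done x hx
    rw [h.pos_ord p hp]
  · obtain ⟨e', he', e1⟩ := (hL.adj _ (h.lt p (by omega)) _).1 ha
    obtain ⟨q', hq', e2, e3⟩ := h.edge p hp (by omega) e' he' (.inl (by omega))
    obtain rfl := hinj q' hq' q hq (e2.trans e1)
    exact e3

/-- The left side counts the steps done. Adjacency lists of the separator are never scanned, and all
other vertices have degree at most `k`; so the search is fast enough although the machine does not
know `k`. -/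
theorem Visited.spent_le (h : Visited G S deg nb ord pos root mark head tail v e)
    (hL : Lists G deg nb) (hS : IsSeparator G k S) :
    v + e + ∑ p ∈ Finset.Ico S.card head, (deg (ord p) + 1) ≤ n * (k + 2) := by
  have hd : ∀ p, S.card ≤ p → p < tail → deg (ord p) ≤ k := fun p hp hpt =>
    hL.deg_le_of_isSeparator hS (h.lt p hpt) fun h' => by have := (h.mem p hpt).2 h'; omega
  have hh := h.head_le
  have ht := h.tail_le
  have hv := h.v_le
  have h1 : ∑ p ∈ Finset.Ico S.card head, (deg (ord p) + 1) ≤ (head - S.card) * (k + 1) := by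
    refine (Finset.sum_le_card_nsmul _ _ (k + 1) fun p hp => ?_).trans_eq (by simp)
    obtain ⟨g1, g2⟩ := Finset.mem_Ico.1 hp
    have := hd p g1 (by omega)
    omega
  have e1 : n * (k + 2) = n * (k + 1) + n := by ring
  rcases Nat.lt_or_eq_of_le hh with h2 | h2
  · have h3 := (h.e_le h2).trans (hd head h.s_le h2)
    have h4 : (head - S.card + 1) * (k + 1) ≤ n * (k + 1) := Nat.mul_le_mul_right _ (by omega)
    rw [add_one_mul] at h4
    omega
  · have h3 := h.e_zero h2
    have h4 : (head - S.card) * (k + 1) ≤ n * (k + 1) := Nat.mul_le_mul_right _ (by omega)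
    omega

end

/-- Appends vertex `reg 27` to the queue if it is new. -/
def visit (c : ℕ) : Prog :=
  Prog.ite (load 30 (reg 27)) skip
    (store 30 (reg 27) (const 1) ;; store 3 (reg 24) (reg 27) ;; store 4 (reg 27) (reg 24) ;;
      store 31 (reg 24) (const c) ;; assign 24 (reg 24 + const 1))

/-- Starts the search in the separator. -/
def visitSep : Prog :=
  forTo 31 (reg 0) (store 30 (reg 31) (const 0)) ;;
  forTo 31 (reg 1) (assign 27 (load 2 (reg 31)) ;; store 3 (reg 31) (reg 27) ;;
    store 4 (reg 27) (reg 31) ;; store 30 (reg 27) (const 1)) ;;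
  assign 23 (reg 1) ;; assign 24 (reg 1) ;; assign 25 (const 0) ;; assign 26 (const 0)

/-- One step of the search. -/
def visitStep : Prog :=
  Prog.ite ((reg 23).less (reg 24))
    (Prog.ite ((reg 26).less (load 0 (load 3 (reg 23) + const 1) - load 0 (load 3 (reg 23))))
      (assign 27 (load 1 (load 0 (load 3 (reg 23)) + reg 26)) ;; visit 0 ;;
        assign 26 (reg 26 + const 1))
      (assign 23 (reg 23 + const 1) ;; assign 26 (const 0)))
    (assign 27 (reg 25) ;; visit 1 ;; assign 25 (reg 25 + const 1))

/-- Graph search. -/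
def visitAll : Prog :=
  visitSep ;; Prog.loop ((reg 25).less (reg 0) + (reg 23).less (reg 24)) visitStep

section
variable {n k w : ℕ} {G : SimpleGraph (Fin n)} {S : Finset (Fin n)} {s : State}
  {deg : ℕ → ℕ} {nb : ℕ → ℕ → ℕ}

/-- The state holds an intermediate state of graph search. -/
def State.Vis (G : SimpleGraph (Fin n)) (S : Finset (Fin n)) (deg : ℕ → ℕ) (nb : ℕ → ℕ → ℕ)
    (s : State) : Prop :=
  Visited G S deg nb (s.mem 3) (s.mem 4) (s.mem 31) (s.mem 30) (s.reg 23) (s.reg 24) (s.reg 25)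
    (s.reg 26)

theorem visit_runs (h : s.Vis G S deg nb) (hw : n + 1 < 2 ^ w) {c u : ℕ} (hcw : c < 2 ^ w)
    (hu : s.reg 27 = u) (hun : u < n)
    (hc : s.mem 30 u = 0 → c = 0 ∧ s.reg 23 < s.reg 24 ∧ AdjN G (s.mem 3 (s.reg 23)) u ∨
      c ≠ 0 ∧ s.reg 23 = s.reg 24) :
    Runs w (visit c) s 20 fun s' => s'.Vis G S deg nb ∧ s'.mem 30 u ≠ 0 ∧ s.reg 24 ≤ s'.reg 24 ∧
      ∀ p < s.reg 24, s'.mem 3 p = s.mem 3 p := by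
  refine (Runs.straight (p := visit c) ?_).time_le (by simp [visit, Prog.time])
  refine ⟨trivial, fun h0 => ⟨h, by simpa [hu] using h0, le_rfl, fun _ _ => rfl⟩, fun h0 => ?_⟩
  have h0 : s.mem 30 u = 0 := by simpa [hu] using h0
  have ht := h.tail_le
  have hw0 : w ≠ 0 := by rintro rfl; simp at hw
  obtain ⟨h1, h2⟩ := h.push (ord' := fun i => if i = s.reg 24 then u else s.mem 3 i)
    (pos' := fun i => if i = u then s.reg 24 else s.mem 4 i)
    (root' := fun i => if i = s.reg 24 then c else s.mem 31 i)
    (mark' := fun i => if i = u then 1 else s.mem 30 i) hun h0 (hc h0) (fun _ => rfl) (fun _ => rfl)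
    (fun _ => rfl) (fun _ => rfl)
  refine ⟨trivial, by simp [hw0], trivial, trivial, trivial, trivial, trivial, hcw, ?_, ?_, ?_, ?_, ?_⟩
  · simp [hw0]; omega
  · rw [State.Vis]
    convert h1 using 1 <;> first | (funext i; simp [hu]) | simp [hu]
  · simp [hu]
  · simp
  · intro p hp
    simp; omega

theorem visitSep_runs (h : IsInput w G S s) (hw : n + 1 < 2 ^ w) (hL : Lists G deg nb) :
    Runs w visitSep s ((n + 1) * 60) fun s' => s'.Vis G S deg nb := by
  have hw0 : w ≠ 0 := by rintro rfl; simp at hw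
  have hsn : S.card ≤ n := by simpa using S.card_le_univ
  have hlt : ∀ p < S.card, MemN S (s.mem 2 p) := fun p hp => by
    obtain ⟨u, hu, e⟩ := h.sep.mapsTo (show p ∈ Set.Iio S.card from hp)
    rw [← e]; exact ⟨u.2, hu⟩
  have hinj : ∀ p < S.card, ∀ q < S.card, s.mem 2 p = s.mem 2 q → p = q := fun p hp q hq e => by
    have hj := h.sep.injOn
    exact @hj p hp q hq e
  have hsurj : ∀ u, MemN S u → ∃ p < S.card, s.mem 2 p = u := by
    rintro u ⟨hu, hm⟩
    obtain ⟨p, hp, e⟩ := h.sep.surjOn ⟨⟨u, hu⟩, hm, rfl⟩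
    exact ⟨p, hp, e⟩
  apply Runs.time_le
  · apply Runs.seq
    · refine Runs.fill (A := 30) (m := n) (f := fun _ => 0) (T := 3) rfl
        (fun s' hS => ⟨trivial, (hS.1 0 rfl).trans h.order⟩) ?_
      intro x s3 hx h31 hS3 _
      refine Runs.time_le (T := Prog.time (store 30 (reg 31) (const 0))) (Runs.straight ?_) le_rfl
      refine ⟨trivial, by simp, by simp [h31], ?_⟩
      intro j hj; simp [h31, hj]
    rintro s1 hS1 ⟨hz, -⟩
    apply Runs.seq
    · refine Runs.for_const (m := S.card) (T := 20) (I := fun i s' =>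
          (∀ p < i, s'.mem 3 p = s.mem 2 p) ∧ (∀ p < i, s'.mem 4 (s.mem 2 p) = p) ∧
          ∀ u < n, s'.mem 30 u ≠ 0 ↔ ∃ p < i, s.mem 2 p = u) rfl
        (fun s' hS => ⟨trivial, (hS.1 1 rfl).trans ((hS1.1 1 rfl).trans h.card)⟩)
        (fun _ _ _ h => h) ⟨by simp, by simp, fun u hu => by simp [hz u hu]⟩ ?_
        (fun s' _ _ h' => h')
      rintro i s2 hi h31 hS2 ⟨i1, i2, i3⟩
      have f2 : s2.mem 2 = s.mem 2 := (hS2.2 2 rfl).trans (hS1.2 2 rfl)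
      refine Runs.time_le (T := Prog.time (assign 27 (load 2 (reg 31)) ;; store 3 (reg 31) (reg 27) ;;
        store 4 (reg 27) (reg 31) ;; store 30 (reg 27) (const 1))) (Runs.straight ?_)
        (by simp [Prog.time])
      refine ⟨trivial, trivial, trivial, trivial, trivial, trivial, by simp [hw0], ?_, ?_, ?_⟩
      · intro p hp
        simp only [setMem_mem, setReg_mem, setReg_reg, setMem_reg, val_reg, val_load, h31, f2]
        simp
        split_ifs with hpi
        · rw [hpi]
        · exact i1 p (by omega)
      · intro p hp
        simp only [setMem_mem, setReg_mem, setReg_reg, setMem_reg, val_reg, val_load, h31, f2]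
        simp
        split_ifs with hpi
        · exact (hinj _ (by omega) _ hi hpi).symm
        · refine i2 p ?_
          rcases Nat.lt_succ_iff_lt_or_eq.1 hp with h1 | rfl
          · exact h1
          · exact absurd rfl hpi
      · intro u hu
        simp only [setMem_mem, setReg_mem, setReg_reg, setMem_reg, val_reg, val_load, val_const, h31, f2]
        simp only [if_true, true_and, show ¬ (30 = 4) by decide, show ¬ (30 = 3) by decide, false_and,
          if_false]
        split_ifs with hu'
        · exact ⟨fun _ => ⟨i, by omega, hu'.symm⟩, fun _ => one_ne_zero⟩
        · rw [i3 u hu]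
          constructor
          · rintro ⟨p, hp, e⟩; exact ⟨p, by omega, e⟩
          · rintro ⟨p, hp, e⟩
            rcases Nat.lt_succ_iff_lt_or_eq.1 hp with h1 | rfl
            · exact ⟨p, h1, e⟩
            · exact absurd e.symm hu'
    rintro s2 hS2 ⟨i1, i2, i3⟩
    have f1 : s2.reg 1 = S.card := (hS2.1 1 rfl).trans ((hS1.1 1 rfl).trans h.card)
    refine Runs.straight ⟨trivial, trivial, by simp, by simp, ?_⟩
    simp only [State.Vis, setReg_mem, setReg_reg, val_reg, val_const, f1]
    simp
    exact
      { s_le := le_rfl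
        head_le := le_rfl
        v_le := Nat.zero_le _
        lt := fun p hp => by rw [i1 p hp]; exact (hlt p hp).1
        pos_ord := fun p hp => by rw [i1 p hp]; exact i2 p hp
        mark_iff := fun u hu => by
          rw [i3 u hu]
          exact exists_congr fun p => and_congr_right fun hp => by rw [i1 p hp]
        mem := fun p hp => by rw [i1 p hp]; exact iff_of_true hp (hlt p hp)
        sep := fun u hu => by
          obtain ⟨p, hp, e⟩ := hsurj u hu
          exact ⟨p, hp, (i1 p hp).trans e⟩
        edge := fun p hp hpt => by omega
        queue := fun p hp hpt => by omega
        parent := fun p hp hpt => by omega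
        done := fun u hu => by omega
        e_le := fun h => by omega
        e_zero := fun _ => rfl }
  · simp [Prog.time]; omega

/-- Every step raises the count of `Visited.spent_le`: it advances an edge, the head or the scan for
new vertices. Finishing a list of length `deg` trades `deg` for `deg + 1`. -/
theorem visitStep_runs (hv : s.Vis G S s.deg s.nb) (hL : Lists G s.deg s.nb) (hw : n + 1 < 2 ^ w)
    (hc : s.reg 25 < n ∨ s.reg 23 < s.reg 24) :
    Runs w visitStep s 60 fun s' => s'.Vis G S s.deg s.nb ∧
      s.reg 25 + s.reg 26 + ∑ p ∈ Finset.Ico S.card (s.reg 23), (s.deg (s.mem 3 p) + 1) <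
      s'.reg 25 + s'.reg 26 + ∑ p ∈ Finset.Ico S.card (s'.reg 23), (s.deg (s'.mem 3 p) + 1) := by
  have hw0 : w ≠ 0 := by rintro rfl; simp at hw
  have ht := hv.tail_le
  have hh := hv.head_le
  have hsum : ∀ s' : State, (∀ p < s.reg 24, s'.mem 3 p = s.mem 3 p) →
      ∑ p ∈ Finset.Ico S.card (s.reg 23), (s.deg (s'.mem 3 p) + 1) =
        ∑ p ∈ Finset.Ico S.card (s.reg 23), (s.deg (s.mem 3 p) + 1) := by
    intro s' h
    refine Finset.sum_congr rfl fun p hp => ?_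
    rw [h p (by have := (Finset.mem_Ico.1 hp).2; omega)]
  have hok : s.Ok w → ∀ v, s.mem 0 (v + 1) < 2 ^ w := fun h v => h.mem _ _
  apply Runs.intro_ok
  intro hO
  refine (Runs.ite (T := 55) (by simp) (fun h1 => ?_) (fun h1 => ?_)).time_le (by simp)
  · have h1 : s.reg 23 < s.reg 24 := by by_contra h'; simp [h'] at h1
    have hu := hv.lt _ h1
    refine (Runs.ite (T := 35) (by simp [hw0]; omega) (fun h2 => ?_) (fun h2 => ?_)).time_le (by simp)
    · have h2 : s.reg 26 < s.deg (s.mem 3 (s.reg 23)) := by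
        by_contra h'; exact h2 (if_neg h')
      have hnb := (hL.adj _ hu _).2 ⟨_, h2, rfl⟩
      have hb : s.mem 0 (s.mem 3 (s.reg 23)) + s.reg 26 < 2 ^ w := by
        have := hO.mem 0 (s.mem 3 (s.reg 23) + 1)
        rw [State.deg] at h2
        omega
      apply Runs.time_le
      · apply Runs.seq
        · exact Runs.straight (Q := fun s' => s'.reg 27 = s.nb (s.mem 3 (s.reg 23)) (s.reg 26))
            ⟨by simpa using hb, by simp [State.nb]⟩
        intro s1 hS1 h27
        have hv1 : s1.Vis G S s.deg s.nb := by
          rw [State.Vis, hS1.2 3 rfl, hS1.2 4 rfl, hS1.2 31 rfl, hS1.2 30 rfl, hS1.1 23 rfl,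
            hS1.1 24 rfl, hS1.1 25 rfl, hS1.1 26 rfl]
          exact hv
        apply Runs.seq
        · refine visit_runs hv1 hw (c := 0) (by simp) h27 hnb.2.1 (fun _ => .inl ⟨rfl, ?_⟩)
          rw [hS1.2 3 rfl, hS1.1 23 rfl, hS1.1 24 rfl]
          exact ⟨h1, hnb⟩
        rintro s2 hS2 ⟨hv2, hm, h24, h3⟩
        rw [hS1.1 24 rfl] at h24 h3
        have f23 : s2.reg 23 = s.reg 23 := (hS2.1 23 rfl).trans (hS1.1 23 rfl)
        have f25 : s2.reg 25 = s.reg 25 := (hS2.1 25 rfl).trans (hS1.1 25 rfl)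
        have f26 : s2.reg 26 = s.reg 26 := (hS2.1 26 rfl).trans (hS1.1 26 rfl)
        have h3' : ∀ p < s.reg 24, s2.mem 3 p = s.mem 3 p := fun p hp => by
          rw [h3 p hp, hS1.2 3 rfl]
        have e1 := h3' _ h1
        have hb26 : s.reg 26 + 1 < 2 ^ w := by
          have := hL.deg_le hu
          omega
        refine Runs.straight ⟨by simp [f26, hw0, hb26], ?_, ?_⟩
        · rw [State.Vis] at hv2 ⊢
          simp only [setReg_mem, setReg_reg, val_add, val_reg, val_const]
          simp
          rw [f23, f26] at hv2 ⊢
          exact hv2.next_edge (by omega) (by rw [e1]; exact h2) (by rw [e1]; exact hnb.2.1)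
            (by rw [e1]; exact hm)
        · simp only [setReg_mem, setReg_reg, val_add, val_reg, val_const]
          simp
          rw [f23, f25, f26, hsum s2 h3']
          omega
      · simp [Prog.time]
    · have h2 : s.deg (s.mem 3 (s.reg 23)) ≤ s.reg 26 := by
        by_contra h'
        exact one_ne_zero ((if_pos (not_le.1 h')).symm.trans h2)
      refine Runs.time_le (T := Prog.time (assign 23 (reg 23 + const 1) ;; assign 26 (const 0)))
        (Runs.straight ⟨by simp [hw0]; omega, by simp, ?_, ?_⟩) (by simp [Prog.time])
      · rw [State.Vis]
        simp only [setReg_mem, setReg_reg, val_add, val_reg, val_const]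
        simp
        exact hv.next_head h1 h2
      · simp only [setReg_mem, setReg_reg, val_add, val_reg, val_const]
        simp
        have h3 := hv.s_le
        have h4 := hv.e_le h1
        rw [Finset.sum_Ico_succ_top h3]
        simp only [Finset.sum_add_distrib, Finset.sum_const, smul_eq_mul, mul_one] at *
        omega
  · have h1 : s.reg 23 = s.reg 24 := by
      by_contra h'
      simp [show s.reg 23 < s.reg 24 by omega] at h1
    have hvn : s.reg 25 < n := by omega
    apply Runs.time_le
    · apply Runs.seq
      · exact Runs.straight (Q := fun s' => s'.reg 27 = s.reg 25) ⟨trivial, by simp⟩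
      intro s1 hS1 h27
      have hv1 : s1.Vis G S s.deg s.nb := by
        rw [State.Vis, hS1.2 3 rfl, hS1.2 4 rfl, hS1.2 31 rfl, hS1.2 30 rfl, hS1.1 23 rfl,
          hS1.1 24 rfl, hS1.1 25 rfl, hS1.1 26 rfl]
        exact hv
      apply Runs.seq
      · refine visit_runs hv1 hw (c := 1) (by simp [hw0]) h27 hvn (fun _ => .inr ⟨one_ne_zero, ?_⟩)
        rw [hS1.1 23 rfl, hS1.1 24 rfl]
        exact h1
      rintro s2 hS2 ⟨hv2, hm, h24, h3⟩
      rw [hS1.1 24 rfl] at h24 h3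
      have f23 : s2.reg 23 = s.reg 23 := (hS2.1 23 rfl).trans (hS1.1 23 rfl)
      have f25 : s2.reg 25 = s.reg 25 := (hS2.1 25 rfl).trans (hS1.1 25 rfl)
      have f26 : s2.reg 26 = s.reg 26 := (hS2.1 26 rfl).trans (hS1.1 26 rfl)
      have h3' : ∀ p < s.reg 24, s2.mem 3 p = s.mem 3 p := fun p hp => by
        rw [h3 p hp, hS1.2 3 rfl]
      refine Runs.straight ⟨by simp [f25, hw0]; omega, ?_, ?_⟩
      · rw [State.Vis] at hv2 ⊢
        simp only [setReg_mem, setReg_reg, val_add, val_reg, val_const]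
        simp
        rw [f25] at hv2 ⊢
        exact hv2.next_vertex hvn hm
      · simp only [setReg_mem, setReg_reg, val_add, val_reg, val_const]
        simp
        rw [f23, f25, f26, hsum s2 h3']
        omega
    · simp [Prog.time]

theorem visitAll_runs (h : IsInput w G S s) (hS : IsSeparator G k S) (hw : n + 2 < 2 ^ w) :
    Runs w visitAll s ((n + 1) * (k + 2) * 200) fun s' =>
      Ordering G S (s'.mem 3) (s'.mem 4) (s'.mem 31) := by
  have hL := h.lists
  have hw0 : w ≠ 0 := by rintro rfl; simp at hw
  apply Runs.time_le
  · apply Runs.seq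
    · exact visitSep_runs h (by omega) hL
    intro s1 hS1 hv1
    have hlists : ∀ s', Same visitStep.wr visitStep.wm s1 s' → s'.deg = s.deg ∧ s'.nb = s.nb := by
      intro s' hS'
      have e0 : s'.mem 0 = s.mem 0 := (hS'.2 0 rfl).trans (hS1.2 0 rfl)
      have e1 : s'.mem 1 = s.mem 1 := (hS'.2 1 rfl).trans (hS1.2 1 rfl)
      exact ⟨funext fun v => by rw [State.deg, State.deg, e0],
        funext₂ fun v e => by rw [State.nb, State.nb, e0, e1]⟩
    have hreg : ∀ s', Same visitStep.wr visitStep.wm s1 s' → s'.reg 0 = n := fun s' hS' =>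
      (hS'.1 0 rfl).trans ((hS1.1 0 rfl).trans h.order)
    refine (Runs.while (T := 60) (I := fun s' => s'.Vis G S s.deg s.nb)
      (Φ := fun s' => n * (k + 2) - (s'.reg 25 + s'.reg 26 +
        ∑ p ∈ Finset.Ico S.card (s'.reg 23), (s.deg (s'.mem 3 p) + 1)))
      hv1 (fun s' hS' hv => ?_) (fun s' hS' hv hc => ?_) (fun s' hS' hv hc => ?_)).time_le
      (Nat.mul_le_mul_right _ (Nat.succ_le_succ (Nat.sub_le _ _)))
    · simp only [safe_add, safe_less, safe_reg, val_less, val_reg, true_and]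
      have hle : ∀ (p : Prop) [Decidable p], (if p then 1 else 0 : ℕ) ≤ 1 := fun p _ => by
        split_ifs <;> omega
      exact (Nat.add_le_add (hle _) (hle _)).trans_lt (show 1 + 1 < 2 ^ w by omega)
    · obtain ⟨e1, e2⟩ := hlists s' hS'
      have h0 := hreg s' hS'
      have := visitStep_runs (w := w) (s := s') (by rw [e1, e2]; exact hv) (by rw [e1, e2]; exact hL) (by omega) (by
        by_contra hne
        push Not at hne
        simp [h0, hne.1.not_gt, hne.2.not_gt] at hc)
      rw [e1, e2] at this
      refine this.mono le_rfl fun s'' _ h3 => ⟨h3.1, ?_⟩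
      have := h3.1.spent_le hL hS
      omega
    · have h0 := hreg s' hS'
      have h1 := hv.head_le
      have h2 := hv.v_le
      simp only [val_add, val_less, val_reg, h0] at hc
      simp only [Nat.add_eq_zero_iff, ite_eq_right_iff, one_ne_zero, imp_false] at hc
      have c2 : ¬ s'.reg 23 < s'.reg 24 := fun h' => one_ne_zero ((if_pos h').symm.trans hc.2)
      have h3 : s'.reg 25 = n ∧ s'.reg 23 = s'.reg 24 := by omega
      rw [State.Vis, h3.1, h3.2] at hv
      exact hv.ordering hL
  · have e1 : (n + 1) * (k + 2) = n * (k + 2) + k + 2 := by ring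
    have h1 : n ≤ n * (k + 2) := Nat.le_mul_of_pos_right _ (by omega)
    simp
    rw [e1]
    omega

end

/-- The positions from `p` to `q` have no root, except perhaps the first. -/
def NoRoot (root : ℕ → ℕ) (p q : ℕ) : Prop := ∀ r, p < r → r ≤ q → root r = 0

/-- There is an interval of `M` positions `≥ s` without inner roots. -/
def IsRun (s n : ℕ) (root : ℕ → ℕ) (M : ℕ) : Prop :=
  ∃ p q, s ≤ p ∧ p ≤ q ∧ q < n ∧ NoRoot root p q ∧ M = q + 1 - p

/-- The largest length of an interval of positions `≥ s` without inner roots is `M`. -/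
def MaxRun (s n : ℕ) (root : ℕ → ℕ) (M : ℕ) : Prop :=
  (∀ p q, s ≤ p → p ≤ q → q < n → NoRoot root p q → q + 1 - p ≤ M) ∧
    (M = 0 ∨ IsRun s n root M)

/-! ### Greedy partition of the components into blocks. -/

section
variable {n s N m M k : ℕ} {root bs loc bs' loc' : ℕ → ℕ}

/-- A partition of the first `n` positions into blocks that have at least `k` vertices, and
hardly more. -/
structure Greedy (n s k M : ℕ) (rt : ℕ → ℕ) (m : ℕ) (bs loc : ℕ → ℕ) : Prop
    extends Blocks n s (2 * k + M) rt m bs loc where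
  many : (m - 2) * k ≤ bs (m - 1)
  last : ∀ r, bs (m - 1) < r → r < n → rt r ≠ 0 → r < bs (m - 1) + k

theorem Blocks.s_le_bs (h : Blocks n s N root m bs loc) {b : ℕ} (hb : 1 ≤ b) (hbm : b ≤ m) :
    s ≤ bs b := by
  induction b, hb using Nat.le_induction with
  | base => rw [h.bs_one]
  | succ b hb ih => exact (ih (by omega)).trans (h.mono b (by omega))

/-- At the start of a component, a block that has at least `k` vertices is closed, and an empty one
is opened. Hence all closed blocks are large and there are few. -/
theorem Greedy.add_block (h : Greedy n s k M root m bs loc) (hr : root n ≠ 0)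
    (hk : k ≤ n - bs (m - 1)) (hM : s ≤ k) (hbs : ∀ i, bs' i = if i = m + 1 then n else bs i) :
    Greedy n s k M root (m + 1) bs' loc := by
  have hm := h.two_le
  have hb : ∀ b ≤ m, bs' b = bs b := fun b hb => by rw [hbs, if_neg (by omega)]
  have hl : bs' (m + 1) = n := by rw [hbs, if_pos rfl]
  have split : ∀ b < m + 1, b < m ∨ b = m := fun b hb => by omega
  constructor
  case many =>
    rw [Nat.add_sub_cancel, hb m le_rfl, h.bs_m, show m + 1 - 2 = m - 2 + 1 by omega, add_one_mul]
    have h1 := h.many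
    have h2 := h.mono (m - 1) (by omega)
    rw [show m - 1 + 1 = m by omega, h.bs_m] at h2
    omega
  case last => intro r; rw [Nat.add_sub_cancel, hb m le_rfl, h.bs_m]; omega
  exact
    { bs_zero := by rw [hb _ (by omega), h.bs_zero]
      bs_one := by rw [hb _ (by omega), h.bs_one]
      bs_m := hl
      two_le := by omega
      mono := fun b hbm => by
        rcases split b hbm with h1 | rfl
        · rw [hb _ h1.le, hb _ h1]; exact h.mono b h1
        · rw [hb _ le_rfl, hl, h.bs_m]
      root := fun b h2 hbm => by
        rcases split b hbm with h1 | rfl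
        · rw [hb _ h1.le]; exact h.root b h2 h1
        · rw [hb _ le_rfl, h.bs_m]; exact hr
      s_le := h.s_le
      size := fun b h2 hbm => by
        rcases split b hbm with h1 | rfl
        · rw [hb _ h1.le, hb _ h1]; exact h.size b h2 h1
        · rw [hb _ le_rfl, hl, h.bs_m]; omega
      loc_sep := h.loc_sep
      loc_block := fun b p h2 hbm h3 h4 => by
        rcases split b hbm with h1 | rfl
        · rw [hb _ h1.le] at *; rw [hb _ h1] at h4; exact h.loc_block b p h2 h1 h3 h4
        · rw [hb _ le_rfl, h.bs_m] at h3; omega }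

/-- A block with `k` vertices is not extended by a new component, so it grows only by the rest of
the current one, which has at most `M` vertices. -/
theorem Greedy.grow (h : Greedy n s k M root m bs loc) (hk : 0 < k) (hM : s ≤ k)
    (hR : ∀ p, s ≤ p → p ≤ n → NoRoot root p n → n + 1 - p ≤ M)
    (hl : root n = 0 ∨ n - bs (m - 1) < k)
    (hbs : ∀ i, bs' i = if i = m then n + 1 else bs i)
    (hloc : ∀ i, loc' i = if i = n then s + (n - bs (m - 1)) else loc i) :
    Greedy (n + 1) s k M root m bs' loc' := by
  have hm := h.two_le
  have hb : ∀ b < m, bs' b = bs b := fun b hb => by rw [hbs, if_neg (by omega)]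
  have hlm : bs' m = n + 1 := by rw [hbs, if_pos rfl]
  have hs : s ≤ bs (m - 1) ∧ bs (m - 1) ≤ n := by
    have h1 := h.mono (m - 1) (by omega)
    rw [show m - 1 + 1 = m by omega, h.bs_m] at h1
    exact ⟨h.s_le_bs (by omega) (by omega), h1⟩
  have split : ∀ b < m, b + 1 < m ∨ b = m - 1 := fun b hb => by omega
  have hroot : ∀ r, bs (m - 1) < r → r < n + 1 → root r ≠ 0 → r < bs (m - 1) + k := fun r r1 r2 r3 => by
    rcases Nat.lt_succ_iff_lt_or_eq.1 r2 with h1 | rfl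
    · exact h.last r r1 h1 r3
    · have := hl.resolve_left r3; omega
  have hm1 : m - 1 + 1 = m := by omega
  constructor
  case many => rw [hb _ (by omega)]; exact h.many
  case last => intro r; rw [hb _ (by omega)]; exact hroot r
  exact
    { bs_zero := by rw [hb _ (by omega), h.bs_zero]
      bs_one := by rw [hb _ (by omega), h.bs_one]
      bs_m := hlm
      two_le := hm
      mono := fun b hbm => by
        rcases split b hbm with h1 | rfl
        · rw [hb _ hbm, hb _ h1]; exact h.mono b hbm
        · rw [hb _ hbm, hm1, hlm]; omega
      root := fun b h2 hbm => by rw [hb _ hbm]; exact h.root b h2 hbm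
      s_le := h.s_le
      size := fun b h2 hbm => by
        rcases split b hbm with h1 | rfl
        · rw [hb _ hbm, hb _ h1]; exact h.size b h2 hbm
        · rw [hb _ hbm, hm1, hlm]
          -- From the vertex number `k` of the block on, no component starts. That part of the block
          -- is a run and has at most `M` positions, and the separator adds at most `k`.
          by_cases h3 : bs (m - 1) + k ≤ n
          · have := hR (bs (m - 1) + k - 1) (by omega) (by omega) fun r r1 r2 => by
              by_contra h4
              have := hroot r (by omega) (by omega) h4
              omega
            omega
          · omega
      loc_sep := fun p hp => by rw [hloc, if_neg (by omega)]; exact h.loc_sep p hp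
      loc_block := fun b p h2 hbm h3 h4 => by
        rw [hb _ hbm] at *
        rw [hloc]
        rcases split b hbm with h1 | rfl
        · rw [hb _ h1] at h4
          have h5 : bs (b + 1) ≤ bs (m - 1) := by
            have : ∀ c, b + 1 ≤ c → c < m → bs (b + 1) ≤ bs c := by
              intro c hc
              induction c, hc using Nat.le_induction with
              | base => intro _; exact le_rfl
              | succ c hc ih => intro hcm; exact (ih (by omega)).trans (h.mono c (by omega))
            exact this _ (by omega) (by omega)
          rw [if_neg (by omega)]
          exact h.loc_block b p h2 hbm h3 h4
        · rw [hm1, hlm] at h4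
          split_ifs with h5
          · rw [h5]
          · exact h.loc_block (m - 1) p h2 hbm h3 (by rw [hm1, h.bs_m]; omega) }

end

/-- Computes the largest length of a component in register `2`. -/
def maxRun : Prog :=
  assign 2 (const 0) ;; assign 25 (reg 1) ;;
  forTo 23 (reg 0 - reg 1) (
    assign 24 (reg 1 + reg 23) ;;
    Prog.ite (load 31 (reg 24)) (assign 25 (reg 24)) skip ;;
    Prog.ite ((reg 2).less (reg 24 + const 1 - reg 25)) (assign 2 (reg 24 + const 1 - reg 25)) skip)

/-- Partitions the vertices into blocks. -/
def makeBlocks : Prog :=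
  forTo 31 (reg 1) (store 6 (reg 31) (reg 31)) ;;
  store 5 (const 0) (const 0) ;; store 5 (const 1) (reg 1) ;; store 5 (const 2) (reg 1) ;;
  assign 3 (const 2) ;;
  forTo 23 (reg 0 - reg 1) (
    assign 24 (reg 1 + reg 23) ;;
    Prog.ite (load 31 (reg 24))
      (Prog.ite ((reg 24 - load 5 (reg 3 - const 1)).less (reg 2)) skip (assign 3 (reg 3 + const 1)))
      skip ;;
    store 6 (reg 24) (reg 1 + (reg 24 - load 5 (reg 3 - const 1))) ;;
    store 5 (reg 3) (reg 24 + const 1))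

section
variable {w n c k M : ℕ} {s : State}

/-- The input does not contain `k`. The program replaces it by `|S| + M`, with `M` the longest run,
which is at most every `k` for which `S` is a `k`-separator. -/
theorem maxRun_runs (h0 : s.reg 0 = n) (h1 : s.reg 1 = c) (hw : n + 2 < 2 ^ w) :
    Runs w maxRun s ((n + 1) * 60) fun s' => MaxRun c n (s.mem 31) (s'.reg 2) := by
  have hw0 : w ≠ 0 := by rintro rfl; simp at hw
  apply Runs.time_le
  · apply Runs.seq
    · exact Runs.straight (Q := fun s' => s'.reg 2 = 0) ⟨by simp, by simp⟩
    intro s1 hS1 f2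
    apply Runs.seq
    · exact Runs.straight (Q := fun s' => s'.reg 25 = c) ⟨trivial, by simp [hS1.1 1 rfl, h1]⟩
    intro s2 hS2 f25
    have f2 : s2.reg 2 = 0 := (hS2.1 2 rfl).trans f2
    have g0 : s2.reg 0 = n := (hS2.1 0 rfl).trans ((hS1.1 0 rfl).trans h0)
    have g1 : s2.reg 1 = c := (hS2.1 1 rfl).trans ((hS1.1 1 rfl).trans h1)
    have g31 : s2.mem 31 = s.mem 31 := (hS2.2 31 rfl).trans (hS1.2 31 rfl)
    refine Runs.for_const (m := n - c) (T := 40) (I := fun i s' =>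
        MaxRun c (c + i) (s.mem 31) (s'.reg 2) ∧ c ≤ s'.reg 25 ∧ s'.reg 25 ≤ c + i ∧
          (s'.reg 25 = c ∨ s.mem 31 (s'.reg 25) ≠ 0) ∧
          ∀ r, s'.reg 25 < r → r < c + i → s.mem 31 r = 0) rfl
      (fun s' hS => ⟨by simp, by simp [hS.1 0 rfl, hS.1 1 rfl, g0, g1]⟩)
      (fun _ _ _ h => by simpa using h) ?_ ?_ ?_
    · refine ⟨⟨fun p q _ _ _ => by omega, .inl f2⟩, f25.ge, f25.le, .inl f25, fun r => by omega⟩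
    · rintro i s3 hi h23 hS3 ⟨⟨i1, i2⟩, i3, i4, i5, i6⟩
      have e1 : s3.reg 1 = c := (hS3.1 1 rfl).trans g1
      have e31 : s3.mem 31 = s.mem 31 := (hS3.2 31 rfl).trans g31
      apply Runs.time_le
      · apply Runs.seq
        · refine Runs.straight (p := assign 24 (reg 1 + reg 23)) (Q := fun s' => s'.reg 24 = c + i)
            ⟨by simp [e1, h23]; omega, by simp [e1, h23]⟩
        intro s4 hS4 h24
        rw [← hS4.1 25 rfl] at i3 i4 i5 i6
        have e31 : s4.mem 31 = s.mem 31 := (hS4.2 31 rfl).trans e31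
        apply Runs.seq
        · refine Runs.straight (Q := fun s' => c ≤ s'.reg 25 ∧ s'.reg 25 ≤ c + i ∧
            (s'.reg 25 = c ∨ s.mem 31 (s'.reg 25) ≠ 0) ∧
            ∀ r, s'.reg 25 < r → r < c + (i + 1) → s.mem 31 r = 0)
            ⟨trivial, fun hc => ⟨trivial, ?_⟩, fun hc => ⟨i3, i4, i5, fun r r1 r2 => ?_⟩⟩
          · simp only [val_load, val_reg, h24, e31] at hc
            simp [h24, hc]
            omega
          · simp only [val_load, val_reg, h24, e31] at hc
            rcases Nat.lt_or_ge r (c + i) with h | h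
            · exact i6 r r1 h
            · rw [show r = c + i by omega]; exact hc
        rintro s5 hS5 ⟨j3, j4, j5, j6⟩
        have h24 : s5.reg 24 = c + i := (hS5.1 24 rfl).trans h24
        rw [← hS4.1 2 rfl, ← hS5.1 2 rfl] at i1 i2
        have key : ∀ M', s5.reg 2 ≤ M' → c + i + 1 - s5.reg 25 ≤ M' →
            (M' = s5.reg 2 ∨ M' = c + i + 1 - s5.reg 25) → MaxRun c (c + (i + 1)) (s.mem 31) M' := by
          intro M' m1 m2 m3
          constructor
          · intro p q hp hpq hq hr
            rcases Nat.lt_or_ge q (c + i) with h | h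
            · exact (i1 p q hp hpq h hr).trans m1
            · have : s5.reg 25 ≤ p := by
                by_contra hlt
                rcases j5 with j5 | j5
                · omega
                · exact j5 (hr _ (by omega) (by omega))
              omega
          · rcases m3 with rfl | rfl
            · refine i2.imp id fun ⟨p, q, p1, p2, p3, p4⟩ => ⟨p, q, p1, p2, by omega, p4⟩
            · exact .inr ⟨s5.reg 25, c + i, j3, j4, by omega, fun r r1 r2 => j6 r r1 (by omega), rfl⟩
        refine Runs.straight ⟨by simp [h24, hw0]; omega, fun hc => ?_, fun hc => ?_⟩
        · have hlt : s5.reg 2 < c + i + 1 - s5.reg 25 := by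
            by_contra h'; simp [h24, h'] at hc
          refine ⟨by simp [h24, hw0]; omega, ?_⟩
          simp only [setReg_reg, val_sub, val_add, val_reg, val_const, h24]
          exact ⟨key _ hlt.le le_rfl (.inr rfl), j3, by simp; omega, j5, j6⟩
        · have hlt : c + i + 1 - s5.reg 25 ≤ s5.reg 2 := by
            by_contra h'; simp [h24, show s5.reg 2 < c + i + 1 - s5.reg 25 by omega] at hc
          exact ⟨key _ le_rfl hlt (.inl rfl), j3, by omega, j5, j6⟩
      · simp [Prog.time]
    · rintro s3 hS3 - ⟨i1, -⟩
      by_cases hc : c ≤ n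
      · rwa [show c + (n - c) = n by omega] at i1
      · refine ⟨fun p q _ _ _ => by omega, .inl ?_⟩
        rcases i1.2 with h | ⟨p, q, _, _, _, _⟩ <;> omega
  · simp [Prog.time]; omega

theorem makeBlocks_runs (h0 : s.reg 0 = n) (h1 : s.reg 1 = c) (h2 : s.reg 2 = k) (hk : 0 < k)
    (hcn : c ≤ n) (hck : c ≤ k) (hM : MaxRun c n (s.mem 31) M) (hw : n + 2 < 2 ^ w) :
    Runs w makeBlocks s ((n + 1) * 200) fun s' =>
      Greedy n c k M (s.mem 31) (s'.reg 3) (s'.mem 5) (s'.mem 6) := by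
  have hw0 : w ≠ 0 := by rintro rfl; simp at hw
  apply Runs.time_le
  · apply Runs.seq
    · refine Runs.fill (A := 6) (m := c) (f := id) (T := 3) rfl
        (fun s' hS => ⟨trivial, (hS.1 1 rfl).trans h1⟩) ?_
      intro x s3 hx h31 hS3 _
      refine Runs.time_le (T := Prog.time (store 6 (reg 31) (reg 31))) (Runs.straight ?_) le_rfl
      refine ⟨trivial, by simp, by simp [h31], ?_⟩
      intro j hj; simp [h31, hj]
    rintro s1 hS1 ⟨f6, -⟩
    have g0 : s1.reg 0 = n := (hS1.1 0 rfl).trans h0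
    have g1 : s1.reg 1 = c := (hS1.1 1 rfl).trans h1
    have g2 : s1.reg 2 = k := (hS1.1 2 rfl).trans h2
    have g31 : s1.mem 31 = s.mem 31 := hS1.2 31 rfl
    apply Runs.seq
    · refine Runs.straight (p := store 5 (const 0) (const 0)) (Q := fun s' => s'.mem 5 0 = 0)
        ⟨by simp, by simp, by simp⟩
    intro s2 hS2 e0
    apply Runs.seq
    · refine Runs.straight (p := store 5 (const 1) (reg 1)) (Q := fun s' => s'.mem 5 0 = 0 ∧ s'.mem 5 1 = c)
        ⟨by simp [hw0], trivial, by simp [e0], by simp [hS2.1 1 rfl, g1]⟩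
    rintro s3 hS3 ⟨e0, e1⟩
    apply Runs.seq
    · refine Runs.straight (p := store 5 (const 2) (reg 1))
        (Q := fun s' => s'.mem 5 0 = 0 ∧ s'.mem 5 1 = c ∧ s'.mem 5 2 = c)
        ⟨by simp; omega, trivial, by simp [e0], by simp [e1], by simp [hS3.1 1 rfl, hS2.1 1 rfl, g1]⟩
    rintro s4 hS4 ⟨e0, e1, e2⟩
    apply Runs.seq
    · exact Runs.straight (p := assign 3 (const 2)) (Q := fun s' => s'.reg 3 = 2)
        ⟨by simp; omega, by simp⟩
    intro s5 hS5 f3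
    have hS : Same [3] [5] s1 s5 := (((hS2.mono (by simp [Prog.wr]) (by simp [Prog.wm])).trans
      (hS3.mono (by simp [Prog.wr]) (by simp [Prog.wm]))).trans
      (hS4.mono (by simp [Prog.wr]) (by simp [Prog.wm]))).trans
      (hS5.mono (by simp [Prog.wr]) (by simp [Prog.wm]))
    rw [← hS5.2 5 rfl] at e0 e1 e2
    rw [← hS.2 6 rfl] at f6
    have g0 := (hS.1 0 rfl).trans g0
    have g1 := (hS.1 1 rfl).trans g1
    have g2 := (hS.1 2 rfl).trans g2
    have g31 := (hS.2 31 rfl).trans g31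
    refine Runs.for_const (m := n - c) (T := 75) (I := fun i s' =>
        Greedy (c + i) c k M (s.mem 31) (s'.reg 3) (s'.mem 5) (s'.mem 6) ∧ s'.reg 3 ≤ i + 2) rfl
      (fun s' hS => ⟨by simp, by simp [hS.1 0 rfl, hS.1 1 rfl, g0, g1]⟩)
      (fun _ _ _ h => by simpa using h) ?_ ?_ ?_
    · rw [f3]
      refine ⟨⟨⟨e0, e1, e2, le_rfl, ?_, fun b _ _ => by omega, by omega, ?_, f6, ?_⟩, by simp, ?_⟩, le_rfl⟩
      · intro b hb
        obtain rfl | rfl : b = 0 ∨ b = 1 := by omega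
        · rw [e0]; exact Nat.zero_le _
        · rw [e1, e2]
      · intro b hb1 hb2
        obtain rfl : b = 1 := by omega
        rw [e1, e2]; omega
      · intro b p hb1 hb2 h3 h4
        obtain rfl : b = 1 := by omega
        rw [e1] at h3; rw [e2] at h4; omega
      · rw [e1]; intro r; omega
    · rintro i s6 hi h23 hS6 ⟨hG, hm⟩
      have e1 := (hS6.1 1 rfl).trans g1
      have e2 := (hS6.1 2 rfl).trans g2
      have e31 := (hS6.2 31 rfl).trans g31
      have h2m := hG.two_le
      have hR : ∀ p, c ≤ p → p ≤ c + i → NoRoot (s.mem 31) p (c + i) → c + i + 1 - p ≤ M :=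
        fun p h1 h2 h3 => hM.1 p _ h1 h2 (by omega) h3
      apply Runs.time_le
      · apply Runs.seq
        · exact Runs.straight (p := assign 24 (reg 1 + reg 23)) (Q := fun s' => s'.reg 24 = c + i)
            ⟨by simp [e1, h23]; omega, by simp [e1, h23]⟩
        intro s7 hS7 h24
        rw [← hS7.2 5 rfl, ← hS7.2 6 rfl, ← hS7.1 3 rfl] at hG
        rw [← hS7.1 3 rfl] at hm h2m
        have e1 := (hS7.1 1 rfl).trans e1
        have e2 := (hS7.1 2 rfl).trans e2
        have e31 := (hS7.2 31 rfl).trans e31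
        apply Runs.seq
        · refine Runs.straight (Q := fun s' =>
            ∃ bs, (∀ j, j ≠ s'.reg 3 → s'.mem 5 j = bs j) ∧
              Greedy (c + i) c k M (s.mem 31) (s'.reg 3) bs (s'.mem 6) ∧ s'.reg 3 ≤ i + 3 ∧
              (s.mem 31 (c + i) = 0 ∨ c + i - bs (s'.reg 3 - 1) < k))
            ⟨trivial, fun hc => ⟨by simp [hw0], fun hd => ?_, fun hd => ⟨by simp [hw0]; omega, ?_⟩⟩, fun hc => ?_⟩
          · simp only [val_less, val_sub, val_load, val_reg, val_const, h24, e2] at hd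
            refine ⟨_, fun _ _ => rfl, hG, by omega, .inr ?_⟩
            by_contra h'
            exact hd (if_neg h')
          · simp only [val_less, val_sub, val_load, val_reg, val_const, h24, e2] at hd
            simp only [val_load, val_reg, h24, e31] at hc
            have hd : k ≤ c + i - s7.mem 5 (s7.reg 3 - 1) := by
              by_contra h'
              exact one_ne_zero ((if_pos (not_le.1 h')).symm.trans hd)
            simp only [setReg_reg, setReg_mem, val_add, val_reg, val_const, if_true]
            refine ⟨_, ?_, hG.add_block hc hd hck fun _ => rfl, by omega, .inr ?_⟩
            · intro j hj; rw [if_neg hj]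
            · rw [Nat.add_sub_cancel, if_neg (by omega), hG.bs_m]; omega
          · simp only [val_load, val_reg, h24, e31] at hc
            exact ⟨_, fun _ _ => rfl, hG, by omega, .inl hc⟩
        rintro s8 hS8 ⟨bs, hb, hG, hm, hl⟩
        have h24 := (hS8.1 24 rfl).trans h24
        have e1 := (hS8.1 1 rfl).trans e1
        have h2m := hG.two_le
        have hb1 := hb (s8.reg 3 - 1) (by omega)
        have hG' := hG.grow (bs' := fun j => if j = s8.reg 3 then c + i + 1 else s8.mem 5 j)
          (loc' := fun j => if j = c + i then c + (c + i - bs (s8.reg 3 - 1)) else s8.mem 6 j)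
          (by omega) hck hR hl (fun j => by split_ifs with h; exacts [rfl, hb j h]) fun _ => rfl
        refine Runs.straight (p := _ ;; _) ⟨by simp [h24], ?_, by simp, by simp [h24, hw0]; omega, ?_, ?_⟩
        · have := hG.s_le_bs (b := s8.reg 3 - 1) (by omega) (by omega)
          simp [h24, e1, hw0, hb1]; omega
        · convert hG' using 1
          · rfl
          · simp
          · funext j; simp [h24]
          · funext j; simp [h24, e1, hb1]
        · simp; omega
      · simp [Prog.time]
    · rintro s6 - - ⟨h1, -⟩
      rwa [show c + (n - c) = n by omega] at h1
  · simp [Prog.time]; omega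

end

/-! ### Parameters and tables. -/

theorem spread_zero (n L : ℕ) : spread n L 0 = 0 := by
  induction L with
  | zero => rfl
  | succ L ih => rw [spread, Nat.zero_div, Nat.zero_mod, ih, zero_mul]

/-- The power of a register. -/
def pw (r : ℕ) : ℕ → Expr
  | 0 => const 1
  | q + 1 => pw r q * reg r

theorem pw_spec {w r q x : ℕ} {s : State} (hw : w ≠ 0) (hx : 0 < x) (h : s.reg r = x)
    (hlt : x ^ q < 2 ^ w) : (pw r q).safe w s ∧ (pw r q).val s = x ^ q := by
  induction q with
  | zero => exact ⟨by simp [pw, hw], rfl⟩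
  | succ q ih =>
    obtain ⟨h1, h2⟩ := ih ((Nat.pow_le_pow_right hx (Nat.le_succ q)).trans_lt hlt)
    simp only [pw, safe_mul, safe_reg, val_mul, val_reg, h1, h2, h, true_and]
    exact ⟨by rwa [← pow_succ], (pow_succ _ _).symm⟩

theorem pw_cost (r q : ℕ) : (pw r q).cost = 2 * q + 1 := by
  induction q with
  | zero => rfl
  | succ q ih => rw [pw, cost_mul, ih, cost_reg]; ring

/-- The entries of the tables of coefficients. -/
def MulAlg.coef (a : MulAlg) (t i : ℕ) : ℤ :=
  if t = 8 then a.α (i / (a.n * a.n)) (i % (a.n * a.n))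
  else if t = 9 then a.β (i / (a.n * a.n)) (i % (a.n * a.n)) else a.γ (i % a.r) (i / a.r)

/-- The cells of the tables of coefficients. -/
def MulAlg.cells (a : MulAlg) : List (ℕ × ℕ) :=
  [8, 9, 10].flatMap fun t => (List.range (a.r * (a.n * a.n))).map fun i => (t, i)

theorem MulAlg.mem_cells {a : MulAlg} {t i : ℕ} :
    (t, i) ∈ a.cells ↔ (t = 8 ∨ t = 9 ∨ t = 10) ∧ i < a.r * (a.n * a.n) := by
  simp [MulAlg.cells, eq_comm (b := t)]
  tauto

/-- The representation of `z / D` modulo `M = D * N + 1`. -/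
def modInv (M N : ℕ) (z : ℤ) : ℕ := (z.toNat * (M - N) + (-z).toNat * N) % M

/-- Words are natural numbers, so the positive part of `z` is multiplied by `M - N`, which
represents `-N`, and the negative part by `N`. -/
theorem modInv_spec {M N : ℕ} (z : ℤ) (h : N ≤ M) :
    (modInv M N z : ZMod M) = -((N : ℕ) : ZMod M) * z := by
  have h1 : ((z.toNat : ℤ) - (-z).toNat : ℤ) = z := Int.toNat_sub_toNat_neg z
  rw [modInv, ZMod.natCast_mod]
  conv_rhs => rw [← h1]
  push_cast [Nat.cast_sub h]
  rw [ZMod.natCast_self]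
  ring

theorem modInv_bound {M N : ℕ} (z : ℤ) (h : N ≤ M) :
    z.toNat * (M - N) + (-z).toNat * N ≤ z.natAbs * M := by
  rcases le_total 0 z with hz | hz
  · rw [show (-z).toNat = 0 by omega, zero_mul, add_zero]
    exact Nat.mul_le_mul (by omega) (by omega)
  · rw [show z.toNat = 0 by omega, zero_mul, zero_add]
    exact Nat.mul_le_mul (by omega) h

/-- Writes the tables of coefficients. -/
def coefs (f : ℕ → ℕ → ℤ) : List (ℕ × ℕ) → Prog
  | [] => skip
  | x :: l => store x.1 (const x.2)
      ((const (f x.1 x.2).toNat * (reg 8 - reg 4) + const (-f x.1 x.2).toNat * reg 4) % reg 8) ;;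
      coefs f l

theorem coefs_runs {w M N : ℕ} {f : ℕ → ℕ → ℤ} {l : List (ℕ × ℕ)} {s : State} (h8 : s.reg 8 = M)
    (h4 : s.reg 4 = N) (hN : 0 < N) (hNM : N < M)
    (hw : ∀ x ∈ l, x.2 < 2 ^ w ∧ (f x.1 x.2).natAbs * M < 2 ^ w) :
    Runs w (coefs f l) s (l.length * 20 + 1) fun s' => s'.reg = s.reg ∧
      ∀ t i, s'.mem t i = if (t, i) ∈ l then modInv M N (f t i) else s.mem t i := by
  induction l generalizing s with
  | nil => exact Runs.straight (p := skip) ⟨rfl, fun t i => by simp⟩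
  | cons x l ih =>
    obtain ⟨h1, h2⟩ := hw x (by simp)
    have h3 := modInv_bound (f x.1 x.2) hNM.le
    have h5 : 0 < M - N := by omega
    have hle : ∀ y c : ℕ, 0 < c → y ≤ y * c := fun y c hc => Nat.le_mul_of_pos_right _ hc
    have h6 := hle (f x.1 x.2).toNat _ h5
    have h7 := hle (-f x.1 x.2).toNat _ hN
    apply Runs.time_le
    · apply Runs.seq
      · refine Runs.straight (p := store _ _ _) (Q := fun s' => s'.reg = s.reg ∧
          ∀ t i, s'.mem t i = if (t, i) = x then modInv M N (f t i) else s.mem t i)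
          ⟨h1, ?_, rfl, fun t i => ?_⟩
        · simp only [safe_mod, safe_add, safe_mul, safe_const, safe_sub, safe_reg, val_mul, val_const,
            val_sub, val_reg, h8, h4, true_and, and_true]
          omega
        · simp only [setMem_mem, val_mod, val_add, val_mul, val_const, val_sub, val_reg, h8, h4,
            Prod.ext_iff]
          split_ifs with hx
          · obtain ⟨rfl, rfl⟩ := hx; rfl
          · rfl
      rintro s1 - ⟨e1, e2⟩
      exact (ih (by rw [e1, h8]) (by rw [e1, h4]) fun y hy => hw y (by simp [hy]))
        |>.mono le_rfl fun s2 _ h => show s2.reg = s.reg ∧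
          ∀ t i, s2.mem t i = if (t, i) ∈ x :: l then modInv M N (f t i) else s.mem t i from
          ⟨h.1.trans e1, fun t i => by
            rw [h.2, e2]
            simp only [List.mem_cons]
            split_ifs <;> simp_all⟩
    · simp [Prog.time]; omega

/-- Computes the dimension of the matrices. -/
def dimension (a : MulAlg) : Prog :=
  (assign 4 (const 1) ;; assign 5 (const 0) ;; assign 6 (const 1) ;; assign 7 (const 1)) ;;
  Prog.loop ((reg 4).less (const 3 * reg 2))
    (assign 4 (reg 4 * const a.n) ;; assign 5 (reg 5 + const 1) ;;
      assign 6 (reg 6 * const (a.n * a.n)) ;; assign 7 (reg 7 * const a.r))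

/-- Computes the base for hashing. -/
def hashBase (q b0 : ℕ) : Prog :=
  assign 9 (const b0) ;;
  Prog.loop ((pw 9 q).less (reg 2)) (assign 9 (reg 9 + const 1))

section
variable {w k : ℕ} {a : MulAlg} {s : State}

theorem MulAlg.two_le_r (a : MulAlg) : 2 ≤ a.r := by
  have h1 := a.two_le
  have h2 := a.sq_le
  nlinarith

theorem MulAlg.dim_le (a : MulAlg) (L : ℕ) :
    a.n ^ L ≤ (a.n * a.n) ^ L ∧ (a.n * a.n) ^ L ≤ a.r ^ L ∧ L < a.r ^ L :=
  ⟨Nat.pow_le_pow_left (Nat.le_mul_of_pos_left _ (by have := a.two_le; omega)) L,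
    Nat.pow_le_pow_left a.sq_le L,
    L.lt_two_pow_self.trans_le (Nat.pow_le_pow_left a.two_le_r L)⟩

/-- The loop stops at the first power of `n` that reaches `3 * k`, so it overshoots by less than a
factor `n`. All powers needed later are computed alongside. -/
theorem dimension_runs (h2 : s.reg 2 = k) (hk : 0 < k) (hkw : 3 * k < 2 ^ w) (hr : a.r < 2 ^ w)
    (hw : ∀ L, a.n ^ L ≤ 3 * k * a.n → a.r ^ L < 2 ^ w) :
    Runs w (dimension a) s (k * 200) fun s' => ∃ L, s'.reg 4 = a.n ^ L ∧ s'.reg 5 = L ∧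
      s'.reg 6 = (a.n * a.n) ^ L ∧ s'.reg 7 = a.r ^ L ∧ 3 * k ≤ a.n ^ L ∧ a.n ^ L ≤ 3 * k * a.n := by
  have hw0 : w ≠ 0 := by rintro rfl; simp at hkw; omega
  have hn := a.two_le
  have hnr := a.sq_le
  have hnn : a.n ≤ a.n * a.n := Nat.le_mul_of_pos_left _ (by omega)
  have h1 : 1 ≤ 3 * k * a.n := Nat.mul_pos (by omega) (by omega)
  apply Runs.time_le
  · apply Runs.seq
    · exact Runs.straight (Q := fun s' => s'.reg 4 = 1 ∧ s'.reg 5 = 0 ∧ s'.reg 6 = 1 ∧ s'.reg 7 = 1)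
        ⟨by simp [hw0], by simp, by simp [hw0], by simp [hw0], by simp, by simp, by simp, by simp⟩
    rintro s1 hS1 ⟨h4, h5, h6, h7⟩
    refine Runs.time_le (T := (3 * k - s1.reg 4 + 1) * (20 + 6)) (T' := 3 * k * 26) (Runs.while (T := 20) (I := fun s' => ∃ L, s'.reg 4 = a.n ^ L ∧ s'.reg 5 = L ∧
      s'.reg 6 = (a.n * a.n) ^ L ∧ s'.reg 7 = a.r ^ L ∧ a.n ^ L ≤ 3 * k * a.n)
      (Φ := fun s' => 3 * k - s'.reg 4) ⟨0, h4, h5, h6, h7, by simpa using h1⟩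
      (fun s' hS' _ => ?_) ?_ ?_) (Nat.mul_le_mul_right _ (by omega))
    · have := (hS'.1 2 rfl).trans ((hS1.1 2 rfl).trans h2)
      simp [this]; omega
    · rintro s2 hS2 ⟨L, g4, g5, g6, g7, -⟩ hc
      have g2 := (hS2.1 2 rfl).trans ((hS1.1 2 rfl).trans h2)
      have hc : a.n ^ L < 3 * k := by
        by_contra h'
        simp [g4, g2, h'] at hc
      have hle : a.n ^ (L + 1) ≤ 3 * k * a.n := by
        rw [pow_succ]; exact Nat.mul_le_mul_right _ hc.le
      have hlt := hw _ hle
      obtain ⟨d1, d2, d3⟩ := a.dim_le (L + 1)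
      have hpos : 0 < a.n ^ L := by positivity
      have hgt : a.n ^ L < a.n ^ (L + 1) := by rw [pow_succ]; nlinarith
      refine Runs.time_le (T := Prog.time (assign 4 (reg 4 * const a.n) ;; assign 5 (reg 5 + const 1) ;;
        assign 6 (reg 6 * const (a.n * a.n)) ;; assign 7 (reg 7 * const a.r)))
        (Runs.straight ⟨?_, ?_, ?_, ?_, ⟨L + 1, ?_, ?_, ?_, ?_, hle⟩, ?_⟩) (by simp [Prog.time])
      · simp [g4, ← pow_succ]; omega
      · simp [g5, hw0]; omega
      · simp [g6, ← pow_succ]; omega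
      · simp [g7, ← pow_succ]; omega
      · simp [g4, pow_succ]
      · simp [g5]
      · simp [g6, pow_succ]
      · simp [g7, pow_succ]
      · simp [g4, ← pow_succ]; omega
    · rintro s2 hS2 ⟨L, g4, g5, g6, g7, g8⟩ hc
      have g2 := (hS2.1 2 rfl).trans ((hS1.1 2 rfl).trans h2)
      refine ⟨L, g4, g5, g6, g7, ?_, g8⟩
      by_contra h'
      simp [g4, g2, show a.n ^ L < 3 * k by omega] at hc
  · simp [Prog.time]; omega

/-- Linear search for the first `b ≥ b0` with `k ≤ b ^ q`. It takes at most `k` rounds, and unless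
`b = b0` the base is about `k ^ (1 / q)`. -/
theorem hashBase_runs {q b0 : ℕ} (h2 : s.reg 2 = k) (hk : 0 < k) (hq : 0 < q) (hb : 0 < b0)
    (hw : (b0 + k) ^ q < 2 ^ w) :
    Runs w (hashBase q b0) s (k * (4 * q + 30)) fun s' =>
      b0 ≤ s'.reg 9 ∧ s'.reg 9 ≤ b0 + k ∧ k ≤ s'.reg 9 ^ q ∧
        (s'.reg 9 = b0 ∨ (s'.reg 9 - 1) ^ q < k) := by
  have hle : ∀ x : ℕ, x ≤ x ^ q := fun x => Nat.le_self_pow hq.ne' x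
  have hbk := hle (b0 + k)
  have hw0 : w ≠ 0 := by rintro rfl; simp at hw; omega
  apply Runs.time_le
  · apply Runs.seq
    · exact Runs.straight (Q := fun s' => s'.reg 9 = b0) ⟨by simp; omega, by simp⟩
    intro s1 hS1 h9
    have hp : ∀ s' : State, b0 ≤ s'.reg 9 → s'.reg 9 ≤ b0 + k →
        (pw 9 q).safe w s' ∧ (pw 9 q).val s' = s'.reg 9 ^ q := fun s' g1 g2 =>
      pw_spec hw0 (by omega) rfl ((Nat.pow_le_pow_left g2 q).trans_lt hw)
    refine Runs.time_le (T := (b0 + k - s1.reg 9 + 1) * (4 + (2 * q + 1 + 1 + 1 + 1)))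
      (T' := (k + 1) * (2 * q + 8)) (pw_cost 9 q ▸ Runs.while (T := 4) (I := fun s' => b0 ≤ s'.reg 9 ∧ s'.reg 9 ≤ b0 + k ∧
        (s'.reg 9 = b0 ∨ (s'.reg 9 - 1) ^ q < k))
      (Φ := fun s' => b0 + k - s'.reg 9) ⟨h9.ge, by omega, .inl h9⟩
      (fun s' hS' h => by simpa using (hp s' h.1 h.2.1).1) ?_ ?_)
      (Nat.mul_le_mul (by omega) (by omega))
    · rintro s2 hS2 ⟨g1, g3, -⟩ hc
      have g2 := (hS2.1 2 rfl).trans ((hS1.1 2 rfl).trans h2)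
      have hc : s2.reg 9 ^ q < k := by
        by_contra h'
        simp [(hp s2 g1 g3).2, g2, h'] at hc
      have := hle (s2.reg 9)
      refine Runs.time_le (T := Prog.time (assign 9 (reg 9 + const 1)))
        (Runs.straight ⟨by simp [hw0]; omega, ?_, ?_⟩) (by simp [Prog.time])
      · simp only [setReg_reg, val_add, val_reg, val_const, if_true]
        exact ⟨by omega, by omega, .inr (by rwa [Nat.add_sub_cancel])⟩
      · simp; omega
    · rintro s2 hS2 ⟨g1, g3, g4⟩ hc
      have g2 := (hS2.1 2 rfl).trans ((hS1.1 2 rfl).trans h2)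
      refine ⟨g1, g3, ?_, g4⟩
      by_contra h'
      simp [(hp s2 g1 g3).2, g2, show s2.reg 9 ^ q < k by omega] at hc
  · simp [Prog.time]; nlinarith

/-- Computes the parameters and the tables. -/
def makeParams (a : MulAlg) (l q b0 A Dg : ℕ) : Prog :=
  dimension a ;; hashBase q b0 ;;
  assign 8 (const a.D * reg 4 + const 1) ;;
  assign 10 (reg 9 * const (A ^ Dg) + const 1) ;;
  assign 11 (const A * pw 10 l) ;;
  store 7 (const 0) (const 0) ;;
  forTo 31 (reg 4)
    (store 7 (reg 31) (load 7 (reg 31 / const a.n) * const (a.n * a.n) + reg 31 % const a.n)) ;;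
  coefs a.coef a.cells

/-- Words are large enough for the parameters. -/
structure Room (w : ℕ) (a : MulAlg) (l q b0 A Dg k : ℕ) : Prop where
  three : 3 * k < 2 ^ w
  r : a.r * (a.n * a.n) < 2 ^ w
  pow : ∀ L, a.n ^ L ≤ 3 * k * a.n → a.r ^ L < 2 ^ w
  mod : ∀ L, a.n ^ L ≤ 3 * k * a.n → a.mod L * a.mod L + a.mod L < 2 ^ w
  coef : ∀ L, a.n ^ L ≤ 3 * k * a.n → ∀ x ∈ a.cells, (a.coef x.1 x.2).natAbs * a.mod L < 2 ^ w
  base : (b0 + k) ^ q < 2 ^ w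
  R : (b0 + k) * A ^ Dg + 1 < 2 ^ w
  Z : A * ((b0 + k) * A ^ Dg + 1) ^ l < 2 ^ w

theorem coefs_wr (f : ℕ → ℕ → ℤ) (l : List (ℕ × ℕ)) : (coefs f l).wr = [] := by
  induction l with
  | nil => rfl
  | cons x l ih => simp [coefs, Prog.wr, ih]

theorem MulAlg.coefs_wm (a : MulAlg) : (coefs a.coef a.cells).wm ⊆ [8, 9, 10] := by
  have : ∀ l : List (ℕ × ℕ), (coefs a.coef l).wm ⊆ l.map Prod.fst := by
    intro l
    induction l with
    | nil => exact List.Subset.refl _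
    | cons x l ih => exact List.cons_subset_cons _ ih
  intro t ht
  obtain ⟨⟨t', i⟩, hx, rfl⟩ := List.mem_map.1 (this _ ht)
  simpa using (MulAlg.mem_cells.1 hx).1

theorem makeParams_wr (a : MulAlg) (l q b0 A Dg : ℕ) :
    (makeParams a l q b0 A Dg).wr ⊆ [4, 5, 6, 7, 9, 8, 10, 11, 31] := by
  simp [makeParams, dimension, hashBase, forTo, Prog.wr, coefs_wr]

theorem makeParams_wm (a : MulAlg) (l q b0 A Dg : ℕ) :
    (makeParams a l q b0 A Dg).wm ⊆ [7, 8, 9, 10] := by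
  have := a.coefs_wm
  simp only [makeParams, dimension, hashBase, forTo, Prog.wm, List.append_subset, List.nil_append]
  refine ⟨by simp, by simp, fun x hx => by have := this hx; simp at this ⊢; tauto⟩

theorem exists_makeParams_runs (a : MulAlg) (l q b0 A Dg : ℕ) (hq : 0 < q) (hb : 0 < b0)
    (hA : 0 < A) : ∃ K, ∀ {w k : ℕ} {s : State}, s.reg 2 = k → 0 < k → Room w a l q b0 A Dg k →
    Runs w (makeParams a l q b0 A Dg) s (K * k) fun s' =>
      ∃ L b, MulEnv w a L s' ∧ 3 * k ≤ a.n ^ L ∧ a.n ^ L ≤ 3 * k * a.n ∧ b0 ≤ b ∧ k ≤ b ^ q ∧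
        (b = b0 ∨ (b - 1) ^ q < k) ∧ b ≤ b0 + k ∧ s'.reg 9 = b ∧ s'.reg 10 = b * A ^ Dg + 1 ∧
        s'.reg 11 = A * (b * A ^ Dg + 1) ^ l := by
  refine ⟨a.n * 100 + 4 * q + 400 + 2 * l + a.cells.length * 20, ?_⟩
  intro w k s h2 hk hw
  have hn := a.two_le
  have hr2 := a.two_le_r
  have hw0 : w ≠ 0 := by rintro rfl; have := hw.three; simp at this; omega
  have hnr : a.n * a.n ≤ a.r * (a.n * a.n) := Nat.le_mul_of_pos_left _ (by omega)
  have hrr : a.r ≤ a.r * (a.n * a.n) := Nat.le_mul_of_pos_right _ (by positivity)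
  have hnn : a.n ≤ a.n * a.n := Nat.le_mul_of_pos_left _ (by omega)
  have hrw := hw.r
  apply Runs.time_le
  · apply Runs.seq
    · exact dimension_runs h2 hk hw.three (by omega) hw.pow
    rintro s1 hS1 ⟨L, h4, h5, h6, h7, hL1, hL2⟩
    have hpos : 0 < a.n ^ L := by positivity
    have hmod := hw.mod L hL2
    have hM1 : a.n ^ L < a.mod L := by
      have := Nat.mul_le_mul_right (a.n ^ L) a.pos
      rw [MulAlg.mod]; omega
    obtain ⟨d1, d2, d3⟩ := a.dim_le L
    have hpow := hw.pow L hL2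
    apply Runs.seq
    · exact hashBase_runs ((hS1.1 2 rfl).trans h2) hk hq hb hw.base
    intro s2 hS2 h9
    obtain ⟨b, hb9⟩ : ∃ b, s2.reg 9 = b := ⟨_, rfl⟩
    rw [hb9] at h9
    obtain ⟨b1, b2, b3, b4⟩ := h9
    have hR1 : b * A ^ Dg ≤ (b0 + k) * A ^ Dg := Nat.mul_le_mul_right _ b2
    have hR := hw.R
    have hZ1 : A * (b * A ^ Dg + 1) ^ l ≤ A * ((b0 + k) * A ^ Dg + 1) ^ l := by gcongr
    have hZ := hw.Z
    have hZ2 : (b * A ^ Dg + 1) ^ l ≤ A * (b * A ^ Dg + 1) ^ l := Nat.le_mul_of_pos_left _ hA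
    have hA1 : A ≤ A * (b * A ^ Dg + 1) ^ l := Nat.le_mul_of_pos_right _ (by positivity)
    have hA2 : A ^ Dg ≤ b * A ^ Dg := Nat.le_mul_of_pos_left _ (by omega)
    have h4 := (hS2.1 4 rfl).trans h4
    apply Runs.seq
    · refine Runs.straight (p := assign 8 _) (Q := fun s' => s'.reg 8 = a.mod L)
        ⟨?_, by simp [h4, MulAlg.mod]⟩
      have h8 : a.D * a.n ^ L + 1 = a.mod L := rfl
      have := Nat.le_mul_of_pos_right a.D hpos
      simp [h4, hw0]; omega
    intro s3 hS3 h8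
    have h9 := (hS3.1 9 rfl).trans hb9
    apply Runs.seq
    · refine Runs.straight (p := assign 10 _) (Q := fun s' => s'.reg 10 = b * A ^ Dg + 1)
        ⟨?_, by simp [h9]⟩
      simp [h9, hw0]; omega
    intro s4 hS4 h10
    apply Runs.seq
    · obtain ⟨p1, p2⟩ := pw_spec (q := l) hw0 (Nat.succ_pos _) h10 (hZ2.trans_lt (hZ1.trans_lt hZ))
      refine Runs.straight (p := assign 11 _)
        (Q := fun s' => s'.reg 11 = A * (b * A ^ Dg + 1) ^ l) ⟨?_, by simp [p2]⟩
      simp only [safe_mul, safe_const, val_mul, val_const, p1, p2, true_and]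
      exact ⟨hA1.trans_lt (hZ1.trans_lt hZ), hZ1.trans_lt hZ⟩
    intro s5 hS5 h11
    apply Runs.seq
    · exact Runs.straight (p := store 7 (const 0) (const 0)) (Q := fun s' => s'.mem 7 0 = 0)
        ⟨by simp, by simp, by simp⟩
    intro s6 hS6 hz
    have hS : Same [8, 10, 11] [7] s2 s6 := (((hS3.mono (by simp [Prog.wr]) (by simp [Prog.wm])).trans
      (hS4.mono (by simp [Prog.wr]) (by simp [Prog.wm]))).trans
      (hS5.mono (by simp [Prog.wr]) (by simp [Prog.wm]))).trans
      (hS6.mono (by simp [Prog.wr]) (by simp [Prog.wm]))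
    have h4 := (hS.1 4 rfl).trans h4
    have h8 := (hS6.1 8 rfl).trans ((hS5.1 8 rfl).trans ((hS4.1 8 rfl).trans h8))
    have hsp : ∀ i < a.n ^ L, spread a.n L i < (a.n * a.n) ^ L := fun i hi => by
      have := addr_lt (n := a.n) (L := L) hi hi
      rw [addr] at this; omega
    apply Runs.seq
    · refine Runs.time_le (T' := (3 * k * a.n + 1) * 20) (Runs.for_const (m := a.n ^ L) (T := 12)
        (Q := fun s' => ∀ j < a.n ^ L, s'.mem 7 j = spread a.n L j)
        (I := fun i s' => s'.mem 7 0 = 0 ∧ ∀ j < i, s'.mem 7 j = spread a.n L j) rfl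
        (fun s' hS' => ⟨trivial, (hS'.1 4 rfl).trans h4⟩) (fun _ _ _ h => h) ⟨hz, by simp⟩ ?_
        (fun _ _ _ h => h.2)) (Nat.mul_le_mul_right _ (by omega))
      rintro i s7 hi h31 hS7 ⟨i0, i1⟩
      -- The table is filled by splitting off the lowest digit. Index `0` refers to itself, which is
      -- why cell `0` is initialized before the loop.
      have h5 : s7.mem 7 (i / a.n) * (a.n * a.n) + i % a.n = spread a.n L i := by
        rw [spread_eq (by omega) hi]
        rcases Nat.eq_zero_or_pos i with rfl | h
        · rw [Nat.zero_div, i0]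
          rw [spread_zero, zero_mul, Nat.zero_mod]
        · rw [i1 _ (Nat.div_lt_self h (by omega))]
      have h6 := hsp i hi
      refine Runs.time_le (T := Prog.time (store 7 (reg 31) (load 7 (reg 31 / const a.n) *
        const (a.n * a.n) + reg 31 % const a.n))) (Runs.straight ⟨trivial, ?_, ?_, ?_⟩)
        (by simp [Prog.time])
      · simp only [safe_add, safe_mul, safe_load, safe_div, safe_reg, safe_const, safe_mod, val_load,
          val_div, val_reg, val_const, val_mul, val_mod, h31, true_and, h5]
        omega
      · simp only [setMem_mem, val_add, val_load, val_div, val_reg, val_const, val_mul, val_mod, h31, h5,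
          true_and]
        split_ifs with h
        · rw [← h, spread_zero]
        · exact i0
      · intro j hj
        simp only [setMem_mem, val_add, val_load, val_div, val_reg, val_const, val_mul, val_mod, h31, h5,
          true_and]
        split_ifs with h
        · rw [h]
        · exact i1 j (by omega)
    intro s7 hS7 hm7
    have h4 := (hS7.1 4 rfl).trans h4
    have h8 := (hS7.1 8 rfl).trans h8
    refine (coefs_runs h8 h4 hpos hM1 fun x hx => ⟨?_, hw.coef L hL2 x hx⟩).mono le_rfl ?_
    · have := (MulAlg.mem_cells.1 (show (x.1, x.2) ∈ a.cells from hx)).2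
      omega
    · rintro s8 hS8 ⟨hr, hm⟩
      have hval : ∀ t i, (t = 8 ∨ t = 9 ∨ t = 10) → i < a.r * (a.n * a.n) → s8.mem t i < a.mod L ∧
          (s8.mem t i : ZMod (a.mod L)) = -((a.n ^ L : ℕ) : ZMod (a.mod L)) * a.coef t i := by
        intro t i ht hi
        rw [hm, if_pos (MulAlg.mem_cells.2 ⟨ht, hi⟩)]
        exact ⟨Nat.mod_lt _ (by omega), modInv_spec _ hM1.le⟩
      have hqx : ∀ q < a.r, ∀ x < a.n * a.n, q * (a.n * a.n) + x < a.r * (a.n * a.n) ∧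
          (q * (a.n * a.n) + x) / (a.n * a.n) = q ∧ (q * (a.n * a.n) + x) % (a.n * a.n) = x := by
        intro q hq x hx
        have h := Nat.mul_le_mul_right (a.n * a.n) (Nat.succ_le_of_lt hq)
        rw [Nat.succ_mul] at h
        refine ⟨by omega, ?_, ?_⟩
        · rw [mul_comm, Nat.mul_add_div (by omega), Nat.div_eq_of_lt hx, add_zero]
        · rw [mul_comm, Nat.mul_add_mod, Nat.mod_eq_of_lt hx]
      have hf : Same [31] [7] s6 s7 := hS7.mono (by simp [forTo, Prog.wr]) (by simp [forTo, Prog.wm])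
      have hold : ∀ r, [8, 10, 11, 31].elem r = false → s8.reg r = s2.reg r := fun r hr' => by
        rw [hr, hf.1 r (by simp at hr' ⊢; tauto), hS.1 r (by simp at hr' ⊢; tauto)]
      refine ⟨L, b, ⟨hmod, hpow, hrw, by rw [hr]; exact h4, ?_, ?_, ?_, by rw [hr]; exact h8, ?_, ?_, ?_, ?_⟩,
        hL1, hL2, b1, b3, b4, b2, ?_, ?_, ?_⟩
      · rw [hold 5 rfl, hS2.1 5 rfl, h5]
      · rw [hold 6 rfl, hS2.1 6 rfl, h6]
      · rw [hold 7 rfl, hS2.1 7 rfl, h7]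
      · intro i hi
        rw [hm, if_neg (fun h => by have := (MulAlg.mem_cells.1 h).1; omega)]
        exact hm7 i hi
      · intro q hq x hx
        obtain ⟨g1, g2, g3⟩ := hqx q hq x hx
        have := hval 8 _ (by simp) g1
        simpa [MulAlg.coef, g2, g3] using this
      · intro q hq x hx
        obtain ⟨g1, g2, g3⟩ := hqx q hq x hx
        have := hval 9 _ (by simp) g1
        simpa [MulAlg.coef, g2, g3] using this
      · intro x hx q hq
        have h := Nat.mul_le_mul_right a.r (Nat.succ_le_of_lt hx)
        rw [Nat.succ_mul, mul_comm (a.n * a.n)] at h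
        have := hval 10 (x * a.r + q) (by simp) (by omega)
        have g2 : (x * a.r + q) / a.r = x := by
          rw [mul_comm, Nat.mul_add_div (by omega), Nat.div_eq_of_lt hq, add_zero]
        have g3 : (x * a.r + q) % a.r = q := by rw [mul_comm, Nat.mul_add_mod, Nat.mod_eq_of_lt hq]
        simpa [MulAlg.coef, g2, g3] using this
      · rw [hold 9 rfl, hb9]
      · rw [hr, hS7.1 10 rfl, hS6.1 10 rfl, hS5.1 10 rfl, h10]
      · rw [hr, hS7.1 11 rfl, hS6.1 11 rfl, h11]
  · have e1 : (a.n * 100 + 4 * q + 400 + 2 * l + a.cells.length * 20) * k =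
        k * a.n * 100 + 4 * (k * q) + 400 * k + 2 * (l * k) + a.cells.length * k * 20 := by ring
    have e2 : k * (4 * q + 30) = 4 * (k * q) + 30 * k := by ring
    have e3 : l ≤ l * k := Nat.le_mul_of_pos_right _ hk
    have e4 : a.cells.length ≤ a.cells.length * k := Nat.le_mul_of_pos_right _ hk
    simp only [Prog.time, cost_add, cost_mul, cost_const, cost_reg, pw_cost]
    rw [e1, e2]
    have e5 : (3 * k * a.n + 1) * 20 = k * a.n * 60 + 20 := by ring
    rw [e5]
    generalize k * a.n = X1 at *
    generalize k * q = X2 at *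
    generalize l * k = X3 at *
    generalize a.cells.length * k = X4 at *
    omega

end

/-- Words are large enough for a graph of order `n`. -/
structure Big (w : ℕ) (a : MulAlg) (l q b0 A Dg n : ℕ) : Prop where
  n_lt : n + 3 < 2 ^ w
  l_lt : (l + 1) * (n + 1) < 2 ^ w
  room : ∀ k ≤ n, Room w a l q b0 A Dg k
  cells : ∀ k ≤ n, ∀ L, a.n ^ L ≤ 3 * k * a.n → (l + 1) * (l + 1) * (a.n * a.n) ^ L < 2 ^ w
  ids : ∀ k ≤ n, ∀ L, a.n ^ L ≤ 3 * k * a.n → (n + 3) * a.n ^ L < 2 ^ w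

/-- Every number that occurs is bounded by a polynomial in `n + 1` whose coefficients and degree
depend on the fixed parameters only; `W` exceeds all of them. For `r ^ L` the crude bound `r ≤ n ^
r` for the fixed `r` gives degree `r`. -/
theorem exists_big (a : MulAlg) (l q b0 A Dg : ℕ) :
    ∃ W, ∀ w n, W * (n + 1) ^ W < 2 ^ w → Big w a l q b0 A Dg n := by
  obtain ⟨c, hc⟩ : ∃ c, ∀ x ∈ a.cells, (a.coef x.1 x.2).natAbs ≤ c :=
    ⟨_, fun x hx => List.le_sum_of_mem (List.mem_map_of_mem (f := fun x : ℕ × ℕ =>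
      (a.coef x.1 x.2).natAbs) hx)⟩
  obtain ⟨m, hm⟩ : ∃ m, m = 3 * a.n := ⟨_, rfl⟩
  obtain ⟨d, hd⟩ : ∃ d, d = a.D * m + 1 := ⟨_, rfl⟩
  obtain ⟨e, he⟩ : ∃ e, e = (b0 + 1) * A ^ Dg + 1 := ⟨_, rfl⟩
  refine ⟨m + 2 + a.r * (a.n * a.n) + m ^ a.r + a.r + 2 * (d * d) + c * d + (b0 + 1) ^ q + q + e +
    A * e ^ l + l + (l + 1) * (l + 1) * (m * m) + 3 * m, ?_⟩
  intro w n hw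
  generalize hW : m + 2 + a.r * (a.n * a.n) + m ^ a.r + a.r + 2 * (d * d) + c * d + (b0 + 1) ^ q + q +
    e + A * e ^ l + l + (l + 1) * (l + 1) * (m * m) + 3 * m = W at hw
  have small : ∀ x c' d', x ≤ c' * (n + 1) ^ d' → c' ≤ W → d' ≤ W → x < 2 ^ w := by
    intro x c' d' h1 h2 h3
    refine (h1.trans (Nat.mul_le_mul h2 (Nat.pow_le_pow_right (by omega) h3))).trans_lt hw
  have hn := a.two_le
  have hl2 : l + 1 ≤ (l + 1) * (l + 1) * (m * m) := by
    rw [mul_assoc]; exact Nat.le_mul_of_pos_right _ (by subst hm; positivity)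
  have hN : ∀ k ≤ n, ∀ L, a.n ^ L ≤ 3 * k * a.n → a.n ^ L ≤ m * (n + 1) := by
    intro k hk L hL
    refine hL.trans ?_
    rw [hm, show 3 * k * a.n = 3 * a.n * k by ring]
    exact Nat.mul_le_mul_left _ (by omega)
  have hM : ∀ k ≤ n, ∀ L, a.n ^ L ≤ 3 * k * a.n → a.mod L ≤ d * (n + 1) := by
    intro k hk L hL
    have := Nat.mul_le_mul_left a.D (hN k hk L hL)
    rw [MulAlg.mod, hd, add_one_mul, mul_assoc]
    omega
  have hb : ∀ k ≤ n, b0 + k ≤ (b0 + 1) * (n + 1) := fun k hk => by nlinarith [Nat.zero_le (b0 * n)]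
  have hR : ∀ k ≤ n, (b0 + k) * A ^ Dg + 1 ≤ e * (n + 1) := fun k hk => by
    have := Nat.mul_le_mul_right (A ^ Dg) (hb k hk)
    have e1 : e * (n + 1) = (b0 + 1) * (n + 1) * A ^ Dg + (n + 1) := by rw [he]; ring
    omega
  refine ⟨small _ 3 1 (by rw [pow_one]; omega) (by omega) (by omega),
    small _ (l + 1) 1 (by rw [pow_one]) (by omega) (by omega), fun k hk => ?_, fun k hk L hL => ?_,
    fun k hk L hL => ?_⟩
  · refine ⟨small _ 3 1 (by rw [pow_one]; omega) (by omega) (by omega),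
      small _ _ 0 (by rw [pow_zero, mul_one]) (by omega) (by omega), fun L hL => ?_, fun L hL => ?_,
      fun L hL x hx => ?_, ?_, small _ _ 1 (by rw [pow_one]; exact hR k hk) (by omega) (by omega), ?_⟩
    · refine small _ (m ^ a.r) a.r ?_ (by omega) (by omega)
      calc a.r ^ L ≤ (a.n ^ a.r) ^ L := Nat.pow_le_pow_left
            (a.r.lt_two_pow_self.le.trans (Nat.pow_le_pow_left hn _)) _
        _ = (a.n ^ L) ^ a.r := by rw [← pow_mul, ← pow_mul, mul_comm]
        _ ≤ (m * (n + 1)) ^ a.r := Nat.pow_le_pow_left (hN k hk L hL) _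
        _ = _ := mul_pow _ _ _
    · refine small _ (2 * (d * d)) 2 ?_ (by omega) (by omega)
      have h1 := Nat.mul_le_mul (hM k hk L hL) (hM k hk L hL)
      have h2 : a.mod L ≤ a.mod L * a.mod L := Nat.le_mul_of_pos_left _ (Nat.succ_pos _)
      have e1 : 2 * (d * d) * (n + 1) ^ 2 = 2 * (d * (n + 1) * (d * (n + 1))) := by ring
      omega
    · refine small _ (c * d) 1 ?_ (by omega) (by omega)
      rw [pow_one, mul_assoc]
      exact Nat.mul_le_mul (hc x hx) (hM k hk L hL)
    · refine small _ ((b0 + 1) ^ q) q ?_ (by omega) (by omega)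
      rw [← mul_pow]; exact Nat.pow_le_pow_left (hb k hk) _
    · refine small _ (A * e ^ l) l ?_ (by omega) (by omega)
      rw [mul_assoc, ← mul_pow]
      exact Nat.mul_le_mul_left _ (Nat.pow_le_pow_left (hR k hk) _)
  · refine small _ ((l + 1) * (l + 1) * (m * m)) 2 ?_ (by omega) (by omega)
    have h1 := Nat.mul_le_mul (hN k hk L hL) (hN k hk L hL)
    rw [mul_pow, mul_assoc _ (m * m), show m * m * (n + 1) ^ 2 = m * (n + 1) * (m * (n + 1)) by ring]
    exact Nat.mul_le_mul_left _ h1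
  · refine small _ (3 * m) 2 ?_ (by omega) (by omega)
    calc (n + 3) * a.n ^ L ≤ (3 * (n + 1)) * (m * (n + 1)) :=
          Nat.mul_le_mul (by omega) (hN k hk L hL)
      _ = _ := by ring

/-- The number of colourings is `O(b ^ l)`, and `s * s` and `N` are `O(b ^ (2 * q))` and `O(b ^ q)`
as `k ≤ b ^ q`. The product is a constant times `b ^ (l + 3 * q)`, and `b0` is chosen so large that
the constant is at most `b`; hence one more digit. -/
theorem ids_le {b b0 q l A Dg k s N n : ℕ} (hDg : Dg = l + 3 * q + 1) (hA : 0 < A) (hb0 : 0 < b0) (hb : b0 ≤ b) (hk : k ≤ b ^ q)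
    (hs : s ≤ k) (hN : N ≤ 3 * k * n)
    (h0 : (A * (2 * A ^ Dg) ^ l * ((l + 1) * (l + 1) * l) + 1) * (3 * n) ≤ b0) :
    (A * (b * A ^ Dg + 1) ^ l * ((l + 1) * (l + 1) * (s * s) * l) + 1) * N ≤
      b ^ Dg := by
  have h1 : b * A ^ Dg + 1 ≤ b * (2 * A ^ Dg) := by
    have : 1 ≤ b * A ^ Dg := Nat.mul_pos (by omega) (by positivity)
    have e : b * (2 * A ^ Dg) = b * A ^ Dg + b * A ^ Dg := by ring
    omega
  have h2 : 1 ≤ b ^ l * (b ^ q * b ^ q) := Nat.mul_pos (Nat.pow_pos (by omega))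
    (Nat.mul_pos (Nat.pow_pos (by omega)) (Nat.pow_pos (by omega)))
  have hs' := hs.trans hk
  calc _ ≤ (A * (b * (2 * A ^ Dg)) ^ l * ((l + 1) * (l + 1) * (b ^ q * b ^ q) * l) +
          b ^ l * (b ^ q * b ^ q)) * (3 * b ^ q * n) := by
        refine Nat.mul_le_mul (Nat.add_le_add ?_ h2) (hN.trans (by gcongr))
        gcongr
    _ = (A * (2 * A ^ Dg) ^ l * ((l + 1) * (l + 1) * l) + 1) * (3 * n) * b ^ (l + 3 * q) := by
        rw [mul_pow, show b ^ (l + 3 * q) = b ^ l * (b ^ q * b ^ q * b ^ q) by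
          rw [pow_add, mul_comm 3, pow_mul]; ring]
        ring
    _ ≤ b * b ^ (l + 3 * q) := Nat.mul_le_mul_right _ (h0.trans hb)
    _ = b ^ Dg := by rw [hDg]; ring

theorem Blocks.mono_size {n s N N' m : ℕ} {root bs loc : ℕ → ℕ} (h : Blocks n s N root m bs loc)
    (hN : N ≤ N') : Blocks n s N' root m bs loc :=
  { h with s_le := h.s_le.trans hN, size := fun b h1 h2 => (h.size b h1 h2).trans hN }

theorem _root_.IsSeparator.pos {n k : ℕ} {G : SimpleGraph (Fin n)} {S : Finset (Fin n)}
    (h : IsSeparator G k S) (hn : 1 ≤ n) : 1 ≤ k := by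
  by_contra hk
  have h0 := h.1
  have h1 : S = ∅ := Finset.card_eq_zero.1 (by omega)
  obtain ⟨K, hK⟩ := InComp.exists (G := G) (S := S) (u := 0) hn (by rintro ⟨_, h⟩; simp [h1] at h)
  have := h.card_le _ (T := {0}) id Function.injective_id.injOn fun x hx =>
    (by rw [Finset.mem_singleton.1 hx]; exact hK)
  simp at this
  omega

/-- Prepares the search. -/
def prepare (a : MulAlg) (l q b0 A Dg : ℕ) : Prog :=
  visitAll ;; maxRun ;; assign 2 (reg 1 + reg 2) ;; makeBlocks ;; makeParams a l q b0 A Dg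

/-- The layout represents the search for a cycle in the graph. -/
structure Represents {n N : ℕ} (G : SimpleGraph (Fin n)) (c l : ℕ) (Y : Layout N) (ord : ℕ → ℕ) :
    Prop where
  n_eq : Y.n = n
  s_eq : Y.s = c
  closed : ∀ u, Y.Closed l u → ∃ (v : Fin n) (p : G.Walk v v), p.IsCycle ∧ p.length = l ∧
    ∀ i < l, ord (u i) = (p.getVert i : ℕ)
  cyc : ∀ (v : Fin n) (p : G.Walk v v), p.IsCycle → p.length = l → ∃ u, Y.Cyc l u

/-- `kk` is the program's own value `|S| + M` in place of `k`. All blocks except two have at least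
`kk` vertices, and `kk ≤ n`, whence the factor `3` in the bound for `Y.m * kk`. -/
theorem exists_prepare_runs (a : MulAlg) {l q b0 A Dg : ℕ} (hl : 3 ≤ l) (hDg : Dg = l + 3 * q + 1) (hq : 0 < q) (hb0 : 0 < b0)
    (hA : Dg * (l * l) < A)
    (h0 : (A * (2 * A ^ Dg) ^ l * ((l + 1) * (l + 1) * l) + 1) * (3 * a.n) ≤ b0) :
    ∃ K, ∀ {n k w : ℕ} {G : SimpleGraph (Fin n)} {S : Finset (Fin n)} {s : State}, 1 ≤ n →
    IsSeparator G k S → IsInput w G S s → Big w a l q b0 A Dg n →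
    Runs w (prepare a l q b0 A Dg) s (K * (n * k)) fun s' => 1 ≤ k ∧
      ∃ (kk L b R Z : ℕ) (Y : Layout (a.n ^ L)), SearchEnv w a l L Y A Dg b R Z s' ∧
        Represents G S.card l Y (s'.mem 3) ∧ 1 ≤ kk ∧ kk ≤ k ∧ kk ≤ n ∧ S.card ≤ kk ∧
        Y.m * kk ≤ 3 * n ∧ a.n ^ L ≤ 3 * kk * a.n ∧ (b = b0 ∨ (b - 1) ^ q < kk) ∧
        R = b * A ^ Dg + 1 ∧ Z = A * R ^ l := by
  obtain ⟨K, hK⟩ := exists_makeParams_runs a l q b0 A Dg hq hb0 (by omega)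
  refine ⟨K + 2000, ?_⟩
  intro n k w G S s hn hS hI hw
  have hnw := hw.n_lt
  have hcn : S.card ≤ n := by simpa using S.card_le_univ
  have hck := hS.1
  have hL := hI.lists
  have hk0 := hS.pos hn
  apply Runs.intro_ok
  intro hO
  apply Runs.time_le
  · apply Runs.seq
    · exact visitAll_runs hI hS (by omega)
    intro s1 hS1 hOrd
    have f0 : s1.reg 0 = n := (hS1.1 0 rfl).trans hI.order
    have f1 : s1.reg 1 = S.card := (hS1.1 1 rfl).trans hI.card
    apply Runs.seq
    · exact maxRun_runs f0 f1 (by omega)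
    intro s2 hS2 hM
    have f0 := (hS2.1 0 rfl).trans f0
    have f1 := (hS2.1 1 rfl).trans f1
    obtain ⟨M, hM2⟩ : ∃ M, s2.reg 2 = M := ⟨_, rfl⟩
    rw [hM2] at hM
    have hMk : M ≤ k - S.card ∧ M ≤ n - S.card := by
      rcases hM.2 with h | ⟨p, r, h1, h2, h3, h4, h5⟩
      · omega
      · have := hOrd.run_le hS h1 h2 h3 h4
        omega
    have hkk : 1 ≤ S.card + M := by
      rcases Nat.eq_zero_or_pos S.card with h | h
      · have := hM.1 0 0 (by omega) le_rfl hn fun r _ _ => by omega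
        omega
      · omega
    apply Runs.seq
    · exact Runs.straight (p := assign 2 _) (Q := fun s' => s'.reg 2 = S.card + M)
        ⟨by simp [f1, hM2]; omega, by simp [f1, hM2]⟩
    intro s3 hS3 h2
    have f0 := (hS3.1 0 rfl).trans f0
    have f1 := (hS3.1 1 rfl).trans f1
    have e31 : s3.mem 31 = s1.mem 31 := (hS3.2 31 rfl).trans (hS2.2 31 rfl)
    apply Runs.seq
    · exact makeBlocks_runs f0 f1 h2 hkk hcn (by omega) (e31 ▸ hM) (by omega)
    intro s4 hS4 hG
    have h2 := (hS4.1 2 rfl).trans h2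
    have f0 := (hS4.1 0 rfl).trans f0
    have f1 := (hS4.1 1 rfl).trans f1
    have hroom := hw.room (S.card + M) (by omega)
    refine ((hK h2 hkk hroom).time_le (T' := K * k) (Nat.mul_le_mul_left _ (by omega))).mono le_rfl ?_
    rintro s5 hS5 ⟨L, b, hE, hL1, hL2, hb1, hb2, hb3, hb4, h9, h10, h11⟩
    have hS5 := hS5.mono (makeParams_wr a l q b0 A Dg) (makeParams_wm a l q b0 A Dg)
    have g : ∀ t, t = 0 ∨ t = 1 → s5.mem t = s.mem t := fun t ht => by
      rcases ht with rfl | rfl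
      · rw [hS5.2 0 rfl, hS4.2 0 rfl, hS3.2 0 rfl, hS2.2 0 rfl, hS1.2 0 rfl]
      · rw [hS5.2 1 rfl, hS4.2 1 rfl, hS3.2 1 rfl, hS2.2 1 rfl, hS1.2 1 rfl]
    have g0 := g 0 (by simp)
    have g1 := g 1 (by simp)
    have g3 : s5.mem 3 = s1.mem 3 := by rw [hS5.2 3 rfl, hS4.2 3 rfl, hS3.2 3 rfl, hS2.2 3 rfl]
    have g4 : s5.mem 4 = s1.mem 4 := by rw [hS5.2 4 rfl, hS4.2 4 rfl, hS3.2 4 rfl, hS2.2 4 rfl]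
    -- Greedy blocks have size at most `2 * kk + M ≤ 3 * kk`, which the dimension `n ^ L` exceeds or
    -- equals.
    have hB := hG.toBlocks.mono_size (N' := a.n ^ L) (by omega)
    have hm : (s4.reg 3 - 2) * (S.card + M) ≤ n := by
      have h1 := hG.mono (s4.reg 3 - 1) (by have := hG.two_le; omega)
      rw [show s4.reg 3 - 1 + 1 = s4.reg 3 by have := hG.two_le; omega, hG.bs_m] at h1
      exact hG.many.trans h1
    have hmn : s4.reg 3 ≤ n + 2 := by
      have := Nat.le_mul_of_pos_right (s4.reg 3 - 2) hkk
      omega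
    have hOrd : Ordering G S (s5.mem 3) (s5.mem 4) (s3.mem 31) := by rw [g3, g4, e31]; exact hOrd
    have hR1 : b * A ^ Dg ≤ (b0 + (S.card + M)) * A ^ Dg := Nat.mul_le_mul_right _ hb4
    have hR := hroom.R
    have hZ1 : A * (b * A ^ Dg + 1) ^ l ≤ A * ((b0 + (S.card + M)) * A ^ Dg + 1) ^ l := by gcongr
    refine ⟨by omega, S.card + M, L, b, _, _, hOrd.layout hB rfl hL, ?_,
      ⟨rfl, rfl, fun u hu => hOrd.exists_cycle hl hB rfl hL hu,
        fun v p hp hpl => hOrd.exists_cyc hB rfl hL hp hpl⟩,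
      hkk, by omega, by omega, by omega, ?_, hL2, hb3, rfl, rfl⟩
    · have hlt := hw.ids _ (show S.card + M ≤ n by omega) L hL2
      refine ⟨⟨hE, hw.cells _ (by omega) L hL2, ?_, ?_, ?_, ?_, ?_, ?_, ?_, ?_, ?_, ?_, ?_⟩,
        by omega, hA, Nat.lt_succ_self _, rfl, by omega, hZ1.trans_lt hroom.Z, ?_, ?_, h9, h10, h11⟩
      · show n + 1 < 2 ^ w; omega
      · show s4.reg 3 + 1 < 2 ^ w; omega
      · exact (hS5.1 0 rfl).trans f0
      · exact (hS5.1 1 rfl).trans f1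
      · exact hS5.1 3 rfl
      · intro p hp
        have := hOrd.lt p hp
        omega
      · intro p hp
        rw [g0]; rfl
      · intro p hp e he
        have he : e < s.deg (s5.mem 3 p) := he
        have := hO.mem 0 (s5.mem 3 p + 1)
        rw [State.deg] at he
        rw [g0]; omega
      · intro p hp e he
        rw [g0, g1]; rfl
      · intro b' _
        rw [hS5.2 5 rfl]; rfl
      · intro p _
        rw [hS5.2 6 rfl]; rfl
      · exact (Nat.mul_le_mul_right _ (show s4.reg 3 + 1 ≤ n + 3 by omega)).trans_lt hlt
      · exact ids_le hDg (by omega) hb0 hb1 hb2 (show S.card ≤ S.card + M by omega) hL2 h0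
    · show s4.reg 3 * (S.card + M) ≤ 3 * n
      have e : s4.reg 3 * (S.card + M) = (s4.reg 3 - 2) * (S.card + M) + 2 * (S.card + M) := by
        rw [← add_mul]; congr 1; have := hG.two_le; omega
      omega
  · have h1 : n ≤ n * k := Nat.le_mul_of_pos_right _ (by omega)
    have h2 : k ≤ n * k := Nat.le_mul_of_pos_left _ (by omega)
    have h3 : K * k ≤ K * (n * k) := Nat.mul_le_mul_left _ h2
    have e1 : (n + 1) * (k + 2) * 200 = 200 * (n * k) + 400 * n + 200 * k + 400 := by ring
    rw [e1, add_mul K]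
    simp only [Prog.time, cost_add, cost_reg]
    omega


/-! ### The running time as a power of `k`. -/

theorem base_le {b b0 q k : ℕ} (hq : 0 < q) (hb0 : 0 < b0) (hk : 1 ≤ k)
    (h : b = b0 ∨ (b - 1) ^ q < k) : (b : ℝ) ≤ (b0 + 1) * (k : ℝ) ^ ((q : ℝ)⁻¹) := by
  have hy : 1 ≤ (k : ℝ) ^ ((q : ℝ)⁻¹) := Real.one_le_rpow (by exact_mod_cast hk) (by positivity)
  have hb1 : (1 : ℝ) ≤ b0 := by exact_mod_cast hb0
  rcases h with rfl | h
  · nlinarith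
  · have h1 : (((b - 1 : ℕ) : ℝ) ^ q) ≤ k := by exact_mod_cast h.le
    have h2 := Real.rpow_le_rpow (by positivity) h1 (show 0 ≤ (q : ℝ)⁻¹ by positivity)
    rw [Real.pow_rpow_inv_natCast (by positivity) hq.ne'] at h2
    have h3 : (b : ℝ) ≤ ((b - 1 : ℕ) : ℝ) + 1 := by exact_mod_cast (by omega : b ≤ b - 1 + 1)
    nlinarith

/-- `n ^ L` is `O(k)`. Then `r ^ L` is at most `(n ^ L) ^ (ω + δ)`, and the logarithmic factor obeys
`L + 1 ≤ 2 ^ L ≤ (n ^ L) ^ δ`, by the choice of the small algorithm. -/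
theorem unit_le {a : MulAlg} {ω δ : ℝ} (hω : 0 ≤ ω) (hδ : 0 < δ) (hr : (a.r : ℝ) ≤ (a.n : ℝ) ^ (ω + δ))
    (h2 : 2 ≤ (a.n : ℝ) ^ δ) {k L : ℕ} (hL : a.n ^ L ≤ 3 * k * a.n) :
    (a.unit L : ℝ) ≤ 2 * (3 * a.n : ℝ) ^ (ω + 2 * δ) * (k : ℝ) ^ (ω + 2 * δ) := by
  have hn : (0 : ℝ) ≤ a.n := by positivity
  have hX : ((a.n : ℝ) ^ L) ≤ 3 * a.n * k := by
    have : ((a.n ^ L : ℕ) : ℝ) ≤ ((3 * k * a.n : ℕ) : ℝ) := by exact_mod_cast hL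
    push_cast at this
    linarith
  have hpow : ∀ e : ℝ, 0 ≤ e → ((a.n : ℝ) ^ e) ^ L ≤ (3 * a.n * k : ℝ) ^ e := fun e he => by
    rw [← Real.rpow_natCast, ← Real.rpow_mul hn, mul_comm e, Real.rpow_mul hn, Real.rpow_natCast]
    exact Real.rpow_le_rpow (by positivity) hX he
  have h3 : ((a.r ^ L : ℕ) : ℝ) ≤ (3 * a.n * k : ℝ) ^ (ω + δ) := by
    push_cast
    exact (pow_le_pow_left₀ (by positivity) hr L).trans (hpow _ (by positivity))
  have h4 : ((L + 1 : ℕ) : ℝ) ≤ (3 * a.n * k : ℝ) ^ δ := by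
    have h5 : ((L + 1 : ℕ) : ℝ) ≤ 2 ^ L := by exact_mod_cast L.lt_two_pow_self
    exact h5.trans ((pow_le_pow_left₀ (by norm_num) h2 L).trans (hpow _ hδ.le))
  have h6 : a.unit L ≤ (L + 1) * (2 * a.r ^ L) := by
    have := (a.dim_le L).2.2
    exact Nat.mul_le_mul_left _ (by omega)
  have h7 : (0 : ℝ) ≤ 3 * a.n * k := by positivity
  calc (a.unit L : ℝ) ≤ ((L + 1 : ℕ) : ℝ) * (2 * ((a.r ^ L : ℕ) : ℝ)) := by exact_mod_cast h6
    _ ≤ (3 * a.n * k : ℝ) ^ δ * (2 * (3 * a.n * k : ℝ) ^ (ω + δ)) := by gcongr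
    _ = 2 * (3 * a.n * k : ℝ) ^ (ω + 2 * δ) := by
      rw [show ω + 2 * δ = δ + (ω + δ) by ring, Real.rpow_add_of_nonneg h7 hδ.le (by positivity)]
      ring
    _ = _ := by rw [Real.mul_rpow (by positivity) (by positivity)]; ring

/-- The number of colourings is `O(k ^ (l / q))`, hence `O(k ^ (2 * δ))`. The `m = O(n / k)` blocks
cost `O(k ^ (ω + 2 * δ))` each, and reading the separator's lists costs `O(k * n)`, which is covered
because `ω - 1 ≥ 1`. -/
theorem exists_time_le {a : MulAlg} {ω δ : ℝ} (hω : 2 ≤ ω) (hδ : 0 < δ)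
    (hr : (a.r : ℝ) ≤ (a.n : ℝ) ^ (ω + δ)) (h2 : 2 ≤ (a.n : ℝ) ^ δ) {l q b0 A Dg : ℕ} (hq : 0 < q)
    (hb0 : 0 < b0) (hlq : (l : ℝ) ≤ q * (2 * δ)) :
    ∃ C : ℝ, 0 ≤ C ∧ ∀ {n k L b R Z m c : ℕ}, 1 ≤ n → 1 ≤ k → c ≤ k → m * k ≤ 3 * n →
      a.n ^ L ≤ 3 * k * a.n → (b = b0 ∨ (b - 1) ^ q < k) → R = b * A ^ Dg + 1 → Z = A * R ^ l →
      (((Z + 1) * (m * a.unit L + (c + 1) * (n + 1)) : ℕ) : ℝ) ≤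
        C * (k : ℝ) ^ (ω - 1 + 4 * δ) * n := by
  refine ⟨(A * ((b0 + 1) * (A ^ Dg + 1)) ^ l + 1) * (6 * (3 * a.n : ℝ) ^ (ω + 2 * δ) + 4), by positivity, ?_⟩
  intro n k L b R Z m c hn hk hc hm hL hb hR hZ
  have hx : (1 : ℝ) ≤ k := by exact_mod_cast hk
  have hx0 : (0 : ℝ) < k := by linarith
  have hn1 : (1 : ℝ) ≤ n := by exact_mod_cast hn
  have hy : 1 ≤ (k : ℝ) ^ ((q : ℝ)⁻¹) := Real.one_le_rpow hx (by positivity)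
  have hZ1 : ((Z + 1 : ℕ) : ℝ) ≤ (A * ((b0 + 1) * (A ^ Dg + 1)) ^ l + 1) * (k : ℝ) ^ (2 * δ) := by
    have h3 : (R : ℝ) ≤ (b0 + 1) * (A ^ Dg + 1) * (k : ℝ) ^ ((q : ℝ)⁻¹) := by
      rw [hR]
      push_cast
      have h4 := mul_le_mul_of_nonneg_right (base_le hq hb0 hk hb) (show (0 : ℝ) ≤ A ^ Dg by positivity)
      have h5 : (1 : ℝ) ≤ (b0 + 1) * (k : ℝ) ^ ((q : ℝ)⁻¹) := by
        nlinarith [show (0 : ℝ) ≤ b0 by positivity]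
      calc _ ≤ (b0 + 1) * (k : ℝ) ^ ((q : ℝ)⁻¹) * A ^ Dg + (b0 + 1) * (k : ℝ) ^ ((q : ℝ)⁻¹) :=
            add_le_add h4 h5
        _ = _ := by ring
    have h4 : ((k : ℝ) ^ ((q : ℝ)⁻¹)) ^ l ≤ (k : ℝ) ^ (2 * δ) := by
      rw [← Real.rpow_natCast, ← Real.rpow_mul hx0.le]
      refine Real.rpow_le_rpow_of_exponent_le hx ?_
      rw [inv_mul_le_iff₀ (by exact_mod_cast hq)]
      exact hlq
    have h5 : (1 : ℝ) ≤ (k : ℝ) ^ (2 * δ) := Real.one_le_rpow hx (by positivity)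
    have h6 := pow_le_pow_left₀ (by positivity) h3 l
    rw [mul_pow] at h6
    rw [hZ]
    push_cast
    calc (A : ℝ) * R ^ l + 1 ≤ A * (((b0 + 1) * (A ^ Dg + 1)) ^ l * (k : ℝ) ^ (2 * δ)) + (k : ℝ) ^ (2 * δ) := by
          refine add_le_add (mul_le_mul_of_nonneg_left (h6.trans ?_) (by positivity)) h5
          exact mul_le_mul_of_nonneg_left h4 (by positivity)
      _ = _ := by ring
  have e1 : (k : ℝ) ^ (ω + 2 * δ) = k * (k : ℝ) ^ (ω - 1 + 2 * δ) := by
    rw [show ω + 2 * δ = 1 + (ω - 1 + 2 * δ) by ring, Real.rpow_add hx0, Real.rpow_one]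
  have h7 : ((m * a.unit L : ℕ) : ℝ) ≤ 6 * (3 * a.n : ℝ) ^ (ω + 2 * δ) * ((k : ℝ) ^ (ω - 1 + 2 * δ) * n) := by
    have h8 := unit_le (by linarith) hδ hr h2 hL
    have h9 : (m : ℝ) * k ≤ 3 * n := by exact_mod_cast hm
    push_cast
    calc (m : ℝ) * a.unit L ≤ m * (2 * (3 * a.n : ℝ) ^ (ω + 2 * δ) * (k : ℝ) ^ (ω + 2 * δ)) := by gcongr
      _ = m * k * (2 * (3 * a.n : ℝ) ^ (ω + 2 * δ) * (k : ℝ) ^ (ω - 1 + 2 * δ)) := by rw [e1]; ring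
      _ ≤ 3 * n * (2 * (3 * a.n : ℝ) ^ (ω + 2 * δ) * (k : ℝ) ^ (ω - 1 + 2 * δ)) := by gcongr
      _ = _ := by ring
  have h8 : (((c + 1) * (n + 1) : ℕ) : ℝ) ≤ 4 * ((k : ℝ) ^ (ω - 1 + 2 * δ) * n) := by
    have h9 : (k : ℝ) ≤ (k : ℝ) ^ (ω - 1 + 2 * δ) := by
      conv_lhs => rw [← Real.rpow_one (k : ℝ)]
      exact Real.rpow_le_rpow_of_exponent_le hx (by linarith)
    have hc' : (c : ℝ) ≤ k := by exact_mod_cast hc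
    push_cast
    calc ((c : ℝ) + 1) * (n + 1) ≤ (2 * k) * (2 * n) := by gcongr <;> linarith
      _ = 4 * (k * n) := by ring
      _ ≤ _ := by gcongr
  rw [Nat.cast_mul, Nat.cast_add (m * a.unit L)]
  calc _ ≤ ((A * ((b0 + 1) * (A ^ Dg + 1)) ^ l + 1) * (k : ℝ) ^ (2 * δ)) *
        (6 * (3 * a.n : ℝ) ^ (ω + 2 * δ) * ((k : ℝ) ^ (ω - 1 + 2 * δ) * n) +
          4 * ((k : ℝ) ^ (ω - 1 + 2 * δ) * n)) := by gcongr
    _ = _ := by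
      rw [show ω - 1 + 4 * δ = 2 * δ + (ω - 1 + 2 * δ) by ring, Real.rpow_add hx0 (2 * δ)]
      generalize (k : ℝ) ^ (2 * δ) = u
      generalize (k : ℝ) ^ (ω - 1 + 2 * δ) = v
      generalize (3 * a.n : ℝ) ^ (ω + 2 * δ) = t
      ring

/-- As `n + 1 ≤ 2 ^ (log n + 1)`, words of length `2 * W * (log n + 1)` hold both the coefficient
and the power. -/
theorem word_lt {W C w n : ℕ} (hC : 2 * W ≤ C) (hw : C * (Nat.log 2 n + 1) ≤ w) (hW : 0 < W) :
    W * (n + 1) ^ W < 2 ^ w := by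
  have h1 : n + 1 ≤ 2 ^ (Nat.log 2 n + 1) := Nat.lt_pow_succ_log_self (by norm_num) n
  have h2 : W < 2 ^ (W * (Nat.log 2 n + 1)) :=
    W.lt_two_pow_self.trans_le (Nat.pow_le_pow_right (by omega) (Nat.le_mul_of_pos_right _ (by omega)))
  calc W * (n + 1) ^ W < 2 ^ (W * (Nat.log 2 n + 1)) * (2 ^ (Nat.log 2 n + 1)) ^ W :=
        Nat.mul_lt_mul_of_lt_of_le h2 (Nat.pow_le_pow_left h1 _) (by positivity)
    _ = 2 ^ (2 * W * (Nat.log 2 n + 1)) := by rw [← pow_mul, ← pow_add]; congr 1; ring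
    _ ≤ 2 ^ w := Nat.pow_le_pow_right (by omega) ((Nat.mul_le_mul_right _ hC).trans hw)

theorem IsInput.ok {w n : ℕ} {G : SimpleGraph (Fin n)} {S : Finset (Fin n)} {s : State}
    (h : IsInput w G S s) (hw : 0 < w) : s.Ok w := ⟨hw, h.reg_lt, h.mem_lt⟩

theorem le_mul_rpow {n k : ℕ} {e : ℝ} (hk : 1 ≤ k) (he : 1 ≤ e) : ((n * k : ℕ) : ℝ) ≤ (k : ℝ) ^ e * n := by
  have hx : (1 : ℝ) ≤ k := by exact_mod_cast hk
  have h9 : (k : ℝ) ≤ (k : ℝ) ^ e := by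
    conv_lhs => rw [← Real.rpow_one (k : ℝ)]
    exact Real.rpow_le_rpow_of_exponent_le hx he
  push_cast
  rw [mul_comm]
  gcongr

end WordRAM

/-! ### The main theorem: choice of the parameters. -/

theorem mainTheorem8 (ℓ : ℕ) (ε : ℝ) (hε : 0 < ε) :
    ∃ (P : WordRAM.Prog) (C : ℕ),
      ∀ (n : ℕ) (G : SimpleGraph (Fin n)) (S : Finset (Fin n)) (k : ℕ),
        1 ≤ n → IsSeparator G k S →
        ∀ (w : ℕ), C * (Nat.log 2 n + 1) ≤ w →
        ∀ (s : WordRAM.State), WordRAM.IsInput w G S s →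
          ∃ (s' : WordRAM.State) (t : ℕ), WordRAM.Exec w P s s' t ∧
            (t : ℝ) ≤ C * (k : ℝ) ^ (matMulExponent - 1 + ε) * n ∧
            WordRAM.IsCycleAnswer ℓ G s' := by
  have hω := two_le_matMulExponent
  -- A simple graph has no cycle of length below `3`, so the program that always answers no is
  -- correct.
  by_cases hl : ℓ < 3
  · refine ⟨.assign 0 (.const 0), 2, fun n G S k hn hS w hw s hI => ?_⟩
    have hk := hS.pos hn
    obtain ⟨s', t, h1, h2, -, h4⟩ := WordRAM.Runs.straight (w := w) (p := .assign 0 (.const 0)) (s := s)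
      (Q := fun s' => s'.reg 0 = 0) ⟨by simp, by simp⟩ (hI.ok (by omega))
    refine ⟨s', t, h1, ?_, .inr ⟨h4, fun ⟨u, p, hp, hpl⟩ => by have := hp.three_le_length; omega⟩⟩
    have h5 := WordRAM.le_mul_rpow (n := n) hk (show 1 ≤ matMulExponent - 1 + ε by linarith)
    have h6 : (1 : ℝ) ≤ ((n * k : ℕ) : ℝ) := by exact_mod_cast Nat.mul_pos hn hk
    have h7 : (t : ℝ) ≤ 2 := by exact_mod_cast h2
    push_cast
    linarith
  -- The estimate loses `4 * δ` in the exponent: `2 * δ` for matrix multiplication and `2 * δ` for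
  -- the number of colourings.
  · have hδ : 0 < ε / 4 := by positivity
    obtain ⟨n₀, r, hn₀, hrank, hr, h2⟩ := exists_matMulRankLE hδ
    obtain ⟨D, α, β, γ, hD, halg⟩ := hrank.exists_isBilinearAlgorithm (by omega)
    obtain ⟨a, han, har⟩ : ∃ a : WordRAM.MulAlg, a.n = n₀ ∧ a.r = r :=
      ⟨⟨n₀, r, D, α, β, γ, hn₀, by have := hrank.sq_le; rwa [pow_two] at this, hD, halg⟩, rfl, rfl⟩
    rw [← han, ← har] at hr
    rw [← han] at h2
    -- Large enough for `ℓ / q ≤ ε / 2 = 2 * δ`; the added `1` makes `q` positive also for large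
    -- `ε`.
    obtain ⟨q, hq⟩ : ∃ q, q = ⌈2 * (ℓ : ℝ) / ε⌉₊ + 1 := ⟨_, rfl⟩
    have hlq : (ℓ : ℝ) ≤ q * (2 * (ε / 4)) := by
      have h3 := Nat.le_ceil (2 * (ℓ : ℝ) / ε)
      rw [div_le_iff₀ hε] at h3
      rw [hq]
      push_cast
      nlinarith
    obtain ⟨Dg, hDg⟩ : ∃ Dg, Dg = ℓ + 3 * q + 1 := ⟨_, rfl⟩
    -- One more hash parameter than all pairs of vertices of a cycle can spoil.
    obtain ⟨A, hA⟩ : ∃ A, A = Dg * (ℓ * ℓ) + 1 := ⟨_, rfl⟩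
    obtain ⟨b, hb⟩ : ∃ b, b = (A * (2 * A ^ Dg) ^ ℓ * ((ℓ + 1) * (ℓ + 1) * ℓ) + 1) * (3 * a.n) := ⟨_, rfl⟩
    have hb0 : 0 < b := hb ▸ Nat.mul_pos (by omega) (by omega)
    obtain ⟨K, hK⟩ := WordRAM.exists_prepare_runs a (by omega : 3 ≤ ℓ) hDg (by omega) hb0
      (by omega : Dg * (ℓ * ℓ) < A) hb.ge
    obtain ⟨K', hK'⟩ := WordRAM.exists_findCycle_runs a (by omega : 0 < ℓ) A Dg
    obtain ⟨W, hW⟩ := WordRAM.exists_big a ℓ q b A Dg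
    obtain ⟨c, hc, hc'⟩ := WordRAM.exists_time_le (A := A) (Dg := Dg) hω hδ hr h2
      (by omega : 0 < q) hb0 hlq
    refine ⟨.seq (WordRAM.prepare a ℓ q b A Dg) (WordRAM.findCycle a ℓ A Dg),
      2 * (W + 1) + K + ⌈K' * c⌉₊, fun n G S k hn hS w hw s hI => ?_⟩
    have hbig : WordRAM.Big w a ℓ q b A Dg n := by
      refine hW w n ((Nat.mul_le_mul (Nat.le_succ W) (Nat.pow_le_pow_right (by omega)
        (Nat.le_succ W))).trans_lt (WordRAM.word_lt (W := W + 1) (by omega) hw (by omega)))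
    have hk := hS.pos hn
    have hx : (1 : ℝ) ≤ k := by exact_mod_cast hk
    have h3 : 0 ≤ c * (k : ℝ) ^ (matMulExponent - 1 + ε) * n := by positivity
    obtain ⟨s', t, h4, h5, -, h6⟩ := WordRAM.Runs.seq (hK hn hS hI hbig)
      (T' := K' * ⌊c * (k : ℝ) ^ (matMulExponent - 1 + ε) * n⌋₊)
      (Q' := fun s' => WordRAM.IsCycleAnswer ℓ G s') (by
        rintro s1 - ⟨-, kk, L, b', R, Z, Y, hE, hY, h7, h8, h9, h10, h11, h12, h13, h14, h15⟩
        refine (hK' hE (by rw [hY.n_eq]; exact hbig.l_lt)).mono (Nat.mul_le_mul_left _ (Nat.le_floor ?_)) ?_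
        · rw [hY.n_eq, hY.s_eq]
          refine (hc' hn h7 h10 h11 h12 h13 h14 h15).trans ?_
          rw [show 4 * (ε / 4) = ε by ring]
          -- The program's time is bounded in terms of its own `kk`; monotonicity of the power
          -- transfers the bound to every admissible `k`.
          have : (kk : ℝ) ≤ k := by exact_mod_cast h8
          gcongr
          linarith
        · rintro s2 - (⟨h0, u, hu, hm⟩ | ⟨h0, hm⟩)
          · obtain ⟨v, p, hp, hpl, hv⟩ := hY.closed u hu
            exact .inl ⟨h0, v, p, hp, hpl, fun i hi => (hm i hi).trans (hv i hi)⟩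
          · exact .inr ⟨h0, fun ⟨v, p, hp, hpl⟩ => hm (hY.cyc v p hp hpl)⟩)
      (hI.ok (by
        refine lt_of_lt_of_le ?_ hw
        exact Nat.mul_pos (by omega) (by omega)))
    refine ⟨s', t, h4, ?_, h6⟩
    have h7 := WordRAM.le_mul_rpow (n := n) hk (show 1 ≤ matMulExponent - 1 + ε by linarith)
    have h8 := Nat.floor_le h3
    have h9 := Nat.le_ceil ((K' : ℝ) * c)
    obtain ⟨V, hV⟩ : ∃ V, V = (k : ℝ) ^ (matMulExponent - 1 + ε) * n := ⟨_, rfl⟩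
    have hV0 : 0 ≤ V := by rw [hV]; positivity
    have h10 : (t : ℝ) ≤ K * ((n * k : ℕ) : ℝ) + K' * (⌊c * (k : ℝ) ^ (matMulExponent - 1 + ε) * n⌋₊ : ℝ) := by
      exact_mod_cast h5
    rw [mul_assoc, ← hV] at h8 h10 ⊢
    rw [← hV] at h7
    push_cast
    calc (t : ℝ) ≤ K * V + K' * (c * V) := h10.trans (by gcongr)
      _ = (K + K' * c) * V := by ring
      _ ≤ (2 * (W + 1) + K + ⌈(K' : ℝ) * c⌉₊) * V := by
        gcongr
        have : (0 : ℝ) ≤ W := by positivity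
        linarith
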